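/- Let $H$ be the $4\times 15$ parity-check matrix over $\mathbb F_2$ whose column $q\in\{1,\dots,15\}$ is $q$ in binary, and consider the $[[15,7,3]]$ Hamming code, the stabilizer code on qubits $1,\dots,15$ that has one $X$ stabilizer and one $Z$ stabilizer for each row of $H$. A logical basis is a choice of operators $\bar X_j=X_{S^X_j}$, $\bar Z_j=Z_{S^Z_j}$ ($1\le j\le 7$) that commute with the stabilizers and such that $\bar X_i,\bar Z_j$ anticommute for $i=j$ and commute for $i\ne j$; the encoded basis states are $|\bar x\rangle\propto\prod_j\bar X_j^{x_j}\sum_{X_S\text{ stabilizer}}X_S|0^{15}\rangle$, and they span the code space. There are logical bases with $\bar Z_1=Z_{\{1,4,5\}}$, $\bar Z_2=Z_{\{1,6,7\}}$, $\bar Z_3=Z_{\{1,8,9\}}$. For each such basis the following hold. (a) The product, in any order, of the round-robin gates CCZ on all tuples of $\{1,4,5\}\times\{1,6,7\}\times\{1,8,9\}$ (a CZ or $Z$ gate when two or three of the qubits coincide: one $Z$, six CZ and twenty CCZ gates) preserves the code space and acts on it as the logical CCZ gate on logical qubits $1,2,3$. (b) Consider the following protocol on $19$ qubits, $15$ data qubits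 and $4$ ancillas. Take the gates of (a) in any order. The $Z$ gate is applied directly. Each CZ gate on $(i,j)$ is replaced by the flag gadget: prepare ancilla $f$ in $|+\rangle$ and $g$ in $|0\rangle$; apply $\mathrm{CNOT}_{j\to g}$, $\mathrm{CNOT}_{f\to j}$, $\mathrm{CZ}_{i,j}$, $\mathrm{CZ}_{i,f}$, $\mathrm{CNOT}_{f\to j}$, $\mathrm{CNOT}_{j\to g}$; measure $f$ in the $X$ basis and $g$ in the $Z$ basis. Each CCZ gate on $(i,j,l)$ is replaced by the four-ancilla gadget: prepare $f,f'$ in $|+\rangle$ and $g,g'$ in $|0\rangle$; apply $\mathrm{CNOT}_{j\to g}$, $\mathrm{CNOT}_{l\to g'}$, $\mathrm{CNOT}_{f\to j}$, $\mathrm{CNOT}_{f'\to l}$, then CCZ on $\{i\}\times\{j,f\}\times\{l,f'\}$ (in the order $(i,j,l),(i,f,l),(i,j,f'),(i,f,f')$), then the same four CNOTs in the order $f\to j$, $f'\to l$, $j\to g$, $l\to g'$; measure $f,f'$ in the $X$ basis and $g,g'$ in the $Z$ basis. After every gadget, $X$ error correction is applied, itself with noisy gates: the four $Z$ stabilizers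 are measured one after the other, each with a $|0\rangle$ ancilla $s$ that collects the parity by CNOTs from its eight qubits, in the order $8,9,10,12,11,14,13,15$; $4,5,6,12,7,14,13,15$; $2,3,6,10,7,14,11,15$; $1,5,3,9,7,11,13,15$ respectively, and a $|+\rangle$ flag $t$, measured in the $X$ basis, with $\mathrm{CNOT}_{t\to s}$ after the first and before the last of the eight CNOTs; at the first nontrivial (syndrome or flag) outcome all four syndromes are extracted again without flag, and $X$ gates are applied to a set of data qubits given by a classical rule from the measurement outcomes so far. At the end, perfect $X$ and $Z$ error correction is applied, by a correction table depending on all the earlier outcomes. For each order of the gates the classical rules can be chosen, independently of the logical basis, such that this protocol is a fault-tolerant implementation of the logical CCZ gate on logical qubits $1,2,3$. Here a protocol (an adaptive sequence of $X,Z,H,S$, CNOT, CZ, CCZ gates, single-qubit preparations in $|0\rangle,|+\rangle$ and single-qubit measurements in the $Z$ and $X$ bases, followed by perfect error correction with a table depending on all outcomes) is called a fault-tolerant implementation of a logical operator $U$ if, whenever the input lies in the code space (with arbitrary ancilla state) and at most one fault occurs, for every sequence of measurement outcomes the final state lies in the code space with no logical error: an input encoding $\varphi$ is mapped to the encoded $U\varphi$,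 times an ancilla state, up to normalisation and phase. A fault is an arbitrary Pauli operator on the qubits of a gate right after that gate, or an arbitrary one-qubit Pauli operator on any of the qubits at any time. (c) Universal computation is possible with $19$ qubits: the logical CCZ gate on logical qubits $1,2,3$, together with those logical Clifford gates that have a fault-tolerant implementation with four ancillas ($19$ qubits), generates a dense subset of the unitary group $U(2^7)$ of the seven logical qubits. -/

import Mathlib

open scoped Matrix

noncomputable section

namespace EncodedCCZ

/-! ### Qubits, states, Pauli operators -/

/-- Pure (not necessarily normalised) states of qubits labelled by `W`, given by their amplitudes
in the computational basis; a basis state is a bit string `W → ZMod 2`. -/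
abbrev State (W : Type) := (W → ZMod 2) → ℂ

/-- `(-1)^b`. -/
def sgn (b : ZMod 2) : ℂ := if b = 0 then 1 else -1

/-- The Pauli operator `Z^z X^x`, for bit strings `x` and `z` (global phases are irrelevant here,
so for instance the strings `x = z = e_w` stand for `Y` on `w`). -/
def pauli {W : Type} [Fintype W] (x z : W → ZMod 2) (ψ : State W) : State W :=
  fun y => sgn (z ⬝ᵥ y) * ψ (y + x)

/-- Elementary unitary gates. For `cz` and `ccz` repeated wires are harmless: the gate is then the
corresponding gate on fewer qubits. -/
inductive Gate (W : Type) : Type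
  | x (w : W)
  | z (w : W)
  | h (w : W)
  | s (w : W)
  | cnot (control target : W) (ne : control ≠ target)
  | cz (u v : W)
  | ccz (u v w : W)

/-- The unitary of a gate. -/
def Gate.apply {W : Type} [DecidableEq W] : Gate W → State W → State W
  | .x w, ψ => fun y => ψ (Function.update y w (y w + 1))
  | .z w, ψ => fun y => sgn (y w) * ψ y
  | .h w, ψ => fun y => ((Real.sqrt 2 : ℝ) : ℂ)⁻¹ *
      ∑ b : ZMod 2, sgn (b * y w) * ψ (Function.update y w b)
  | .s w, ψ => fun y => (if y w = 0 then 1 else Complex.I) * ψ y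
  | .cnot c t _, ψ => fun y => ψ (Function.update y t (y t + y c))
  | .cz u v, ψ => fun y => sgn (y u * y v) * ψ y
  | .ccz u v w, ψ => fun y => sgn (y u * y v * y w) * ψ y

/-- The wires a gate acts on. -/
def Gate.support {W : Type} : Gate W → Set W
  | .x w => {w}
  | .z w => {w}
  | .h w => {w}
  | .s w => {w}
  | .cnot c t _ => {c, t}
  | .cz u v => {u, v}
  | .ccz u v w => {u, v, w}

/-- Apply a list of gates, the head of the list first. -/
def applyGates {W : Type} [DecidableEq W] (gs : List (Gate W)) (ψ : State W) : State W :=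
  gs.foldl (fun ψ g => g.apply ψ) ψ

/-! ### The fifteen-qubit Hamming code -/

/-- The parity checks; each row gives one `X` stabilizer and one `Z` stabilizer. The column of
qubit `q` (qubits are numbered `1, …, 15`) is `q` in binary. -/
def parityCheck : Matrix (Fin 4) (Fin 15) (ZMod 2) :=
  !![0,0,0,0,0,0,0,1,1,1,1,1,1,1,1;
     0,0,0,1,1,1,1,0,0,0,0,1,1,1,1;
     0,1,1,0,0,1,1,0,0,1,1,0,0,1,1;
     1,0,1,0,1,0,1,0,1,0,1,0,1,0,1]

/-- The index of qubit number `q`, for `1 ≤ q ≤ 15`. -/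
def qb (q : ℕ) : Fin 15 := ⟨(q + 14) % 15, Nat.mod_lt _ (by norm_num)⟩

/-- The indicator string of a list of qubits. -/
def indicator (l : List (Fin 15)) : Fin 15 → ZMod 2 := fun i => if i ∈ l then 1 else 0

/-- The code space: the states fixed by all the stabilizers. -/
def codeSpace : Set (State (Fin 15)) :=
  {ψ | ∀ r : Fin 4, pauli (parityCheck r) 0 ψ = ψ ∧ pauli 0 (parityCheck r) ψ = ψ}

/-- A choice of seven logical qubits: the rows of `SX` and `SZ` are the supports of logical
operators `X̄_j` and `Z̄_j`. They commute with the stabilizers, and `X̄_i` and `Z̄_j` anticommute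
for `i = j` and commute for `i ≠ j`. -/
def IsLogicalBasis (SX SZ : Matrix (Fin 7) (Fin 15) (ZMod 2)) : Prop :=
  SX * parityCheckᵀ = 0 ∧ SZ * parityCheckᵀ = 0 ∧ SX * SZᵀ = 1

/-- The encoded basis state `|x̄⟩ ∝ ∏_j X̄_j^{x_j} ∑_{stabilizers X_S} X_S |0^15⟩`, normalised. -/
def codeword (SX : Matrix (Fin 7) (Fin 15) (ZMod 2)) (x : Fin 7 → ZMod 2) : State (Fin 15) :=
  fun y => ∑ u : Fin 4 → ZMod 2, if y = x ᵥ* SX + u ᵥ* parityCheck then 1 / 4 else 0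

/-- The encoding map, from states of the seven logical qubits to states of the code block. -/
def encode (SX : Matrix (Fin 7) (Fin 15) (ZMod 2)) (φ : State (Fin 7)) : State (Fin 15) :=
  fun y => ∑ x : Fin 7 → ZMod 2, φ x * codeword SX x y

/-! ### Adaptive protocols with `a` ancilla qubits, and their noisy execution -/

/-- The wires: fifteen data qubits and `a` ancilla qubits. -/
abbrev Wire (a : ℕ) := Fin 15 ⊕ Fin a

/-- The two bases for preparations and measurements: `Z` (`|0⟩, |1⟩`) and `X` (`|+⟩, |-⟩`).
Outcome `0` stands for `|0⟩`, respectively `|+⟩`; outcome `1` for `|1⟩`, respectively `|-⟩`. -/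
inductive MBasis : Type
  | Z
  | X

/-- Strings on the data qubits, extended by zero to the ancilla qubits. -/
def onData {a : ℕ} (x : Fin 15 → ZMod 2) : Wire a → ZMod 2 := Sum.elim x 0

/-- The product of a state of the data and a state of the ancilla qubits. -/
def tensor {a : ℕ} (ψ : State (Fin 15)) (χ : State (Fin a)) : State (Wire a) :=
  fun y => ψ (fun i => y (Sum.inl i)) * χ (fun i => y (Sum.inr i))

/-- An adaptive protocol: a tree of gates, single-qubit preparations (resets) to `|0⟩` or `|+⟩`,
and single-qubit measurements on whose outcomes everything later may depend. At the end the block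
is handed over to error correction with a correction table, that assigns to the `Z` syndrome and
the `X` syndrome the strings `x` and `z` of a Pauli correction; as the table sits at a leaf of the
tree, it may use all the earlier measurement outcomes. -/
inductive Protocol (a : ℕ) : Type
  | finish (table : (Fin 4 → ZMod 2) → (Fin 4 → ZMod 2) →
      (Fin 15 → ZMod 2) × (Fin 15 → ZMod 2)) : Protocol a
  | gate (g : Gate (Wire a)) (next : Protocol a) : Protocol a
  | prep (B : MBasis) (w : Wire a) (next : Protocol a) : Protocol a
  | meas (B : MBasis) (w : Wire a) (next : ZMod 2 → Protocol a) : Protocol a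

/-- The Kraus operators of resetting the qubit `w`: `|0⟩⟨b|` or `|+⟩⟨b|`, for `b = 0, 1`. -/
def prepBranch {a : ℕ} : MBasis → Wire a → ZMod 2 → State (Wire a) → State (Wire a)
  | .Z, w, b, ψ => fun y => if y w = 0 then ψ (Function.update y w b) else 0
  | .X, w, b, ψ => fun y => ((Real.sqrt 2 : ℝ) : ℂ)⁻¹ * ψ (Function.update y w b)

/-- The projection of the qubit `w` belonging to measurement outcome `b`. -/
def measBranch {a : ℕ} : MBasis → Wire a → ZMod 2 → State (Wire a) → State (Wire a)
  | .Z, w, b, ψ => fun y => if y w = b then ψ y else 0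
  | .X, w, b, ψ => fun y => (1 / 2) *
      ∑ c : ZMod 2, sgn (b * (y w + c)) * ψ (Function.update y w c)

/-- The projection of the data onto the states with `Z` syndrome `s` (eigenvalues `(-1)^{s_r}` of
the `Z` stabilizers) and `X` syndrome `t`. -/
def syndromeProj {a : ℕ} (s t : Fin 4 → ZMod 2) (ψ : State (Wire a)) : State (Wire a) :=
  fun y => if parityCheck *ᵥ (fun i => y (Sum.inl i)) = s then
    (1 / 16) * ∑ u : Fin 4 → ZMod 2, sgn (u ⬝ᵥ t) * ψ (y + onData (u ᵥ* parityCheck)) else 0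

/-- `Run k p ψ ψ'`: with at most `k` faults, one of the branches (choices of all the measurement
outcomes) of the protocol `p`, started in `ψ`, ends in the unnormalised state `ψ'` after perfect
final error correction. A fault is
* an arbitrary Pauli operator on the qubits of a gate, right after the gate, or
* an arbitrary one-qubit Pauli operator on any data or ancilla qubit at any time (this covers
  faults of resting qubits, of preparations and of measurements).
A branch of probability zero ends in `0`. -/
inductive Run {a : ℕ} : ℕ → Protocol a → State (Wire a) → State (Wire a) → Prop
  | finish (k : ℕ) (table) (s t : Fin 4 → ZMod 2) (ψ : State (Wire a)) :
      Run k (.finish table) ψ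
        (pauli (onData (table s t).1) (onData (table s t).2) (syndromeProj s t ψ))
  | gate (k : ℕ) (g : Gate (Wire a)) (p : Protocol a) (ψ ψ' : State (Wire a)) :
      Run k p (g.apply ψ) ψ' → Run k (.gate g p) ψ ψ'
  | gateFault (k : ℕ) (g : Gate (Wire a)) (p : Protocol a) (x z : Wire a → ZMod 2)
      (hxz : ∀ w, w ∉ g.support → x w = 0 ∧ z w = 0) (ψ ψ' : State (Wire a)) :
      Run k p (pauli x z (g.apply ψ)) ψ' → Run (k + 1) (.gate g p) ψ ψ'
  | idleFault (k : ℕ) (p : Protocol a) (w : Wire a) (b c : ZMod 2) (ψ ψ' : State (Wire a)) :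
      Run k p (pauli (Pi.single w b) (Pi.single w c) ψ) ψ' → Run (k + 1) p ψ ψ'
  | prep (k : ℕ) (B : MBasis) (w : Wire a) (p : Protocol a) (b : ZMod 2)
      (ψ ψ' : State (Wire a)) :
      Run k p (prepBranch B w b ψ) ψ' → Run k (.prep B w p) ψ ψ'
  | meas (k : ℕ) (B : MBasis) (w : Wire a) (p : ZMod 2 → Protocol a) (b : ZMod 2)
      (ψ ψ' : State (Wire a)) :
      Run k (p b) (measBranch B w b ψ) ψ' → Run k (.meas B w p) ψ ψ'

/-- The protocol is a fault-tolerant implementation of the logical operator `U`: if the input lies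
in the code space (and the ancilla qubits are in any state), at most one fault occurs, and the
subsequent error correction is perfect, then in every branch the output lies in the code space and
has no logical error, that is, it is the encoded `U φ` (times a state of the ancilla qubits, which
absorbs normalisation and global phase). -/
def FaultTolerant {a : ℕ} (SX : Matrix (Fin 7) (Fin 15) (ZMod 2)) (p : Protocol a)
    (U : Matrix (Fin 7 → ZMod 2) (Fin 7 → ZMod 2) ℂ) : Prop :=
  ∀ (φ : State (Fin 7)) (χ : State (Fin a)) (ψ' : State (Wire a)),
    Run 1 p (tensor (encode SX φ) χ) ψ' →
      ∃ χ' : State (Fin a), ψ' = tensor (encode SX (U *ᵥ φ)) χ'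

/-! ### The gadgets -/

/-- The measurement outcomes so far, in order. -/
abbrev Record := List (ZMod 2)

/-- Apply gates, then continue with `p`. -/
def withGates {a : ℕ} (gs : List (Gate (Wire a))) (p : Protocol a) : Protocol a :=
  gs.foldr Protocol.gate p

/-- Prepare ancilla qubits. -/
def withPreps {a : ℕ} (l : List (MBasis × Fin a)) (p : Protocol a) : Protocol a :=
  l.foldr (fun q p => Protocol.prep q.1 (Sum.inr q.2) p) p

/-- Measure ancilla qubits, append the outcomes to the record, and continue with `k`. -/
def withMeas {a : ℕ} : List (MBasis × Fin a) → (Record → Protocol a) → Record → Protocol a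
  | [], k, rec => k rec
  | q :: qs, k, rec => .meas q.1 (Sum.inr q.2) fun b => withMeas qs k (rec ++ [b])

/-- CNOT from data qubit `i` to ancilla qubit `j`. -/
def cnotDA {a : ℕ} (i : Fin 15) (j : Fin a) : Gate (Wire a) :=
  .cnot (Sum.inl i) (Sum.inr j) Sum.inl_ne_inr

/-- CNOT from ancilla qubit `j` to data qubit `i`. -/
def cnotAD {a : ℕ} (j : Fin a) (i : Fin 15) : Gate (Wire a) :=
  .cnot (Sum.inr j) (Sum.inl i) Sum.inr_ne_inl

/-- The flag gadget for a CZ gate on `i, j`. Ancilla `1` (prepared as `|0⟩`, measured in the `Z`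
basis) is the outer flag that catches `X` faults on `j`; ancilla `0` (prepared as `|+⟩`, measured
in the `X` basis) is the inner flag that catches `Z` faults on `j`. -/
def czGadget (i j : Fin 15) (k : Record → Protocol 4) (rec : Record) : Protocol 4 :=
  withPreps [(.X, 0), (.Z, 1)] <|
  withGates [cnotDA j 1, cnotAD 0 j,
    .cz (Sum.inl i) (Sum.inl j), .cz (Sum.inl i) (Sum.inr 0),
    cnotAD 0 j, cnotDA j 1] <|
  withMeas [(.X, 0), (.Z, 1)] k rec

/-- The four-ancilla gadget for a CCZ gate on `i, j, l`: round-robin CCZ gates on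
`{i} × {j, ancilla 0} × {l, ancilla 2}`, where the ancillas `0` and `2` are inner flags for `Z`
faults on `j` and `l`, and the ancillas `1` and `3` outer flags for `X` faults on `j` and `l`. -/
def cczGadget (i j l : Fin 15) (k : Record → Protocol 4) (rec : Record) : Protocol 4 :=
  withPreps [(.X, 0), (.Z, 1), (.X, 2), (.Z, 3)] <|
  withGates [cnotDA j 1, cnotDA l 3, cnotAD 0 j, cnotAD 2 l,
    .ccz (Sum.inl i) (Sum.inl j) (Sum.inl l), .ccz (Sum.inl i) (Sum.inr 0) (Sum.inl l),
    .ccz (Sum.inl i) (Sum.inl j) (Sum.inr 2), .ccz (Sum.inl i) (Sum.inr 0) (Sum.inr 2),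
    cnotAD 0 j, cnotAD 2 l, cnotDA j 1, cnotDA l 3] <|
  withMeas [(.X, 0), (.Z, 1), (.X, 2), (.Z, 3)] k rec

/-- The order in which the qubits of each `Z` stabilizer are coupled to the syndrome qubit. -/
def zOrder (r : Fin 4) (n : Fin 8) : Fin 15 :=
  qb ((![![8, 9, 10, 12, 11, 14, 13, 15],
         ![4, 5, 6, 12, 7, 14, 13, 15],
         ![2, 3, 6, 10, 7, 14, 11, 15],
         ![1, 5, 3, 9, 7, 11, 13, 15]] : Fin 4 → Fin 8 → ℕ) r n)

/-- Fault-tolerant extraction of the syndrome of a `Z` stabilizer. Ancilla `0` (prepared as `|0⟩`)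
collects the syndrome; ancilla `1` (prepared as `|+⟩`) is a flag for `Z` faults on ancilla `0`.
The continuation receives the two outcomes. -/
def flaggedSyndrome (r : Fin 4) (k : ZMod 2 → ZMod 2 → Record → Protocol 4) (rec : Record) :
    Protocol 4 :=
  let flag : Gate (Wire 4) := .cnot (Sum.inr 1) (Sum.inr 0) (by decide)
  let c : Fin 8 → Gate (Wire 4) := fun n => cnotDA (zOrder r n) 0
  withPreps [(.Z, 0), (.X, 1)] <|
  withGates [c 0, flag, c 1, c 2, c 3, c 4, c 5, c 6, flag, c 7] <|
  .meas .Z (Sum.inr 0) fun b => .meas .X (Sum.inr 1) fun f => k b f (rec ++ [b, f])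

/-- Extraction of the syndrome of a `Z` stabilizer without a flag. -/
def unflaggedSyndrome (r : Fin 4) (k : Record → Protocol 4) (rec : Record) : Protocol 4 :=
  withPreps [(.Z, 0)] <|
  withGates ((List.finRange 8).map fun n => cnotDA (zOrder r n) 0) <|
  withMeas [(.Z, 0)] k rec

/-- Extract the given syndromes without flags, then apply the `X` correction that the rule `xr`
assigns to the record. -/
def extractAndCorrect (xr : Record → Fin 15 → ZMod 2) (k : Record → Protocol 4) :
    List (Fin 4) → Record → Protocol 4
  | [], rec => withGates
      (((List.finRange 15).filter fun i => xr rec i = 1).map fun i => Gate.x (Sum.inl i)) (k rec)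
  | r :: rs, rec => unflaggedSyndrome r (extractAndCorrect xr k rs) rec

/-- `X` error correction, from the list of the `Z` stabilizers still to be measured: measure them
one by one with flags; at the first nontrivial outcome, extract all four syndromes again without
flags, and correct. -/
def xCorrectionFrom (xr : Record → Fin 15 → ZMod 2) (k : Record → Protocol 4) :
    List (Fin 4) → Record → Protocol 4
  | [], rec => k rec
  | r :: rs, rec => flaggedSyndrome r (fun b f rec' =>
      if b = 0 ∧ f = 0 then xCorrectionFrom xr k rs rec'
      else extractAndCorrect xr k (List.finRange 4) rec') rec

/-- `X` error correction with two ancilla qubits. -/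
def xCorrection (xr : Record → Fin 15 → ZMod 2) (k : Record → Protocol 4) :
    Record → Protocol 4 :=
  xCorrectionFrom xr k (List.finRange 4)

/-! ### The encoded CCZ gate -/

/-- The tuples of `{1,4,5} × {1,6,7} × {1,8,9}`. -/
def triples : List (Fin 15 × Fin 15 × Fin 15) :=
  [qb 1, qb 4, qb 5] ×ˢ ([qb 1, qb 6, qb 7] ×ˢ [qb 1, qb 8, qb 9])

/-- The ideal physical gate of a tuple: a CCZ gate, or CZ or Z when qubits coincide. -/
def roundRobinGate (t : Fin 15 × Fin 15 × Fin 15) : Gate (Fin 15) :=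
  match [t.1, t.2.1, t.2.2].dedup with
  | [i] => .z i
  | [i, j] => .cz i j
  | _ => .ccz t.1 t.2.1 t.2.2

/-- The fault-tolerant version of the gate of a tuple: the gadget followed by `X` error correction
(a lone `Z` gate is just applied). -/
def stage (xr : Record → Fin 15 → ZMod 2) (t : Fin 15 × Fin 15 × Fin 15)
    (k : Record → Protocol 4) (rec : Record) : Protocol 4 :=
  match [t.1, t.2.1, t.2.2].dedup with
  | [i] => .gate (.z (Sum.inl i)) (k rec)
  | [i, j] => czGadget i j (xCorrection xr k) rec
  | _ => cczGadget t.1 t.2.1 t.2.2 (xCorrection xr k) rec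

/-- The protocol for a list of tuples, from a given record on. The rule `xr` chooses the
intermediate `X` corrections, and `fr` the table of the final error correction. -/
def protocolFrom (xr : Record → Fin 15 → ZMod 2)
    (fr : Record → (Fin 4 → ZMod 2) → (Fin 4 → ZMod 2) → (Fin 15 → ZMod 2) × (Fin 15 → ZMod 2)) :
    List (Fin 15 × Fin 15 × Fin 15) → Record → Protocol 4
  | [], rec => .finish (fr rec)
  | t :: ts, rec => stage xr t (protocolFrom xr fr ts) rec

/-- The protocol for the encoded CCZ gate, with the round-robin gates in the given order. It uses
`15 + 4 = 19` qubits. -/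
def cczProtocol (order : List (Fin 15 × Fin 15 × Fin 15)) (xr : Record → Fin 15 → ZMod 2)
    (fr : Record → (Fin 4 → ZMod 2) → (Fin 4 → ZMod 2) → (Fin 15 → ZMod 2) × (Fin 15 → ZMod 2)) :
    Protocol 4 :=
  protocolFrom xr fr order []

/-- The CCZ gate on the first three logical qubits. -/
def logicalCCZ : Matrix (Fin 7 → ZMod 2) (Fin 7 → ZMod 2) ℂ :=
  Matrix.diagonal fun x => sgn (x 0 * x 1 * x 2)

/-- The logical operators `Z̄_1, Z̄_2, Z̄_3` are `Z` on `{1,4,5}`, `{1,6,7}` and `{1,8,9}`. -/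
def HasTargetLogicals (SZ : Matrix (Fin 7) (Fin 15) (ZMod 2)) : Prop :=
  SZ 0 = indicator [qb 1, qb 4, qb 5] ∧ SZ 1 = indicator [qb 1, qb 6, qb 7] ∧
    SZ 2 = indicator [qb 1, qb 8, qb 9]

/-- `U` is a Clifford operator (up to phase it maps Paulis to Paulis by conjugation). -/
def IsClifford (U : Matrix (Fin 7 → ZMod 2) (Fin 7 → ZMod 2) ℂ) : Prop :=
  ∀ x z : Fin 7 → ZMod 2, ∃ (x' z' : Fin 7 → ZMod 2) (c : ℂ), ∀ φ : State (Fin 7),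
    U *ᵥ (pauli x z φ) = c • pauli x' z' (U *ᵥ φ)

end EncodedCCZ

end

open EncodedCCZ

set_option linter.unusedSectionVars false

noncomputable section

namespace EncodedCCZ

/-! ### Signs and Pauli operators -/

/-! Fault tolerance. Each branch of a fault-free run is a linear operator, so the states from which
every branch reaches the goal form a submodule, `safe`. After the one allowed fault it is therefore
enough to treat Pauli errors whose span contains the faulty state. Before the fault the state is
known exactly, and `Safe1` follows that single state. Between round-robin gates the data need not
satisfy the `X` stabilizers, but they stay supported on strings satisfying the parity checks
(`InCode`), and this is what the `Z` checks need. Bit flips that a check reveals are corrected at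
once, as they do not commute with the remaining gates. Phase flips do commute with them
(`roundRobinGate_pauli`) and wait for the final table.

The decoder works because a fault leads to one of a few classes of errors, and the record tells
which. A gadget on the qubits `T` (`czGadget_fault`, `cczGadget_fault`) leaves an arbitrary error on
`T` if a flag is raised. If no flag is raised, it leaves a single-qubit error, or the flip of one
qubit of `T` with arbitrary phase flips on `T`; in the latter case the flip is found by the next
checks and gives `T` away. A fault in a flagged check (`flagged_fault`) leaves a single-qubit error
up to stabilizers if the flag is silent, and otherwise at most one bit flip together with phase
flips along a suffix of the coupling order. Within each class the syndrome determines the error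
(`injOn_singles`, `injOn_suppStrings`, `injOn_suffixes`): columns of the check matrix are distinct
and non-zero, the distinct columns of each tuple are independent, and the suffixes of the chosen
orders have different syndromes. `decode_fired` combines this. An error that stays unnoticed without
any flag is a single-qubit error, and enters the next gadget as a fault before its first gate.

The logical action is the distributive law: on a code string `y` the round-robin phases add up to
the product of the three parities of `y` on `{1,4,5}`, `{1,6,7}`, `{1,8,9}`, and `y q ^ 2 = y q`
accounts for coinciding qubits.

Universality. Let `Γ` be the closure of the generated group and consider the self-adjoint `a` with
`exp (i t a)` in `Γ` for all real `t`. By the Lie product formula they form a real vector space,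
stable under conjugation by `Γ`. Transversal Hadamard gates followed by a qubit permutation (a
transvection of the labels) conjugate the logical CCZ, `1 - 2P`, into `1 - 2Q`, where `P Q P = P /
8` and `Q P Q = Q / 8`. The product of these reflections is a rotation by an angle with cosine `2 /
8 - 1 = -3 / 4`, which by Niven's theorem is not a rational multiple of `π`, so `Γ` contains the
whole one-parameter group generated by a multiple of `i (P Q - Q P)` (`rotator_mem`). Averaging over
logical Pauli conjugations strips two of the three tensor factors and leaves the rotations about one
logical Pauli operator (`ThreePairs.mul_mem`). Products of anticommuting axes, transversal `H` and
`S`, the cyclic automorphism of order fifteen and a logical CZ spread them to every Pauli axis.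
These span all self-adjoint operators (`infinitesimal_eq_top`), hence `Γ` is the full unitary group
(`eq_top_of_lieAlg`); by compactness the generated monoid is already dense. -/

theorem zmod2_cases (a : ZMod 2) : a = 0 ∨ a = 1 := by revert a; decide

theorem zmod2_add_self (a : ZMod 2) : a + a = 0 := CharTwo.add_self_eq_zero a

theorem zmod2_ne_zero {a : ZMod 2} : a ≠ 0 ↔ a = 1 := by revert a; decide

@[simp] theorem sgn_zero : sgn 0 = 1 := by simp [sgn]

@[simp] theorem sgn_one : sgn 1 = -1 := by simp [sgn]

theorem sgn_add (a b : ZMod 2) : sgn (a + b) = sgn a * sgn b := by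
  rcases zmod2_cases a with rfl | rfl <;> rcases zmod2_cases b with rfl | rfl <;>
    simp [zmod2_add_self]

@[simp] theorem sgn_mul_self (a : ZMod 2) : sgn a * sgn a = 1 := by
  rw [← sgn_add, zmod2_add_self, sgn_zero]

theorem sum_zmod2 {M : Type*} [AddCommMonoid M] (f : ZMod 2 → M) : ∑ b, f b = f 0 + f 1 :=
  Fin.sum_univ_two f

theorem string_add_self {W : Type*} (x : W → ZMod 2) : x + x = 0 :=
  funext fun _ => zmod2_add_self _

theorem add_add_cancel_string {W : Type*} (x y : W → ZMod 2) : x + y + y = x := by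
  rw [add_assoc, string_add_self, add_zero]

/-! ### Gates and Pauli operators as linear maps -/

section Linear

variable {W : Type} [Fintype W] [DecidableEq W]

/-- `pauli` as a linear map. -/
def pauliLin (x z : W → ZMod 2) : State W →ₗ[ℂ] State W where
  toFun := pauli x z
  map_add' ψ φ := by ext y; simp [pauli, mul_add]
  map_smul' c ψ := by ext y; simp [pauli]; ring

@[simp] theorem pauliLin_apply (x z : W → ZMod 2) (ψ : State W) : pauliLin x z ψ = pauli x z ψ :=
  rfl

theorem pauli_smul (x z : W → ZMod 2) (c : ℂ) (ψ : State W) :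
    pauli x z (c • ψ) = c • pauli x z ψ := (pauliLin x z).map_smul c ψ

theorem pauli_pauli (x z x' z' : W → ZMod 2) (ψ : State W) :
    pauli x z (pauli x' z' ψ) = sgn (z' ⬝ᵥ x) • pauli (x + x') (z + z') ψ := by
  ext y
  simp only [pauli, Pi.smul_apply, smul_eq_mul, dotProduct_add, add_dotProduct, sgn_add,
    add_assoc]
  ring

@[simp] theorem pauli_zero_zero (ψ : State W) : pauli 0 0 ψ = ψ := by ext y; simp [pauli]

/-- The unitary of a gate as a linear map. -/
def Gate.lin (g : Gate W) : State W →ₗ[ℂ] State W where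
  toFun := g.apply
  map_add' ψ φ := by
    cases g <;> ext y <;> simp [Gate.apply, mul_add, Finset.sum_add_distrib]
  map_smul' c ψ := by
    cases g <;> ext y <;>
      simp only [Gate.apply, Finset.mul_sum, Pi.smul_apply, smul_eq_mul, RingHom.id_apply]
    case h => exact Finset.sum_congr rfl fun _ _ => by ring
    all_goals ring

@[simp] theorem Gate.lin_apply (g : Gate W) (ψ : State W) : g.lin ψ = g.apply ψ := rfl

/-- `applyGates` as a linear map. -/
def gatesLin (gs : List (Gate W)) : State W →ₗ[ℂ] State W where
  toFun := applyGates gs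
  map_add' ψ φ := by
    induction gs generalizing ψ φ with
    | nil => rfl
    | cons g gs ih =>
      simp only [applyGates, List.foldl_cons] at ih ⊢
      rw [← ih, ← Gate.lin_apply, map_add]; rfl
  map_smul' c ψ := by
    induction gs generalizing ψ with
    | nil => rfl
    | cons g gs ih =>
      simp only [applyGates, List.foldl_cons] at ih ⊢
      rw [← ih, ← Gate.lin_apply, map_smul]; rfl

@[simp] theorem gatesLin_apply (gs : List (Gate W)) (ψ : State W) :
    gatesLin gs ψ = applyGates gs ψ := rfl

omit [Fintype W] in
@[simp] theorem applyGates_nil (ψ : State W) : applyGates [] ψ = ψ := rfl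

omit [Fintype W] in
@[simp] theorem applyGates_cons (g : Gate W) (gs : List (Gate W)) (ψ : State W) :
    applyGates (g :: gs) ψ = applyGates gs (g.apply ψ) := rfl

omit [Fintype W] in
theorem applyGates_append (gs hs : List (Gate W)) (ψ : State W) :
    applyGates (gs ++ hs) ψ = applyGates hs (applyGates gs ψ) := by
  simp [applyGates]

end Linear

/-! ### Product states of data and ancillas, and the branch operators as linear maps -/

section Wires

variable {a : ℕ}

/-- `tensor` as a linear map in the ancilla state. -/
def tensorLin (d : State (Fin 15)) : State (Fin a) →ₗ[ℂ] State (Wire a) where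
  toFun := tensor d
  map_add' χ χ' := by ext y; simp [tensor, mul_add]
  map_smul' c χ := by ext y; simp [tensor]; ring

/-- `tensor` as a linear map in the data state. -/
def tensorLeft (χ : State (Fin a)) : State (Fin 15) →ₗ[ℂ] State (Wire a) where
  toFun d := tensor d χ
  map_add' d d' := by ext y; simp [tensor, add_mul]
  map_smul' c d := by ext y; simp [tensor]; ring

theorem tensor_smul (d : State (Fin 15)) (c : ℂ) (χ : State (Fin a)) :
    tensor d (c • χ) = c • tensor d χ := (tensorLin d).map_smul c χ

theorem smul_tensor (d : State (Fin 15)) (c : ℂ) (χ : State (Fin a)) :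
    tensor (c • d) χ = c • tensor d χ := (tensorLeft χ).map_smul c d

/-- The part of a string on the data qubits. -/
def dataPart (x : Wire a → ZMod 2) : Fin 15 → ZMod 2 := fun i => x (Sum.inl i)

/-- The part of a string on the ancilla qubits. -/
def ancPart (x : Wire a → ZMod 2) : Fin a → ZMod 2 := fun i => x (Sum.inr i)

theorem pauli_tensor (x z : Wire a → ZMod 2) (d : State (Fin 15)) (χ : State (Fin a)) :
    pauli x z (tensor d χ) =
      tensor (pauli (dataPart x) (dataPart z) d) (pauli (ancPart x) (ancPart z) χ) := by
  ext y
  simp only [pauli, tensor, dotProduct, Fintype.sum_sum_type, sgn_add, Pi.add_apply, dataPart,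
    ancPart]
  have h1 : (fun i => y (Sum.inl i) + x (Sum.inl i)) =
    (fun i => y (Sum.inl i)) + fun i => x (Sum.inl i) := rfl
  have h2 : (fun i => y (Sum.inr i) + x (Sum.inr i)) =
    (fun i => y (Sum.inr i)) + fun i => x (Sum.inr i) := rfl
  rw [h1, h2]
  unfold dataPart ancPart
  ring

/-- `prepBranch` as a linear map. -/
def prepLin (B : MBasis) (w : Wire a) (b : ZMod 2) : State (Wire a) →ₗ[ℂ] State (Wire a) where
  toFun := prepBranch B w b
  map_add' ψ φ := by
    cases B <;> ext y
    · simp only [prepBranch, Pi.add_apply]; split_ifs <;> simp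
    · simp [prepBranch, mul_add]
  map_smul' c ψ := by
    cases B <;> ext y
    · simp [prepBranch]
    · simp [prepBranch]; ring

/-- `measBranch` as a linear map. -/
def measLin (B : MBasis) (w : Wire a) (b : ZMod 2) : State (Wire a) →ₗ[ℂ] State (Wire a) where
  toFun := measBranch B w b
  map_add' ψ φ := by
    cases B <;> ext y
    · simp only [measBranch, Pi.add_apply]; split_ifs <;> simp
    · simp only [measBranch, Pi.add_apply, mul_add, Finset.sum_add_distrib]
  map_smul' c ψ := by
    cases B <;> ext y
    · simp [measBranch]
    · simp only [measBranch, Pi.smul_apply, smul_eq_mul, Finset.mul_sum, RingHom.id_apply]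
      exact Finset.sum_congr rfl fun _ _ => by ring

/-- `syndromeProj` as a linear map. -/
def syndromeLin (s t : Fin 4 → ZMod 2) : State (Wire a) →ₗ[ℂ] State (Wire a) where
  toFun := syndromeProj s t
  map_add' ψ φ := by
    ext y
    simp only [syndromeProj, Pi.add_apply]
    split_ifs
    · simp [mul_add, Finset.sum_add_distrib]
    · simp
  map_smul' c ψ := by
    ext y
    simp only [syndromeProj, Pi.smul_apply, smul_eq_mul, RingHom.id_apply]
    split_ifs
    · simp only [Finset.mul_sum]
      exact Finset.sum_congr rfl fun _ _ => by ring
    · simp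

@[simp] theorem prepLin_apply (B : MBasis) (w : Wire a) (b : ZMod 2) (ψ : State (Wire a)) :
    prepLin B w b ψ = prepBranch B w b ψ := rfl

@[simp] theorem measLin_apply (B : MBasis) (w : Wire a) (b : ZMod 2) (ψ : State (Wire a)) :
    measLin B w b ψ = measBranch B w b ψ := rfl

@[simp] theorem syndromeLin_apply (s t : Fin 4 → ZMod 2) (ψ : State (Wire a)) :
    syndromeLin s t ψ = syndromeProj s t ψ := by
  simp only [syndromeLin, LinearMap.coe_mk, AddHom.coe_mk]

/-! ### Runs without faults and with one fault -/

/-- The states from which every branch of a faultless run ends in `T`. -/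
def safe (T : Submodule ℂ (State (Wire a))) : Protocol a → Submodule ℂ (State (Wire a))
  | .finish table => ⨅ s, ⨅ t, (T.comap
      (pauliLin (onData (table s t).1) (onData (table s t).2))).comap (syndromeLin s t)
  | .gate g p => (safe T p).comap g.lin
  | .prep B w p => ⨅ b, (safe T p).comap (prepLin B w b)
  | .meas B w p => ⨅ b, (safe T (p b)).comap (measLin B w b)

variable (T : Submodule ℂ (State (Wire a)))

/-- A single-qubit Pauli fault now, and no fault later, leads to `T`. -/
def IdleSafe (p : Protocol a) (ψ : State (Wire a)) : Prop :=
  ∀ (w : Wire a) (b c : ZMod 2), pauli (Pi.single w b) (Pi.single w c) ψ ∈ safe T p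

/-- The states from which every branch of a run with at most one fault ends in `T`. -/
def Safe1 : Protocol a → State (Wire a) → Prop
  | .finish table, ψ => IdleSafe T (.finish table) ψ
  | .gate g p, ψ => IdleSafe T (.gate g p) ψ ∧ Safe1 p (g.apply ψ) ∧
      ∀ x z : Wire a → ZMod 2, (∀ w, w ∉ g.support → x w = 0 ∧ z w = 0) →
        pauli x z (g.apply ψ) ∈ safe T p
  | .prep B w p, ψ => IdleSafe T (.prep B w p) ψ ∧ ∀ b, Safe1 p (prepBranch B w b ψ)
  | .meas B w p, ψ => IdleSafe T (.meas B w p) ψ ∧ ∀ b, Safe1 (p b) (measBranch B w b ψ)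

variable {T}

/-- Soundness of `safe`. Because `safe` is a submodule, later arguments only have to test it on
states that span the possible ones. -/
theorem mem_of_run_zero {p : Protocol a} {ψ ψ' : State (Wire a)} (h : Run 0 p ψ ψ')
    (hψ : ψ ∈ safe T p) : ψ' ∈ T := by
  induction p generalizing ψ with
  | finish table =>
    cases h with
    | finish _ _ s t =>
      simp only [safe, Submodule.mem_iInf, Submodule.mem_comap, pauliLin_apply,
        syndromeLin_apply] at hψ
      exact hψ s t
  | gate g p ih =>
    cases h with
    | gate _ _ _ _ _ h => exact ih h hψ
  | prep B w p ih =>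
    cases h with
    | prep _ _ _ _ b _ _ h =>
      simp only [safe, Submodule.mem_iInf] at hψ
      exact ih h (hψ b)
  | meas B w p ih =>
    cases h with
    | meas _ _ _ _ b _ _ h =>
      simp only [safe, Submodule.mem_iInf] at hψ
      exact ih b h (hψ b)

/-- The identity counts as a Pauli fault, so the fault-free case is contained; the wire `w` merely
witnesses that there is one. -/
theorem IdleSafe.mem {p : Protocol a} {ψ : State (Wire a)} (w : Wire a) (h : IdleSafe T p ψ) :
    ψ ∈ safe T p := by simpa using h w 0 0

theorem Safe1.idle {p : Protocol a} {ψ : State (Wire a)} (h : Safe1 T p ψ) : IdleSafe T p ψ := by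
  cases p with
  | finish => exact h
  | gate => exact h.1
  | prep => exact h.1
  | meas => exact h.1

/-- The fault either happens now, after which `safe` takes over, or later, and then the present step
is the ideal one. -/
theorem mem_of_run_one {p : Protocol a} {ψ ψ' : State (Wire a)} (h : Run 1 p ψ ψ')
    (hψ : Safe1 T p ψ) : ψ' ∈ T := by
  induction p generalizing ψ with
  | finish table =>
    cases h with
    | finish _ _ s t => exact mem_of_run_zero (.finish 0 table s t ψ) (hψ.mem (Sum.inl 0))
    | idleFault _ _ w b c _ _ h => exact mem_of_run_zero h (hψ w b c)
  | gate g p ih =>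
    cases h with
    | gate _ _ _ _ _ h => exact ih h hψ.2.1
    | gateFault _ _ _ x z hxz _ _ h => exact mem_of_run_zero h (hψ.2.2 x z hxz)
    | idleFault _ _ w b c _ _ h => exact mem_of_run_zero h (hψ.1 w b c)
  | prep B w p ih =>
    cases h with
    | prep _ _ _ _ b _ _ h => exact ih h (hψ.2 b)
    | idleFault _ _ w b c _ _ h => exact mem_of_run_zero h (hψ.1 w b c)
  | meas B w p ih =>
    cases h with
    | meas _ _ _ _ b _ _ h => exact ih b h (hψ.2 b)
    | idleFault _ _ w b c _ _ h => exact mem_of_run_zero h (hψ.1 w b c)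

end Wires

/-! ### The code -/

theorem eq_of_add_eq_zero {W : Type*} {x y : W → ZMod 2} (h : x + y = 0) : x = y := by
  rw [← add_add_cancel_string x y, h, zero_add]

theorem sgn_sum {ι : Type*} (s : Finset ι) (f : ι → ZMod 2) :
    sgn (∑ i ∈ s, f i) = ∏ i ∈ s, sgn (f i) := by
  classical
  induction s using Finset.induction_on with
  | empty => simp
  | insert i s hi ih => rw [Finset.sum_insert hi, Finset.prod_insert hi, sgn_add, ih]

theorem sum_sgn_dotProduct {ι : Type*} [Fintype ι] [DecidableEq ι] (v : ι → ZMod 2) :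
    ∑ u : ι → ZMod 2, sgn (u ⬝ᵥ v) = if v = 0 then 2 ^ Fintype.card ι else 0 := by
  have h : ∑ u : ι → ZMod 2, sgn (u ⬝ᵥ v) = ∏ i, ∑ b : ZMod 2, sgn (b * v i) := by
    rw [Finset.prod_univ_sum]
    simp [dotProduct, sgn_sum]
  rw [h]
  split_ifs with hv
  · subst hv
    simp [Finset.prod_const]
  · obtain ⟨i, hi⟩ := Function.ne_iff.1 hv
    refine Finset.prod_eq_zero (Finset.mem_univ i) ?_
    rw [zmod2_ne_zero.1 hi, sum_zmod2]
    simp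

/-- The syndrome of a string. -/
def synd (y : Fin 15 → ZMod 2) : Fin 4 → ZMod 2 := parityCheck *ᵥ y

theorem synd_add (x y : Fin 15 → ZMod 2) : synd (x + y) = synd x + synd y :=
  Matrix.mulVec_add _ _ _

@[simp] theorem synd_zero : synd 0 = 0 := Matrix.mulVec_zero _

theorem synd_single (q : Fin 15) (b : ZMod 2) (r : Fin 4) :
    synd (Pi.single q b) r = parityCheck r q * b := by
  simp [synd]

theorem parityCheck_mul_transpose : parityCheck * parityCheckᵀ = 0 := by decide +kernel

theorem synd_vecMul (u : Fin 4 → ZMod 2) : synd (u ᵥ* parityCheck) = 0 := by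
  rw [synd, ← Matrix.mulVec_transpose, Matrix.mulVec_mulVec, parityCheck_mul_transpose,
    Matrix.zero_mulVec]

theorem dotProduct_row_eq (u : Fin 4 → ZMod 2) (y : Fin 15 → ZMod 2) :
    (u ᵥ* parityCheck) ⬝ᵥ y = u ⬝ᵥ synd y := (Matrix.dotProduct_mulVec _ _ _).symm

theorem synd_eq_zero_iff (y : Fin 15 → ZMod 2) : synd y = 0 ↔
    (y 7 + y 8 + y 9 + y 10 + y 11 + y 12 + y 13 + y 14 = 0 ∧
     y 3 + y 4 + y 5 + y 6 + y 11 + y 12 + y 13 + y 14 = 0 ∧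
     y 1 + y 2 + y 5 + y 6 + y 9 + y 10 + y 13 + y 14 = 0 ∧
     y 0 + y 2 + y 4 + y 6 + y 8 + y 10 + y 12 + y 14 = 0) := by
  rw [funext_iff, Fin.forall_fin_succ, Fin.forall_fin_succ, Fin.forall_fin_succ,
    Fin.forall_fin_one]
  simp [synd, parityCheck, Matrix.mulVec, dotProduct, Fin.sum_univ_succ, add_assoc]

/-- The positions that are not powers of two. -/
def freePos : Fin 11 → Fin 15 := ![2, 4, 5, 6, 8, 9, 10, 11, 12, 13, 14]

/-- The columns of qubits `1`, `2`, `4`, `8` (indices `0`, `1`, `3`, `7`) are the unit vectors, so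
each check determines one of these coordinates from the eleven others. -/
theorem eq_zero_of_free {y : Fin 15 → ZMod 2} (h : synd y = 0) (hf : ∀ k, y (freePos k) = 0) :
    y = 0 := by
  rw [synd_eq_zero_iff] at h
  have e : ∀ k q, freePos k = q → y q = 0 := fun k q hq => hq ▸ hf k
  have h2 := e 0 2 rfl
  have h4 := e 1 4 rfl
  have h5 := e 2 5 rfl
  have h6 := e 3 6 rfl
  have h8 := e 4 8 rfl
  have h9 := e 5 9 rfl
  have h10 := e 6 10 rfl
  have h11 := e 7 11 rfl
  have h12 := e 8 12 rfl
  have h13 := e 9 13 rfl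
  have h14 := e 10 14 rfl
  simp only [h2, h4, h5, h6, h8, h9, h10, h11, h12, h13, h14, add_zero] at h
  ext q
  fin_cases q
  exacts [h.2.2.2, h.2.2.1, h2, h.2.1, h4, h5, h6, h.1, h8, h9, h10, h11, h12, h13, h14]

theorem row_eq_zero {u : Fin 4 → ZMod 2} (h : u ᵥ* parityCheck = 0) : u = 0 := by
  -- The columns at the indices `7`, `3`, `1`, `0` are the unit vectors; there the combination of
  -- rows shows its own coefficients.
  have h0 := congrFun h 7
  have h1 := congrFun h 3
  have h2 := congrFun h 1
  have h3 := congrFun h 0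
  simp [Matrix.vecMul, dotProduct, Fin.sum_univ_four, parityCheck] at h0 h1 h2 h3
  ext r
  fin_cases r <;> assumption

section Basis

variable {SX SZ : Matrix (Fin 7) (Fin 15) (ZMod 2)}

theorem IsLogicalBasis.check_mul_Z (h : IsLogicalBasis SX SZ) : parityCheck * SZᵀ = 0 := by
  have := congrArg Matrix.transpose h.2.1
  simpa [Matrix.transpose_mul] using this

theorem IsLogicalBasis.check_mul_X (h : IsLogicalBasis SX SZ) : parityCheck * SXᵀ = 0 := by
  have := congrArg Matrix.transpose h.1
  simpa [Matrix.transpose_mul] using this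

theorem IsLogicalBasis.synd_X (h : IsLogicalBasis SX SZ) (x : Fin 7 → ZMod 2) :
    synd (x ᵥ* SX) = 0 := by
  rw [synd, ← Matrix.mulVec_transpose, Matrix.mulVec_mulVec, h.check_mul_X, Matrix.zero_mulVec]

theorem IsLogicalBasis.synd_Z (h : IsLogicalBasis SX SZ) (x : Fin 7 → ZMod 2) :
    synd (x ᵥ* SZ) = 0 := by
  rw [synd, ← Matrix.mulVec_transpose, Matrix.mulVec_mulVec, h.check_mul_Z, Matrix.zero_mulVec]

theorem IsLogicalBasis.Z_X (h : IsLogicalBasis SX SZ) (x : Fin 7 → ZMod 2) :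
    SZ *ᵥ (x ᵥ* SX) = x := by
  rw [← Matrix.vecMul_transpose, Matrix.vecMul_vecMul, h.2.2, Matrix.vecMul_one]

theorem IsLogicalBasis.X_Z (h : IsLogicalBasis SX SZ) (x : Fin 7 → ZMod 2) :
    SX *ᵥ (x ᵥ* SZ) = x := by
  have : SZ * SXᵀ = 1 := by simpa [Matrix.transpose_mul] using congrArg Matrix.transpose h.2.2
  rw [← Matrix.vecMul_transpose, Matrix.vecMul_vecMul, this, Matrix.vecMul_one]

theorem IsLogicalBasis.Z_check (h : IsLogicalBasis SX SZ) (u : Fin 4 → ZMod 2) :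
    SZ *ᵥ (u ᵥ* parityCheck) = 0 := by
  rw [← Matrix.vecMul_transpose, Matrix.vecMul_vecMul, h.check_mul_Z, Matrix.vecMul_zero]

theorem IsLogicalBasis.X_check (h : IsLogicalBasis SX SZ) (u : Fin 4 → ZMod 2) :
    SX *ᵥ (u ᵥ* parityCheck) = 0 := by
  rw [← Matrix.vecMul_transpose, Matrix.vecMul_vecMul, h.check_mul_X, Matrix.vecMul_zero]

/-- Restriction to the free positions is injective. Only this bound is needed, as any logical basis
exhibits `2 ^ 11` code strings. -/
theorem card_code : Fintype.card {y : Fin 15 → ZMod 2 // synd y = 0} ≤ 2 ^ 11 := by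
  have : Function.Injective (fun (y : {y : Fin 15 → ZMod 2 // synd y = 0}) (k : Fin 11) =>
      y.1 (freePos k)) := by
    intro y y' h
    have hs : synd (y.1 + y'.1) = 0 := by rw [synd_add, y.2, y'.2, add_zero]
    have := eq_zero_of_free hs fun k => by
      have := congrFun h k
      simp only at this
      simp [this, zmod2_add_self]
    exact Subtype.ext (by simpa [add_add_cancel_string] using congrArg (· + y'.1) this)
  simpa using Fintype.card_le_of_injective _ this

/-- The `2 ^ 7 * 2 ^ 4` strings `x ᵥ* SX + u ᵥ* parityCheck` are distinct, since `SZ` reads off `x`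
and the checks are independent. By `card_code` there is no room for further code strings. -/
theorem IsLogicalBasis.exists_row (h : IsLogicalBasis SX SZ) {y : Fin 15 → ZMod 2}
    (hy : synd y = 0) : ∃ u : Fin 4 → ZMod 2, y = (SZ *ᵥ y) ᵥ* SX + u ᵥ* parityCheck := by
  let f : (Fin 7 → ZMod 2) × (Fin 4 → ZMod 2) → {y : Fin 15 → ZMod 2 // synd y = 0} :=
    fun p => ⟨p.1 ᵥ* SX + p.2 ᵥ* parityCheck, by
      rw [synd_add, h.synd_X, synd_vecMul, add_zero]⟩
  have key : ∀ p, SZ *ᵥ (f p).1 = p.1 := fun p => by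
    simp only [f]
    rw [Matrix.mulVec_add, h.Z_X, h.Z_check, add_zero]
  have hinj : Function.Injective f := by
    rintro ⟨x, u⟩ ⟨x', u'⟩ hp
    have hx : x = x' := (key (x, u)).symm.trans (by rw [hp, key])
    subst hx
    have hu : u ᵥ* parityCheck = u' ᵥ* parityCheck := by
      simpa [f] using congrArg Subtype.val hp
    have : (u + u') ᵥ* parityCheck = 0 := by
      rw [Matrix.add_vecMul, hu, string_add_self]
    have := row_eq_zero this
    have : u = u' := by simpa [add_add_cancel_string] using congrArg (· + u') this
    rw [this]
  have hbij : Function.Bijective f := (Fintype.bijective_iff_injective_and_card f).2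
    ⟨hinj, le_antisymm (Fintype.card_le_of_injective f hinj) (by
      simpa [← pow_add] using card_code)⟩
  obtain ⟨p, hp⟩ := hbij.2 ⟨y, hy⟩
  have hp' : (f p).1 = y := by rw [hp]
  refine ⟨p.2, ?_⟩
  rw [← hp', key]

/-- A code string belongs to exactly one coset of the stabilizer strings, the one labelled by its
parities with the logical `Z` operators. With this closed form, diagonal gates and Pauli operators
on encoded states are computed pointwise. -/
theorem IsLogicalBasis.eq_of_rows (h : IsLogicalBasis SX SZ) (φ : State (Fin 7))
    (y : Fin 15 → ZMod 2) :
    encode SX φ y = if synd y = 0 then φ (SZ *ᵥ y) / 4 else 0 := by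
  unfold encode codeword
  split_ifs with hy
  · obtain ⟨u, hu⟩ := h.exists_row hy
    rw [Finset.sum_eq_single (SZ *ᵥ y)]
    · rw [Finset.sum_eq_single u]
      · rw [if_pos hu]; ring
      · intro u' _ hne
        refine if_neg fun h' => hne ?_
        have : (u + u') ᵥ* parityCheck = 0 := by
          rw [Matrix.add_vecMul, add_left_cancel (hu.symm.trans h'), string_add_self]
        have := row_eq_zero this
        exact (by simpa [add_add_cancel_string] using congrArg (· + u') this : u = u').symm
      · simp
    · intro x _ hx
      rw [Finset.sum_eq_zero, mul_zero]
      intro u' _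
      refine if_neg fun h' => hx ?_
      rw [h', Matrix.mulVec_add, h.Z_X, h.Z_check, add_zero]
    · simp
  · refine Finset.sum_eq_zero fun x _ => ?_
    rw [Finset.sum_eq_zero, mul_zero]
    intro u _
    refine if_neg fun h' => hy ?_
    rw [h', synd_add, h.synd_X, synd_vecMul, add_zero]

/-- A state supported on the strings that satisfy the parity checks. -/
def InCode (d : State (Fin 15)) : Prop := ∀ y, d y ≠ 0 → synd y = 0

theorem IsLogicalBasis.inCode (h : IsLogicalBasis SX SZ) (φ : State (Fin 7)) :
    InCode (encode SX φ) := fun y hy => by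
  by_contra hs
  rw [h.eq_of_rows, if_neg hs] at hy
  exact hy rfl

theorem IsLogicalBasis.encode_add_row (h : IsLogicalBasis SX SZ) (φ : State (Fin 7))
    (y : Fin 15 → ZMod 2) (u : Fin 4 → ZMod 2) :
    encode SX φ (y + u ᵥ* parityCheck) = encode SX φ y := by
  rw [h.eq_of_rows, h.eq_of_rows, synd_add, synd_vecMul, add_zero, Matrix.mulVec_add, h.Z_check,
    add_zero]

/-- The `Z` stabilizers constrain the support, the `X` stabilizers impose invariance under shifts.
The halves are separated because only the first is known to survive between the round-robin gates.
-/
theorem mem_codeSpace_iff (ψ : State (Fin 15)) : ψ ∈ codeSpace ↔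
    InCode ψ ∧ ∀ (y : Fin 15 → ZMod 2) (u : Fin 4 → ZMod 2), ψ (y + u ᵥ* parityCheck) = ψ y := by
  constructor
  · intro h
    refine ⟨fun y hy => funext fun r => ?_, fun y u => ?_⟩
    · have := congrFun (h r).2 y
      simp only [pauli, add_zero] at this
      have h1 : sgn (parityCheck r ⬝ᵥ y) = 1 := mul_right_cancel₀ hy (by rw [this, one_mul])
      change parityCheck r ⬝ᵥ y = 0
      rcases zmod2_cases (parityCheck r ⬝ᵥ y) with h0 | h0
      · exact h0
      · rw [h0] at h1
        norm_num [sgn] at h1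
    · have step : ∀ (r : Fin 4) (b : ZMod 2) y, ψ (y + b • parityCheck r) = ψ y := by
        intro r b y
        rcases zmod2_cases b with rfl | rfl
        · simp
        · have := congrFun (h r).1 y
          simpa [pauli] using this
      have e : y + u ᵥ* parityCheck = y + u 0 • parityCheck 0 + u 1 • parityCheck 1 +
          u 2 • parityCheck 2 + u 3 • parityCheck 3 := by
        ext q
        simp [Matrix.vecMul, dotProduct, Fin.sum_univ_four, add_assoc]
      rw [e, step, step, step, step]
  · rintro ⟨h1, h2⟩ r
    refine ⟨funext fun y => ?_, funext fun y => ?_⟩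
    · have := h2 y (Pi.single r 1)
      rw [Matrix.single_one_vecMul] at this
      simp only [pauli, zero_dotProduct, sgn_zero, one_mul]
      exact this
    · simp only [pauli, add_zero]
      by_cases hy : ψ y = 0
      · rw [hy, mul_zero]
      · have : parityCheck r ⬝ᵥ y = 0 := congrFun (h1 y hy) r
        rw [this, sgn_zero, one_mul]

theorem IsLogicalBasis.range_encode (h : IsLogicalBasis SX SZ) :
    Set.range (encode SX) = codeSpace := by
  ext ψ
  rw [mem_codeSpace_iff]
  constructor
  · rintro ⟨φ, rfl⟩
    exact ⟨h.inCode φ, h.encode_add_row φ⟩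
  · rintro ⟨h1, h2⟩
    -- The factor four undoes the normalisation of the codewords; by invariance one representative
    -- per coset suffices.
    refine ⟨fun x => 4 * ψ (x ᵥ* SX), funext fun y => ?_⟩
    rw [h.eq_of_rows]
    split_ifs with hy
    · obtain ⟨u, hu⟩ := h.exists_row hy
      conv_rhs => rw [hu, h2]
      ring
    · by_contra hne
      exact hy (h1 y (Ne.symm hne))

end Basis

/-! ### Final error correction -/

/-- On the support of `pauli a c d` the syndrome is constantly `synd a`, so a `Z` stabilizer acts
there as a sign. Phase errors thus matter only modulo the rows, even when the `X` stabilizers fail.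
-/
theorem pauli_add_row {d : State (Fin 15)} (hd : InCode d) (a c : Fin 15 → ZMod 2)
    (u : Fin 4 → ZMod 2) :
    pauli a (c + u ᵥ* parityCheck) d = sgn (u ⬝ᵥ synd a) • pauli a c d := by
  ext y
  simp only [pauli, add_dotProduct, sgn_add, dotProduct_row_eq, Pi.smul_apply, smul_eq_mul]
  by_cases hy : d (y + a) = 0
  · simp [hy]
  · have := hd _ hy
    have : synd y = synd a := by
      rw [synd_add] at this
      simpa [add_add_cancel_string] using congrArg (· + synd a) this
    rw [this]
    ring

/-- A Pauli operator maps the code space into one joint eigenspace of the stabilizers. The sum over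
`u` is a character sum that tests `t = synd c`. -/
theorem syndromeProj_tensor_pauli {k : ℕ} {d : State (Fin 15)} (hd : d ∈ codeSpace)
    (a c : Fin 15 → ZMod 2) (χ : State (Fin k)) (s t : Fin 4 → ZMod 2) :
    syndromeProj s t (tensor (pauli a c d) χ) =
      if s = synd a ∧ t = synd c then tensor (pauli a c d) χ else 0 := by
  obtain ⟨h1, h2⟩ := (mem_codeSpace_iff d).1 hd
  ext y
  have hsum : ∑ u : Fin 4 → ZMod 2, sgn (u ⬝ᵥ t) *
      tensor (pauli a c d) χ (y + onData (u ᵥ* parityCheck)) =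
      (if t = synd c then 16 else 0) * tensor (pauli a c d) χ y := by
    have : ∀ u : Fin 4 → ZMod 2, sgn (u ⬝ᵥ t) *
        tensor (pauli a c d) χ (y + onData (u ᵥ* parityCheck)) =
        sgn (u ⬝ᵥ (t + synd c)) * tensor (pauli a c d) χ y := by
      intro u
      have e1 : (fun i => (y + (onData (u ᵥ* parityCheck) : Wire k → ZMod 2)) (Sum.inl i)) =
        (fun i => y (Sum.inl i)) + u ᵥ* parityCheck := by ext i; simp [onData]
      have e2 : (fun i => (y + (onData (u ᵥ* parityCheck) : Wire k → ZMod 2)) (Sum.inr i)) =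
        (fun i => y (Sum.inr i)) := by ext i; simp [onData]
      simp only [tensor, e1, e2, pauli, dotProduct_add, sgn_add]
      rw [dotProduct_comm c (u ᵥ* parityCheck), dotProduct_row_eq, add_right_comm, h2]
      ring
    rw [Finset.sum_congr rfl fun u _ => this u, ← Finset.sum_mul, sum_sgn_dotProduct]
    have : t + synd c = 0 ↔ t = synd c := by
      constructor
      · intro h
        simpa [add_add_cancel_string] using congrArg (· + synd c) h
      · rintro rfl; exact string_add_self _
    simp only [this, Fintype.card_fin]
    norm_num
  simp only [syndromeProj, hsum]
  by_cases hy : d ((fun i => y (Sum.inl i)) + a) = 0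
  · have : tensor (pauli a c d) χ y = 0 := by simp only [tensor, pauli, hy, mul_zero, zero_mul]
    rw [this, mul_zero, mul_zero, ite_self]
    split_ifs
    · exact this.symm
    · rfl
  · have hs : parityCheck *ᵥ (fun i => y (Sum.inl i)) = synd a := by
      have := h1 _ hy
      rw [synd_add] at this
      exact eq_of_add_eq_zero this
    rw [hs]
    by_cases hs' : synd a = s
    · by_cases ht : t = synd c
      · rw [if_pos hs', if_pos ht, if_pos ⟨hs'.symm, ht⟩]
        ring
      · rw [if_pos hs', if_neg ht, if_neg fun h => ht h.2]
        simp
    · rw [if_neg hs', if_neg fun h => hs' h.1.symm]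
      rfl

/-- The states with the given data part. -/
def goal {k : ℕ} (d : State (Fin 15)) : Submodule ℂ (State (Wire k)) :=
  LinearMap.range (tensorLin d)

/-- Only the branch with the syndromes of the actual error survives, and there applying the same
Pauli operator once more cancels the error up to sign. -/
theorem finish_mem_safe {k : ℕ} {d : State (Fin 15)} (hd : d ∈ codeSpace)
    (table : (Fin 4 → ZMod 2) → (Fin 4 → ZMod 2) → (Fin 15 → ZMod 2) × (Fin 15 → ZMod 2))
    (a c : Fin 15 → ZMod 2) (h : table (synd a) (synd c) = (a, c)) (χ : State (Fin k)) :
    tensor (pauli a c d) χ ∈ safe (goal d) (.finish table) := by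
  simp only [safe, Submodule.mem_iInf, Submodule.mem_comap, pauliLin_apply, syndromeLin_apply]
  intro s t
  rw [syndromeProj_tensor_pauli hd]
  split_ifs with hst
  · obtain ⟨rfl, rfl⟩ := hst
    rw [h, pauli_tensor]
    have e1 : dataPart (onData a : Wire k → ZMod 2) = a := rfl
    have e2 : dataPart (onData c : Wire k → ZMod 2) = c := rfl
    have e3 : ancPart (onData a : Wire k → ZMod 2) = 0 := rfl
    have e4 : ancPart (onData c : Wire k → ZMod 2) = 0 := rfl
    rw [e1, e2, e3, e4, pauli_pauli, string_add_self, string_add_self, pauli_zero_zero,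
      pauli_zero_zero, smul_tensor]
    exact Submodule.smul_mem _ _ ⟨χ, rfl⟩
  · rw [← pauliLin_apply, map_zero]
    exact Submodule.zero_mem _

/-! ### Qubits with a definite value -/

theorem zmod2_add_eq_one {a b : ZMod 2} (h : a ≠ b) : a + b = 1 := by revert a b; decide

section HasVal

variable {W : Type} [Fintype W] [DecidableEq W]

/-- The qubit `w` is in the basis state `v` of the basis `B`. -/
def HasVal (B : MBasis) (w : W) (v : ZMod 2) (ψ : State W) : Prop :=
  match B with
  | .Z => ∀ y, y w ≠ v → ψ y = 0
  | .X => ∀ y b, ψ (Function.update y w b) = sgn (v * (y w + b)) * ψ y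

/-- The entry of a Pauli operator that flips the value of a qubit in the basis `B`. -/
def flipEntry (B : MBasis) (x z : W → ZMod 2) : W → ZMod 2 :=
  match B with
  | .Z => x
  | .X => z

theorem dotProduct_update (z y : W → ZMod 2) (w : W) (b : ZMod 2) :
    z ⬝ᵥ Function.update y w b = z ⬝ᵥ y + z w * (y w + b) := by
  have : Function.update y w b = y + Pi.single w (y w + b) := by
    ext w'
    by_cases h : w' = w
    · subst h; simp [← add_assoc, zmod2_add_self]
    · simp [h]
  rw [this, dotProduct_add, dotProduct_single]

theorem update_add_string (y x : W → ZMod 2) (w : W) (b : ZMod 2) :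
    Function.update y w b + x = Function.update (y + x) w (b + x w) := by
  ext w'
  by_cases h : w' = w
  · subst h; simp
  · simp [h]

theorem HasVal.pauli {B : MBasis} {w : W} {v : ZMod 2} {ψ : State W} (h : HasVal B w v ψ)
    (x z : W → ZMod 2) : HasVal B w (v + flipEntry B x z w) (EncodedCCZ.pauli x z ψ) := by
  cases B with
  | Z =>
    intro y hy
    simp only [EncodedCCZ.pauli]
    rw [h (y + x), mul_zero]
    intro h'
    apply hy
    rw [← h']
    simp [flipEntry, add_assoc, zmod2_add_self]
  | X =>
    intro y b
    simp only [EncodedCCZ.pauli, dotProduct_update, update_add_string]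
    rw [h (y + x)]
    have e : (y + x) w + (b + x w) = y w + b := by
      rw [Pi.add_apply, add_add_add_comm, zmod2_add_self, add_zero]
    rw [e]
    simp only [flipEntry, add_mul, sgn_add]
    ring

theorem HasVal.congr_val {B : MBasis} {w : W} {v v' : ZMod 2} {ψ : State W} (h : HasVal B w v ψ)
    (hv : v = v') : HasVal B w v' ψ := hv ▸ h

end HasVal

section Blocks

variable {a : ℕ}

theorem dataPart_update (y : Wire a → ZMod 2) (q : Fin a) (b : ZMod 2) :
    dataPart (Function.update y (Sum.inr q) b) = dataPart y := by
  ext i; simp [dataPart]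

theorem ancPart_update (y : Wire a → ZMod 2) (q : Fin a) (b : ZMod 2) :
    ancPart (Function.update y (Sum.inr q) b) = Function.update (ancPart y) q b := by
  ext i
  by_cases h : i = q
  · subst h; simp [ancPart]
  · simp [ancPart, h]

theorem tensor_eq (d : State (Fin 15)) (χ : State (Fin a)) (y : Wire a → ZMod 2) :
    tensor d χ y = d (dataPart y) * χ (ancPart y) := rfl

/-- The effect of `prepBranch` on the ancilla qubits. -/
def prepAnc : MBasis → Fin a → ZMod 2 → State (Fin a) → State (Fin a)
  | .Z, q, b, χ => fun y => if y q = 0 then χ (Function.update y q b) else 0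
  | .X, q, b, χ => fun y => ((Real.sqrt 2 : ℝ) : ℂ)⁻¹ * χ (Function.update y q b)

/-- The effect of `measBranch` on the ancilla qubits. -/
def measAnc : MBasis → Fin a → ZMod 2 → State (Fin a) → State (Fin a)
  | .Z, q, b, χ => fun y => if y q = b then χ y else 0
  | .X, q, b, χ => fun y => (1 / 2) *
      ∑ c : ZMod 2, sgn (b * (y q + c)) * χ (Function.update y q c)

theorem prepBranch_tensor (B : MBasis) (q : Fin a) (b : ZMod 2) (d : State (Fin 15))
    (χ : State (Fin a)) : prepBranch B (Sum.inr q) b (tensor d χ) = tensor d (prepAnc B q b χ) := by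
  cases B <;> ext y <;>
    simp only [prepBranch, tensor_eq, prepAnc, dataPart_update, ancPart_update]
  · rw [show ancPart y q = y (Sum.inr q) from rfl]
    split_ifs <;> simp
  · ring

theorem measBranch_tensor (B : MBasis) (q : Fin a) (b : ZMod 2) (d : State (Fin 15))
    (χ : State (Fin a)) : measBranch B (Sum.inr q) b (tensor d χ) = tensor d (measAnc B q b χ) := by
  cases B <;> ext y <;>
    simp only [measBranch, tensor_eq, measAnc, dataPart_update, ancPart_update]
  · rw [show ancPart y q = y (Sum.inr q) from rfl]
    split_ifs <;> simp
  · rw [show ancPart y q = y (Sum.inr q) from rfl]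
    simp only [Finset.mul_sum]
    exact Finset.sum_congr rfl fun _ _ => by ring

theorem HasVal.tensor {B : MBasis} {q : Fin a} {v : ZMod 2} {χ : State (Fin a)}
    (h : HasVal B q v χ) (d : State (Fin 15)) :
    HasVal B (Sum.inr q) v (EncodedCCZ.tensor d χ) := by
  cases B with
  | Z =>
    intro y hy
    rw [tensor_eq, h (ancPart y) hy, mul_zero]
  | X =>
    intro y b
    rw [tensor_eq, tensor_eq, dataPart_update, ancPart_update, h]
    rw [show ancPart y q = y (Sum.inr q) from rfl]
    ring

theorem hasVal_prepAnc (B : MBasis) (q : Fin a) (b : ZMod 2) (χ : State (Fin a)) :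
    HasVal B q 0 (prepAnc B q b χ) := by
  cases B with
  | Z => exact fun y hy => if_neg hy
  | X => intro y b; simp [prepAnc]

theorem HasVal.prepAnc {B : MBasis} {q : Fin a} {v : ZMod 2} {χ : State (Fin a)}
    (h : HasVal B q v χ) (B' : MBasis) {q' : Fin a} (hq : q ≠ q') (b : ZMod 2) :
    HasVal B q v (EncodedCCZ.prepAnc B' q' b χ) := by
  cases B with
  | Z =>
    intro y hy
    have : χ (Function.update y q' b) = 0 := h _ (by rwa [Function.update_of_ne hq])
    cases B' <;> simp [EncodedCCZ.prepAnc, this]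
  | X =>
    intro y c
    have : χ (Function.update (Function.update y q c) q' b) =
        sgn (v * (y q + c)) * χ (Function.update y q' b) := by
      rw [Function.update_comm hq, h, Function.update_of_ne hq]
    cases B' <;> simp only [EncodedCCZ.prepAnc, this, Function.update_of_ne hq.symm]
    · split_ifs <;> simp
    · ring

theorem HasVal.measBranch {B : MBasis} {w : Wire a} {v : ZMod 2} {ψ : State (Wire a)}
    (h : HasVal B w v ψ) (B' : MBasis) {w' : Wire a} (hw : w ≠ w') (b : ZMod 2) :
    HasVal B w v (EncodedCCZ.measBranch B' w' b ψ) := by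
  cases B with
  | Z =>
    intro y hy
    cases B' with
    | Z => simp [EncodedCCZ.measBranch, h y hy]
    | X =>
      simp only [EncodedCCZ.measBranch]
      rw [Finset.sum_eq_zero, mul_zero]
      intro c _
      rw [h _ (by rwa [Function.update_of_ne hw]), mul_zero]
  | X =>
    intro y c
    cases B' with
    | Z =>
      simp only [EncodedCCZ.measBranch, Function.update_of_ne hw.symm, h y c]
      split_ifs <;> simp
    | X =>
      simp only [EncodedCCZ.measBranch, Function.update_of_ne hw.symm, Finset.mul_sum]
      refine Finset.sum_congr rfl fun e _ => ?_
      rw [Function.update_comm hw, h, Function.update_of_ne hw]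
      ring

/-- This is what definite values are for: a branch with the wrong outcome has probability zero, its
state is `0`, and every demand on it is met. -/
theorem HasVal.measBranch_eq_zero {B : MBasis} {w : Wire a} {v : ZMod 2} {ψ : State (Wire a)}
    (h : HasVal B w v ψ) {b : ZMod 2} (hb : b ≠ v) : EncodedCCZ.measBranch B w b ψ = 0 := by
  have hbv : b + v = 1 := zmod2_add_eq_one hb
  cases B with
  | Z =>
    ext y
    simp only [EncodedCCZ.measBranch]
    split_ifs with hy
    · exact h y (hy ▸ hb)
    · rfl
  | X =>
    ext y
    simp only [EncodedCCZ.measBranch, h y, sum_zmod2, Pi.zero_apply]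
    have e : ∀ c, sgn (b * (y w + c)) * (sgn (v * (y w + c)) * ψ y) = sgn (y w + c) * ψ y := by
      intro c
      rw [← mul_assoc, ← sgn_add, ← add_mul, hbv, one_mul]
    rw [e, e, sgn_add, sgn_add]
    simp

/-- Pauli operators on one wire commute with measurements of other wires. -/
theorem measBranch_pauli_single (B : MBasis) {w w' : Wire a} (hw : w ≠ w') (b x z : ZMod 2)
    (ψ : State (Wire a)) :
    measBranch B w' b (pauli (Pi.single w x) (Pi.single w z) ψ) =
      pauli (Pi.single w x) (Pi.single w z) (measBranch B w' b ψ) := by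
  cases B with
  | Z =>
    ext y
    simp [measBranch, pauli, hw.symm]
  | X =>
    ext y
    simp only [measBranch, pauli, dotProduct_update, update_add_string, Pi.add_apply,
      Pi.single_eq_of_ne hw.symm, add_zero, zero_mul, Finset.mul_sum]
    exact Finset.sum_congr rfl fun _ _ => by ring

theorem prepAnc_pauli_single (B : MBasis) {w w' : Fin a} (hw : w ≠ w') (b x z : ZMod 2)
    (χ : State (Fin a)) :
    prepAnc B w' b (pauli (Pi.single w x) (Pi.single w z) χ) =
      pauli (Pi.single w x) (Pi.single w z) (prepAnc B w' b χ) := by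
  cases B with
  | Z =>
    ext y
    simp [prepAnc, pauli, hw, hw.symm, update_add_string]
  | X =>
    ext y
    simp only [prepAnc, pauli, dotProduct_update, update_add_string,
      Pi.single_eq_of_ne hw.symm, add_zero, zero_mul]
    ring

/-! ### Blocks of preparations, gates and measurements -/

/-- Measure ancilla qubits and continue with the outcomes. -/
def measK : List (MBasis × Fin a) → (Record → Protocol a) → Protocol a
  | [], K => K []
  | q :: qs, K => .meas q.1 (Sum.inr q.2) fun b => measK qs fun o => K (b :: o)

theorem withMeas_eq (qs : List (MBasis × Fin a)) (k : Record → Protocol a) (rec : Record) :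
    withMeas qs k rec = measK qs fun o => k (rec ++ o) := by
  induction qs generalizing rec with
  | nil => simp [withMeas, measK]
  | cons q qs ih => simp [withMeas, measK, ih]

/-- The projection belonging to a list of outcomes. -/
def measAll : List (MBasis × Fin a) → Record → State (Wire a) →ₗ[ℂ] State (Wire a)
  | [], _ => LinearMap.id
  | q :: qs, o => measAll qs o.tail ∘ₗ measLin q.1 (Sum.inr q.2) (o.headD 0)

theorem measAll_cons (q : MBasis × Fin a) (qs : List (MBasis × Fin a)) (b : ZMod 2) (o : Record)
    (ψ : State (Wire a)) :
    measAll (q :: qs) (b :: o) ψ = measAll qs o (measBranch q.1 (Sum.inr q.2) b ψ) := rfl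

variable {T : Submodule ℂ (State (Wire a))}

theorem mem_safe_measK {ms : List (MBasis × Fin a)} {K : Record → Protocol a}
    {ψ : State (Wire a)}
    (h : ∀ o : Record, o.length = ms.length → measAll ms o ψ ∈ safe T (K o)) :
    ψ ∈ safe T (measK ms K) := by
  induction ms generalizing K ψ with
  | nil => exact h [] rfl
  | cons q qs ih =>
    simp only [measK, safe, Submodule.mem_iInf, Submodule.mem_comap, measLin_apply]
    exact fun b => ih fun o ho => h (b :: o) (by simp [ho])

theorem mem_safe_withGates {gs : List (Gate (Wire a))} {p : Protocol a} {ψ : State (Wire a)} :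
    ψ ∈ safe T (withGates gs p) ↔ applyGates gs ψ ∈ safe T p := by
  induction gs generalizing ψ with
  | nil => rfl
  | cons g gs ih => exact ih

/-- All the listed ancilla qubits are freshly prepared. -/
def Prepared (ps : List (MBasis × Fin a)) (χ : State (Fin a)) : Prop :=
  ∀ q ∈ ps, HasVal q.1 q.2 0 χ

/-- The list `qs` collects the ancillas prepared already. They keep their values because the
ancillas are distinct. -/
theorem mem_safe_withPreps_aux {ps qs : List (MBasis × Fin a)} {p : Protocol a}
    {d : State (Fin 15)} {χ : State (Fin a)} (hnd : ((qs ++ ps).map Prod.snd).Nodup)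
    (h : ∀ χ', Prepared (qs ++ ps) χ' → tensor d χ' ∈ safe T p) (hχ : Prepared qs χ) :
    tensor d χ ∈ safe T (withPreps ps p) := by
  induction ps generalizing qs χ with
  | nil => exact h χ (by simpa using hχ)
  | cons q ps ih =>
    simp only [withPreps, List.foldr_cons, safe, Submodule.mem_iInf, Submodule.mem_comap,
      prepLin_apply, prepBranch_tensor]
    intro b
    refine ih (qs := qs ++ [q]) (by simpa using hnd) (by simpa using h) ?_
    intro q' hq'
    rcases List.mem_append.1 hq' with hq' | hq'
    · refine (hχ q' hq').prepAnc _ ?_ _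
      intro he
      rw [List.map_append, List.nodup_append] at hnd
      exact hnd.2.2 _ (List.mem_map_of_mem hq') q.2 (by simp) he
    · rw [List.mem_singleton.1 hq']
      exact hasVal_prepAnc _ _ _ _

theorem mem_safe_withPreps {ps : List (MBasis × Fin a)} {p : Protocol a}
    {d : State (Fin 15)} {χ : State (Fin a)} (hnd : (ps.map Prod.snd).Nodup)
    (h : ∀ χ', Prepared ps χ' → tensor d χ' ∈ safe T p) :
    tensor d χ ∈ safe T (withPreps ps p) :=
  mem_safe_withPreps_aux (qs := []) hnd h (by simp [Prepared])

/-- An ancilla fault amid the preparations is erased if its ancilla is still to be reset; otherwise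
it commutes past the remaining resets and becomes a fault right after the last one. -/
theorem mem_safe_withPreps_fault {ps qs : List (MBasis × Fin a)} {p : Protocol a}
    {d : State (Fin 15)} {χ : State (Fin a)} (hnd : ((qs ++ ps).map Prod.snd).Nodup)
    (h : ∀ χ', Prepared (qs ++ ps) χ' → ∀ (w : Wire a) (b c : ZMod 2),
      pauli (Pi.single w b) (Pi.single w c) (tensor d χ') ∈ safe T p) (hχ : Prepared qs χ)
    (w : Fin a) (b c : ZMod 2) :
    tensor d (pauli (Pi.single w b) (Pi.single w c) χ) ∈ safe T (withPreps ps p) := by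
  induction ps generalizing qs χ with
  | nil =>
    have := h χ (by simpa using hχ) (Sum.inr w) b c
    rw [pauli_tensor] at this
    have e1 : ∀ b : ZMod 2, dataPart (Pi.single (Sum.inr w) b : Wire a → ZMod 2) = 0 := by
      intro b; ext i; simp [dataPart]
    have e2 : ∀ b : ZMod 2, ancPart (Pi.single (Sum.inr w) b : Wire a → ZMod 2) =
        Pi.single w b := by
      intro b; ext i; simp [ancPart, Pi.single_apply]
    change _ ∈ safe T p
    simpa [e1, e2] using this
  | cons q ps ih =>
    simp only [withPreps, List.foldr_cons, safe, Submodule.mem_iInf, Submodule.mem_comap,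
      prepLin_apply, prepBranch_tensor]
    intro b'
    have hq : ∀ χ', Prepared qs χ' → Prepared (qs ++ [q]) (prepAnc q.1 q.2 b' χ') := by
      intro χ' hχ' q' hq'
      rcases List.mem_append.1 hq' with hq' | hq'
      · refine (hχ' q' hq').prepAnc _ ?_ _
        intro he
        rw [List.map_append, List.nodup_append] at hnd
        exact hnd.2.2 _ (List.mem_map_of_mem hq') q.2 (by simp) he
      · rw [List.mem_singleton.1 hq']
        exact hasVal_prepAnc _ _ _ _
    by_cases hw : w = q.2
    · subst hw
      refine mem_safe_withPreps_aux (qs := qs ++ [q]) (by simpa using hnd)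
        (fun χ' hχ' => by simpa using h χ' (by simpa using hχ') (Sum.inl 0) 0 0) (hq _ ?_)
      intro q' hq'
      refine ((hχ q' hq').pauli _ _).congr_val ?_
      have hne : q'.2 ≠ q.2 := by
        intro he
        rw [List.map_append, List.nodup_append] at hnd
        exact hnd.2.2 _ (List.mem_map_of_mem hq') q.2 (by simp) he
      cases q'.1 <;> simp [flipEntry, hne]
    · rw [prepAnc_pauli_single _ hw]
      exact ih (qs := qs ++ [q]) (by simpa using hnd) (by simpa using h) (hq _ hχ)

theorem safe1_withPreps_aux {ps qs : List (MBasis × Fin a)} {p : Protocol a}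
    {d : State (Fin 15)} {χ : State (Fin a)} (hnd : ((qs ++ ps).map Prod.snd).Nodup)
    (h1 : ∀ χ', Prepared (qs ++ ps) χ' → Safe1 T p (tensor d χ')) (hχ : Prepared qs χ) :
    Safe1 T (withPreps ps p) (tensor d χ) := by
  induction ps generalizing qs χ with
  | nil => exact h1 χ (by simpa using hχ)
  | cons q ps ih =>
    refine ⟨?_, fun b => ?_⟩
    · intro w b c
      rcases w with i | w
      · rw [pauli_tensor]
        have e : ∀ b : ZMod 2, ancPart (Pi.single (Sum.inl i) b : Wire a → ZMod 2) = 0 := by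
          intro b; ext j; simp [ancPart]
        rw [e, e, pauli_zero_zero]
        refine mem_safe_withPreps_aux (qs := qs) (p := p) (ps := q :: ps) hnd ?_ hχ
        intro χ' hχ'
        have := (h1 χ' hχ').idle (Sum.inl i) b c
        rwa [pauli_tensor, e, e, pauli_zero_zero] at this
      · have := mem_safe_withPreps_fault (T := T) (p := p) (d := d) hnd
          (fun χ' hχ' => (h1 χ' hχ').idle) hχ w b c
        rw [pauli_tensor]
        have e1 : ∀ b : ZMod 2, dataPart (Pi.single (Sum.inr w) b : Wire a → ZMod 2) = 0 := by
          intro b; ext i; simp [dataPart]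
        have e2 : ∀ b : ZMod 2, ancPart (Pi.single (Sum.inr w) b : Wire a → ZMod 2) =
            Pi.single w b := by
          intro b; ext i; simp [ancPart, Pi.single_apply]
        rw [e1, e1, e2, e2, pauli_zero_zero]
        exact this
    · rw [prepBranch_tensor]
      refine ih (qs := qs ++ [q]) (by simpa using hnd) (by simpa using h1) ?_
      intro q' hq'
      rcases List.mem_append.1 hq' with hq' | hq'
      · refine (hχ q' hq').prepAnc _ ?_ _
        intro he
        rw [List.map_append, List.nodup_append] at hnd
        exact hnd.2.2 _ (List.mem_map_of_mem hq') q.2 (by simp) he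
      · rw [List.mem_singleton.1 hq']
        exact hasVal_prepAnc _ _ _ _

theorem safe1_withPreps {ps : List (MBasis × Fin a)} {p : Protocol a}
    {d : State (Fin 15)} {χ : State (Fin a)} (hnd : (ps.map Prod.snd).Nodup)
    (h : ∀ χ', Prepared ps χ' → Safe1 T p (tensor d χ')) :
    Safe1 T (withPreps ps p) (tensor d χ) :=
  safe1_withPreps_aux (qs := []) hnd h (by simp [Prepared])

/-- The string vanishes outside `S`. -/
def SuppIn {W : Type} (S : Set W) (x : W → ZMod 2) : Prop := ∀ w, w ∉ S → x w = 0

/-- The supports of the faults that can happen right after the gates `l`: single wires, and the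
support of the last gate. -/
def FaultSupport (l : List (Gate (Wire a))) (S : Set (Wire a)) : Prop :=
  (∃ w, S = {w}) ∨ ∃ l' g, l = l' ++ [g] ∧ S = g.support

theorem suppIn_single {W : Type} [DecidableEq W] (w : W) (b : ZMod 2) :
    SuppIn {w} (Pi.single w b : W → ZMod 2) := fun _ hw => Pi.single_eq_of_ne hw _

/-- A fault is located at a cut `l₁ ++ l₂` of the circuit, and the part `l₂` is then ideal. A gate
fault is assigned to the cut right after its gate. -/
theorem safe1_withGates {gs : List (Gate (Wire a))} {p : Protocol a} {ψ : State (Wire a)}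
    (h1 : Safe1 T p (applyGates gs ψ))
    (h2 : ∀ l₁ l₂, gs = l₁ ++ l₂ → ∀ S, FaultSupport l₁ S → ∀ x z, SuppIn S x → SuppIn S z →
      applyGates l₂ (pauli x z (applyGates l₁ ψ)) ∈ safe T p) :
    Safe1 T (withGates gs p) ψ := by
  induction gs generalizing ψ with
  | nil => exact h1
  | cons g gs ih =>
    refine ⟨fun w b c => ?_, ih h1 fun l₁ l₂ h S hS x z hx hz => ?_, fun x z hxz => ?_⟩
    · exact (mem_safe_withGates (gs := g :: gs)).2 (h2 [] (g :: gs) rfl {w} (Or.inl ⟨w, rfl⟩) _ _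
        (suppIn_single w b) (suppIn_single w c))
    · refine h2 (g :: l₁) l₂ (by simp [h]) S ?_ x z hx hz
      rcases hS with hS | ⟨l', g', rfl, hS⟩
      · exact Or.inl hS
      · exact Or.inr ⟨g :: l', g', rfl, hS⟩
    · exact mem_safe_withGates.2 (h2 [g] gs rfl g.support (Or.inr ⟨[], g, rfl, rfl⟩) x z
        (fun w hw => (hxz w hw).1) (fun w hw => (hxz w hw).2))

theorem measAll_pauli_single {ms : List (MBasis × Fin a)} {w : Wire a}
    (hw : ∀ q ∈ ms, w ≠ Sum.inr q.2) (o : Record) (b c : ZMod 2) (ψ : State (Wire a)) :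
    measAll ms o (pauli (Pi.single w b) (Pi.single w c) ψ) =
      pauli (Pi.single w b) (Pi.single w c) (measAll ms o ψ) := by
  induction ms generalizing o ψ with
  | nil => rfl
  | cons q qs ih =>
    simp only [measAll, LinearMap.comp_apply, measLin_apply]
    rw [measBranch_pauli_single _ (hw q (by simp)), ih fun q' hq' => hw q' (by simp [hq'])]

/-- Only faults before the first measurement have to be examined. A later fault on a wire not yet
measured can be moved to the front, and one on the wire just measured can be moved to the start of
the continuation. -/
theorem safe1_measK {ms : List (MBasis × Fin a)} (hnd : (ms.map Prod.snd).Nodup)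
    {K : Record → Protocol a} {ψ : State (Wire a)}
    (h1 : ∀ o : Record, o.length = ms.length → Safe1 T (K o) (measAll ms o ψ))
    (h2 : ∀ (w : Wire a) (b c : ZMod 2) (o : Record), o.length = ms.length →
      measAll ms o (pauli (Pi.single w b) (Pi.single w c) ψ) ∈ safe T (K o)) :
    Safe1 T (measK ms K) ψ := by
  induction ms generalizing K ψ with
  | nil => exact h1 [] rfl
  | cons q qs ih =>
    rw [List.map_cons, List.nodup_cons] at hnd
    refine ⟨fun w b c => mem_safe_measK (ms := q :: qs) (h2 w b c), fun b => ?_⟩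
    refine ih hnd.2 (fun o ho => h1 (b :: o) (by simp [ho])) fun w b' c o ho => ?_
    by_cases hw : w = Sum.inr q.2
    · rw [measAll_pauli_single]
      · exact (h1 (b :: o) (by simp [ho])).idle w b' c
      · rintro q' hq' rfl
        exact hnd.1 (by rw [← Sum.inr_injective hw]; exact List.mem_map_of_mem hq')
    · rw [← measBranch_pauli_single _ hw]
      exact h2 w b' c (b :: o) (by simp [ho])

theorem safe1_zero (p : Protocol a) : Safe1 T p 0 := by
  have h0 : ∀ p, IdleSafe T p 0 := fun p w b c => by
    rw [← pauliLin_apply, map_zero]; exact Submodule.zero_mem _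
  induction p with
  | finish => exact h0 _
  | gate g p ih =>
    refine ⟨h0 _, ?_, fun x z _ => ?_⟩
    · rw [← Gate.lin_apply, map_zero]; exact ih
    · rw [← Gate.lin_apply, map_zero, ← pauliLin_apply, map_zero]; exact Submodule.zero_mem _
  | prep B w p ih =>
    exact ⟨h0 _, fun b => by rw [← prepLin_apply, map_zero]; exact ih⟩
  | meas B w p ih =>
    exact ⟨h0 _, fun b => by rw [← measLin_apply, map_zero]; exact ih b⟩

theorem measAll_tensor (ms : List (MBasis × Fin a)) (o : Record) (d : State (Fin 15))
    (χ : State (Fin a)) : ∃ χ', measAll ms o (tensor d χ) = tensor d χ' := by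
  induction ms generalizing o χ with
  | nil => exact ⟨χ, rfl⟩
  | cons q qs ih =>
    simp only [measAll, LinearMap.comp_apply, measLin_apply, measBranch_tensor]
    exact ih _ _

theorem measAll_eq_zero {ms : List (MBasis × Fin a)} {o : Record} {q : MBasis × Fin a}
    {b v : ZMod 2} {ψ : State (Wire a)} (hq : (q, b) ∈ ms.zip o)
    (hψ : HasVal q.1 (Sum.inr q.2) v ψ) (hb : b ≠ v) (hnd : (ms.map Prod.snd).Nodup) :
    measAll ms o ψ = 0 := by
  induction ms generalizing o ψ with
  | nil => simp at hq
  | cons q' qs ih =>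
    cases o with
    | nil => simp at hq
    | cons b' o =>
      rw [List.map_cons, List.nodup_cons] at hnd
      rw [measAll_cons]
      rw [List.zip_cons_cons, List.mem_cons] at hq
      rcases hq with hq | hq
      · obtain ⟨rfl, rfl⟩ := Prod.mk.inj hq
        rw [hψ.measBranch_eq_zero hb, map_zero]
      · refine ih hq (hψ.measBranch _ ?_ _) hnd.2
        intro he
        exact hnd.1 (by
          rw [← Sum.inr_injective he]
          exact List.mem_map_of_mem (List.of_mem_zip hq).1)

/-- If the listed ancilla qubits have definite values, all the other outcomes are impossible. -/
theorem measAll_eq_zero_of_ne {ms : List (MBasis × Fin a)} {o : Record}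
    {v : MBasis × Fin a → ZMod 2} {ψ : State (Wire a)}
    (hψ : ∀ q ∈ ms, HasVal q.1 (Sum.inr q.2) (v q) ψ) (hnd : (ms.map Prod.snd).Nodup)
    (ho : o.length = ms.length) (hne : o ≠ ms.map v) : measAll ms o ψ = 0 := by
  have : ∃ q b, (q, b) ∈ ms.zip o ∧ b ≠ v q := by
    by_contra hc
    push Not at hc
    apply hne
    apply List.ext_getElem (by simp [ho])
    intro n h1 h2
    have h3 : n < ms.length := ho ▸ h1
    rw [List.getElem_map]
    apply hc
    rw [← List.getElem_zip (h := by simp [h1, h3])]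
    exact List.getElem_mem _
  obtain ⟨q, b, hq, hb⟩ := this
  exact measAll_eq_zero hq (hψ q (List.of_mem_zip hq).1) hb hnd

/-- A block: prepare ancilla qubits, apply gates, and measure the same ancilla qubits in the bases
they were prepared in. -/
def block (ps : List (MBasis × Fin a)) (gs : List (Gate (Wire a))) (K : Record → Protocol a) :
    Protocol a :=
  withPreps ps (withGates gs (measK ps K))

/-- Without faults, the gates take data in `d` and freshly prepared ancillas to data in `d'` and
ancillas with the values `v`. -/
def Implements (ps : List (MBasis × Fin a)) (gs : List (Gate (Wire a)))
    (v : MBasis × Fin a → ZMod 2) (d d' : State (Fin 15)) : Prop :=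
  ∀ χ, Prepared ps χ → ∃ χ', applyGates gs (tensor d χ) = tensor d' χ' ∧
    ∀ q ∈ ps, HasVal q.1 q.2 (v q) χ'

variable {ps : List (MBasis × Fin a)} {gs : List (Gate (Wire a))} {K : Record → Protocol a}
  {v : MBasis × Fin a → ZMod 2} {d d' : State (Fin 15)}

theorem block_mem_safe (hnd : (ps.map Prod.snd).Nodup) (hg : Implements ps gs v d d')
    (h : ∀ χ, tensor d' χ ∈ safe T (K (ps.map v))) (χ : State (Fin a)) :
    tensor d χ ∈ safe T (block ps gs K) := by
  refine mem_safe_withPreps hnd fun χ₁ hχ₁ => mem_safe_withGates.2 (mem_safe_measK fun o ho => ?_)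
  obtain ⟨χ₂, h2, hv⟩ := hg χ₁ hχ₁
  rw [h2]
  by_cases hov : o = ps.map v
  · obtain ⟨χ₃, h3⟩ := measAll_tensor ps o d' χ₂
    rw [h3, hov]
    exact h χ₃
  · rw [measAll_eq_zero_of_ne (fun q hq => (hv q hq).tensor d') hnd ho hov]
    exact Submodule.zero_mem _

/-- The fault happens after the block, which is `h`, or at a cut of its gates, which is `hf`; faults
before the measurements are the cut at the very end. Without a fault all outcomes but the predicted
one have probability zero. -/
theorem block_safe1 (hnd : (ps.map Prod.snd).Nodup) (hg : Implements ps gs v d d')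
    (h : ∀ χ, Safe1 T (K (ps.map v)) (tensor d' χ))
    (hf : ∀ χ, Prepared ps χ → ∀ l₁ l₂, gs = l₁ ++ l₂ → ∀ S, FaultSupport l₁ S → ∀ x z,
      SuppIn S x → SuppIn S z → ∀ o : Record, o.length = ps.length →
      measAll ps o (applyGates l₂ (pauli x z (applyGates l₁ (tensor d χ)))) ∈ safe T (K o))
    (χ : State (Fin a)) : Safe1 T (block ps gs K) (tensor d χ) := by
  refine safe1_withPreps hnd fun χ₁ hχ₁ => safe1_withGates (safe1_measK hnd (fun o ho => ?_)
    fun w b c o ho => ?_) fun l₁ l₂ hl S hS x z hx hz => mem_safe_measK fun o ho =>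
      hf χ₁ hχ₁ l₁ l₂ hl S hS x z hx hz o ho
  · obtain ⟨χ₂, h2, hv⟩ := hg χ₁ hχ₁
    rw [h2]
    by_cases hov : o = ps.map v
    · obtain ⟨χ₃, h3⟩ := measAll_tensor ps o d' χ₂
      rw [h3, hov]
      exact h χ₃
    · rw [measAll_eq_zero_of_ne (fun q hq => (hv q hq).tensor d') hnd ho hov]
      exact safe1_zero _
  · exact hf χ₁ hχ₁ gs [] (by simp) {w} (Or.inl ⟨w, rfl⟩) _ _ (suppIn_single w b)
      (suppIn_single w c) o ho

end Blocks

/-! ### Propagation of errors through CNOT, CZ and CCZ gates -/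

section Push

variable {W : Type} [Fintype W] [DecidableEq W]

/-- CNOT, CZ and CCZ gates. -/
def Gate.IsClassical : Gate W → Prop
  | .cnot _ _ _ => True
  | .cz _ _ => True
  | .ccz _ _ _ => True
  | _ => False

/-- A shift by `x` followed by multiplication with the function `φ`. -/
def twist (x : W → ZMod 2) (φ : (W → ZMod 2) → ℂ) (ψ : State W) : State W :=
  fun y => φ y * ψ (y + x)

theorem pauli_eq_twist (x z : W → ZMod 2) (ψ : State W) :
    pauli x z ψ = twist x (fun y => sgn (z ⬝ᵥ y)) ψ := rfl

theorem dependsOn_sgn_dotProduct {S : Set W} {z : W → ZMod 2} (hz : SuppIn S z) :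
    DependsOn (fun y : W → ZMod 2 => sgn (z ⬝ᵥ y)) S := by
  intro y y' h
  simp only
  congr 1
  refine Finset.sum_congr rfl fun w _ => ?_
  by_cases hw : w ∈ S
  · rw [h w hw]
  · rw [hz w hw, zero_mul, zero_mul]

/-- The propagation of bit flips through a gate. -/
def Gate.pushX : Gate W → (W → ZMod 2) → W → ZMod 2
  | .cnot c t _, u => Function.update u t (u t + u c)
  | _, u => u

/-- These gates permute the basis strings up to signs, so a shift followed by a phase function keeps
this form. Behind CZ or CCZ the phase is in general no longer that of a Pauli operator, but it still
depends on wires in `S` only. -/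
theorem exists_twist_gate {S : Set W} {g : Gate W} (hg : g.IsClassical) (hS : g.support ⊆ S)
    (x : W → ZMod 2) {φ : (W → ZMod 2) → ℂ} (hφ : DependsOn φ S) :
    ∃ φ', DependsOn φ' S ∧ ∀ ψ, g.apply (twist x φ ψ) = twist (g.pushX x) φ' (g.apply ψ) := by
  cases g with
  | cnot c t ne =>
    refine ⟨fun y => φ (Function.update y t (y t + y c)), fun y y' h => hφ fun w hw => ?_,
      fun ψ => ?_⟩
    · have hc : y c = y' c := h c (hS (by simp [Gate.support]))
      by_cases hwt : w = t
      · subst hwt; simp [h w hw, hc]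
      · simp [hwt, h w hw]
    · ext y
      simp only [Gate.apply, twist, Gate.pushX]
      congr 2
      ext w
      by_cases hwt : w = t
      · subst hwt
        simp only [Pi.add_apply, Function.update_self, Function.update_of_ne ne]
        ring_nf
        rw [show (x c * 2 : ZMod 2) = 0 by rw [mul_two, zmod2_add_self], add_zero]
      · simp [hwt]
  | cz u v =>
    refine ⟨fun y => sgn (y u * y v) * φ y * sgn ((y + x) u * (y + x) v), fun y y' h => ?_,
      fun ψ => ?_⟩
    · have hu : y u = y' u := h u (hS (by simp [Gate.support]))
      have hv : y v = y' v := h v (hS (by simp [Gate.support]))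
      simp only [Pi.add_apply, hu, hv, hφ h]
    · ext y
      simp only [Gate.apply, twist, Gate.pushX]
      linear_combination (-sgn (y u * y v) * φ y * ψ (y + x)) *
        sgn_mul_self ((y + x) u * (y + x) v)
  | ccz u v w =>
    refine ⟨fun y => sgn (y u * y v * y w) * φ y * sgn ((y + x) u * (y + x) v * (y + x) w),
      fun y y' h => ?_, fun ψ => ?_⟩
    · have hu : y u = y' u := h u (hS (by simp [Gate.support]))
      have hv : y v = y' v := h v (hS (by simp [Gate.support]))
      have hw : y w = y' w := h w (hS (by simp [Gate.support]))
      simp only [Pi.add_apply, hu, hv, hw, hφ h]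
    · ext y
      simp only [Gate.apply, twist, Gate.pushX]
      linear_combination (-sgn (y u * y v * y w) * φ y * ψ (y + x)) *
        sgn_mul_self ((y + x) u * (y + x) v * (y + x) w)
  | _ => exact hg.elim

/-- The propagation of bit flips through gates. -/
def pushXs (gs : List (Gate W)) (x : W → ZMod 2) : W → ZMod 2 :=
  gs.foldl (fun x g => g.pushX x) x

theorem exists_twist {S : Set W} {gs : List (Gate W)} (hg : ∀ g ∈ gs, g.IsClassical)
    (hS : ∀ g ∈ gs, g.support ⊆ S) (x : W → ZMod 2) {φ : (W → ZMod 2) → ℂ}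
    (hφ : DependsOn φ S) :
    ∃ φ', DependsOn φ' S ∧
      ∀ ψ, applyGates gs (twist x φ ψ) = twist (pushXs gs x) φ' (applyGates gs ψ) := by
  induction gs generalizing x φ with
  | nil => exact ⟨φ, hφ, fun _ => rfl⟩
  | cons g gs ih =>
    obtain ⟨φ₁, h1, e1⟩ := exists_twist_gate (hg g (by simp)) (hS g (by simp)) x hφ
    obtain ⟨φ₂, h2, e2⟩ := ih (fun g' h => hg g' (by simp [h])) (fun g' h => hS g' (by simp [h]))
      (g.pushX x) h1
    refine ⟨φ₂, h2, fun ψ => ?_⟩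
    rw [applyGates_cons, e1, e2]
    rfl

theorem pushXs_append (gs hs : List (Gate W)) (x : W → ZMod 2) :
    pushXs (gs ++ hs) x = pushXs hs (pushXs gs x) := by simp [pushXs]

theorem HasVal.twist {w : W} {v : ZMod 2} {ψ : State W} (h : HasVal .Z w v ψ)
    (x : W → ZMod 2) (φ : (W → ZMod 2) → ℂ) :
    HasVal .Z w (v + x w) (EncodedCCZ.twist x φ ψ) := by
  intro y hy
  simp only [EncodedCCZ.twist]
  rw [h (y + x), mul_zero]
  intro h'
  apply hy
  rw [← h']
  simp [add_assoc, zmod2_add_self]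

theorem pauli_cnot (c t : W) (ne : c ≠ t) (x z : W → ZMod 2) (ψ : State W) :
    (Gate.cnot c t ne).apply (pauli x z ψ) =
      pauli (Function.update x t (x t + x c)) (Function.update z c (z c + z t))
        ((Gate.cnot c t ne).apply ψ) := by
  ext y
  simp only [Gate.apply, pauli]
  congr 1
  · congr 1
    rw [dotProduct_update, dotProduct_comm (Function.update z c _) y, dotProduct_update,
      dotProduct_comm y]
    have e1 : y t + (y t + y c) = y c := by rw [← add_assoc, zmod2_add_self, zero_add]
    have e2 : z c + (z c + z t) = z t := by rw [← add_assoc, zmod2_add_self, zero_add]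
    rw [e1, e2, mul_comm]
  · congr 1
    ext w
    by_cases hwt : w = t
    · subst hwt
      simp only [Pi.add_apply, Function.update_self, Function.update_of_ne ne]
      ring_nf
      rw [show (x c * 2 : ZMod 2) = 0 by rw [mul_two, zmod2_add_self], add_zero]
    · simp [hwt]

theorem pauli_commute_of_disjoint {g : Gate W} (hg : g.IsClassical) {S : Set W}
    (hS : ∀ w ∈ g.support, w ∉ S) {x z : W → ZMod 2} (hx : SuppIn S x) (hz : SuppIn S z)
    (ψ : State W) : g.apply (pauli x z ψ) = pauli x z (g.apply ψ) := by
  cases g with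
  | cnot c t ne =>
    have hc : x c = 0 := hx c (hS c (by simp [Gate.support]))
    have ht : z t = 0 := hz t (hS t (by simp [Gate.support]))
    rw [pauli_cnot, hc, ht, add_zero, add_zero, Function.update_eq_self, Function.update_eq_self]
  | cz u v =>
    have hu : x u = 0 := hx u (hS u (by simp [Gate.support]))
    have hv : x v = 0 := hx v (hS v (by simp [Gate.support]))
    ext y
    simp only [Gate.apply, pauli, Pi.add_apply, hu, hv, add_zero]
    ring
  | ccz u v w =>
    have hu : x u = 0 := hx u (hS u (by simp [Gate.support]))
    have hv : x v = 0 := hx v (hS v (by simp [Gate.support]))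
    have hw : x w = 0 := hx w (hS w (by simp [Gate.support]))
    ext y
    simp only [Gate.apply, pauli, Pi.add_apply, hu, hv, hw, add_zero]
    ring
  | _ => exact hg.elim

/-- Pauli operators supported in `S` are taken to Pauli operators supported in `S`. -/
def Gate.Tracks (S : Set W) (g : Gate W) : Prop :=
  (∃ c t ne, g = .cnot c t ne ∧ c ∈ S ∧ t ∈ S) ∨ (g.IsClassical ∧ ∀ w ∈ g.support, w ∉ S)

theorem exists_pauli_of_tracks {S : Set W} {gs : List (Gate W)} (hg : ∀ g ∈ gs, g.Tracks S)
    {x z : W → ZMod 2} (hx : SuppIn S x) (hz : SuppIn S z) :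
    ∃ x' z', SuppIn S x' ∧ SuppIn S z' ∧
      ∀ ψ, applyGates gs (pauli x z ψ) = pauli x' z' (applyGates gs ψ) := by
  induction gs generalizing x z with
  | nil => exact ⟨x, z, hx, hz, fun _ => rfl⟩
  | cons g gs ih =>
    rcases hg g (by simp) with ⟨c, t, ne, rfl, hc, ht⟩ | ⟨h1, h2⟩
    · have hx' : SuppIn S (Function.update x t (x t + x c)) := fun w hw => by
        rw [Function.update_of_ne (fun h => hw (by rwa [h])), hx w hw]
      have hz' : SuppIn S (Function.update z c (z c + z t)) := fun w hw => by
        rw [Function.update_of_ne (fun h => hw (by rwa [h])), hz w hw]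
      obtain ⟨x'', z'', h1, h2, h3⟩ := ih (fun g' h => hg g' (by simp [h])) hx' hz'
      exact ⟨x'', z'', h1, h2, fun ψ => by rw [applyGates_cons, pauli_cnot, h3]; rfl⟩
    · obtain ⟨x'', z'', h3, h4, h5⟩ := ih (fun g' h => hg g' (by simp [h])) hx hz
      exact ⟨x'', z'', h3, h4, fun ψ => by
        rw [applyGates_cons, pauli_commute_of_disjoint h1 h2 hx hz, h5]; rfl⟩

theorem pauli_commute_disjoint_list {S : Set W} {gs : List (Gate W)}
    (hg : ∀ g ∈ gs, g.IsClassical ∧ ∀ w ∈ g.support, w ∉ S)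
    {x z : W → ZMod 2} (hx : SuppIn S x) (hz : SuppIn S z) (ψ : State W) :
    applyGates gs (pauli x z ψ) = pauli x z (applyGates gs ψ) := by
  induction gs generalizing ψ with
  | nil => rfl
  | cons g gs ih =>
    rw [applyGates_cons, applyGates_cons,
      pauli_commute_of_disjoint (hg g (by simp)).1 (hg g (by simp)).2 hx hz,
      ih fun g' h => hg g' (by simp [h])]

/-- CZ and CCZ gates. -/
def Gate.IsDiagonal : Gate W → Prop
  | .cz _ _ => True
  | .ccz _ _ _ => True
  | _ => False

theorem pauli_commute_diagonal {gs : List (Gate W)} (hg : ∀ g ∈ gs, g.IsDiagonal)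
    (z : W → ZMod 2) (ψ : State W) :
    applyGates gs (pauli 0 z ψ) = pauli 0 z (applyGates gs ψ) := by
  induction gs generalizing ψ with
  | nil => rfl
  | cons g gs ih =>
    rw [applyGates_cons, applyGates_cons, ← ih fun g' h => hg g' (by simp [h])]
    congr 1
    have := hg g (by simp)
    cases g with
    | cz u v => ext y; simp only [Gate.apply, pauli, add_zero]; ring
    | ccz u v w => ext y; simp only [Gate.apply, pauli, add_zero]; ring
    | _ => exact this.elim

theorem pushXs_diagonal {gs : List (Gate W)} (hg : ∀ g ∈ gs, g.IsDiagonal) (x : W → ZMod 2) :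
    pushXs gs x = x := by
  induction gs with
  | nil => rfl
  | cons g gs ih =>
    have : g.pushX x = x := by
      have := hg g (by simp)
      cases g with
      | cz => rfl
      | ccz => rfl
      | _ => exact this.elim
    have e : pushXs (g :: gs) x = pushXs gs (g.pushX x) := rfl
    rw [e, this, ih fun g' h => hg g' (by simp [h])]

theorem sgn_mul (a b : ZMod 2) : sgn (a * b) = 1 - (1 / 2) * ((1 - sgn a) * (1 - sgn b)) := by
  rcases zmod2_cases a with rfl | rfl <;> rcases zmod2_cases b with rfl | rfl <;> norm_num

theorem sgn_mul_mul (a b c : ZMod 2) :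
    sgn (a * b * c) = 1 - (1 / 4) * ((1 - sgn a) * ((1 - sgn b) * (1 - sgn c))) := by
  rw [sgn_mul, sgn_mul]; ring

/-- Twice the projection onto the states with `1` on `w`. -/
def zDefect (w : W) (ψ : State W) : State W := ψ - pauli 0 (Pi.single w 1) ψ

theorem zDefect_apply (w : W) (ψ : State W) (y : W → ZMod 2) :
    zDefect w ψ y = (1 - sgn (y w)) * ψ y := by
  simp only [zDefect, pauli, Pi.sub_apply, single_dotProduct, one_mul, add_zero]
  ring

theorem cnot_apply_eq (c t : W) (ne : c ≠ t) (ψ : State W) :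
    (Gate.cnot c t ne).apply ψ =
      ψ + (1 / 2 : ℂ) • zDefect c (pauli (Pi.single t 1) 0 ψ - ψ) := by
  ext y
  have e : Function.update y t (y t + y c) = y + Pi.single t (y c) := by
    ext w
    by_cases h : w = t
    · subst h; simp
    · simp [h]
  simp only [Gate.apply, e, pauli, Pi.add_apply, Pi.smul_apply, Pi.sub_apply, smul_eq_mul,
    zDefect_apply, zero_dotProduct, sgn_zero, one_mul]
  rcases zmod2_cases (y c) with h | h <;> rw [h]
  · simp
  · rw [sgn_one]; ring

theorem cz_apply_eq (u v : W) (ψ : State W) :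
    (Gate.cz u v).apply ψ = ψ - (1 / 2 : ℂ) • zDefect u (zDefect v ψ) := by
  ext y
  simp only [Gate.apply, Pi.smul_apply, Pi.sub_apply, smul_eq_mul, zDefect_apply, sgn_mul]
  ring

theorem ccz_apply_eq (u v w : W) (ψ : State W) :
    (Gate.ccz u v w).apply ψ = ψ - (1 / 4 : ℂ) • zDefect u (zDefect v (zDefect w ψ)) := by
  ext y
  simp only [Gate.apply, Pi.smul_apply, Pi.sub_apply, smul_eq_mul, zDefect_apply, sgn_mul_mul]
  ring

/-- CNOT, CZ and CCZ are linear combinations of Pauli operators on their own wires, as the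
expansions through `zDefect` show. -/
theorem gate_mem_of_pauli {g : Gate W} (hg : g.IsClassical) {P : Submodule ℂ (State W)}
    (hP : ∀ x z, SuppIn g.support x → SuppIn g.support z → ∀ ψ ∈ P, pauli x z ψ ∈ P)
    {ψ : State W} (hψ : ψ ∈ P) : g.apply ψ ∈ P := by
  have hs0 : SuppIn g.support (0 : W → ZMod 2) := fun _ _ => rfl
  have hs1 : ∀ w ∈ g.support, SuppIn g.support (Pi.single w 1 : W → ZMod 2) := fun w hw v hv =>
    Pi.single_eq_of_ne (fun h => hv (by rw [h]; exact hw)) _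
  have hN : ∀ w ∈ g.support, ∀ ψ ∈ P, zDefect w ψ ∈ P := fun w hw ψ hψ =>
    P.sub_mem hψ (hP _ _ hs0 (hs1 w hw) ψ hψ)
  cases g with
  | cnot c t ne =>
    rw [cnot_apply_eq]
    exact P.add_mem hψ (P.smul_mem _ (hN c (Or.inl rfl) _
      (P.sub_mem (hP _ _ (hs1 t (Or.inr rfl)) hs0 ψ hψ) hψ)))
  | cz u v =>
    rw [cz_apply_eq]
    exact P.sub_mem hψ (P.smul_mem _ (hN u (Or.inl rfl) _ (hN v (Or.inr rfl) _ hψ)))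
  | ccz u v w =>
    rw [ccz_apply_eq]
    exact P.sub_mem hψ (P.smul_mem _ (hN u (Or.inl rfl) _ (hN v (Or.inr (Or.inl rfl)) _
      (hN w (Or.inr (Or.inr rfl)) _ hψ))))
  | _ => exact hg.elim

end Push

/-! ### Spans of Pauli errors -/

section ErrSpan

variable {k : ℕ}

/-- A set of Pauli errors of the data, given by their `x` and `z` strings. -/
abbrev ErrorSet := Set ((Fin 15 → ZMod 2) × (Fin 15 → ZMod 2))

/-- The span of the states with data part `d` subject to an error in `A`. -/
def errSpan (k : ℕ) (A : ErrorSet) (d : State (Fin 15)) : Submodule ℂ (State (Wire k)) :=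
  Submodule.span ℂ {ψ | ∃ p ∈ A, ∃ χ, ψ = tensor (pauli p.1 p.2 d) χ}

theorem tensor_mem_errSpan {A : ErrorSet} {d : State (Fin 15)} {a c : Fin 15 → ZMod 2}
    (h : (a, c) ∈ A) (χ : State (Fin k)) : tensor (pauli a c d) χ ∈ errSpan k A d :=
  Submodule.subset_span ⟨(a, c), h, χ, rfl⟩

theorem errSpan_le {A : ErrorSet} {d : State (Fin 15)} {P : Submodule ℂ (State (Wire k))}
    (h : ∀ a c, (a, c) ∈ A → ∀ χ, tensor (pauli a c d) χ ∈ P) : errSpan k A d ≤ P :=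
  Submodule.span_le.2 (by rintro _ ⟨⟨a, c⟩, hp, χ, rfl⟩; exact h a c hp χ)

theorem errSpan_mono {A A' : ErrorSet} (h : A ⊆ A') (d : State (Fin 15)) :
    errSpan k A d ≤ errSpan k A' d :=
  errSpan_le fun _ _ hp χ => tensor_mem_errSpan (h hp) χ

theorem measAll_mem_errSpan {A : ErrorSet} {d : State (Fin 15)} (ms : List (MBasis × Fin k))
    (o : Record) {ψ : State (Wire k)} (hψ : ψ ∈ errSpan k A d) :
    measAll ms o ψ ∈ errSpan k A d := by
  have : errSpan k A d ≤ (errSpan k A d).comap (measAll ms o) := errSpan_le fun a c hp χ => by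
    obtain ⟨χ', h⟩ := measAll_tensor ms o (pauli a c d) χ
    rw [Submodule.mem_comap, h]
    exact tensor_mem_errSpan hp χ'
  exact this hψ

/-- The wires of a set of data qubits, and all the ancilla qubits. -/
def withAnc (k : ℕ) (T : Set (Fin 15)) : Set (Wire k) := {w | ∀ i, w = Sum.inl i → i ∈ T}

/-- The Pauli errors on the qubits in `T`. -/
def localErr (T : Set (Fin 15)) : ErrorSet := {p | SuppIn T p.1 ∧ SuppIn T p.2}

theorem suppIn_dataPart {T : Set (Fin 15)} {x : Wire k → ZMod 2} (h : SuppIn (withAnc k T) x) :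
    SuppIn T (dataPart x) := fun i hi => h (Sum.inl i) fun h => hi (h i rfl)

theorem SuppIn.add {W : Type} {S : Set W} {x y : W → ZMod 2} (hx : SuppIn S x)
    (hy : SuppIn S y) : SuppIn S (x + y) := fun w hw => by simp [hx w hw, hy w hw]

theorem SuppIn.mono {W : Type} {S S' : Set W} {x : W → ZMod 2} (hx : SuppIn S x) (h : S ⊆ S') :
    SuppIn S' x := fun w hw => hx w fun h' => hw (h h')

theorem pauli_mem_errSpan {A : ErrorSet} {d : State (Fin 15)} {x z : Wire k → ZMod 2}
    (hA : ∀ p ∈ A, (dataPart x + p.1, dataPart z + p.2) ∈ A) {ψ : State (Wire k)}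
    (hψ : ψ ∈ errSpan k A d) : pauli x z ψ ∈ errSpan k A d := by
  have : errSpan k A d ≤ (errSpan k A d).comap (pauliLin x z) := errSpan_le fun a c hp χ => by
    rw [Submodule.mem_comap, pauliLin_apply, pauli_tensor, pauli_pauli, smul_tensor]
    exact Submodule.smul_mem _ _ (tensor_mem_errSpan (hA _ hp) _)
  exact this hψ

theorem pauli_mem_localErr {T : Set (Fin 15)} {d : State (Fin 15)} {x z : Wire k → ZMod 2}
    (hx : SuppIn (withAnc k T) x) (hz : SuppIn (withAnc k T) z) {ψ : State (Wire k)}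
    (hψ : ψ ∈ errSpan k (localErr T) d) : pauli x z ψ ∈ errSpan k (localErr T) d :=
  pauli_mem_errSpan (A := localErr T) (fun _ hp => ⟨(suppIn_dataPart hx).add hp.1, (suppIn_dataPart hz).add hp.2⟩)
    hψ

theorem applyGates_mem_localErr {T : Set (Fin 15)} {d : State (Fin 15)}
    {gs : List (Gate (Wire k))} (hg : ∀ g ∈ gs, g.IsClassical)
    (hS : ∀ g ∈ gs, g.support ⊆ withAnc k T) {ψ : State (Wire k)}
    (hψ : ψ ∈ errSpan k (localErr T) d) : applyGates gs ψ ∈ errSpan k (localErr T) d := by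
  induction gs generalizing ψ with
  | nil => exact hψ
  | cons g gs ih =>
    refine ih (fun g' h => hg g' (by simp [h])) (fun g' h => hS g' (by simp [h]))
      (gate_mem_of_pauli (hg g (by simp)) (fun x z hx hz ψ hψ => ?_) hψ)
    exact pauli_mem_localErr (hx.mono (hS g (by simp))) (hz.mono (hS g (by simp))) hψ

/-- The errors with `x` string `a` and `z` string supported in `T`. -/
def phaseErr (a : Fin 15 → ZMod 2) (T : Set (Fin 15)) : ErrorSet := {p | p.1 = a ∧ SuppIn T p.2}

/-- The identity is the sum of the projections `(1 + Z) / 2` and `(1 - Z) / 2` of qubit `i`; behind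
each of them the phase may be evaluated with the bit of `i` frozen. -/
theorem twist_eq_half (i : Fin 15) (x : Wire k → ZMod 2) (φ : (Wire k → ZMod 2) → ℂ)
    (ψ : State (Wire k)) : twist x φ ψ = (1 / 2 : ℂ) •
      ((twist x (fun y => φ (Function.update y (Sum.inl i) 0)) ψ +
        pauli 0 (Pi.single (Sum.inl i) 1)
          (twist x (fun y => φ (Function.update y (Sum.inl i) 0)) ψ)) +
      (twist x (fun y => φ (Function.update y (Sum.inl i) 1)) ψ -
        pauli 0 (Pi.single (Sum.inl i) 1)
          (twist x (fun y => φ (Function.update y (Sum.inl i) 1)) ψ))) := by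
  ext y
  have e1 : φ (Function.update y (Sum.inl i) (y (Sum.inl i))) = φ y := by
    rw [Function.update_eq_self]
  simp only [twist, pauli, Pi.add_apply, Pi.smul_apply, Pi.sub_apply, smul_eq_mul,
    single_dotProduct, one_mul, add_zero]
  rcases zmod2_cases (y (Sum.inl i)) with h | h <;> rw [h] at e1 ⊢ <;> rw [e1]
  · rw [sgn_zero]; ring
  · rw [sgn_one]; ring

/-- A phase that depends only on the data qubits in `T` and on the ancilla qubits is a
superposition of `Z` errors in `T`. -/
theorem twist_mem_errSpan (T : Finset (Fin 15)) (d : State (Fin 15)) (χ : State (Fin k))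
    (x : Wire k → ZMod 2) {φ : (Wire k → ZMod 2) → ℂ} (hφ : DependsOn φ (withAnc k (T : Set _))) :
    twist x φ (tensor d χ) ∈ errSpan k (phaseErr (dataPart x) T) d := by
  induction T using Finset.induction_on generalizing φ with
  | empty =>
    have : twist x φ (tensor d χ) = tensor (pauli (dataPart x) 0 d)
        (fun y => φ (Sum.elim 0 y) * χ (y + ancPart x)) := by
      ext y
      have e : φ y = φ (Sum.elim 0 (ancPart y)) := hφ fun w hw => by
        rcases w with i | i
        · exact absurd (hw i rfl) (by simp)
        · rfl
      have e1 : dataPart (y + x) = dataPart y + dataPart x := rfl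
      have e2 : ancPart (y + x) = ancPart y + ancPart x := rfl
      simp only [twist, tensor_eq, pauli, e, e1, e2, zero_dotProduct, sgn_zero, one_mul]
      ring
    rw [this]
    have h0 : (dataPart x, (0 : Fin 15 → ZMod 2)) ∈
        phaseErr (dataPart x) ((∅ : Finset (Fin 15)) : Set (Fin 15)) := ⟨rfl, fun _ _ => rfl⟩
    exact tensor_mem_errSpan h0 _
  | insert i T _ ih =>
    have hmono : phaseErr (dataPart x) T ⊆ phaseErr (dataPart x) (insert i T : Finset _) := by
      intro p hp
      exact ⟨hp.1, hp.2.mono (by simp)⟩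
    have key : ∀ b : ZMod 2, twist x (fun y => φ (Function.update y (Sum.inl i) b))
        (tensor d χ) ∈ errSpan k (phaseErr (dataPart x) (insert i T : Finset _)) d := fun b => by
      refine errSpan_mono hmono d (ih fun y y' h => hφ fun w hw => ?_)
      by_cases hwi : w = Sum.inl i
      · subst hwi; simp
      · rw [Function.update_of_ne hwi, Function.update_of_ne hwi]
        refine h w fun j hj => ?_
        have := hw j hj
        rw [Finset.coe_insert, Set.mem_insert_iff] at this
        rcases this with rfl | h
        · exact absurd hj hwi
        · exact h
    have hA : ∀ p ∈ phaseErr (dataPart x) (insert i T : Finset _),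
        (dataPart (0 : Wire k → ZMod 2) + p.1,
          dataPart (Pi.single (Sum.inl i) 1 : Wire k → ZMod 2) + p.2) ∈
          phaseErr (dataPart x) (insert i T : Finset _) := by
      intro p hp
      refine ⟨(zero_add p.1).trans hp.1, SuppIn.add (fun j hj => ?_) hp.2⟩
      have : j ≠ i := fun h => hj (by simp [h])
      simp [dataPart, this]
    -- Freezing the bit of `i` removes it from the dependence of the phase, at the price of a
    -- possible `Z` on `i`.
    rw [twist_eq_half i]
    exact Submodule.smul_mem _ _ (Submodule.add_mem _
      (Submodule.add_mem _ (key 0) (pauli_mem_errSpan hA (key 0)))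
      (Submodule.sub_mem _ (key 1) (pauli_mem_errSpan hA (key 1))))

end ErrSpan

/-! ### The gadgets -/

/-- The single-qubit Pauli errors. -/
def singleErr : ErrorSet := {p | ∃ q b c, p.1 = Pi.single q b ∧ p.2 = Pi.single q c}

/-- The errors that a gadget on the qubits `T` may leave behind when all the flags are trivial. -/
def quietErr (T : Set (Fin 15)) : ErrorSet :=
  {p | p ∈ singleErr ∨ ∃ q ∈ T, p.1 = Pi.single q 1 ∧ SuppIn T p.2}

/-- The errors that a gadget on the qubits `T` may leave behind, depending on whether all the flags
are trivial. -/
def gadgetErr (T : Set (Fin 15)) (quiet : Prop) : ErrorSet :=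
  {p | (quiet → p ∈ quietErr T) ∧ (¬ quiet → p ∈ localErr T)}

/-- A list of trivial outcomes. -/
def zeros (n : ℕ) : Record := List.replicate n 0

theorem eq_single_of_suppIn {W : Type} [DecidableEq W] {w : W} {x : W → ZMod 2}
    (h : SuppIn {w} x) : x = Pi.single w (x w) := by
  ext v
  by_cases hv : v = w
  · subst hv; simp
  · rw [Pi.single_eq_of_ne hv, h v hv]

theorem pauli_mem_singleErr {k : ℕ} {A : ErrorSet} (hA : singleErr ⊆ A) {x z : Wire k → ZMod 2}
    {q : Fin 15} (hx : SuppIn {q} (dataPart x)) (hz : SuppIn {q} (dataPart z))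
    (d : State (Fin 15)) (χ : State (Fin k)) : pauli x z (tensor d χ) ∈ errSpan k A d := by
  rw [pauli_tensor]
  have h : (dataPart x, dataPart z) ∈ A :=
    hA ⟨q, _, _, eq_single_of_suppIn hx, eq_single_of_suppIn hz⟩
  exact tensor_mem_errSpan h _

theorem mem_of_concat_eq_append {α : Type*} {l X Y : List α} {g : α} (h : X ++ Y = l ++ [g])
    (hY : Y ≠ []) : g ∈ Y := by
  obtain ⟨Y', g', rfl⟩ := (List.eq_nil_or_concat' Y).resolve_left hY
  rw [← List.append_assoc] at h
  have := (List.append_inj' h rfl).2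
  simp_all

section Gadgets

variable {i j l : Fin 15}

/-- The gates of `czGadget` that couple the flags. -/
def czPre (j : Fin 15) : List (Gate (Wire 4)) := [cnotDA j 1, cnotAD 0 j]

/-- The CZ gates of `czGadget`. -/
def czMid (i j : Fin 15) : List (Gate (Wire 4)) :=
  [.cz (Sum.inl i) (Sum.inl j), .cz (Sum.inl i) (Sum.inr 0)]

/-- The gates of `czGadget` that decouple the flags. -/
def czPost (j : Fin 15) : List (Gate (Wire 4)) := [cnotAD 0 j, cnotDA j 1]

/-- The gates of `czGadget`. -/
def czGates (i j : Fin 15) : List (Gate (Wire 4)) := czPre j ++ (czMid i j ++ czPost j)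

/-- The flags of `czGadget`. -/
def czFlags : List (MBasis × Fin 4) := [(.X, 0), (.Z, 1)]

theorem czGadget_eq (i j : Fin 15) (k : Record → Protocol 4) (rec : Record) :
    czGadget i j k rec = block czFlags (czGates i j) fun o => k (rec ++ o) := by
  rw [czGadget, withMeas_eq]
  rfl

/-- The gates of `cczGadget` that couple the flags. -/
def cczPre (j l : Fin 15) : List (Gate (Wire 4)) :=
  [cnotDA j 1, cnotDA l 3, cnotAD 0 j, cnotAD 2 l]

/-- The CCZ gates of `cczGadget`. -/
def cczMid (i j l : Fin 15) : List (Gate (Wire 4)) :=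
  [.ccz (Sum.inl i) (Sum.inl j) (Sum.inl l), .ccz (Sum.inl i) (Sum.inr 0) (Sum.inl l),
    .ccz (Sum.inl i) (Sum.inl j) (Sum.inr 2), .ccz (Sum.inl i) (Sum.inr 0) (Sum.inr 2)]

/-- The gates of `cczGadget` that decouple the flags. -/
def cczPost (j l : Fin 15) : List (Gate (Wire 4)) :=
  [cnotAD 0 j, cnotAD 2 l, cnotDA j 1, cnotDA l 3]

/-- The gates of `cczGadget`. -/
def cczGates (i j l : Fin 15) : List (Gate (Wire 4)) :=
  cczPre j l ++ (cczMid i j l ++ cczPost j l)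

/-- The flags of `cczGadget`. -/
def cczFlags : List (MBasis × Fin 4) := [(.X, 0), (.Z, 1), (.X, 2), (.Z, 3)]

theorem cczGadget_eq (i j l : Fin 15) (k : Record → Protocol 4) (rec : Record) :
    cczGadget i j l k rec = block cczFlags (cczGates i j l) fun o => k (rec ++ o) := by
  rw [cczGadget, withMeas_eq]
  rfl

theorem applyGates_czGates (hij : i ≠ j) (ψ : State (Wire 4)) :
    applyGates (czGates i j) ψ = (Gate.cz (Sum.inl i) (Sum.inl j)).apply ψ := by
  ext y
  simp [czGates, czPre, czMid, czPost, cnotDA, cnotAD, Gate.apply, hij, add_assoc, zmod2_add_self, mul_add,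
    sgn_add]
  linear_combination (sgn (y (Sum.inl i) * y (Sum.inl j)) * ψ y) *
    sgn_mul_self (y (Sum.inl i) * y (Sum.inr 0))

theorem applyGates_cczGates (hij : i ≠ j) (hil : i ≠ l) (hjl : j ≠ l) (ψ : State (Wire 4)) :
    applyGates (cczGates i j l) ψ =
      (Gate.ccz (Sum.inl i) (Sum.inl j) (Sum.inl l)).apply ψ := by
  ext y
  simp [cczGates, cczPre, cczMid, cczPost, cnotDA, cnotAD, Gate.apply, hij, hil, hjl, hjl.symm,
    add_assoc, zmod2_add_self, mul_add, add_mul, sgn_add]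
  -- The phases at the arguments `j + f` and `l + f'` have been expanded; every factor that involves
  -- an ancilla bit occurs an even number of times. `U` stands for the string after all CNOTs, which
  -- is `y` again.
  have key : ∀ U : Wire 4 → ZMod 2, U = y →
      sgn (y (Sum.inl i) * y (Sum.inr 0) * y (Sum.inr 2)) *
      (sgn (y (Sum.inl i) * y (Sum.inl j) * y (Sum.inr 2)) *
        sgn (y (Sum.inl i) * y (Sum.inr 0) * y (Sum.inr 2)) *
        (sgn (y (Sum.inl i) * y (Sum.inr 0) * y (Sum.inl l)) *
          sgn (y (Sum.inl i) * y (Sum.inr 0) * y (Sum.inr 2)) *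
          (sgn (y (Sum.inl i) * y (Sum.inl j) * y (Sum.inl l)) *
            sgn (y (Sum.inl i) * y (Sum.inl j) * y (Sum.inr 2)) *
            (sgn (y (Sum.inl i) * y (Sum.inr 0) * y (Sum.inl l)) *
              sgn (y (Sum.inl i) * y (Sum.inr 0) * y (Sum.inr 2))) * ψ U))) =
      sgn (y (Sum.inl i) * y (Sum.inl j) * y (Sum.inl l)) * ψ y := by
    rintro U rfl
    have h1 := sgn_mul_self (U (Sum.inl i) * U (Sum.inr 0) * U (Sum.inr 2))
    have h2 := sgn_mul_self (U (Sum.inl i) * U (Sum.inl j) * U (Sum.inr 2))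
    have h3 := sgn_mul_self (U (Sum.inl i) * U (Sum.inr 0) * U (Sum.inl l))
    generalize sgn (U (Sum.inl i) * U (Sum.inr 0) * U (Sum.inr 2)) = p at *
    generalize sgn (U (Sum.inl i) * U (Sum.inl j) * U (Sum.inr 2)) = q at *
    generalize sgn (U (Sum.inl i) * U (Sum.inr 0) * U (Sum.inl l)) = r at *
    generalize sgn (U (Sum.inl i) * U (Sum.inl j) * U (Sum.inl l)) = s at *
    linear_combination (p * p * q * q * r * r * s * ψ U + q * q * r * r * s * ψ U) * h1 +
      (r * r * s * ψ U) * h2 + s * ψ U * h3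
  refine key _ ?_
  ext w
  rcases w with w | w
  · by_cases h1 : w = j
    · subst h1; simp
    · by_cases h2 : w = l
      · subst h2; simp [h1]
      · simp [h1, h2]
  · fin_cases w <;> simp

/-- The fault analysis that is common to both gadgets. The gates are `pre ++ mid ++ post`; `fam` is a
family of sets of wires that are tracked through `pre` and `post`, and `Q` describes the Pauli
faults of the gates in `mid`. -/
theorem gadget_fault {T : Set (Fin 15)} {ps : List (MBasis × Fin 4)}
    (hnd : (ps.map Prod.snd).Nodup) {pre mid post : List (Gate (Wire 4))}
    (hclass : ∀ g ∈ pre ++ (mid ++ post), g.IsClassical)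
    (hsupp : ∀ g ∈ pre ++ (mid ++ post), g.support ⊆ withAnc 4 T)
    {d d' : State (Fin 15)} {χ : State (Fin 4)} (hχ : Prepared ps χ)
    (hall : applyGates (pre ++ (mid ++ post)) (tensor d χ) = tensor d' χ)
    (hd : tensor d χ ∈ errSpan 4 (localErr T) d')
    {fam : Set (Set (Wire 4))}
    (htrack : ∀ S ∈ fam, ∀ g ∈ pre ++ post, g.Tracks S)
    (hdata : ∀ S ∈ fam, ∃ q, ∀ i, Sum.inl i ∈ S → i = q)
    (hcover : ∀ w ∈ withAnc 4 T, ∃ S ∈ fam, w ∈ S)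
    (hgate : ∀ g ∈ pre ++ post, ∃ S ∈ fam, g.support ⊆ S)
    (hpre : ∀ S ∈ fam, ∀ x z, SuppIn S x → SuppIn S z →
      applyGates (mid ++ post) (pauli x z (applyGates pre (tensor d χ))) ∈
        errSpan 4 (quietErr T) d')
    {Q : (Wire 4 → ZMod 2) → (Wire 4 → ZMod 2) → Prop}
    (hQgate : ∀ g ∈ mid, ∀ x z, SuppIn g.support x → SuppIn g.support z → Q x z)
    (hQsingle : ∀ w ∈ withAnc 4 T, (∀ x z, SuppIn {w} x → SuppIn {w} z → Q x z) ∨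
      ∀ g ∈ mid, w ∉ g.support)
    (hmid : ∀ m₁ m₂, mid = m₁ ++ m₂ → ∀ x z, Q x z →
      measAll ps (zeros ps.length) (applyGates (m₂ ++ post)
        (pauli x z (applyGates (pre ++ m₁) (tensor d χ)))) ∈ errSpan 4 (quietErr T) d')
    {l₁ l₂ : List (Gate (Wire 4))} (hl : pre ++ (mid ++ post) = l₁ ++ l₂) {S : Set (Wire 4)}
    (hS : FaultSupport l₁ S) {x z : Wire 4 → ZMod 2} (hx : SuppIn S x) (hz : SuppIn S z)
    {o : Record} (ho : o.length = ps.length) :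
    measAll ps o (applyGates l₂ (pauli x z (applyGates l₁ (tensor d χ)))) ∈
      errSpan 4 (gadgetErr T (o = zeros ps.length)) d' := by
  have hsingle : singleErr ⊆ quietErr T := fun p hp => Or.inl hp
  -- a single-qubit fault outside
  by_cases hout : ∃ q, q ∉ T ∧ S = {Sum.inl q}
  · obtain ⟨q, hq, rfl⟩ := hout
    have hdis : ∀ g ∈ l₂, g.IsClassical ∧ ∀ w ∈ g.support, w ∉ ({Sum.inl q} : Set (Wire 4)) := by
      intro g hg
      have hg' : g ∈ pre ++ (mid ++ post) := by rw [hl]; exact List.mem_append_right _ hg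
      refine ⟨hclass g hg', fun w hw hwq => hq ?_⟩
      exact hsupp g hg' hw q hwq
    rw [pauli_commute_disjoint_list hdis hx hz, ← applyGates_append, ← hl, hall]
    by_cases hoz : o = zeros ps.length
    · refine measAll_mem_errSpan _ _ (pauli_mem_singleErr (q := q) ?_ ?_ ?_ _ _)
      · intro p hp
        exact ⟨fun _ => Or.inl hp, fun h => absurd hoz h⟩
      · intro i hi
        exact hx _ fun h => hi (Sum.inl_injective h)
      · intro i hi
        exact hz _ fun h => hi (Sum.inl_injective h)
    · rw [measAll_eq_zero_of_ne (v := fun _ => 0) (fun r hr => ?_) hnd ho]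
      · exact Submodule.zero_mem _
      · rw [List.map_const']
        exact hoz
      · refine (((hχ r hr).tensor d').pauli x z).congr_val ?_
        have hne : (Sum.inr r.2 : Wire 4) ∉ ({Sum.inl q} : Set (Wire 4)) := by simp
        cases r.1 <;> simp [flipEntry, hx _ hne, hz _ hne]
  -- a fault inside
  have hSin : S ⊆ withAnc 4 T := by
    rcases hS with ⟨w, rfl⟩ | ⟨l', g, rfl, rfl⟩
    · intro w' hw' q hq
      by_contra hqT
      exact hout ⟨q, hqT, by rw [← hq, Set.mem_singleton_iff.1 hw']⟩
    · exact hsupp g (by rw [hl]; simp)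
  by_cases hoz : o = zeros ps.length
  swap
  -- With nontrivial outcomes it suffices that fault and gates act only on `T` and the ancillas, so
  -- that the error stays on `T`.
  · have hsub : localErr T ⊆ gadgetErr T (o = zeros ps.length) := fun p hp =>
      ⟨fun h => absurd h hoz, fun _ => hp⟩
    refine errSpan_mono hsub _ (measAll_mem_errSpan _ _ ?_)
    have h1 : ∀ g ∈ l₁ ++ l₂, g.IsClassical := by rw [← hl]; exact hclass
    have h2 : ∀ g ∈ l₁ ++ l₂, g.support ⊆ withAnc 4 T := by rw [← hl]; exact hsupp
    refine applyGates_mem_localErr (fun g hg => h1 g (by simp [hg]))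
      (fun g hg => h2 g (by simp [hg])) (pauli_mem_localErr (hx.mono hSin) (hz.mono hSin) ?_)
    exact applyGates_mem_localErr (fun g hg => h1 g (by simp [hg]))
      (fun g hg => h2 g (by simp [hg])) hd
  have hsub : quietErr T ⊆ gadgetErr T (o = zeros ps.length) := fun p hp =>
    ⟨fun _ => hp, fun h => absurd hoz h⟩
  refine errSpan_mono hsub _ ?_
  have hfin : ∀ S' ∈ fam, ∀ x z, SuppIn S' x → SuppIn S' z →
      pauli x z (tensor d' χ) ∈ errSpan 4 (quietErr T) d' := by
    intro S' hS' x z hx hz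
    obtain ⟨q, hq⟩ := hdata S' hS'
    exact pauli_mem_singleErr hsingle (q := q) (fun i hi => hx _ fun h => hi (hq i h))
      (fun i hi => hz _ fun h => hi (hq i h)) _ _
  -- tracked faults in `pre`
  have hA : ∀ A₁ A₂, pre = A₁ ++ A₂ → ∀ S' ∈ fam, S ⊆ S' → 
      applyGates (A₂ ++ (mid ++ post)) (pauli x z (applyGates A₁ (tensor d χ))) ∈
        errSpan 4 (quietErr T) d' := by
    intro A₁ A₂ hA S' hS' hSS
    obtain ⟨x', z', hx', hz', h⟩ := exists_pauli_of_tracks (gs := A₂)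
      (fun g hg => htrack S' hS' g (by simp [hA, hg])) (hx.mono hSS) (hz.mono hSS)
    rw [applyGates_append, h, ← applyGates_append, ← hA]
    exact hpre S' hS' x' z' hx' hz'
  -- tracked faults in `post`
  have hC : ∀ C₁ C₂, post = C₁ ++ C₂ → ∀ S' ∈ fam, S ⊆ S' →
      applyGates C₂ (pauli x z (applyGates (pre ++ (mid ++ C₁)) (tensor d χ))) ∈
        errSpan 4 (quietErr T) d' := by
    intro C₁ C₂ hC S' hS' hSS
    obtain ⟨x', z', hx', hz', h⟩ := exists_pauli_of_tracks (gs := C₂)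
      (fun g hg => htrack S' hS' g (by simp [hC, hg])) (hx.mono hSS) (hz.mono hSS)
    rw [h, ← applyGates_append]
    have e : pre ++ (mid ++ C₁) ++ C₂ = pre ++ (mid ++ post) := by simp [hC]
    rw [e, hall]
    exact hfin S' hS' x' z' hx' hz'
  have hsing : ∀ w, S = {w} → ∃ S' ∈ fam, S ⊆ S' := by
    rintro w rfl
    obtain ⟨S', h1, h2⟩ := hcover w (hSin rfl)
    exact ⟨S', h1, by simpa using h2⟩
  rcases List.append_eq_append_iff.1 hl with ⟨B', rfl, hB⟩ | ⟨A', hA', rfl⟩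
  · rcases List.append_eq_append_iff.1 hB with ⟨C', rfl, hC'⟩ | ⟨M', hM', rfl⟩
    · -- in `post`
      by_cases hC0 : C' = []
      · subst hC0
        rw [List.append_nil] at hS ⊢
        -- At the cut between `mid` and `post` a gate fault still belongs to the last gate of `mid`,
        -- while a single-wire fault can be counted to `post`.
        have hQm : Q x z ∨ ∃ S' ∈ fam, S ⊆ S' := by
          rcases hS with ⟨w, rfl⟩ | ⟨l', g, hl', rfl⟩
          · exact Or.inr (hsing w rfl)
          · by_cases hm : mid = []
            · subst hm
              rw [List.append_nil] at hl'
              exact Or.inr (hgate g (by simp [hl']))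
            · exact Or.inl (hQgate g (mem_of_concat_eq_append hl' hm) x z hx hz)
        rw [List.nil_append] at hC'
        subst hC'
        rcases hQm with hQ | ⟨S', hS', hSS⟩
        · have := hmid mid [] (by simp) x z hQ
          rw [hoz]
          exact this
        · have := hC [] post rfl S' hS' hSS
          rw [List.append_nil] at this
          exact measAll_mem_errSpan _ _ this
      · have : ∃ S' ∈ fam, S ⊆ S' := by
          rcases hS with ⟨w, rfl⟩ | ⟨l', g, hl', rfl⟩
          · exact hsing w rfl
          · rw [← List.append_assoc] at hl'
            exact hgate g (by
              rw [hC']; simp [mem_of_concat_eq_append hl' hC0])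
        obtain ⟨S', hS', hSS⟩ := this
        exact measAll_mem_errSpan _ _ (hC C' l₂ hC' S' hS' hSS)
    · -- in `mid`
      by_cases hB0 : B' = []
      · subst hB0
        rw [List.append_nil] at hS ⊢
        rw [List.nil_append] at hM'
        subst hM'
        have : ∃ S' ∈ fam, S ⊆ S' := by
          rcases hS with ⟨w, rfl⟩ | ⟨l', g, hl', rfl⟩
          · exact hsing w rfl
          · exact hgate g (by simp [hl'])
        obtain ⟨S', hS', hSS⟩ := this
        exact measAll_mem_errSpan _ _ (hA pre [] (by simp) S' hS' hSS)
      · rw [hoz]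
        rcases hS with ⟨w, rfl⟩ | ⟨l', g, hl', rfl⟩
        · rcases hQsingle w (hSin rfl) with hQ | hdis
          · exact hmid B' M' hM' x z (hQ x z hx hz)
          -- A fault on a wire that no gate of `mid` touches commutes with the rest of `mid` and may
          -- be moved to the start of `post`.
          · have hd2 : ∀ g ∈ M', g.IsClassical ∧ ∀ w' ∈ g.support, w' ∉ ({w} : Set (Wire 4)) := by
              intro g hg
              have hgm : g ∈ mid := by rw [hM']; simp [hg]
              refine ⟨hclass g (by simp [hgm]), ?_⟩
              rintro w' hw' rfl
              exact hdis g hgm hw'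
            obtain ⟨S', hS', hSS⟩ := hsing w rfl
            rw [applyGates_append, pauli_commute_disjoint_list hd2 hx hz, ← applyGates_append]
            have := hC [] post rfl S' hS' hSS
            rw [List.append_nil, hM', ← List.append_assoc] at this
            exact measAll_mem_errSpan _ _ this
        · exact hmid B' M' hM' x z (hQgate g (by
            rw [hM']; simp [mem_of_concat_eq_append hl' hB0]) x z hx hz)
  · -- in `pre`
    have : ∃ S' ∈ fam, S ⊆ S' := by
      rcases hS with ⟨w, rfl⟩ | ⟨l', g, rfl, rfl⟩
      · exact hsing w rfl
      · exact hgate g (by simp [hA'])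
    obtain ⟨S', hS', hSS⟩ := this
    exact measAll_mem_errSpan _ _ (hA l₁ A' hA' S' hS' hSS)

end Gadgets

/-! ### Pauli errors and CNOT gates -/

section Push

variable {W : Type} [Fintype W] [DecidableEq W]

/-- CNOT gates. -/
def Gate.IsCnot : Gate W → Prop
  | .cnot _ _ _ => True
  | _ => False

/-- The propagation of phase flips through a CNOT gate. -/
def Gate.pushZ : Gate W → (W → ZMod 2) → W → ZMod 2
  | .cnot c t _, u => Function.update u c (u c + u t)
  | _, u => u

/-- The propagation of phase flips through CNOT gates. -/
def pushZs (gs : List (Gate W)) (z : W → ZMod 2) : W → ZMod 2 :=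
  gs.foldl (fun z g => g.pushZ z) z

theorem applyGates_pauli_of_isCnot {gs : List (Gate W)} (hg : ∀ g ∈ gs, g.IsCnot)
    (x z : W → ZMod 2) (ψ : State W) :
    applyGates gs (pauli x z ψ) = pauli (pushXs gs x) (pushZs gs z) (applyGates gs ψ) := by
  induction gs generalizing x z ψ with
  | nil => rfl
  | cons g gs ih =>
    have h := hg g (by simp)
    cases g with
    | cnot c t ne =>
      rw [applyGates_cons, pauli_cnot, ih fun g' h => hg g' (by simp [h])]
      rfl
    | _ => exact h.elim

end Push

theorem measAll_zeros_eq_zero {k : ℕ} {ms : List (MBasis × Fin k)} {q : MBasis × Fin k}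
    {ψ : State (Wire k)} (hq : q ∈ ms) (hψ : HasVal q.1 (Sum.inr q.2) 1 ψ)
    (hnd : (ms.map Prod.snd).Nodup) : measAll ms (zeros ms.length) ψ = 0 := by
  refine measAll_eq_zero (q := q) (b := 0) ?_ hψ (by decide) hnd
  clear hnd
  induction ms with
  | nil => simp at hq
  | cons r ms ih =>
    rw [zeros, List.length_cons, List.replicate_succ, List.zip_cons_cons, List.mem_cons]
    rcases List.mem_cons.1 hq with rfl | hq
    · exact Or.inl rfl
    · exact Or.inr (ih hq)

/-! ### Bit flips in a gadget: the phases they cause and the flags they raise -/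

section Twist

variable {T : Finset (Fin 15)} {gs : List (Gate (Wire 4))} {ψ : State (Wire 4)}
  {d : State (Fin 15)} {χ : State (Fin 4)} {x z : Wire 4 → ZMod 2}

theorem exists_twist_pauli (hclass : ∀ g ∈ gs, g.IsClassical)
    (hsupp : ∀ g ∈ gs, g.support ⊆ withAnc 4 (T : Set _)) (hψ : applyGates gs ψ = tensor d χ)
    (hz : SuppIn (withAnc 4 (T : Set _)) z) :
    ∃ φ, DependsOn φ (withAnc 4 (T : Set _)) ∧
      applyGates gs (pauli x z ψ) = twist (pushXs gs x) φ (tensor d χ) := by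
  obtain ⟨φ, h1, h2⟩ := exists_twist hclass hsupp x (dependsOn_sgn_dotProduct hz)
  exact ⟨φ, h1, by rw [pauli_eq_twist, h2, hψ]⟩

/-- If the bit flips end as the flip of one qubit `q` of `T`, the accompanying phase is a
superposition of `Z` errors on `T`, whichever CZ or CCZ gates were crossed. -/
theorem pauli_mem_quietErr (hclass : ∀ g ∈ gs, g.IsClassical)
    (hsupp : ∀ g ∈ gs, g.support ⊆ withAnc 4 (T : Set _)) (hψ : applyGates gs ψ = tensor d χ)
    (hz : SuppIn (withAnc 4 (T : Set _)) z) {q : Fin 15} (hq : q ∈ T)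
    (hx : dataPart (pushXs gs x) = Pi.single q 1) :
    applyGates gs (pauli x z ψ) ∈ errSpan 4 (quietErr T) d := by
  obtain ⟨φ, h1, h2⟩ := exists_twist_pauli (x := x) hclass hsupp hψ hz
  rw [h2]
  refine errSpan_mono ?_ _ (twist_mem_errSpan T d χ _ h1)
  intro p hp
  exact Or.inr ⟨q, hq, hp.1.trans hx, hp.2⟩

/-- A phase function does not affect values in the `Z` basis, so an outer flag that is flipped
cannot read zero. -/
theorem measAll_pauli_eq_zero {ps : List (MBasis × Fin 4)} (hnd : (ps.map Prod.snd).Nodup)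
    (hχ : Prepared ps χ) (hclass : ∀ g ∈ gs, g.IsClassical)
    (hsupp : ∀ g ∈ gs, g.support ⊆ withAnc 4 (T : Set _)) (hψ : applyGates gs ψ = tensor d χ)
    (hz : SuppIn (withAnc 4 (T : Set _)) z) {q : Fin 4} (hq : (MBasis.Z, q) ∈ ps)
    (hx : pushXs gs x (Sum.inr q) = 1) :
    measAll ps (zeros ps.length) (applyGates gs (pauli x z ψ)) = 0 := by
  obtain ⟨φ, -, h2⟩ := exists_twist_pauli (x := x) hclass hsupp hψ hz
  rw [h2]
  refine measAll_zeros_eq_zero hq ?_ hnd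
  exact (((hχ _ hq).tensor d).twist _ φ).congr_val (by rw [hx, zero_add])

end Twist

/-! ### Fault analysis of the CZ and CCZ gadgets -/

section Gadgets

variable {i j l : Fin 15}

theorem applyGates_czMid (ψ : State (Wire 4)) (y : Wire 4 → ZMod 2) :
    applyGates (czMid i j) ψ y =
      sgn (y (Sum.inl i) * (y (Sum.inl j) + y (Sum.inr 0))) * ψ y := by
  simp only [czMid, applyGates_cons, applyGates_nil, Gate.apply, mul_add, sgn_add]
  ring

theorem applyGates_cczMid (ψ : State (Wire 4)) (y : Wire 4 → ZMod 2) :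
    applyGates (cczMid i j l) ψ y =
      sgn (y (Sum.inl i) * (y (Sum.inl j) + y (Sum.inr 0)) * (y (Sum.inl l) + y (Sum.inr 2))) *
        ψ y := by
  simp only [cczMid, applyGates_cons, applyGates_nil, Gate.apply, mul_add, add_mul, sgn_add]
  ring

theorem cz_tensor (d : State (Fin 15)) (χ : State (Fin 4)) :
    (Gate.cz (Sum.inl i) (Sum.inl j)).apply (tensor d χ) = tensor ((Gate.cz i j).apply d) χ := by
  ext y; simp only [Gate.apply, tensor]; ring

theorem ccz_tensor (d : State (Fin 15)) (χ : State (Fin 4)) :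
    (Gate.ccz (Sum.inl i) (Sum.inl j) (Sum.inl l)).apply (tensor d χ) =
      tensor ((Gate.ccz i j l).apply d) χ := by
  ext y; simp only [Gate.apply, tensor]; ring

theorem cz_cz (d : State (Fin 15)) : (Gate.cz i j).apply ((Gate.cz i j).apply d) = d := by
  ext y; simp only [Gate.apply]; rw [← mul_assoc, sgn_mul_self, one_mul]

theorem ccz_ccz (d : State (Fin 15)) : (Gate.ccz i j l).apply ((Gate.ccz i j l).apply d) = d := by
  ext y; simp only [Gate.apply]; rw [← mul_assoc, sgn_mul_self, one_mul]

theorem tensor_mem_localErr (T : Set (Fin 15)) (d : State (Fin 15)) (χ : State (Fin 4)) :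
    tensor d χ ∈ errSpan 4 (localErr T) d := by
  have h : ((0 : Fin 15 → ZMod 2), (0 : Fin 15 → ZMod 2)) ∈ localErr T :=
    ⟨fun _ _ => rfl, fun _ _ => rfl⟩
  simpa using tensor_mem_errSpan (d := d) h χ

theorem czGates_isClassical : ∀ g ∈ czGates i j, g.IsClassical := by
  simp [czGates, czPre, czMid, czPost, cnotDA, cnotAD, Gate.IsClassical]

theorem czGates_support : ∀ g ∈ czGates i j,
    g.support ⊆ withAnc 4 (({i, j} : Finset (Fin 15)) : Set (Fin 15)) := by
  simp [czGates, czPre, czMid, czPost, cnotDA, cnotAD, Gate.support, withAnc, Set.insert_subset_iff]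

theorem cczGates_isClassical : ∀ g ∈ cczGates i j l, g.IsClassical := by
  simp [cczGates, cczPre, cczMid, cczPost, cnotDA, cnotAD, Gate.IsClassical]

theorem cczGates_support : ∀ g ∈ cczGates i j l,
    g.support ⊆ withAnc 4 (({i, j, l} : Finset (Fin 15)) : Set (Fin 15)) := by
  simp [cczGates, cczPre, cczMid, cczPost, cnotDA, cnotAD, Gate.support, withAnc,
    Set.insert_subset_iff]

theorem cczFlags_nodup : (cczFlags.map Prod.snd).Nodup := by decide

theorem czFlags_nodup : (czFlags.map Prod.snd).Nodup := by decide

/-- The wires of the branch of `cczGadget` (or `czGadget`) at the data qubit `j` with the flags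
`f` and `g`. -/
def branch (j : Fin 15) (f g : Fin 4) : Set (Wire 4) := {Sum.inl j, Sum.inr f, Sum.inr g}

theorem suppIn_withAnc_of_forall {k : ℕ} {T : Set (Fin 15)} {z : Wire k → ZMod 2}
    (h : ∀ i, i ∉ T → z (Sum.inl i) = 0) : SuppIn (withAnc k T) z := by
  intro w hw
  rcases w with i | q
  · exact h i fun hi => hw fun i' h' => by rw [← Sum.inl_injective h']; exact hi
  · exact absurd (fun i h' => by simp at h') hw

/-- The middle gates multiply to the phase of `i * (j + f) * (l + f')`, where `f`, `f'` are the
inner flags. A fault in the coupling or decoupling stays on one of the sets `{j, f, g}`, `{l, f',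
g'}`, `{i}`, each with one data qubit, so it ends as a single-qubit error or as the flip of that
qubit with phases. A faulty CCZ gate touches only one of `j`, `f` and one of `l`, `f'`. Hence a bit
flip there reaches an outer flag, and a phase flip on `j` or `l` reaches an inner flag; when all
flags are silent, the only data qubit hit directly is `i`. -/
theorem cczGadget_fault (hij : i ≠ j) (hil : i ≠ l) (hjl : j ≠ l) {d d' : State (Fin 15)}
    (hd : d' = (Gate.ccz i j l).apply d) {χ : State (Fin 4)} (hχ : Prepared cczFlags χ)
    {l₁ l₂ : List (Gate (Wire 4))} (hl : cczGates i j l = l₁ ++ l₂) {S : Set (Wire 4)}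
    (hS : FaultSupport l₁ S) {x z : Wire 4 → ZMod 2} (hx : SuppIn S x) (hz : SuppIn S z)
    {o : Record} (ho : o.length = cczFlags.length) :
    measAll cczFlags o (applyGates l₂ (pauli x z (applyGates l₁ (tensor d χ)))) ∈
      errSpan 4 (gadgetErr (({i, j, l} : Finset (Fin 15)) : Set (Fin 15)) (o = zeros 4)) d' := by
  have hall : applyGates (cczGates i j l) (tensor d χ) = tensor d' χ := by
    rw [applyGates_cczGates hij hil hjl, ccz_tensor, hd]
  have hpost : ∀ m₁ m₂, cczMid i j l = m₁ ++ m₂ →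
      applyGates (m₂ ++ cczPost j l) (applyGates (cczPre j l ++ m₁) (tensor d χ)) =
        tensor d' χ := by
    intro m₁ m₂ hm
    rw [← applyGates_append, ← hall, cczGates, hm]
    simp
  have hclass : ∀ m₁ m₂, cczMid i j l = m₁ ++ m₂ → ∀ g ∈ m₂ ++ cczPost j l, g.IsClassical := by
    intro m₁ m₂ hm g hg
    refine cczGates_isClassical (i := i) (j := j) (l := l) g ?_
    rw [cczGates, hm]; simp at hg ⊢; tauto
  have hsupp : ∀ m₁ m₂, cczMid i j l = m₁ ++ m₂ → ∀ g ∈ m₂ ++ cczPost j l, g.support ⊆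
      withAnc 4 (({i, j, l} : Finset (Fin 15)) : Set (Fin 15)) := by
    intro m₁ m₂ hm g hg
    refine cczGates_support (i := i) (j := j) (l := l) g ?_
    rw [cczGates, hm]; simp at hg ⊢; tauto
  have hdiag : ∀ m₁ m₂, cczMid i j l = m₁ ++ m₂ → ∀ g ∈ m₂, g.IsDiagonal := by
    intro m₁ m₂ hm g hg
    have : g ∈ cczMid i j l := by rw [hm]; simp [hg]
    simp only [cczMid, List.mem_cons, List.not_mem_nil, or_false] at this
    rcases this with rfl | rfl | rfl | rfl <;> trivial
  have htrack : ∀ S ∈ ({branch j 0 1, branch l 2 3, {Sum.inl i}} : Set (Set (Wire 4))),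
      ∀ g ∈ cczPre j l ++ cczPost j l, g.Tracks S := by
    rintro S hS g hg
    simp only [Set.mem_insert_iff, Set.mem_singleton_iff, cczPre,
      cczPost, List.cons_append, List.nil_append, List.mem_cons, List.not_mem_nil, or_false]
      at hS hg
    rcases hS with rfl | rfl | rfl <;>
      rcases hg with rfl | rfl | rfl | rfl | rfl | rfl | rfl | rfl <;>
      first
      | (refine Or.inl ⟨_, _, _, rfl, ?_, ?_⟩ <;> simp [branch]; done)
      | (refine Or.inr ⟨trivial, ?_⟩
         simp [cnotDA, cnotAD, Gate.support, branch, hij.symm, hil.symm, hjl.symm, hjl])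
  have hpush : ∀ m₁ m₂, cczMid i j l = m₁ ++ m₂ → ∀ x,
      pushXs (m₂ ++ cczPost j l) x = pushXs (cczPost j l) x := fun m₁ m₂ hm x => by
    rw [pushXs_append, pushXs_diagonal (hdiag m₁ m₂ hm)]
  have hquiet : ∀ m₁ m₂, cczMid i j l = m₁ ++ m₂ → ∀ x z,
      SuppIn (withAnc 4 (({i, j, l} : Finset (Fin 15)) : Set (Fin 15))) z →
      ∀ q ∈ ({i, j, l} : Finset (Fin 15)), dataPart (pushXs (cczPost j l) x) = Pi.single q 1 →
      applyGates (m₂ ++ cczPost j l) (pauli x z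
        (applyGates (cczPre j l ++ m₁) (tensor d χ))) ∈
          errSpan 4 (quietErr (({i, j, l} : Finset (Fin 15)) : Set (Fin 15))) d' := by
    intro m₁ m₂ hm x z hz q hq hx
    exact pauli_mem_quietErr (hclass m₁ m₂ hm) (hsupp m₁ m₂ hm) (hpost m₁ m₂ hm) hz hq
      (by rw [hpush m₁ m₂ hm]; exact hx)
  have hdp : ∀ x : Wire 4 → ZMod 2, dataPart (pushXs (cczPost j l) x) =
      Function.update (Function.update (dataPart x) j (x (Sum.inl j) + x (Sum.inr 0))) l
        (x (Sum.inl l) + x (Sum.inr 2)) := by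
    intro x
    ext q
    by_cases h1 : q = l
    · subst h1
      simp [pushXs, cczPost, cnotDA, cnotAD, Gate.pushX, dataPart, hjl.symm]
    · by_cases h2 : q = j
      · subst h2
        simp [pushXs, cczPost, cnotDA, cnotAD, Gate.pushX, dataPart, hjl]
      · simp [pushXs, cczPost, cnotDA, cnotAD, Gate.pushX, dataPart, h1, h2]
  refine gadget_fault (ps := cczFlags) cczFlags_nodup
    (pre := cczPre j l) (mid := cczMid i j l) (post := cczPost j l)
    cczGates_isClassical cczGates_support hχ hall ?_
    (fam := {branch j 0 1, branch l 2 3, {Sum.inl i}}) htrack ?_ ?_ ?_ ?_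
    (Q := fun x z => (∀ w, (w ≠ Sum.inl i ∧ w ≠ Sum.inl j ∧ w ≠ Sum.inl l ∧ w ≠ Sum.inr 0 ∧
        w ≠ Sum.inr 2) → x w = 0 ∧ z w = 0) ∧
      ((x (Sum.inl j) = 0 ∧ z (Sum.inl j) = 0) ∨ (x (Sum.inr 0) = 0 ∧ z (Sum.inr 0) = 0)) ∧
      ((x (Sum.inl l) = 0 ∧ z (Sum.inl l) = 0) ∨ (x (Sum.inr 2) = 0 ∧ z (Sum.inr 2) = 0)))
    ?_ ?_ ?_ hl hS hx hz ho
  -- CCZ is an involution, so relative to the final data the initial data carry an error on the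
  -- qubits of the tuple.
  · have h1 : tensor d χ = (Gate.ccz (Sum.inl i) (Sum.inl j) (Sum.inl l)).apply (tensor d' χ) := by
      rw [ccz_tensor, hd, ccz_ccz]
    rw [h1]
    exact applyGates_mem_localErr (gs := [.ccz (Sum.inl i) (Sum.inl j) (Sum.inl l)])
      (by simp [Gate.IsClassical]) (by simp [Gate.support, withAnc, Set.insert_subset_iff])
      (tensor_mem_localErr _ _ _)
  · rintro S (rfl | rfl | rfl)
    exacts [⟨j, by simp [branch]⟩, ⟨l, by simp [branch]⟩, ⟨i, by simp⟩]
  · rintro (q | q) hq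
    · have := hq q rfl
      simp only [Finset.coe_insert, Finset.coe_singleton, Set.mem_insert_iff,
        Set.mem_singleton_iff] at this
      rcases this with rfl | rfl | rfl <;> simp [branch]
    · fin_cases q <;> simp [branch]
  · intro g hg
    simp only [cczPre, cczPost, List.cons_append, List.nil_append, List.mem_cons,
      List.not_mem_nil, or_false] at hg
    rcases hg with rfl | rfl | rfl | rfl | rfl | rfl | rfl | rfl <;>
      first
      | (refine ⟨branch j 0 1, by simp, ?_⟩
         simp [branch, cnotDA, cnotAD, Gate.support, Set.insert_subset_iff]; done)
      | (refine ⟨branch l 2 3, by simp, ?_⟩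
         simp [branch, cnotDA, cnotAD, Gate.support, Set.insert_subset_iff])
  · intro S hS x z hx hz
    have hzT : SuppIn (withAnc 4 (({i, j, l} : Finset (Fin 15)) : Set (Fin 15))) z := by
      refine suppIn_withAnc_of_forall fun q hq => hz _ fun hqS => hq ?_
      rcases hS with rfl | rfl | rfl <;> simp [branch] at hqS <;> simp [hqS]
    -- These three sums are the shifts of the factors of the phase `i * (j + f) * (l + f')`. If they
    -- vanish, the fault commutes with all four CCZ gates together, although not with each of them.
    by_cases hc : x (Sum.inl i) = 0 ∧ x (Sum.inl j) + x (Sum.inr 0) = 0 ∧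
        x (Sum.inl l) + x (Sum.inr 2) = 0
    · obtain ⟨h1, h2, h3⟩ := hc
      obtain ⟨x', z', hx', hz', h⟩ := exists_pauli_of_tracks (gs := cczPost j l)
        (fun g hg => htrack S hS g (by simp [hg])) hx hz
      have hcomm : applyGates (cczMid i j l) (pauli x z (applyGates (cczPre j l) (tensor d χ))) =
          pauli x z (applyGates (cczMid i j l) (applyGates (cczPre j l) (tensor d χ))) := by
        ext y
        rw [applyGates_cczMid]
        simp only [pauli]
        rw [applyGates_cczMid]
        simp only [Pi.add_apply, h1, add_zero]
        rw [add_add_add_comm, h2, add_zero, add_add_add_comm, h3, add_zero]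
        ring
      have := hpost (cczMid i j l) [] (by simp)
      rw [List.nil_append, applyGates_append] at this
      rw [applyGates_append, hcomm, h, this]
      have hq : ∃ q, ∀ i, Sum.inl i ∈ S → i = q := by
        rcases hS with rfl | rfl | rfl
        exacts [⟨j, by simp [branch]⟩, ⟨l, by simp [branch]⟩, ⟨i, by simp⟩]
      obtain ⟨q, hq⟩ := hq
      exact pauli_mem_singleErr (fun p hp => Or.inl hp) (q := q)
        (fun i hi => hx' _ fun h => hi (hq i h)) (fun i hi => hz' _ fun h => hi (hq i h)) _ _
    · have := hquiet [] (cczMid i j l) (by simp) x z hzT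
      rw [List.append_nil] at this
      rcases hS with rfl | rfl | rfl
      · have e1 : x (Sum.inl i) = 0 := hx _ (by simp [branch, hij])
        have e2 : x (Sum.inl l) = 0 := hx _ (by simp [branch, hjl.symm])
        have e3 : x (Sum.inr 2) = 0 := hx _ (by simp [branch])
        refine this j (by simp) ?_
        rw [hdp, e2, e3]
        rw [e1, e2, e3] at hc
        have : x (Sum.inl j) + x (Sum.inr 0) = 1 := zmod2_ne_zero.1 fun h => hc ⟨rfl, h, rfl⟩
        rw [this]
        ext q
        by_cases h1 : q = l
        · subst h1; simp [hjl.symm]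
        · by_cases h2 : q = j
          · subst h2; simp [h1]
          · simpa [h1, h2, dataPart] using hx (Sum.inl q) (by simp [branch, h2])
      · have e1 : x (Sum.inl i) = 0 := hx _ (by simp [branch, hil])
        have e2 : x (Sum.inl j) = 0 := hx _ (by simp [branch, hjl])
        have e3 : x (Sum.inr 0) = 0 := hx _ (by simp [branch])
        refine this l (by simp) ?_
        rw [hdp, e2, e3]
        rw [e1, e2, e3] at hc
        have : x (Sum.inl l) + x (Sum.inr 2) = 1 := zmod2_ne_zero.1 fun h => hc ⟨rfl, rfl, h⟩
        rw [this]
        ext q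
        by_cases h1 : q = l
        · subst h1; simp
        · by_cases h2 : q = j
          · subst h2; simp [h1]
          · simpa [h1, h2, dataPart] using hx (Sum.inl q) (by simp [branch, h1])
      · have e : ∀ w, w ≠ Sum.inl i → x w = 0 := fun w hw => hx w hw
        have e1 := e (Sum.inl j) (by simp [hij.symm])
        have e2 := e (Sum.inl l) (by simp [hil.symm])
        have e3 := e (Sum.inr 0) (by simp)
        have e4 := e (Sum.inr 2) (by simp)
        refine this i (by simp) ?_
        rw [hdp, e1, e2, e3, e4]
        rw [e1, e2, e3, e4] at hc
        have : x (Sum.inl i) = 1 := zmod2_ne_zero.1 fun h => hc ⟨h, rfl, rfl⟩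
        ext q
        by_cases h1 : q = l
        · subst h1; simp [hil.symm]
        · by_cases h2 : q = j
          · subst h2; simp [h1, hij.symm]
          · by_cases h3 : q = i
            · subst h3; simpa [h1, h2, dataPart] using this
            · simpa [h1, h2, h3, dataPart] using e (Sum.inl q) (by simp [h3])
  · intro g hg x z hx hz
    simp only [cczMid, List.mem_cons, List.not_mem_nil, or_false] at hg
    have key : ∀ w, w ∉ g.support → x w = 0 ∧ z w = 0 := fun w hw => ⟨hx w hw, hz w hw⟩
    rcases hg with rfl | rfl | rfl | rfl <;>
      refine ⟨fun w hw => key w ?_, ?_, ?_⟩ <;>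
      first
      | (simp [Gate.support]; tauto)
      | (refine Or.inl (key _ ?_)
         simp [Gate.support, hij.symm, hil.symm, hjl, hjl.symm]; done)
      | (refine Or.inr (key _ ?_)
         simp [Gate.support])
  · rintro w hw
    by_cases h1 : w = Sum.inr 1 ∨ w = Sum.inr 3
    · right
      intro g hg
      simp only [cczMid, List.mem_cons, List.not_mem_nil, or_false] at hg
      rcases h1 with rfl | rfl <;> rcases hg with rfl | rfl | rfl | rfl <;> simp [Gate.support]
    · left
      intro x z hx hz
      have key : ∀ w', w' ≠ w → x w' = 0 ∧ z w' = 0 := fun w' h => ⟨hx w' h, hz w' h⟩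
      refine ⟨fun w' h => key w' ?_, ?_, ?_⟩
      · rintro rfl
        rcases w' with q | q
        · have := hw q rfl
          simp at this h
          tauto
        · fin_cases q <;> simp at h h1
      · by_cases h : Sum.inl j = w
        · exact Or.inr (key _ (by rw [← h]; simp))
        · exact Or.inl (key _ h)
      · by_cases h : Sum.inl l = w
        · exact Or.inr (key _ (by rw [← h]; simp))
        · exact Or.inl (key _ h)
  · rintro m₁ m₂ hm x z ⟨hQ, hQj, hQl⟩
    have hzT : SuppIn (withAnc 4 (({i, j, l} : Finset (Fin 15)) : Set (Fin 15))) z := by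
      refine suppIn_withAnc_of_forall fun q hq => (hQ _ ?_).2
      simp at hq
      simpa using hq
    have hx1 : x (Sum.inr 1) = 0 := (hQ _ (by simp)).1
    have hx3 : x (Sum.inr 3) = 0 := (hQ _ (by simp)).1
    -- Decoupling copies this sum onto the outer flag `1`, contradicting silent flags.
    by_cases hxj : x (Sum.inl j) + x (Sum.inr 0) = 1
    · rw [measAll_pauli_eq_zero cczFlags_nodup hχ (hclass m₁ m₂ hm) (hsupp m₁ m₂ hm)
        (hpost m₁ m₂ hm) hzT (q := 1) (by simp [cczFlags])]
      · exact Submodule.zero_mem _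
      · rw [hpush m₁ m₂ hm]
        simpa [pushXs, cczPost, cnotDA, cnotAD, Gate.pushX, hjl, hx1] using hxj
    by_cases hxl : x (Sum.inl l) + x (Sum.inr 2) = 1
    · rw [measAll_pauli_eq_zero cczFlags_nodup hχ (hclass m₁ m₂ hm) (hsupp m₁ m₂ hm)
        (hpost m₁ m₂ hm) hzT (q := 3) (by simp [cczFlags])]
      · exact Submodule.zero_mem _
      · rw [hpush m₁ m₂ hm]
        simpa [pushXs, cczPost, cnotDA, cnotAD, Gate.pushX, hjl.symm, hx3] using hxl
    -- A faulty gate in the middle touches only one of the two wires, so an even sum means that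
    -- neither is flipped.
    have hj0 : x (Sum.inl j) = 0 ∧ x (Sum.inr 0) = 0 := by
      rw [← zmod2_ne_zero, not_not] at hxj
      rcases hQj with h | h <;> rw [h.1] at hxj ⊢ <;> simpa using hxj
    have hl0 : x (Sum.inl l) = 0 ∧ x (Sum.inr 2) = 0 := by
      rw [← zmod2_ne_zero, not_not] at hxl
      rcases hQl with h | h <;> rw [h.1] at hxl ⊢ <;> simpa using hxl
    have hx' : ∀ w, w ≠ Sum.inl i → x w = 0 := by
      intro w hw
      by_cases h1 : w = Sum.inl j
      · rw [h1, hj0.1]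
      by_cases h2 : w = Sum.inl l
      · rw [h2, hl0.1]
      by_cases h3 : w = Sum.inr 0
      · rw [h3, hj0.2]
      by_cases h4 : w = Sum.inr 2
      · rw [h4, hl0.2]
      exact (hQ w ⟨hw, h1, h2, h3, h4⟩).1
    by_cases hxi : x (Sum.inl i) = 1
    · refine measAll_mem_errSpan _ _ (hquiet m₁ m₂ hm x z hzT i (by simp) ?_)
      rw [hdp, hj0.1, hj0.2, hl0.1, hl0.2]
      ext q
      by_cases h1 : q = l
      · subst h1; simp [hil.symm]
      · by_cases h2 : q = j
        · subst h2; simp [h1, hij.symm]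
        · by_cases h3 : q = i
          · subst h3; simpa [h1, h2, dataPart] using hxi
          · simpa [h1, h2, h3, dataPart] using hx' (Sum.inl q) (by simp [h3])
    have hx0 : x = 0 := by
      ext w
      by_cases h : w = Sum.inl i
      · rw [h]
        rwa [← zmod2_ne_zero, not_not] at hxi
      · exact hx' w h
    subst hx0
    have hcnot : ∀ g ∈ cczPost j l, g.IsCnot := by
      simp [cczPost, cnotDA, cnotAD, Gate.IsCnot]
    rw [applyGates_append, pauli_commute_diagonal (hdiag m₁ m₂ hm),
      applyGates_pauli_of_isCnot hcnot, ← applyGates_append, hpost m₁ m₂ hm]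
    have hz1 : z (Sum.inr 1) = 0 := (hQ _ (by simp)).2
    have hz3 : z (Sum.inr 3) = 0 := (hQ _ (by simp)).2
    have hv : ∀ q : Fin 4, (MBasis.X, q) ∈ cczFlags →
        pushZs (cczPost j l) z (Sum.inr q) = 1 →
        measAll cczFlags (zeros cczFlags.length) (pauli (pushXs (cczPost j l) 0)
          (pushZs (cczPost j l) z) (tensor d' χ)) ∈
            errSpan 4 (quietErr (({i, j, l} : Finset (Fin 15)) : Set (Fin 15))) d' := by
      intro q hq h
      rw [measAll_zeros_eq_zero hq ((((hχ _ hq).tensor d').pauli _ _).congr_val ?_)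
        cczFlags_nodup]
      · exact Submodule.zero_mem _
      · simpa [flipEntry] using h
    -- The CNOT from the inner flag to `j` carries a phase flip of `j` back to that flag, which is
    -- measured in the `X` basis.
    by_cases hzj : z (Sum.inr 0) + z (Sum.inl j) = 1
    · refine hv 0 (by simp [cczFlags]) ?_
      simpa [pushZs, cczPost, cnotDA, cnotAD, Gate.pushZ] using hzj
    by_cases hzl : z (Sum.inr 2) + z (Sum.inl l) = 1
    · refine hv 2 (by simp [cczFlags]) ?_
      simpa [pushZs, cczPost, cnotDA, cnotAD, Gate.pushZ] using hzl
    have hzj0 : z (Sum.inl j) = 0 := by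
      rw [← zmod2_ne_zero, not_not] at hzj
      rcases hQj with h | h
      · exact h.2
      · rwa [h.2, zero_add] at hzj
    have hzl0 : z (Sum.inl l) = 0 := by
      rw [← zmod2_ne_zero, not_not] at hzl
      rcases hQl with h | h
      · exact h.2
      · rwa [h.2, zero_add] at hzl
    refine measAll_mem_errSpan _ _ (pauli_mem_singleErr (fun p hp => Or.inl hp) (q := i) ?_ ?_ _ _)
    · intro q hq
      rw [hdp]
      by_cases h1 : q = l
      · subst h1; simp
      · by_cases h2 : q = j
        · subst h2; simp [h1]
        · simp [h1, h2, dataPart]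
    · intro q hq
      rw [Set.mem_singleton_iff] at hq
      by_cases h1 : q = l
      · subst h1
        simp [dataPart, pushZs, cczPost, cnotDA, cnotAD, Gate.pushZ, hzl0, hz3, hjl.symm]
      · by_cases h2 : q = j
        · subst h2
          simp [dataPart, pushZs, cczPost, cnotDA, cnotAD, Gate.pushZ, hzj0, hz1, hjl]
        · have := (hQ (Sum.inl q) (by simp [hq, h1, h2])).2
          simp [dataPart, pushZs, cczPost, cnotDA, cnotAD, Gate.pushZ, h1, h2, this]

/-- The argument of `cczGadget_fault` with a single flagged branch. The idle ancillas `2` and `3`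
form sets of their own, so that every ancilla wire is covered. -/
theorem czGadget_fault (hij : i ≠ j) {d d' : State (Fin 15)}
    (hd : d' = (Gate.cz i j).apply d) {χ : State (Fin 4)} (hχ : Prepared czFlags χ)
    {l₁ l₂ : List (Gate (Wire 4))} (hl : czGates i j = l₁ ++ l₂) {S : Set (Wire 4)}
    (hS : FaultSupport l₁ S) {x z : Wire 4 → ZMod 2} (hx : SuppIn S x) (hz : SuppIn S z)
    {o : Record} (ho : o.length = czFlags.length) :
    measAll czFlags o (applyGates l₂ (pauli x z (applyGates l₁ (tensor d χ)))) ∈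
      errSpan 4 (gadgetErr (({i, j} : Finset (Fin 15)) : Set (Fin 15)) (o = zeros 2)) d' := by
  have hall : applyGates (czGates i j) (tensor d χ) = tensor d' χ := by
    rw [applyGates_czGates hij, cz_tensor, hd]
  have hpost : ∀ m₁ m₂, czMid i j = m₁ ++ m₂ →
      applyGates (m₂ ++ czPost j) (applyGates (czPre j ++ m₁) (tensor d χ)) =
        tensor d' χ := by
    intro m₁ m₂ hm
    rw [← applyGates_append, ← hall, czGates, hm]
    simp
  have hclass : ∀ m₁ m₂, czMid i j = m₁ ++ m₂ → ∀ g ∈ m₂ ++ czPost j, g.IsClassical := by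
    intro m₁ m₂ hm g hg
    refine czGates_isClassical (i := i) (j := j) g ?_
    rw [czGates, hm]; simp at hg ⊢; tauto
  have hsupp : ∀ m₁ m₂, czMid i j = m₁ ++ m₂ → ∀ g ∈ m₂ ++ czPost j, g.support ⊆
      withAnc 4 (({i, j} : Finset (Fin 15)) : Set (Fin 15)) := by
    intro m₁ m₂ hm g hg
    refine czGates_support (i := i) (j := j) g ?_
    rw [czGates, hm]; simp at hg ⊢; tauto
  have hdiag : ∀ m₁ m₂, czMid i j = m₁ ++ m₂ → ∀ g ∈ m₂, g.IsDiagonal := by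
    intro m₁ m₂ hm g hg
    have : g ∈ czMid i j := by rw [hm]; simp [hg]
    simp only [czMid, List.mem_cons, List.not_mem_nil, or_false] at this
    rcases this with rfl | rfl <;> trivial
  have htrack : ∀ S ∈ ({branch j 0 1, {Sum.inl i}, {Sum.inr 2}, {Sum.inr 3}} : Set (Set (Wire 4))),
      ∀ g ∈ czPre j ++ czPost j, g.Tracks S := by
    rintro S hS g hg
    simp only [Set.mem_insert_iff, Set.mem_singleton_iff, czPre,
      czPost, List.cons_append, List.nil_append, List.mem_cons, List.not_mem_nil, or_false]
      at hS hg
    rcases hS with rfl | rfl | rfl | rfl <;>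
      rcases hg with rfl | rfl | rfl | rfl <;>
      first
      | (refine Or.inl ⟨_, _, _, rfl, ?_, ?_⟩ <;> simp [branch]; done)
      | (refine Or.inr ⟨trivial, ?_⟩
         simp [cnotDA, cnotAD, Gate.support, hij.symm])
  have hpush : ∀ m₁ m₂, czMid i j = m₁ ++ m₂ → ∀ x,
      pushXs (m₂ ++ czPost j) x = pushXs (czPost j) x := fun m₁ m₂ hm x => by
    rw [pushXs_append, pushXs_diagonal (hdiag m₁ m₂ hm)]
  have hquiet : ∀ m₁ m₂, czMid i j = m₁ ++ m₂ → ∀ x z,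
      SuppIn (withAnc 4 (({i, j} : Finset (Fin 15)) : Set (Fin 15))) z →
      ∀ q ∈ ({i, j} : Finset (Fin 15)), dataPart (pushXs (czPost j) x) = Pi.single q 1 →
      applyGates (m₂ ++ czPost j) (pauli x z
        (applyGates (czPre j ++ m₁) (tensor d χ))) ∈
          errSpan 4 (quietErr (({i, j} : Finset (Fin 15)) : Set (Fin 15))) d' := by
    intro m₁ m₂ hm x z hz q hq hx
    exact pauli_mem_quietErr (hclass m₁ m₂ hm) (hsupp m₁ m₂ hm) (hpost m₁ m₂ hm) hz hq
      (by rw [hpush m₁ m₂ hm]; exact hx)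
  have hdp : ∀ x : Wire 4 → ZMod 2, dataPart (pushXs (czPost j) x) =
      Function.update (dataPart x) j (x (Sum.inl j) + x (Sum.inr 0)) := by
    intro x
    ext q
    by_cases h2 : q = j
    · subst h2
      simp [pushXs, czPost, cnotDA, cnotAD, Gate.pushX, dataPart]
    · simp [pushXs, czPost, cnotDA, cnotAD, Gate.pushX, dataPart, h2]
  refine gadget_fault (ps := czFlags) czFlags_nodup
    (pre := czPre j) (mid := czMid i j) (post := czPost j)
    czGates_isClassical czGates_support hχ hall ?_
    (fam := {branch j 0 1, {Sum.inl i}, {Sum.inr 2}, {Sum.inr 3}}) htrack ?_ ?_ ?_ ?_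
    (Q := fun x z => (∀ w, (w ≠ Sum.inl i ∧ w ≠ Sum.inl j ∧ w ≠ Sum.inr 0) →
        x w = 0 ∧ z w = 0) ∧
      ((x (Sum.inl j) = 0 ∧ z (Sum.inl j) = 0) ∨ (x (Sum.inr 0) = 0 ∧ z (Sum.inr 0) = 0)))
    ?_ ?_ ?_ hl hS hx hz ho
  · have h1 : tensor d χ = (Gate.cz (Sum.inl i) (Sum.inl j)).apply (tensor d' χ) := by
      rw [cz_tensor, hd, cz_cz]
    rw [h1]
    exact applyGates_mem_localErr (gs := [.cz (Sum.inl i) (Sum.inl j)])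
      (by simp [Gate.IsClassical]) (by simp [Gate.support, withAnc, Set.insert_subset_iff])
      (tensor_mem_localErr _ _ _)
  · rintro S (rfl | rfl | rfl | rfl)
    exacts [⟨j, by simp [branch]⟩, ⟨i, by simp⟩, ⟨i, by simp⟩, ⟨i, by simp⟩]
  · rintro (q | q) hq
    · have := hq q rfl
      simp only [Finset.coe_insert, Finset.coe_singleton, Set.mem_insert_iff,
        Set.mem_singleton_iff] at this
      rcases this with rfl | rfl <;> simp [branch]
    · fin_cases q <;> simp [branch]
  · intro g hg
    simp only [czPre, czPost, List.cons_append, List.nil_append, List.mem_cons,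
      List.not_mem_nil, or_false] at hg
    refine ⟨branch j 0 1, by simp, ?_⟩
    rcases hg with rfl | rfl | rfl | rfl <;>
      simp [branch, cnotDA, cnotAD, Gate.support, Set.insert_subset_iff]
  · intro S hS x z hx hz
    have hzT : SuppIn (withAnc 4 (({i, j} : Finset (Fin 15)) : Set (Fin 15))) z := by
      refine suppIn_withAnc_of_forall fun q hq => hz _ fun hqS => hq ?_
      rcases hS with rfl | rfl | rfl | rfl <;> simp [branch] at hqS <;> simp [hqS]
    by_cases hc : x (Sum.inl i) = 0 ∧ x (Sum.inl j) + x (Sum.inr 0) = 0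
    · obtain ⟨h1, h2⟩ := hc
      obtain ⟨x', z', hx', hz', h⟩ := exists_pauli_of_tracks (gs := czPost j)
        (fun g hg => htrack S hS g (by simp [hg])) hx hz
      have hcomm : applyGates (czMid i j) (pauli x z (applyGates (czPre j) (tensor d χ))) =
          pauli x z (applyGates (czMid i j) (applyGates (czPre j) (tensor d χ))) := by
        ext y
        rw [applyGates_czMid]
        simp only [pauli]
        rw [applyGates_czMid]
        simp only [Pi.add_apply, h1, add_zero]
        rw [add_add_add_comm, h2, add_zero]
        ring
      have := hpost (czMid i j) [] (by simp)
      rw [List.nil_append, applyGates_append] at this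
      rw [applyGates_append, hcomm, h, this]
      have hq : ∃ q, ∀ i, Sum.inl i ∈ S → i = q := by
        rcases hS with rfl | rfl | rfl | rfl
        exacts [⟨j, by simp [branch]⟩, ⟨i, by simp⟩, ⟨i, by simp⟩, ⟨i, by simp⟩]
      obtain ⟨q, hq⟩ := hq
      exact pauli_mem_singleErr (fun p hp => Or.inl hp) (q := q)
        (fun i hi => hx' _ fun h => hi (hq i h)) (fun i hi => hz' _ fun h => hi (hq i h)) _ _
    · have := hquiet [] (czMid i j) (by simp) x z hzT
      rw [List.append_nil] at this
      rcases hS with rfl | rfl | rfl | rfl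
      · have e1 : x (Sum.inl i) = 0 := hx _ (by simp [branch, hij])
        refine this j (by simp) ?_
        rw [hdp]
        rw [e1] at hc
        have : x (Sum.inl j) + x (Sum.inr 0) = 1 := zmod2_ne_zero.1 fun h => hc ⟨rfl, h⟩
        rw [this]
        ext q
        by_cases h2 : q = j
        · subst h2; simp
        · simpa [h2, dataPart] using hx (Sum.inl q) (by simp [branch, h2])
      · have e : ∀ w, w ≠ Sum.inl i → x w = 0 := fun w hw => hx w hw
        have e1 := e (Sum.inl j) (by simp [hij.symm])
        have e3 := e (Sum.inr 0) (by simp)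
        refine this i (by simp) ?_
        rw [hdp, e1, e3]
        rw [e1, e3] at hc
        have : x (Sum.inl i) = 1 := zmod2_ne_zero.1 fun h => hc ⟨h, rfl⟩
        ext q
        by_cases h2 : q = j
        · subst h2; simp [hij.symm]
        · by_cases h3 : q = i
          · subst h3; simpa [h2, dataPart] using this
          · simpa [h2, h3, dataPart] using e (Sum.inl q) (by simp [h3])
      all_goals
        refine absurd ⟨hx _ ?_, ?_⟩ hc
        · simp
        · rw [hx (Sum.inl j) (by simp), hx (Sum.inr 0) (by simp), add_zero]
  · intro g hg x z hx hz
    simp only [czMid, List.mem_cons, List.not_mem_nil, or_false] at hg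
    have key : ∀ w, w ∉ g.support → x w = 0 ∧ z w = 0 := fun w hw => ⟨hx w hw, hz w hw⟩
    rcases hg with rfl | rfl <;>
      refine ⟨fun w hw => key w ?_, ?_⟩ <;>
      first
      | (simp [Gate.support]; tauto)
      | (refine Or.inl (key _ ?_)
         simp [Gate.support, hij.symm]; done)
      | (refine Or.inr (key _ ?_)
         simp [Gate.support])
  · rintro w hw
    by_cases h1 : (∃ q, w = Sum.inl q) ∨ w = Sum.inr 0
    · left
      intro x z hx hz
      have key : ∀ w', w' ≠ w → x w' = 0 ∧ z w' = 0 := fun w' h => ⟨hx w' h, hz w' h⟩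
      refine ⟨fun w' h => key w' ?_, ?_⟩
      · rintro rfl
        rcases h1 with ⟨q, rfl⟩ | rfl
        · have := hw q rfl
          simp at this h
          tauto
        · simp at h
      · by_cases h : Sum.inl j = w
        · exact Or.inr (key _ (by rw [← h]; simp))
        · exact Or.inl (key _ h)
    · right
      intro g hg
      push Not at h1
      simp only [czMid, List.mem_cons, List.not_mem_nil, or_false] at hg
      rcases hg with rfl | rfl <;> simp [Gate.support, h1]
  · rintro m₁ m₂ hm x z ⟨hQ, hQj⟩
    have hzT : SuppIn (withAnc 4 (({i, j} : Finset (Fin 15)) : Set (Fin 15))) z := by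
      refine suppIn_withAnc_of_forall fun q hq => (hQ _ ?_).2
      simp at hq
      simpa using hq
    have hx1 : x (Sum.inr 1) = 0 := (hQ _ (by simp)).1
    by_cases hxj : x (Sum.inl j) + x (Sum.inr 0) = 1
    · rw [measAll_pauli_eq_zero czFlags_nodup hχ (hclass m₁ m₂ hm) (hsupp m₁ m₂ hm)
        (hpost m₁ m₂ hm) hzT (q := 1) (by simp [czFlags])]
      · exact Submodule.zero_mem _
      · rw [hpush m₁ m₂ hm]
        simpa [pushXs, czPost, cnotDA, cnotAD, Gate.pushX, hx1] using hxj
    have hj0 : x (Sum.inl j) = 0 ∧ x (Sum.inr 0) = 0 := by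
      rw [← zmod2_ne_zero, not_not] at hxj
      rcases hQj with h | h <;> rw [h.1] at hxj ⊢ <;> simpa using hxj
    have hx' : ∀ w, w ≠ Sum.inl i → x w = 0 := by
      intro w hw
      by_cases h1 : w = Sum.inl j
      · rw [h1, hj0.1]
      by_cases h3 : w = Sum.inr 0
      · rw [h3, hj0.2]
      exact (hQ w ⟨hw, h1, h3⟩).1
    by_cases hxi : x (Sum.inl i) = 1
    · refine measAll_mem_errSpan _ _ (hquiet m₁ m₂ hm x z hzT i (by simp) ?_)
      rw [hdp, hj0.1, hj0.2]
      ext q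
      by_cases h2 : q = j
      · subst h2; simp [hij.symm]
      · by_cases h3 : q = i
        · subst h3; simpa [h2, dataPart] using hxi
        · simpa [h2, h3, dataPart] using hx' (Sum.inl q) (by simp [h3])
    have hx0 : x = 0 := by
      ext w
      by_cases h : w = Sum.inl i
      · rw [h]
        rwa [← zmod2_ne_zero, not_not] at hxi
      · exact hx' w h
    subst hx0
    have hcnot : ∀ g ∈ czPost j, g.IsCnot := by
      simp [czPost, cnotDA, cnotAD, Gate.IsCnot]
    rw [applyGates_append, pauli_commute_diagonal (hdiag m₁ m₂ hm),
      applyGates_pauli_of_isCnot hcnot, ← applyGates_append, hpost m₁ m₂ hm]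
    have hz1 : z (Sum.inr 1) = 0 := (hQ _ (by simp)).2
    by_cases hzj : z (Sum.inr 0) + z (Sum.inl j) = 1
    · rw [measAll_zeros_eq_zero (q := (MBasis.X, 0)) (by simp [czFlags])
        ((((hχ (MBasis.X, 0) (by simp [czFlags])).tensor d').pauli _ _).congr_val ?_)
        czFlags_nodup]
      · exact Submodule.zero_mem _
      · simpa [flipEntry, pushZs, czPost, cnotDA, cnotAD, Gate.pushZ] using hzj
    have hzj0 : z (Sum.inl j) = 0 := by
      rw [← zmod2_ne_zero, not_not] at hzj
      rcases hQj with h | h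
      · exact h.2
      · rwa [h.2, zero_add] at hzj
    refine measAll_mem_errSpan _ _ (pauli_mem_singleErr (fun p hp => Or.inl hp) (q := i) ?_ ?_ _ _)
    · intro q hq
      rw [hdp]
      by_cases h2 : q = j
      · subst h2; simp
      · simp [h2, dataPart]
    · intro q hq
      rw [Set.mem_singleton_iff] at hq
      by_cases h2 : q = j
      · subst h2
        simp [dataPart, pushZs, czPost, cnotDA, cnotAD, Gate.pushZ, hzj0, hz1]
      · have := (hQ (Sum.inl q) (by simp [hq, h2])).2
        simp [dataPart, pushZs, czPost, cnotDA, cnotAD, Gate.pushZ, h2, this]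

end Gadgets

/-! ### Collecting a parity in an ancilla qubit -/

section Collect

/-- The qubits other than the syndrome qubit. -/
abbrev Source := {w : Wire 4 // w ≠ Sum.inr 0}

/-- CNOT gates onto the syndrome qubit. -/
def collect (l : List Source) : List (Gate (Wire 4)) := l.map fun w => .cnot w.1 (Sum.inr 0) w.2

/-- How often each wire occurs in the list, modulo two. -/
def occurrences (l : List Source) : Wire 4 → ZMod 2 := (l.map fun w => Pi.single w.1 1).sum

theorem occurrences_cons (w : Source) (l : List Source) :
    occurrences (w :: l) = Pi.single w.1 1 + occurrences l := rfl

theorem occurrences_syndrome (l : List Source) : occurrences l (Sum.inr 0) = 0 := by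
  induction l with
  | nil => rfl
  | cons w l ih =>
    rw [occurrences_cons, Pi.add_apply, ih, add_zero, Pi.single_eq_of_ne w.2.symm]

theorem applyGates_collect (l : List Source) (ψ : State (Wire 4)) (y : Wire 4 → ZMod 2) :
    applyGates (collect l) ψ y =
      ψ (Function.update y (Sum.inr 0) (y (Sum.inr 0) + occurrences l ⬝ᵥ y)) := by
  induction l generalizing ψ with
  | nil => simp [collect, occurrences]
  | cons w l ih =>
    have : applyGates (collect (w :: l)) ψ =
      applyGates (collect l) ((Gate.cnot w.1 (Sum.inr 0) w.2).apply ψ) := rfl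
    rw [this, ih, occurrences_cons, add_dotProduct]
    simp only [Gate.apply, Function.update_idem, Function.update_self, Function.update_of_ne w.2,
      single_dotProduct, one_mul]
    have key : ∀ a b c : ZMod 2, a + b + c = a + (c + b) := by decide
    rw [key]

/-- A phase flip of the common target spreads to all sources still to be coupled. The resulting bit
flip of the syndrome qubit plays no role, so it is left unspecified. -/
theorem applyGates_collect_pauli (l : List Source) (x z : Wire 4 → ZMod 2) (ψ : State (Wire 4)) :
    ∃ b : ZMod 2, applyGates (collect l) (pauli x z ψ) = pauli (Function.update x (Sum.inr 0) b)
      (z + z (Sum.inr 0) • occurrences l) (applyGates (collect l) ψ) := by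
  induction l generalizing x z ψ with
  | nil => exact ⟨x (Sum.inr 0), by simp [collect, occurrences]⟩
  | cons w l ih =>
    have e : ∀ ψ, applyGates (collect (w :: l)) ψ =
      applyGates (collect l) ((Gate.cnot w.1 (Sum.inr 0) w.2).apply ψ) := fun _ => rfl
    rw [e, e, pauli_cnot]
    obtain ⟨b, hb⟩ := ih (Function.update x (Sum.inr 0) (x (Sum.inr 0) + x w.1))
      (Function.update z w.1 (z w.1 + z (Sum.inr 0))) ((Gate.cnot w.1 (Sum.inr 0) w.2).apply ψ)
    refine ⟨b, ?_⟩
    rw [hb, Function.update_idem, Function.update_of_ne w.2.symm, occurrences_cons, smul_add,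
      ← add_assoc]
    congr 2
    ext v
    by_cases h : v = w.1
    · subst h; simp
    · simp [h]

/-- A data qubit as a source. -/
def dataSource (q : Fin 15) : Source := ⟨Sum.inl q, Sum.inl_ne_inr⟩

/-- The flag qubit as a source. -/
def flagSource : Source := ⟨Sum.inr 1, by decide⟩

/-- The sources of `flaggedSyndrome`. -/
def flaggedSources (r : Fin 4) : List Source :=
  [dataSource (zOrder r 0), flagSource, dataSource (zOrder r 1), dataSource (zOrder r 2),
    dataSource (zOrder r 3), dataSource (zOrder r 4), dataSource (zOrder r 5),
    dataSource (zOrder r 6), flagSource, dataSource (zOrder r 7)]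

/-- The sources of `unflaggedSyndrome`. -/
def plainSources (r : Fin 4) : List Source := (List.finRange 8).map fun n => dataSource (zOrder r n)

/-- The last qubits of a check, from number `n` on. -/
def suffixString (r : Fin 4) (n : ℕ) : Fin 15 → ZMod 2 :=
  (((List.finRange 8).drop n).map fun m => Pi.single (zOrder r m) 1).sum

theorem suffixString_zero (r : Fin 4) : suffixString r 0 = parityCheck r := by
  have : ∀ (r : Fin 4) (q : Fin 15), suffixString r 0 q + parityCheck r q = 0 := by
    decide +kernel
  exact eq_of_add_eq_zero (funext (this r))

theorem suffixString_eight (r : Fin 4) : suffixString r 8 = 0 := rfl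

theorem suffixString_eq (r : Fin 4) (n : Fin 8) :
    suffixString r n = Pi.single (zOrder r n) 1 + suffixString r (n + 1) := by
  fin_cases n <;> rfl

theorem dataPart_single_inl {k : ℕ} (q : Fin 15) (b : ZMod 2) :
    dataPart (Pi.single (Sum.inl q) b : Wire k → ZMod 2) = Pi.single q b := by
  ext i; simp [dataPart, Pi.single_apply]

theorem dataPart_single_inr {k : ℕ} (q : Fin k) (b : ZMod 2) :
    dataPart (Pi.single (Sum.inr q) b : Wire k → ZMod 2) = 0 := by
  ext i; simp [dataPart]

theorem dataPart_add {k : ℕ} (x y : Wire k → ZMod 2) :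
    dataPart (x + y) = dataPart x + dataPart y := rfl

theorem dataPart_smul {k : ℕ} (b : ZMod 2) (x : Wire k → ZMod 2) :
    dataPart (b • x) = b • dataPart x := rfl

theorem dataPart_occurrences_data (q : Fin 15) (l : List Source) :
    dataPart (occurrences (dataSource q :: l)) = Pi.single q 1 + dataPart (occurrences l) := by
  rw [occurrences_cons, dataPart_add]
  exact congrArg (· + _) (dataPart_single_inl q 1)

theorem dataPart_occurrences_flag (l : List Source) :
    dataPart (occurrences (flagSource :: l)) = dataPart (occurrences l) := by
  rw [occurrences_cons, dataPart_add]
  exact (congrArg (· + _) (dataPart_single_inr 1 1)).trans (zero_add _)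

theorem dotProduct_of_inr {k : ℕ} {x : Wire k → ZMod 2} (h : ∀ q, x (Sum.inr q) = 0)
    (y : Wire k → ZMod 2) : x ⬝ᵥ y = dataPart x ⬝ᵥ dataPart y := by
  simp [dotProduct, Fintype.sum_sum_type, h, dataPart]

theorem occurrences_inr (l : List Source) (h : ∀ w ∈ l, ∃ q, w = dataSource q) (q : Fin 4) :
    occurrences l (Sum.inr q) = 0 := by
  induction l with
  | nil => rfl
  | cons w l ih =>
    obtain ⟨q', rfl⟩ := h w (by simp)
    rw [occurrences_cons, Pi.add_apply, ih fun w hw => h w (by simp [hw])]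
    simp [dataSource]

theorem occurrences_plain (r : Fin 4) (y : Wire 4 → ZMod 2) :
    occurrences (plainSources r) ⬝ᵥ y = synd (dataPart y) r := by
  rw [dotProduct_of_inr]
  · change _ = parityCheck r ⬝ᵥ dataPart y
    rw [← suffixString_zero]
    congr 1
    have : ∀ l : List (Fin 8), dataPart (occurrences (l.map fun n => dataSource (zOrder r n))) =
        (l.map fun m => Pi.single (zOrder r m) 1).sum := by
      intro l
      induction l with
      | nil => rfl
      | cons n l ih => rw [List.map_cons, dataPart_occurrences_data, ih]; rfl
    exact this _
  · refine occurrences_inr _ fun w hw => ?_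
    obtain ⟨n, -, rfl⟩ := List.mem_map.1 hw
    exact ⟨_, rfl⟩

theorem occurrences_flagged (r : Fin 4) (y : Wire 4 → ZMod 2) :
    occurrences (flaggedSources r) ⬝ᵥ y = synd (dataPart y) r := by
  rw [dotProduct_of_inr]
  · simp only [flaggedSources, dataPart_occurrences_data, dataPart_occurrences_flag]
    change _ = parityCheck r ⬝ᵥ dataPart y
    rw [← suffixString_zero]
    rfl
  · intro q
    fin_cases q
    · exact occurrences_syndrome _
    · simp [flaggedSources, occurrences, dataSource, flagSource, zmod2_add_self]
    · simp [flaggedSources, occurrences, dataSource, flagSource]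
    · simp [flaggedSources, occurrences, dataSource, flagSource]

/-- The data have the value `b` of the check `r`. -/
def HasCheck (r : Fin 4) (b : ZMod 2) (D : State (Fin 15)) : Prop :=
  ∀ y, D y ≠ 0 → synd y r = b

theorem InCode.hasCheck {d : State (Fin 15)} (hd : InCode d) (a c : Fin 15 → ZMod 2) (r : Fin 4) :
    HasCheck r (synd a r) (pauli a c d) := by
  intro y hy
  have h := congrFun (hd (y + a) fun h => hy (by simp [pauli, h])) r
  rw [synd_add] at h
  exact congrFun (eq_of_add_eq_zero (x := synd y) (y := synd a)
    (by rw [← synd_add]; exact hd (y + a) fun h => hy (by simp [pauli, h]))) r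

theorem applyGates_collect_tensor {l : List Source} {r : Fin 4} {b : ZMod 2}
    (hl : ∀ y, occurrences l ⬝ᵥ y = synd (dataPart y) r) {D : State (Fin 15)}
    (hD : HasCheck r b D) (χ : State (Fin 4)) :
    applyGates (collect l) (tensor D χ) = tensor D (pauli (Pi.single 0 b) 0 χ) := by
  ext y
  rw [applyGates_collect, hl, tensor_eq, tensor_eq, dataPart_update, ancPart_update]
  by_cases h : D (dataPart y) = 0
  · rw [h, zero_mul, zero_mul]
  · rw [hD _ h]
    congr 1
    simp only [pauli, zero_dotProduct, sgn_zero, one_mul]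
    congr 1
    ext q
    by_cases hq : q = 0
    · subst hq; simp [ancPart]
    · simp [hq]

/-- The qubits of `flaggedSyndrome`. -/
def syndromeFlags : List (MBasis × Fin 4) := [(.Z, 0), (.X, 1)]

theorem syndromeFlags_nodup : (syndromeFlags.map Prod.snd).Nodup := by decide

theorem flaggedSyndrome_eq (r : Fin 4) (k : ZMod 2 → ZMod 2 → Record → Protocol 4)
    (rec : Record) : flaggedSyndrome r k rec =
      block syndromeFlags (collect (flaggedSources r)) fun o =>
        k (o.getD 0 0) (o.getD 1 0) (rec ++ o) := rfl

theorem unflaggedSyndrome_eq (r : Fin 4) (k : Record → Protocol 4) (rec : Record) :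
    unflaggedSyndrome r k rec =
      block [(.Z, 0)] (collect (plainSources r)) fun o => k (rec ++ o) := by
  rw [unflaggedSyndrome, withMeas_eq, collect, plainSources, List.map_map]
  rfl

theorem implements_flagged {r : Fin 4} {b : ZMod 2} {D : State (Fin 15)} (hD : HasCheck r b D) :
    Implements syndromeFlags (collect (flaggedSources r))
      (fun q => if q.2 = 0 then b else 0) D D := by
  intro χ hχ
  refine ⟨_, applyGates_collect_tensor (occurrences_flagged r) hD χ, fun q hq => ?_⟩
  refine ((hχ q hq).pauli _ _).congr_val ?_
  simp only [syndromeFlags, List.mem_cons, List.not_mem_nil, or_false] at hq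
  rcases hq with rfl | rfl <;> simp [flipEntry]

theorem implements_unflagged {r : Fin 4} {b : ZMod 2} {D : State (Fin 15)}
    (hD : HasCheck r b D) :
    Implements [(.Z, 0)] (collect (plainSources r)) (fun _ => b) D D := by
  intro χ hχ
  refine ⟨_, applyGates_collect_tensor (occurrences_plain r) hD χ, fun q hq => ?_⟩
  refine ((hχ q hq).pauli _ _).congr_val ?_
  simp only [List.mem_cons, List.not_mem_nil, or_false] at hq
  rcases hq with rfl
  simp [flipEntry]

/-- A `Z` stabilizer only contributes a sign, so the phase string of an error may be completed by a
check before it is classified. -/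
theorem tensor_mem_errSpan_row {k : ℕ} {A : ErrorSet} {d : State (Fin 15)} (hd : InCode d)
    {a c : Fin 15 → ZMod 2} (r : Fin 4) (h : (a, c + parityCheck r) ∈ A) (χ : State (Fin k)) :
    tensor (pauli a c d) χ ∈ errSpan k A d := by
  have e : parityCheck r = Pi.single r 1 ᵥ* parityCheck := by simp [Matrix.row]
  have h1 := tensor_mem_errSpan (d := d) h χ
  rw [e, pauli_add_row hd, smul_tensor] at h1
  have h2 := Submodule.smul_mem _ (sgn (Pi.single r 1 ⬝ᵥ synd a)) h1
  rwa [smul_smul, sgn_mul_self, one_smul] at h2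

/-- The single-qubit strings. -/
def singles : Set (Fin 15 → ZMod 2) := {c | ∃ q b, c = Pi.single q b}

/-- The errors that a phase flip of the syndrome qubit leaves behind when the flag is raised. -/
def suffixes (r : Fin 4) : Set (Fin 15 → ZMod 2) := {c | ∃ n : Fin 8, c = suffixString r (n + 1)}

/-- The errors that a fault in `flaggedSyndrome` leaves behind, depending on the flag. -/
def flagErr (r : Fin 4) (f : ZMod 2) : ErrorSet :=
  {p | (f = 1 → p.1 ∈ singles ∧ p.2 ∈ suffixes r) ∧ (f = 0 → p ∈ singleErr)}

/-- Faults on at most one data qubit that does not affect the syndrome qubit's phase. -/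
theorem mem_flagErr {r : Fin 4} {f : ZMod 2} {q : Fin 15} {b c : ZMod 2}
    (h : f = 0 ∨ (b = 0 ∧ c = 0)) :
    ((Pi.single q b, Pi.single q c) : (Fin 15 → ZMod 2) × (Fin 15 → ZMod 2)) ∈ flagErr r f := by
  refine ⟨fun hf => ?_, fun _ => ⟨q, b, c, rfl, rfl⟩⟩
  rcases h with h | ⟨rfl, rfl⟩
  · exact absurd (h.symm.trans hf) (by decide)
  · exact ⟨⟨q, 0, rfl⟩, 7, by simp [suffixString_eight]⟩

theorem dataSource_injective {q q' : Fin 15} (h : dataSource q = dataSource q') : q = q' :=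
  Sum.inl_injective (congrArg Subtype.val h)

theorem dataSource_ne_flagSource (q : Fin 15) : dataSource q ≠ flagSource := fun h => by
  have := congrArg Subtype.val h
  simp [dataSource, flagSource] at this

/-- A phase flip of the syndrome qubit spreads to the sources `m₂` that follow. The flag is coupled
after the first and before the last data qubit, so it registers exactly when an odd number of its
two couplings remains. With the flag silent, the remaining data qubits are all, all but one, one or
none of the check, which is a single-qubit error modulo the check. The numbers `b`, `c`, `t`
describe what a faulty CNOT adds on its source. -/
theorem flagged_residual {d : State (Fin 15)} (hd : InCode d) (r : Fin 4) {m₁ m₂ : List Source}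
    (hm : flaggedSources r = m₁ ++ m₂) {q : Fin 15} {b c t : ZMod 2}
    (h : (b = 0 ∧ c = 0 ∧ t = 0) ∨ (m₁.getLast? = some (dataSource q) ∧ t = 0) ∨
      (m₁.getLast? = some flagSource ∧ b = 0 ∧ c = 0)) (χ : State (Fin 4)) :
    tensor (pauli (Pi.single q b) (Pi.single q c + dataPart (occurrences m₂)) d) χ ∈
      errSpan 4 (flagErr r (t + occurrences m₂ (Sum.inr 1))) d := by
  have hlen : m₁.length ≤ 10 := by
    have := congrArg List.length hm
    simp [flaggedSources] at this
    omega
  obtain ⟨h1, h2⟩ : m₁ = (flaggedSources r).take m₁.length ∧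
      m₂ = (flaggedSources r).drop m₁.length := by rw [hm]; simp
  generalize m₁.length = k at h1 h2 hlen
  have hs := suffixString_eq r
  have one : ∀ {x : Fin 15 → ZMod 2}, x + x = 0 := string_add_self _
  -- the residual error when the flag is raised
  have raised : ∀ (q : Fin 15) (b : ZMod 2) (s : Fin 15 → ZMod 2) (n : Fin 8),
      s = suffixString r (n + 1) → tensor (pauli (Pi.single q b) s d) χ ∈
        errSpan 4 (flagErr r 1) d := by
    rintro q b s n rfl
    exact tensor_mem_errSpan (A := flagErr r 1)
      ⟨fun _ => ⟨⟨q, b, rfl⟩, n, rfl⟩, fun h => absurd h (by decide)⟩ χ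
  have quiet : ∀ (q : Fin 15) (b c : ZMod 2) (s : Fin 15 → ZMod 2),
      (s = Pi.single q c ∨ s + parityCheck r = Pi.single q c) →
      tensor (pauli (Pi.single q b) s d) χ ∈ errSpan 4 (flagErr r 0) d := by
    rintro q b c s (rfl | hs)
    · exact tensor_mem_errSpan (mem_flagErr (Or.inl rfl)) χ
    · refine tensor_mem_errSpan_row hd r ?_ χ
      rw [hs]
      exact mem_flagErr (Or.inl rfl)
  have hdata : ∀ q', m₁.getLast? = some (dataSource q') → t = 0 ∧
      (Pi.single q b : Fin 15 → ZMod 2) = Pi.single q' b ∧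
      (Pi.single q c : Fin 15 → ZMod 2) = Pi.single q' c := by
    intro q' hq'
    rcases h with ⟨rfl, rfl, rfl⟩ | ⟨h, rfl⟩ | ⟨h, rfl, rfl⟩
    · simp
    · rw [hq', Option.some_inj] at h
      rw [dataSource_injective h]
      exact ⟨rfl, rfl, rfl⟩
    · rw [hq', Option.some_inj] at h
      exact absurd h (dataSource_ne_flagSource _)
  have hflag : m₁.getLast? = some flagSource → b = 0 ∧ c = 0 := by
    intro hq'
    rcases h with ⟨rfl, rfl, rfl⟩ | ⟨h, rfl⟩ | ⟨h, rfl, rfl⟩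
    · exact ⟨rfl, rfl⟩
    · rw [hq', Option.some_inj] at h
      exact absurd h.symm (dataSource_ne_flagSource _)
    · exact ⟨rfl, rfl⟩
  have hc01 : c = 0 ∨ c = 1 := zmod2_cases c
  have ht01 : t = 0 ∨ t = 1 := zmod2_cases t
  -- coupling of a data qubit while the flag is on
  have inner : ∀ n : Fin 8, n ≠ 0 → m₁.getLast? = some (dataSource (zOrder r n)) →
      dataPart (occurrences m₂) = suffixString r (n + 1) → occurrences m₂ (Sum.inr 1) = 1 →
      tensor (pauli (Pi.single q b) (Pi.single q c + dataPart (occurrences m₂)) d) χ ∈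
        errSpan 4 (flagErr r (t + occurrences m₂ (Sum.inr 1))) d := by
    intro n hn hlast e1 e2
    obtain ⟨rfl, hb, hc⟩ := hdata _ hlast
    rw [e1, e2, hb, hc, zero_add]
    rcases hc01 with rfl | rfl
    · exact raised _ _ _ n (by simp)
    -- A `Z` on the qubit just coupled extends the suffix to the left by one qubit, so the result is
    -- again a suffix. This needs `n ≠ 0`.
    · rw [← hs]
      refine raised _ _ _ (n - 1) ?_
      congr 1
      rw [Fin.val_sub_one_of_ne_zero hn]
      have : (n : ℕ) ≠ 0 := fun h => hn (Fin.ext h)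
      omega
  -- `k` counts the CNOTs before the fault: `2` and `9` lie right behind the two flag couplings, and
  -- for `3` to `8` the flag is coupled in.
  interval_cases k <;> simp only [flaggedSources, List.take_succ_cons, List.take_zero,
    List.drop_succ_cons, List.drop_zero] at h1 h2
  · rcases h with ⟨rfl, rfl, rfl⟩ | ⟨h, -⟩ | ⟨h, -⟩
    · have e1 : dataPart (occurrences m₂) = parityCheck r := by
        rw [h2]
        simp only [dataPart_occurrences_data, dataPart_occurrences_flag]
        rw [← suffixString_zero]; rfl
      have e2 : occurrences m₂ (Sum.inr 1) = 0 := by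
        rw [h2]; simp [occurrences, dataSource, flagSource, zmod2_add_self]
      rw [e1, e2]
      exact quiet q 0 0 _ (Or.inr (by rw [add_assoc, one, add_zero]))
    · simp [h1] at h
    · simp [h1] at h
  · obtain ⟨rfl, hb, hc⟩ := hdata (zOrder r 0) (by rw [h1]; rfl)
    have e1 : dataPart (occurrences m₂) = suffixString r 1 := by
      rw [h2]
      simp only [dataPart_occurrences_data, dataPart_occurrences_flag]
      rfl
    have e2 : occurrences m₂ (Sum.inr 1) = 0 := by
      rw [h2]; simp [occurrences, dataSource, flagSource, zmod2_add_self]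
    rw [e1, e2, hb, hc]
    refine quiet _ _ (c + 1) _ (Or.inr ?_)
    have := hs 0
    simp only [Fin.val_zero, zero_add] at this
    rw [← suffixString_zero, this, Pi.single_add, add_assoc, add_left_comm (suffixString r 1), one,
      add_zero]
  · obtain ⟨rfl, rfl⟩ := hflag (by rw [h1]; rfl)
    have e1 : dataPart (occurrences m₂) = suffixString r 1 := by
      rw [h2]
      simp only [dataPart_occurrences_data, dataPart_occurrences_flag]
      rfl
    have e2 : occurrences m₂ (Sum.inr 1) = 1 := by
      rw [h2]; simp [occurrences, dataSource, flagSource]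
    rw [e1, e2, Pi.single_zero, zero_add]
    rcases ht01 with rfl | rfl
    · rw [zero_add, ← Pi.single_zero q]
      exact raised _ _ _ 0 rfl
    · rw [zmod2_add_self, ← Pi.single_zero (zOrder r 0)]
      refine quiet _ _ 1 _ (Or.inr ?_)
      have := hs 0
      simp only [Fin.val_zero, zero_add] at this
      rw [← suffixString_zero, this, add_left_comm, one, add_zero]
  · exact inner 1 (by decide) (by rw [h1]; rfl)
      (by rw [h2]; simp only [dataPart_occurrences_data, dataPart_occurrences_flag]; rfl)
      (by rw [h2]; simp [occurrences, dataSource, flagSource])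
  · exact inner 2 (by decide) (by rw [h1]; rfl)
      (by rw [h2]; simp only [dataPart_occurrences_data, dataPart_occurrences_flag]; rfl)
      (by rw [h2]; simp [occurrences, dataSource, flagSource])
  · exact inner 3 (by decide) (by rw [h1]; rfl)
      (by rw [h2]; simp only [dataPart_occurrences_data, dataPart_occurrences_flag]; rfl)
      (by rw [h2]; simp [occurrences, dataSource, flagSource])
  · exact inner 4 (by decide) (by rw [h1]; rfl)
      (by rw [h2]; simp only [dataPart_occurrences_data, dataPart_occurrences_flag]; rfl)
      (by rw [h2]; simp [occurrences, dataSource, flagSource])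
  · exact inner 5 (by decide) (by rw [h1]; rfl)
      (by rw [h2]; simp only [dataPart_occurrences_data, dataPart_occurrences_flag]; rfl)
      (by rw [h2]; simp [occurrences, dataSource, flagSource])
  · exact inner 6 (by decide) (by rw [h1]; rfl)
      (by rw [h2]; simp only [dataPart_occurrences_data, dataPart_occurrences_flag]; rfl)
      (by rw [h2]; simp [occurrences, dataSource, flagSource])
  · obtain ⟨rfl, rfl⟩ := hflag (by rw [h1]; rfl)
    have e1 : dataPart (occurrences m₂) = suffixString r 7 := by
      rw [h2]
      simp only [dataPart_occurrences_data]
      rfl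
    have e2 : occurrences m₂ (Sum.inr 1) = 0 := by
      rw [h2]; simp [occurrences, dataSource]
    rw [e1, e2, Pi.single_zero, zero_add, add_zero]
    rcases ht01 with rfl | rfl
    · rw [← Pi.single_zero (zOrder r 7)]
      exact quiet _ _ 1 _ (Or.inl ((hs 7).trans (add_zero _)))
    · rw [← Pi.single_zero q]
      exact raised _ _ _ 6 rfl
  · obtain ⟨rfl, hb, hc⟩ := hdata (zOrder r 7) (by rw [h1]; rfl)
    have e1 : dataPart (occurrences m₂) = 0 := by rw [h2]; rfl
    have e2 : occurrences m₂ (Sum.inr 1) = 0 := by rw [h2]; rfl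
    rw [e1, e2, add_zero, hb, hc]
    exact quiet _ _ c _ (Or.inl (add_zero _))

/-- Without a phase flip on the syndrome qubit only the source wire of the faulty gate is affected.
With one, `flagged_residual` describes how it spreads. -/
theorem flagged_fault {d : State (Fin 15)} (hd : InCode d) {r : Fin 4} {χ : State (Fin 4)}
    (hχ : Prepared syndromeFlags χ) {l₁ l₂ : List (Gate (Wire 4))}
    (hl : collect (flaggedSources r) = l₁ ++ l₂) {S : Set (Wire 4)} (hS : FaultSupport l₁ S)
    {x z : Wire 4 → ZMod 2} (hx : SuppIn S x) (hz : SuppIn S z) {o : Record}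
    (ho : o.length = syndromeFlags.length) :
    measAll syndromeFlags o (applyGates l₂ (pauli x z (applyGates l₁ (tensor d χ)))) ∈
      errSpan 4 (flagErr r (o.getD 1 0)) d := by
  obtain ⟨m₁, m₂, hm, rfl, rfl⟩ := List.map_eq_append_iff.1 hl
  obtain ⟨b, hb⟩ := applyGates_collect_pauli m₂ x z (applyGates (collect m₁) (tensor d χ))
  change measAll syndromeFlags o (applyGates (collect m₂)
    (pauli x z (applyGates (collect m₁) (tensor d χ)))) ∈ _
  have hchk : HasCheck r 0 d := fun y hy => by rw [hd y hy]; rfl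
  have hall : applyGates (collect m₂) (applyGates (collect m₁) (tensor d χ)) = tensor d χ := by
    rw [← applyGates_append, collect, collect, ← List.map_append, ← hm]
    have := applyGates_collect_tensor (occurrences_flagged r) hchk χ
    rwa [Pi.single_zero, pauli_zero_zero] at this
  rw [hb, hall]
  -- The flag is measured in the `X` basis, and its value is determined by the phase flips that
  -- reach it; the other outcome gives the zero state.
  by_cases hf : o.getD 1 0 = z (Sum.inr 1) + z (Sum.inr 0) * occurrences m₂ (Sum.inr 1)
  swap
  · rw [measAll_eq_zero (q := (MBasis.X, 1)) (b := o.getD 1 0)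
      (v := z (Sum.inr 1) + z (Sum.inr 0) * occurrences m₂ (Sum.inr 1)) ?_ ?_ hf
      syndromeFlags_nodup]
    · exact Submodule.zero_mem _
    · obtain ⟨b, f, rfl⟩ := List.length_eq_two.1 ho
      simp [syndromeFlags]
    · exact (((hχ (MBasis.X, 1) (by simp [syndromeFlags])).tensor d).pauli _ _).congr_val
        (by simp [flipEntry])
  rw [hf]
  refine measAll_mem_errSpan _ _ ?_
  rw [pauli_tensor]
  have hxd : dataPart (Function.update x (Sum.inr 0) b) = dataPart x := dataPart_update _ _ _
  rw [hxd, dataPart_add, dataPart_smul]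
  have hsup : (∃ w, S = {w}) ∨ ∃ m' w, m₁ = m' ++ [w] ∧ S = {w.1, Sum.inr 0} := by
    rcases hS with h | ⟨l', g, h, rfl⟩
    · exact Or.inl h
    · obtain ⟨m', n', rfl, -, hn⟩ := List.map_eq_append_iff.1 h
      obtain ⟨w, rfl, rfl⟩ := List.map_eq_singleton_iff.1 hn
      exact Or.inr ⟨m', w, rfl, rfl⟩
  have hsingle : ∀ {y : Wire 4 → ZMod 2} {q : Fin 15}, (∀ i, i ≠ q → y (Sum.inl i) = 0) →
      dataPart y = Pi.single q (y (Sum.inl q)) := by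
    intro y q h
    ext i
    by_cases hi : i = q
    · subst hi; simp [dataPart]
    · simp [dataPart, hi, h i hi]
  rcases zmod2_cases (z (Sum.inr 0)) with hz0 | hz0
  · rw [hz0, zero_smul, add_zero, zero_mul, add_zero]
    have key : ∃ q, (∀ i, i ≠ q → x (Sum.inl i) = 0) ∧ (∀ i, i ≠ q → z (Sum.inl i) = 0) ∧
        (z (Sum.inr 1) = 0 ∨ (x (Sum.inl q) = 0 ∧ z (Sum.inl q) = 0)) := by
      have hne : ∀ w ∈ flaggedSources r, (∃ q, w = dataSource q) ∨ w = flagSource := by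
        simp [flaggedSources]
      rcases hsup with ⟨w | w, rfl⟩ | ⟨m', w, rfl, rfl⟩
      · exact ⟨w, fun i hi => hx _ (by simp [hi]), fun i hi => hz _ (by simp [hi]),
          Or.inl (hz _ (by simp))⟩
      · exact ⟨0, fun i hi => hx _ (by simp), fun i hi => hz _ (by simp),
          Or.inr ⟨hx _ (by simp), hz _ (by simp)⟩⟩
      · rcases hne w (by simp [hm]) with ⟨q, rfl⟩ | rfl
        · exact ⟨q, fun i hi => hx _ (by simp [dataSource, hi]),
            fun i hi => hz _ (by simp [dataSource, hi]), Or.inl (hz _ (by simp [dataSource]))⟩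
        · exact ⟨0, fun i hi => hx _ (by simp [flagSource]),
            fun i hi => hz _ (by simp [flagSource]),
            Or.inr ⟨hx _ (by simp [flagSource]), hz _ (by simp [flagSource])⟩⟩
    obtain ⟨q, h1, h2, h3⟩ := key
    rw [hsingle h1, hsingle h2]
    exact tensor_mem_errSpan (mem_flagErr h3) _
  · rw [hz0, one_smul, one_mul]
    have key : ∃ q, (∀ i, i ≠ q → x (Sum.inl i) = 0) ∧ (∀ i, i ≠ q → z (Sum.inl i) = 0) ∧
        ((x (Sum.inl q) = 0 ∧ z (Sum.inl q) = 0 ∧ z (Sum.inr 1) = 0) ∨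
          (m₁.getLast? = some (dataSource q) ∧ z (Sum.inr 1) = 0) ∨
          (m₁.getLast? = some flagSource ∧ x (Sum.inl q) = 0 ∧ z (Sum.inl q) = 0)) := by
      have hne : ∀ w ∈ flaggedSources r, (∃ q, w = dataSource q) ∨ w = flagSource := by
        simp [flaggedSources]
      rcases hsup with ⟨w, rfl⟩ | ⟨m', w, rfl, rfl⟩
      · have hw : w = Sum.inr 0 := by
          by_contra h
          rw [hz _ fun h' => h h'.symm] at hz0
          exact absurd hz0 (by decide)
        subst hw
        exact ⟨0, fun i hi => hx _ (by simp), fun i hi => hz _ (by simp),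
          Or.inl ⟨hx _ (by simp), hz _ (by simp), hz _ (by simp)⟩⟩
      · rcases hne w (by simp [hm]) with ⟨q, rfl⟩ | rfl
        · exact ⟨q, fun i hi => hx _ (by simp [dataSource, hi]),
            fun i hi => hz _ (by simp [dataSource, hi]),
            Or.inr (Or.inl ⟨by simp, hz _ (by simp [dataSource])⟩)⟩
        · exact ⟨0, fun i hi => hx _ (by simp [flagSource]),
            fun i hi => hz _ (by simp [flagSource]),
            Or.inr (Or.inr ⟨by simp, hx _ (by simp [flagSource]), hz _ (by simp [flagSource])⟩)⟩
    obtain ⟨q, h1, h2, h3⟩ := key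
    rw [hsingle h1, hsingle h2]
    exact flagged_residual hd r hm h3 _

end Collect

/-! ### The stages of the protocol -/

/-- A tuple of qubits of a round-robin gate. -/
abbrev Triple := Fin 15 × Fin 15 × Fin 15

/-- The qubits of a tuple. -/
def tripleWires (t : Triple) : Finset (Fin 15) := [t.1, t.2.1, t.2.2].toFinset

/-- The number of flag outcomes of a stage. -/
def flagCount (t : Triple) : ℕ :=
  match [t.1, t.2.1, t.2.2].dedup with
  | [_] => 0
  | [_, _] => 2
  | _ => 4

/-- The number of outcomes of a stage when all of them are trivial. -/
def outcomeCount (t : Triple) : ℕ :=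
  match [t.1, t.2.1, t.2.2].dedup with
  | [_] => 0
  | _ => flagCount t + 8

theorem dedup_cases (p q r : Fin 15) :
    (∃ i, [p, q, r].dedup = [i] ∧ p = i ∧ q = i ∧ r = i) ∨
    (∃ i j, i ≠ j ∧ [p, q, r].dedup = [i, j] ∧ [p, q, r].toFinset = {i, j} ∧
      ∀ y : Fin 15 → ZMod 2, y p * y q * y r = y i * y j) ∨
    (p ≠ q ∧ p ≠ r ∧ q ≠ r ∧ [p, q, r].dedup = [p, q, r]) := by
  have idem : ∀ a : ZMod 2, a * a = a := by decide
  by_cases hqr : q = r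
  · subst hqr
    by_cases hpq : p = q
    · subst hpq
      exact Or.inl ⟨p, by simp [List.dedup_cons_of_mem, List.dedup_cons_of_notMem], rfl, rfl, rfl⟩
    · refine Or.inr (Or.inl ⟨p, q, hpq, ?_, by simp, fun y => by rw [mul_assoc, idem]⟩)
      rw [List.dedup_cons_of_notMem (by simp [hpq]), List.dedup_cons_of_mem (by simp)]
      simp
  · by_cases hpq : p = q
    · subst hpq
      refine Or.inr (Or.inl ⟨p, r, hqr, ?_, by simp, fun y => by rw [idem]⟩)
      rw [List.dedup_cons_of_mem (by simp), List.dedup_cons_of_notMem (by simp [hqr])]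
      simp
    · by_cases hpr : p = r
      · subst hpr
        refine Or.inr (Or.inl ⟨q, p, hqr, ?_, by simp, fun y => ?_⟩)
        · rw [List.dedup_cons_of_mem (by simp), List.dedup_cons_of_notMem (by simp [hqr])]
          simp
        · rw [mul_right_comm, idem, mul_comm]
      · refine Or.inr (Or.inr ⟨hpq, hpr, hqr, List.dedup_eq_self.2 (by simp [*])⟩)

/-- A stage is a single `Z` gate, or a block that satisfies the fault analysis of the gadgets
followed by error correction. -/
theorem stage_cases (t : Triple) :
    (outcomeCount t = 0 ∧ ∃ i, roundRobinGate t = .z i ∧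
      ∀ xr k rec, stage xr t k rec = .gate (.z (Sum.inl i)) (k rec)) ∨
    (outcomeCount t = flagCount t + 8 ∧ ∃ ps gs, (ps.map Prod.snd).Nodup ∧
      ps.length = flagCount t ∧
      (∀ xr k rec, stage xr t k rec = block ps gs fun o => xCorrection xr k (rec ++ o)) ∧
      (∀ d χ, applyGates gs (tensor d χ) = tensor ((roundRobinGate t).apply d) χ) ∧
      ∀ (d : State (Fin 15)) (χ : State (Fin 4)), Prepared ps χ → ∀ l₁ l₂, gs = l₁ ++ l₂ →
        ∀ S, FaultSupport l₁ S → ∀ x z, SuppIn S x → SuppIn S z → ∀ o : Record,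
        o.length = ps.length →
        measAll ps o (applyGates l₂ (pauli x z (applyGates l₁ (tensor d χ)))) ∈
          errSpan 4 (gadgetErr (tripleWires t : Set (Fin 15)) (o = zeros (flagCount t)))
            ((roundRobinGate t).apply d)) := by
  obtain ⟨p, q, r⟩ := t
  rcases dedup_cases p q r with ⟨i, h, -⟩ | ⟨i, j, hij, h, hT, -⟩ | ⟨hpq, hpr, hqr, h⟩
  · refine Or.inl ⟨?_, i, ?_, fun xr k rec => ?_⟩
    · simp only [outcomeCount, h]
    · simp only [roundRobinGate, h]
    · simp only [stage, h]
  · have hg : roundRobinGate (p, q, r) = .cz i j := by simp only [roundRobinGate, h]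
    have hf : flagCount (p, q, r) = 2 := by simp only [flagCount, h]
    refine Or.inr ⟨?_, czFlags, czGates i j, czFlags_nodup, hf.symm, ?_, ?_, ?_⟩
    · simp only [outcomeCount, h]
    · intro xr k rec
      rw [← czGadget_eq]
      simp only [stage, h]
    · intro d χ
      rw [applyGates_czGates hij, cz_tensor, hg]
    · intro d χ hχ l₁ l₂ hl S hS x z hx hz o ho
      rw [hg, hf, tripleWires, hT]
      exact czGadget_fault hij rfl hχ hl hS hx hz ho
  · have hg : roundRobinGate (p, q, r) = .ccz p q r := by simp only [roundRobinGate, h]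
    have hf : flagCount (p, q, r) = 4 := by simp only [flagCount, h]
    refine Or.inr ⟨?_, cczFlags, cczGates p q r, cczFlags_nodup, hf.symm, ?_, ?_, ?_⟩
    · simp only [outcomeCount, h]
    · intro xr k rec
      rw [← cczGadget_eq]
      simp only [stage, h]
    · intro d χ
      rw [applyGates_cczGates hpq hpr hqr, ccz_tensor, hg]
    · intro d χ hχ l₁ l₂ hl S hS x z hx hz o ho
      have hT : tripleWires (p, q, r) = {p, q, r} := by simp [tripleWires]
      rw [hg, hf, hT]
      exact cczGadget_fault hpq hpr hqr rfl hχ hl hS hx hz ho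

theorem roundRobinGate_apply (t : Triple) (ψ : State (Fin 15)) (y : Fin 15 → ZMod 2) :
    (roundRobinGate t).apply ψ y = sgn (y t.1 * y t.2.1 * y t.2.2) * ψ y := by
  obtain ⟨p, q, r⟩ := t
  have idem : ∀ a : ZMod 2, a * a = a := by decide
  rcases dedup_cases p q r with ⟨i, h, rfl, rfl, rfl⟩ | ⟨i, j, hij, h, hT, hy⟩ |
    ⟨hpq, hpr, hqr, h⟩
  · simp only [roundRobinGate, h, Gate.apply, idem]
  · simp only [roundRobinGate, h, Gate.apply, hy]
  · simp only [roundRobinGate, h, Gate.apply]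

/-- The round-robin gates are diagonal. For this reason phase errors can be left uncorrected until
the final table. -/
theorem roundRobinGate_pauli (t : Triple) (c : Fin 15 → ZMod 2) (d : State (Fin 15)) :
    (roundRobinGate t).apply (pauli 0 c d) = pauli 0 c ((roundRobinGate t).apply d) := by
  ext y
  rw [roundRobinGate_apply]
  simp only [pauli]
  rw [roundRobinGate_apply, add_zero]
  ring

theorem InCode.roundRobinGate {d : State (Fin 15)} (hd : InCode d) (t : Triple) :
    InCode ((roundRobinGate t).apply d) := fun y hy => hd y fun h => hy (by
  rw [roundRobinGate_apply, h, mul_zero])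

/-! ### The decoder -/

/-- The first stage with a nontrivial outcome, and the record from there on. -/
def scan : List Triple → Record → Option (Triple × Record)
  | [], _ => none
  | t :: ts, rec => if ∀ b ∈ rec.take (outcomeCount t), b = 0 then
      scan ts (rec.drop (outcomeCount t)) else some (t, rec)

/-- The first check with a nontrivial outcome, its flag, and the record that follows. -/
def fire : List (Fin 4) → Record → Option (Fin 4 × ZMod 2 × Record)
  | r :: rs, b :: f :: rest => if b = 0 ∧ f = 0 then fire rs rest else some (r, f, rest)
  | _, _ => none

/-- The syndrome at the beginning of a record. -/
def firstSyndrome (rec : Record) : Fin 4 → ZMod 2 := fun r => rec.getD r 0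

open Classical in
/-- An element of `A` with the given syndrome. -/
def decodeIn (A : Set (Fin 15 → ZMod 2)) (s : Fin 4 → ZMod 2) : Fin 15 → ZMod 2 :=
  if h : ∃ c ∈ A, synd c = s then h.choose else 0

/-- The strings supported in `T`. -/
def suppStrings (T : Finset (Fin 15)) : Set (Fin 15 → ZMod 2) := {c | SuppIn (T : Set (Fin 15)) c}

open Classical in
/-- The possible bit flips. -/
def xCandidates (t : Triple) (rec : Record) : Set (Fin 15 → ZMod 2) :=
  if rec.take (flagCount t) = zeros (flagCount t) then singles else suppStrings (tripleWires t)

open Classical in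
/-- The possible phase flips. -/
def zCandidates (t : Triple) (rec : Record) : Set (Fin 15 → ZMod 2) :=
  if rec.take (flagCount t) = zeros (flagCount t) then
    match fire (List.finRange 4) (rec.drop (flagCount t)) with
    | none => singles
    | some (r, f, rest) => if f = 1 then suffixes r else
        if ∃ q ∈ tripleWires t, synd (Pi.single q 1) = firstSyndrome rest then
          suppStrings (tripleWires t) else singles
  else suppStrings (tripleWires t)

/-- The rule for the intermediate `X` corrections. -/
def xRule (order : List Triple) (rec : Record) : Fin 15 → ZMod 2 :=
  match scan order rec with
  | none => 0
  | some (t, rest) => match fire (List.finRange 4) (rest.drop (flagCount t)) with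
    | none => 0
    | some (_, _, last) => decodeIn (xCandidates t rest) (firstSyndrome last)

/-- The phase flips that are possible at the end. -/
def zFinal (order : List Triple) (rec : Record) : Set (Fin 15 → ZMod 2) :=
  match scan order rec with
  | none => singles
  | some (t, rest) => zCandidates t rest

/-- The table of the final error correction. -/
def finalRule (order : List Triple) (rec : Record) (s t : Fin 4 → ZMod 2) :
    (Fin 15 → ZMod 2) × (Fin 15 → ZMod 2) :=
  (decodeIn singles s, decodeIn (zFinal order rec) t)

theorem decodeIn_eq {A : Set (Fin 15 → ZMod 2)} (hA : Set.InjOn synd A) {c : Fin 15 → ZMod 2}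
    (hc : c ∈ A) : decodeIn A (synd c) = c := by
  have h : ∃ c' ∈ A, synd c' = synd c := ⟨c, hc, rfl⟩
  rw [decodeIn, dif_pos h]
  exact hA h.choose_spec.1 hc h.choose_spec.2

/-- The columns of the check matrix are distinct and non-zero; this is distance three. -/
theorem injOn_singles : Set.InjOn synd singles := by
  rintro _ ⟨q, b, rfl⟩ _ ⟨q', b', rfl⟩ h
  have key : ∀ (q q' : Fin 15) (b b' : ZMod 2), (∀ r, parityCheck r q * b = parityCheck r q' * b') →
      b = b' ∧ (b = 0 ∨ q = q') := by decide +kernel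
  obtain ⟨rfl, rfl | rfl⟩ := key q q' b b' fun r => by
    rw [← synd_single, ← synd_single, h]
  · simp
  · rfl

/-- The qubits of a tuple may coincide, so the value at a repeated qubit is counted only at its
first occurrence. -/
theorem eq_sum_singles {p q r : Fin 15} {e : Fin 15 → ZMod 2}
    (h : ∀ x, x ≠ p → x ≠ q → x ≠ r → e x = 0) :
    e = Pi.single p (e p) + (Pi.single q (if q = p then 0 else e q) +
      Pi.single r (if r = p ∨ r = q then 0 else e r)) := by
  ext x
  simp only [Pi.add_apply, Pi.single_apply]
  grind

/-- For each of the twenty-seven tuples the columns of its distinct qubits are linearly independent,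
so once the tuple is known every error on it can be corrected. -/
theorem injOn_suppStrings {t : Triple} (ht : t ∈ triples) :
    Set.InjOn synd (suppStrings (tripleWires t)) := by
  have key : ∀ t ∈ triples, ∀ b₁ b₂ b₃ : ZMod 2,
      (∀ r, parityCheck r t.1 * b₁ + (parityCheck r t.2.1 * b₂ + parityCheck r t.2.2 * b₃) = 0) →
      ∀ q, (if t.1 = q then b₁ else 0) + ((if t.2.1 = q then b₂ else 0) +
        (if t.2.2 = q then b₃ else 0)) = 0 := by decide +kernel
  intro c hc c' hc' h
  apply eq_of_add_eq_zero
  have hs : synd (c + c') = 0 := by rw [synd_add, h, string_add_self]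
  have hsupp : SuppIn (tripleWires t : Set (Fin 15)) (c + c') := SuppIn.add hc hc'
  generalize c + c' = e at hs hsupp
  have he : e = Pi.single t.1 (e t.1) + (Pi.single t.2.1 (if t.2.1 = t.1 then 0 else e t.2.1) +
      Pi.single t.2.2 (if t.2.2 = t.1 ∨ t.2.2 = t.2.1 then 0 else e t.2.2)) := by
    refine eq_sum_singles fun q h1 h2 h3 => hsupp q ?_
    simp [tripleWires, h1, h2, h3]
  rw [he] at hs
  have := key t ht _ _ _ fun r => by
    have := congrFun hs r
    simpa only [synd_add, Pi.add_apply, synd_single, Pi.zero_apply] using this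
  rw [he]
  ext q
  simp only [Pi.add_apply, Pi.single_apply, Pi.zero_apply, @eq_comm _ q]
  exact this q

/-- The coupling orders were chosen for this: the eight suffixes, the empty one included, have eight
different syndromes. -/
theorem injOn_suffixes (r : Fin 4) : Set.InjOn synd (suffixes r) := by
  have key : ∀ (r : Fin 4) (n n' : Fin 8),
      (∀ s, parityCheck s ⬝ᵥ suffixString r (n + 1) = parityCheck s ⬝ᵥ suffixString r (n' + 1)) →
      n = n' := by decide +kernel
  rintro _ ⟨n, rfl⟩ _ ⟨n', rfl⟩ h
  rw [key r n n' fun s => congrFun h s]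

theorem synd_column_ne_zero (q : Fin 15) : synd (Pi.single q 1) ≠ 0 := fun h => by
  have := injOn_singles ⟨q, 1, rfl⟩ ⟨q, 0, rfl⟩ (by rw [h, Pi.single_zero, synd_zero])
  simpa using congrFun this q

theorem zero_mem_singles : (0 : Fin 15 → ZMod 2) ∈ singles := ⟨0, 0, by simp⟩

/-! ### What the decoder reads from the record -/

section Records

variable {order : List Triple} {t : Triple} {ts : List Triple} {rec : Record}

/-- All the outcomes so far are trivial, and the stages `ts` remain. -/
def Clean (order ts : List Triple) (rec : Record) : Prop :=
  ∀ rec', scan order (rec ++ rec') = scan ts rec'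

theorem zeros_add (m n : ℕ) : zeros (m + n) = zeros m ++ zeros n := List.replicate_add ..

theorem length_zeros (n : ℕ) : (zeros n).length = n := List.length_replicate ..

theorem mem_zeros {b : ZMod 2} {n : ℕ} (h : b ∈ zeros n) : b = 0 := List.eq_of_mem_replicate h

theorem eq_zeros {o : Record} (h : ∀ b ∈ o, b = 0) : o = zeros o.length :=
  List.eq_replicate_iff.2 ⟨rfl, h⟩

theorem Clean.next (h : Clean order (t :: ts) rec) :
    Clean order ts (rec ++ zeros (outcomeCount t)) := by
  intro rec'
  rw [List.append_assoc, h, scan, List.take_left' (length_zeros _),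
    List.drop_left' (length_zeros _), if_pos fun b hb => mem_zeros hb]

theorem scan_fired {pre rec' : Record} (hpre : ∃ b ∈ pre, b ≠ 0)
    (hlen : pre.length ≤ outcomeCount t) :
    scan (t :: ts) (pre ++ rec') = some (t, pre ++ rec') := by
  rw [scan, if_neg]
  obtain ⟨b, hb, hb0⟩ := hpre
  intro h
  refine hb0 (h b ?_)
  rw [List.take_append]
  exact List.mem_append_left _ (by rwa [List.take_of_length_le hlen])

theorem fire_eq {rs₁ rs₂ : List (Fin 4)} {r : Fin 4} {b f : ZMod 2} (h : ¬(b = 0 ∧ f = 0))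
    (rest : Record) :
    fire (rs₁ ++ r :: rs₂) (zeros (2 * rs₁.length) ++ b :: f :: rest) = some (r, f, rest) := by
  induction rs₁ with
  | nil => simp [fire, zeros, h]
  | cons s rs₁ ih =>
    have : zeros (2 * (s :: rs₁).length) = 0 :: 0 :: zeros (2 * rs₁.length) := by
      rw [List.length_cons, mul_add, mul_one]; rfl
    rw [this]
    simp only [List.cons_append, fire, and_self, if_true]
    exact ih

theorem firstSyndrome_append (s : Fin 4 → ZMod 2) (rest : Record) :
    firstSyndrome ((List.finRange 4).map s ++ rest) = s := by
  ext r
  fin_cases r <;> rfl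

/-- The errors that are corrected when the flags `o` of the gadget and the check `r` with flag `f`
are the first nontrivial outcomes. -/
def firedErr (t : Triple) (o : Record) (r : Fin 4) (f : ZMod 2) : ErrorSet :=
  {p | (o ≠ zeros (flagCount t) → p ∈ localErr (tripleWires t : Set (Fin 15))) ∧
    (o = zeros (flagCount t) → (f = 1 → p.1 ∈ singles ∧ p.2 ∈ suffixes r) ∧
      (f = 0 → p ∈ quietErr (tripleWires t : Set (Fin 15))))}

/-- The record locates the first nontrivial outcome. A gadget flag points to an error on `T`;
otherwise a raised check flag points to one bit flip and a suffix of phase flips. If only a syndrome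
bit fired, the bit flip is a single one, and the re-extracted syndrome tells whether it lies in `T`,
in which case arbitrary phases on `T` have to be expected. -/
theorem decode_fired (hc : Clean order (t :: ts) rec) (ht : t ∈ triples)
    (hn : outcomeCount t = flagCount t + 8) {o : Record} (ho : o.length = flagCount t)
    {rs₁ rs₂ : List (Fin 4)} {r : Fin 4} (hrs : List.finRange 4 = rs₁ ++ r :: rs₂) {b f : ZMod 2}
    (hbf : ¬(b = 0 ∧ f = 0)) {a c : Fin 15 → ZMod 2} (hp : (a, c) ∈ firedErr t o r f)
    (rest : Record) :
    xRule order (rec ++ o ++ zeros (2 * rs₁.length) ++ [b, f] ++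
      ((List.finRange 4).map (synd a) ++ rest)) = a ∧
    decodeIn (zFinal order (rec ++ o ++ zeros (2 * rs₁.length) ++ [b, f] ++
      ((List.finRange 4).map (synd a) ++ rest))) (synd c) = c := by
  have hlen : rs₁.length + 1 ≤ 4 := by
    have := congrArg List.length hrs
    simp at this
    omega
  have hscan : scan order (rec ++ o ++ zeros (2 * rs₁.length) ++ [b, f] ++
      ((List.finRange 4).map (synd a) ++ rest)) = some (t, o ++ (zeros (2 * rs₁.length) ++
        b :: f :: ((List.finRange 4).map (synd a) ++ rest))) := by
    have e : rec ++ o ++ zeros (2 * rs₁.length) ++ [b, f] ++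
      ((List.finRange 4).map (synd a) ++ rest) = rec ++ ((o ++ zeros (2 * rs₁.length) ++ [b, f]) ++
      ((List.finRange 4).map (synd a) ++ rest)) := by simp only [List.append_assoc]
    rw [e, hc, scan_fired]
    · simp
    · by_cases hb : b = 0
      · exact ⟨f, by simp, fun h => hbf ⟨hb, h⟩⟩
      · exact ⟨b, by simp, hb⟩
    · simp only [List.length_append, ho, length_zeros, List.length_cons, List.length_nil]
      omega
  have hfire := fire_eq (rs₁ := rs₁) (rs₂ := rs₂) (r := r) hbf
    ((List.finRange 4).map (synd a) ++ rest)
  rw [← hrs] at hfire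
  simp only [xRule, zFinal, hscan, zCandidates, xCandidates, List.take_left' ho,
    List.drop_left' ho, hfire, firstSyndrome_append]
  by_cases hz : o = zeros (flagCount t)
  · rw [if_pos hz, if_pos hz]
    obtain ⟨h1, h0⟩ := hp.2 hz
    rcases zmod2_cases f with rfl | rfl
    · rw [if_neg (by decide)]
      rcases h0 rfl with ⟨q, b, c', rfl, rfl⟩ | ⟨q, hq, rfl, hcT⟩
      · refine ⟨decodeIn_eq injOn_singles ⟨q, b, rfl⟩, ?_⟩
        split_ifs with h
        -- Even if the error is on one qubit only, a bit flip that lies in `T` makes its phase part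
        -- supported in `T`, so the larger class of candidates still gives the right answer.
        · obtain ⟨q', hq', h⟩ := h
          have := injOn_singles ⟨q', 1, rfl⟩ ⟨q, b, rfl⟩ h
          have hqq : q' = q := by
            by_contra hne
            have := congrFun this q'
            simp [hne] at this
          subst hqq
          refine decodeIn_eq (injOn_suppStrings ht) fun i hi => ?_
          exact Pi.single_eq_of_ne (fun h => hi (by simpa [h] using hq')) _
        · exact decodeIn_eq injOn_singles ⟨q, c', rfl⟩
      · refine ⟨decodeIn_eq injOn_singles ⟨q, 1, rfl⟩, ?_⟩
        rw [if_pos ⟨q, by simpa using hq, rfl⟩]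
        exact decodeIn_eq (injOn_suppStrings ht) hcT
    · rw [if_pos rfl]
      exact ⟨decodeIn_eq injOn_singles (h1 rfl).1, decodeIn_eq (injOn_suffixes r) (h1 rfl).2⟩
  · rw [if_neg hz, if_neg hz]
    exact ⟨decodeIn_eq (injOn_suppStrings ht) (hp.1 hz).1,
      decodeIn_eq (injOn_suppStrings ht) (hp.1 hz).2⟩

end Records

/-! ### Fault tolerance of the protocol -/

section Protocol

variable {order : List Triple} {t : Triple} {ts : List Triple} {rec : Record}
  {G : Submodule ℂ (State (Wire 4))} {d : State (Fin 15)}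

theorem applyGates_x {l : List (Fin 15)} (hl : l.Nodup) (ψ : State (Wire 4)) :
    applyGates (l.map fun i => Gate.x (Sum.inl i)) ψ = pauli (onData (indicator l)) 0 ψ := by
  induction l generalizing ψ with
  | nil =>
    ext y
    have : (onData (indicator []) : Wire 4 → ZMod 2) = 0 := by
      ext w; rcases w with w | w <;> simp [onData, indicator]
    rw [this, pauli_zero_zero]; rfl
  | cons i l ih =>
    rw [List.nodup_cons] at hl
    rw [List.map_cons, applyGates_cons, ih hl.2]
    ext y
    simp only [pauli, Gate.apply, zero_dotProduct, sgn_zero, one_mul]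
    congr 1
    ext w
    rcases w with w | w
    · by_cases h : w = i
      · subst h
        simp [onData, indicator, hl.1]
      · simp [onData, indicator, h]
    · simp [onData]

theorem filter_indicator (a : Fin 15 → ZMod 2) :
    indicator ((List.finRange 15).filter fun i => a i = 1) = a := by
  ext i
  rcases zmod2_cases (a i) with h | h <;> simp [indicator, h]

theorem dataPart_onData {k : ℕ} (a : Fin 15 → ZMod 2) : dataPart (onData (a := k) a) = a := rfl

theorem ancPart_single_inl {k : ℕ} (q : Fin 15) (b : ZMod 2) :
    ancPart (Pi.single (Sum.inl q) b : Wire k → ZMod 2) = 0 := by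
  ext i; simp [ancPart]

theorem ancPart_onData {k : ℕ} (a : Fin 15 → ZMod 2) : ancPart (onData (a := k) a) = 0 := rfl

/-- There is no second fault, so the unflagged extraction reports the true syndrome of `a`, the rule
returns `a`, and only the phase part remains. -/
theorem extract_mem_safe (hd : InCode d) {xr : Record → Fin 15 → ZMod 2}
    {k : Record → Protocol 4} {a c : Fin 15 → ZMod 2} (rs : List (Fin 4)) (rec : Record)
    (hx : xr (rec ++ rs.map (synd a)) = a)
    (hk : ∀ χ, tensor (pauli 0 c d) χ ∈ safe G (k (rec ++ rs.map (synd a)))) (χ : State (Fin 4)) :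
    tensor (pauli a c d) χ ∈ safe G (extractAndCorrect xr k rs rec) := by
  induction rs generalizing rec χ with
  | nil =>
    simp only [List.map_nil, List.append_nil] at hx hk
    rw [extractAndCorrect, mem_safe_withGates, hx, applyGates_x (List.nodup_finRange 15 |>.filter _),
      filter_indicator, pauli_tensor, dataPart_onData, ancPart_onData, pauli_pauli]
    have e1 : dataPart (0 : Wire 4 → ZMod 2) = 0 := rfl
    have e2 : ancPart (0 : Wire 4 → ZMod 2) = 0 := rfl
    rw [e1, e2, pauli_zero_zero, string_add_self, zero_add, smul_tensor]
    exact Submodule.smul_mem _ _ (hk χ)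
  | cons r rs ih =>
    rw [extractAndCorrect, unflaggedSyndrome_eq]
    refine block_mem_safe (by simp) (implements_unflagged (hd.hasCheck a c r)) (fun χ => ?_) χ
    refine ih _ ?_ (fun χ => ?_) χ
    · simpa using hx
    · simpa using hk χ

/-- Measuring checks that have the value zero has no effect. -/
theorem xCorrectionFrom_quiet (hd : InCode d) {xr : Record → Fin 15 → ZMod 2}
    {k : Record → Protocol 4} {a c : Fin 15 → ZMod 2} (rs : List (Fin 4)) (rec : Record)
    (ha : ∀ r ∈ rs, synd a r = 0)
    (hk : ∀ χ, tensor (pauli a c d) χ ∈ safe G (k (rec ++ zeros (2 * rs.length))))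
    (χ : State (Fin 4)) : tensor (pauli a c d) χ ∈ safe G (xCorrectionFrom xr k rs rec) := by
  induction rs generalizing rec χ with
  | nil => simpa [xCorrectionFrom, zeros] using hk χ
  | cons r rs ih =>
    rw [xCorrectionFrom, flaggedSyndrome_eq]
    refine block_mem_safe syndromeFlags_nodup (implements_flagged (hd.hasCheck a c r))
      (fun χ => ?_) χ
    have e : syndromeFlags.map (fun q => if q.2 = 0 then synd a r else 0) = [0, 0] := by
      simp [syndromeFlags, ha r]
    rw [e]
    refine ih _ (fun r' hr' => ha r' (by simp [hr'])) (fun χ => ?_) χ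
    have e2 : zeros (2 * (r :: rs).length) = [0, 0] ++ zeros (2 * rs.length) := by
      rw [List.length_cons, mul_add, mul_one, add_comm, zeros_add]; rfl
    rw [List.append_assoc, ← e2]
    exact hk χ

variable {xr : Record → Fin 15 → ZMod 2}
  {fr : Record → (Fin 4 → ZMod 2) → (Fin 4 → ZMod 2) → (Fin 15 → ZMod 2) × (Fin 15 → ZMod 2)}

/-- A fault-free run with a phase error that the final table corrects. -/
theorem phase_mem_safe {D : State (Fin 15)} (hD : D ∈ codeSpace) {c : Fin 15 → ZMod 2}
    (ts : List Triple) {d : State (Fin 15)} (hd : InCode d)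
    (hts : applyGates (ts.map roundRobinGate) d = D) (rec : Record)
    (hc : ∀ m, fr (rec ++ zeros m) 0 (synd c) = (0, c)) (χ : State (Fin 4)) :
    tensor (pauli 0 c d) χ ∈ safe (goal D) (protocolFrom xr fr ts rec) := by
  induction ts generalizing d rec χ with
  | nil =>
    obtain rfl : d = D := hts
    refine finish_mem_safe hD _ _ _ ?_ χ
    rw [synd_zero]
    simpa [zeros] using hc 0
  | cons t ts ih =>
    have hd' := hd.roundRobinGate t
    rw [protocolFrom]
    rcases stage_cases t with ⟨-, i, hg, hst⟩ | ⟨-, ps, gs, hnd, hlen, hst, hgs, -⟩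
    · rw [hst]
      have := ih hd' hts rec hc χ
      rw [hg] at this
      change (Gate.z (Sum.inl i)).apply (tensor (pauli 0 c d) χ) ∈ safe _ _
      have e : (Gate.z (Sum.inl i)).apply (tensor (pauli 0 c d) χ) =
          tensor (pauli 0 c ((Gate.z i).apply d)) χ := by
        ext y
        simp only [Gate.apply, tensor, pauli, add_zero]
        ring
      rw [e]
      exact this
    · rw [hst]
      refine block_mem_safe (v := fun _ => 0) (d' := pauli 0 c ((roundRobinGate t).apply d)) hnd
        (fun χ hχ => ⟨χ, ?_, hχ⟩) (fun χ => ?_) χ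
      · rw [hgs, roundRobinGate_pauli]
      · refine xCorrectionFrom_quiet hd' _ _ (by simp) (fun χ => ?_) χ
        refine ih hd' hts _ (fun m => ?_) χ
        rw [List.map_const', ← zeros, List.append_assoc, List.append_assoc, ← zeros_add, ← zeros_add]
        exact hc _

/-- The hypotheses on a partial run without nontrivial outcomes: the stages `ts` remain, and take
`d` to the code state `D`. -/
structure Remaining (order ts : List Triple) (rec : Record) (d D : State (Fin 15)) : Prop where
  clean : Clean order ts rec
  sub : ∀ t ∈ ts, t ∈ triples
  code : D ∈ codeSpace
  inCode : InCode d
  gates : applyGates (ts.map roundRobinGate) d = D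

theorem finalRule_zero (order : List Triple) (rec : Record) {c : Fin 15 → ZMod 2}
    (h : decodeIn (zFinal order rec) (synd c) = c) :
    finalRule order rec 0 (synd c) = (0, c) := by
  rw [finalRule, h, ← synd_zero, decodeIn_eq injOn_singles zero_mem_singles]

/-- Error correction from the checks `rs₂` on, after the gadget of a stage left an error behind or
after a fault in the error correction itself. -/
theorem xCorrection_mem_safe {D : State (Fin 15)} (ht : t ∈ triples)
    (hclean : Clean order (t :: ts) rec)
    (hn : outcomeCount t = flagCount t + 8)
    (hr : Remaining order ts (rec ++ zeros (outcomeCount t)) d D)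
    (hsingle : ∀ p ∈ singleErr, ∀ χ, tensor (pauli p.1 p.2 d) χ ∈ safe (goal D)
      (protocolFrom (xRule order) (finalRule order) ts (rec ++ zeros (outcomeCount t))))
    {o : Record} (ho : o.length = flagCount t) {a c : Fin 15 → ZMod 2}
    (hp : (a, c) ∈ gadgetErr (tripleWires t : Set (Fin 15)) (o = zeros (flagCount t)))
    {rs₁ rs₂ : List (Fin 4)} (hrs : List.finRange 4 = rs₁ ++ rs₂)
    (h0 : (∀ r ∈ rs₁, synd a r = 0) ∨ ((a, c) ∈ singleErr ∧ o = zeros (flagCount t)))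
    (χ : State (Fin 4)) :
    tensor (pauli a c d) χ ∈ safe (goal D) (xCorrectionFrom (xRule order)
      (protocolFrom (xRule order) (finalRule order) ts) rs₂
      (rec ++ o ++ zeros (2 * rs₁.length))) := by
  -- In `h0` the first alternative is an error present since the gadget, seen by all checks of
  -- `rs₁`. The second is a fault amid the checks, which may violate checks measured before it.
  induction rs₂ generalizing rs₁ χ with
  | nil =>
    rw [List.append_nil] at hrs
    have h4 : 2 * rs₁.length = 8 := by rw [← hrs]; rfl
    have hall : (∀ r ∈ rs₁, synd a r = 0) → synd a = 0 := fun h =>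
      funext fun r => h r (by rw [← hrs]; exact List.mem_finRange r)
    rw [xCorrectionFrom, h4]
    by_cases hz : o = zeros (flagCount t)
    · have e : rec ++ o ++ zeros 8 = rec ++ zeros (outcomeCount t) := by
        rw [hn, zeros_add, hz, List.append_assoc]
      rw [e]
      rcases hp.1 hz with hs | ⟨q, hq, ha, -⟩
      · exact hsingle _ hs χ
      · rcases h0 with h0 | ⟨hs, -⟩
        -- A flipped qubit has a non-zero syndrome, so a gadget error of this kind would have fired
        -- one of the checks.
        · exact absurd (hall h0) (by rw [show a = _ from ha]; exact synd_column_ne_zero q)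
        · exact hsingle _ hs χ
    · have hloc := hp.2 hz
      have ha0 : a = 0 := by
        refine injOn_suppStrings ht hloc.1 (fun _ _ => rfl) ?_
        rcases h0 with h0 | ⟨-, h⟩
        · rw [hall h0, synd_zero]
        · exact absurd h hz
      subst ha0
      refine phase_mem_safe hr.code ts hr.inCode hr.gates _ (fun m => ?_) χ
      refine finalRule_zero _ _ ?_
      have hscan : scan order (rec ++ o ++ zeros 8 ++ zeros m) =
          some (t, o ++ (zeros 8 ++ zeros m)) := by
        rw [List.append_assoc, List.append_assoc, hclean, scan_fired]
        · by_contra h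
          push Not at h
          exact hz (by rw [← ho]; exact eq_zeros h)
        · rw [ho, hn]; omega
      simp only [zFinal, hscan, zCandidates, List.take_left' ho]
      rw [if_neg hz]
      exact decodeIn_eq (injOn_suppStrings ht) hloc.2
  | cons r rs₂ ih =>
    rw [xCorrectionFrom, flaggedSyndrome_eq]
    refine block_mem_safe syndromeFlags_nodup (implements_flagged (hr.inCode.hasCheck a c r))
      (fun χ => ?_) χ
    have e : syndromeFlags.map (fun q => if q.2 = 0 then synd a r else 0) = [synd a r, 0] := by
      simp [syndromeFlags]
    rw [e]
    simp only [List.getD_cons_zero, List.getD_cons_succ, and_true]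
    by_cases hb : synd a r = 0
    · rw [if_pos hb, hb]
      have e2 : rec ++ o ++ zeros (2 * rs₁.length) ++ [0, 0] =
          rec ++ o ++ zeros (2 * (rs₁ ++ [r]).length) := by
        rw [List.append_assoc _ (zeros _), List.length_append, mul_add, zeros_add]; rfl
      rw [e2]
      refine ih (rs₁ := rs₁ ++ [r]) (by simpa using hrs) ?_ χ
      refine h0.imp_left fun h r' hr' => ?_
      rcases List.mem_append.1 hr' with h' | h'
      · exact h r' h'
      · rwa [List.mem_singleton.1 h']
    · rw [if_neg hb]
      have hfire : (a, c) ∈ firedErr t o r 0 :=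
        ⟨fun h => hp.2 h, fun h => ⟨fun h => absurd h (by decide), fun _ => hp.1 h⟩⟩
      have hdec := decode_fired hclean ht hn ho hrs (f := 0) (fun h => hb h.1) hfire
      refine extract_mem_safe hr.inCode _ _ ?_ (fun χ => ?_) χ
      · have := (hdec []).1
        rwa [List.append_nil] at this
      · refine phase_mem_safe hr.code ts hr.inCode hr.gates _ (fun m => ?_) χ
        refine finalRule_zero _ _ ?_
        have := (hdec (zeros m)).2
        rwa [← List.append_assoc] at this

theorem Remaining.step {D : State (Fin 15)} (h : Remaining order (t :: ts) rec d D) :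
    Remaining order ts (rec ++ zeros (outcomeCount t)) ((roundRobinGate t).apply d) D :=
  ⟨h.clean.next, fun t ht => h.sub t (by simp [ht]), h.code, h.inCode.roundRobinGate t, h.gates⟩

/-- A fault-free run with a single-qubit error. -/
theorem single_mem_safe {D : State (Fin 15)} (h : Remaining order ts rec d D) {a c : Fin 15 → ZMod 2}
    (hp : (a, c) ∈ singleErr) (χ : State (Fin 4)) : tensor (pauli a c d) χ ∈ safe (goal D)
      (protocolFrom (xRule order) (finalRule order) ts rec) := by
  induction ts generalizing rec d a c χ with
  | nil =>
    obtain rfl : d = D := h.gates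
    refine finish_mem_safe h.code _ _ _ ?_ χ
    obtain ⟨q, b, b', rfl, rfl⟩ := hp
    have hs := h.clean []
    rw [List.append_nil] at hs
    rw [finalRule, zFinal, hs]
    rw [decodeIn_eq injOn_singles ⟨q, b, rfl⟩]
    simp only [scan]
    rw [decodeIn_eq injOn_singles ⟨q, b', rfl⟩]
  | cons t ts ih =>
    have hstep := h.step
    rw [protocolFrom]
    rcases stage_cases t with ⟨hn, i, hg, hst⟩ | ⟨hn, ps, gs, hnd, hlen, hst, hgs, hfault⟩
    · rw [hn, zeros, List.replicate_zero, List.append_nil] at hstep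
      rw [hst]
      have := ih hstep hp χ
      rw [hg] at this
      change (Gate.z (Sum.inl i)).apply (tensor (pauli a c d) χ) ∈ safe _ _
      have e : (Gate.z (Sum.inl i)).apply (tensor (pauli a c d) χ) =
          sgn (a i) • tensor (pauli a c ((Gate.z i).apply d)) χ := by
        ext y
        simp only [Gate.apply, tensor, pauli, Pi.smul_apply, smul_eq_mul]
        have e2 : (fun i => y (Sum.inl i)) + a = fun i => y (Sum.inl i) + a i := rfl
        rw [e2, sgn_add]
        linear_combination (-sgn (y (Sum.inl i)) * sgn (c ⬝ᵥ fun i => y (Sum.inl i)) *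
          d (fun i => y (Sum.inl i) + a i) * χ (fun i => y (Sum.inr i))) * sgn_mul_self (a i)
      rw [e]
      exact Submodule.smul_mem _ _ this
    · rw [hst]
      obtain ⟨q, b, b', hq, hq'⟩ := hp
      refine mem_safe_withPreps hnd fun χ hχ => mem_safe_withGates.2 (mem_safe_measK fun o ho => ?_)
      -- The incoming error is treated as a fault before the first gate of the gadget, so the fault
      -- analysis covers it.
      have hf := hfault d χ hχ [] gs rfl {Sum.inl q} (Or.inl ⟨_, rfl⟩) (Pi.single (Sum.inl q) b)
        (Pi.single (Sum.inl q) b') (suppIn_single _ _) (suppIn_single _ _) o ho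
      have e : tensor (pauli a c d) χ = pauli (Pi.single (Sum.inl q) b) (Pi.single (Sum.inl q) b')
          (applyGates [] (tensor d χ)) := by
        rw [applyGates_nil, pauli_tensor, dataPart_single_inl, dataPart_single_inl,
          ancPart_single_inl, ancPart_single_inl, pauli_zero_zero, show a = _ from hq,
          show c = _ from hq']
      rw [e]
      refine errSpan_le (fun a c hac χ => ?_) hf
      have := xCorrection_mem_safe (h.sub t (by simp)) h.clean hn hstep
        (fun p hp χ => ih hstep hp χ) (ho.trans hlen) hac (rs₁ := []) rfl (Or.inl (by simp)) χ
      rwa [List.length_nil, mul_zero, zeros, List.replicate_zero, List.append_nil] at this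

/-- A run with at most one fault. -/
theorem safe1_protocolFrom {D : State (Fin 15)} (h : Remaining order ts rec d D)
    (χ : State (Fin 4)) : Safe1 (goal D)
      (protocolFrom (xRule order) (finalRule order) ts rec) (tensor d χ) := by
  -- Between stages a fault is an error on one data qubit, or an error on an ancilla, which the
  -- arbitrary ancilla state absorbs.
  have hidle : ∀ {ts rec d}, Remaining order ts rec d D → ∀ χ, IdleSafe (goal D)
      (protocolFrom (xRule order) (finalRule order) ts rec) (tensor d χ) := by
    intro ts rec d h χ w b c
    rw [pauli_tensor]
    refine single_mem_safe h ?_ _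
    rcases w with q | q
    · rw [dataPart_single_inl, dataPart_single_inl]
      exact ⟨q, b, c, rfl, rfl⟩
    · rw [dataPart_single_inr, dataPart_single_inr]
      exact ⟨0, 0, 0, by simp, by simp⟩
  induction ts generalizing rec d χ with
  | nil => exact hidle h χ
  | cons t ts ih =>
    have hstep := h.step
    have hidle0 := hidle h χ
    rw [protocolFrom] at hidle0 ⊢
    rcases stage_cases t with ⟨hn, i, hg, hst⟩ | ⟨hn, ps, gs, hnd, hlen, hst, hgs, hfault⟩
    · rw [hn, zeros, List.replicate_zero, List.append_nil] at hstep
      rw [hst] at hidle0 ⊢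
      have e : (Gate.z (Sum.inl i)).apply (tensor d χ) = tensor ((roundRobinGate t).apply d) χ := by
        rw [hg]
        ext y
        simp only [Gate.apply, tensor]
        ring
      refine ⟨hidle0, ?_, fun x z hxz => ?_⟩
      · rw [e]
        exact ih hstep χ
      · rw [e]
        have e1 : ∀ x : Wire 4 → ZMod 2, (∀ w, w ∉ (Gate.z (Sum.inl i) : Gate (Wire 4)).support →
            x w = 0) → x = Pi.single (Sum.inl i) (x (Sum.inl i)) := fun x hx =>
          eq_single_of_suppIn hx
        rw [e1 x fun w hw => (hxz w hw).1, e1 z fun w hw => (hxz w hw).2]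
        exact hidle hstep χ _ _ _
    · rw [hst]
      have hsing : ∀ p ∈ singleErr, ∀ χ, tensor (pauli p.1 p.2 ((roundRobinGate t).apply d)) χ ∈
          safe (goal D) (protocolFrom (xRule order) (finalRule order) ts
            (rec ++ zeros (outcomeCount t))) := fun p hp χ => single_mem_safe hstep hp χ
      refine block_safe1 (v := fun _ => 0) (d' := (roundRobinGate t).apply d) hnd
        (fun χ hχ => ⟨χ, hgs d χ, hχ⟩) (fun χ => ?_)
        (fun χ hχ l₁ l₂ hl S hS x z hx hz o ho => ?_) χ
      · rw [List.map_const', ← zeros, hlen]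
        suffices ∀ rs₁ rs₂ : List (Fin 4), List.finRange 4 = rs₁ ++ rs₂ → ∀ χ, Safe1 (goal D)
            (xCorrectionFrom (xRule order) (protocolFrom (xRule order) (finalRule order) ts) rs₂
              (rec ++ zeros (flagCount t) ++ zeros (2 * rs₁.length)))
            (tensor ((roundRobinGate t).apply d) χ) by
          have := this [] _ rfl χ
          rwa [List.length_nil, mul_zero, zeros, zeros, List.replicate_zero, List.append_nil] at this
        intro rs₁ rs₂ hrs χ
        induction rs₂ generalizing rs₁ χ with
        | nil =>
          have h4 : 2 * rs₁.length = 8 := by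
            rw [List.append_nil] at hrs
            rw [← hrs]; rfl
          rw [xCorrectionFrom, h4, List.append_assoc, ← zeros_add, ← hn]
          exact ih hstep χ
        | cons r rs₂ ihr =>
          rw [xCorrectionFrom, flaggedSyndrome_eq]
          have hchk : HasCheck r 0 ((roundRobinGate t).apply d) := fun y hy => by
            rw [hstep.inCode y hy]; rfl
          refine block_safe1 syndromeFlags_nodup (implements_flagged hchk) (fun χ => ?_)
            (fun χ hχ l₁ l₂ hl S hS x z hx hz o ho => ?_) χ
          · have e : syndromeFlags.map (fun q => if q.2 = 0 then (0 : ZMod 2) else 0) = [0, 0] := by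
              simp [syndromeFlags]
            rw [e]
            have e2 : rec ++ zeros (flagCount t) ++ zeros (2 * rs₁.length) ++ [0, 0] =
                rec ++ zeros (flagCount t) ++ zeros (2 * (rs₁ ++ [r]).length) := by
              rw [List.append_assoc _ (zeros _), List.length_append, mul_add, zeros_add]; rfl
            rw [e2]
            exact ihr _ (by simpa using hrs) χ
          · refine errSpan_le (fun a c hac χ => ?_)
              (flagged_fault hstep.inCode hχ hl hS hx hz ho)
            obtain ⟨b, f, rfl⟩ := List.length_eq_two.1 ho
            simp only [List.getD_cons_zero, List.getD_cons_succ] at hac ⊢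
            by_cases hbf : b = 0 ∧ f = 0
            -- The fault in this check went unnoticed and left a single-qubit error, which the
            -- remaining checks meet midway.
            · rw [if_pos hbf, hbf.1, hbf.2]
              have e2 : rec ++ zeros (flagCount t) ++ zeros (2 * rs₁.length) ++ [0, 0] =
                  rec ++ zeros (flagCount t) ++ zeros (2 * (rs₁ ++ [r]).length) := by
                rw [List.append_assoc _ (zeros _), List.length_append, mul_add, zeros_add]; rfl
              rw [e2]
              have hs := hac.2 hbf.2
              exact xCorrection_mem_safe (h.sub t (by simp)) h.clean hn hstep hsing
                (length_zeros _) ⟨fun _ => Or.inl hs, fun h => absurd rfl h⟩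
                (rs₁ := rs₁ ++ [r]) (by simpa using hrs) (Or.inr ⟨hs, rfl⟩) χ
            · rw [if_neg hbf]
              have hfire : (a, c) ∈ firedErr t (zeros (flagCount t)) r f :=
                ⟨fun h => absurd rfl h, fun _ => ⟨hac.1, fun h => Or.inl (hac.2 h)⟩⟩
              have hdec := decode_fired h.clean (h.sub t (by simp)) hn (length_zeros _) hrs hbf
                hfire
              refine extract_mem_safe hstep.inCode _ _ ?_ (fun χ => ?_) χ
              · have := (hdec []).1
                rwa [List.append_nil] at this
              · refine phase_mem_safe hstep.code ts hstep.inCode hstep.gates _ (fun m => ?_) χ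
                refine finalRule_zero _ _ ?_
                have := (hdec (zeros m)).2
                rwa [← List.append_assoc] at this
      · refine errSpan_le (fun a c hac χ => ?_)
          (hfault d χ hχ l₁ l₂ hl S hS x z hx hz o ho)
        have := xCorrection_mem_safe (h.sub t (by simp)) h.clean hn hstep hsing
          (ho.trans hlen) hac (rs₁ := []) rfl (Or.inl (by simp)) χ
        rwa [List.length_nil, mul_zero, zeros, List.replicate_zero, List.append_nil] at this

end Protocol

/-! ### The round-robin circuit -/

theorem applyGates_roundRobin (ts : List Triple) (ψ : State (Fin 15)) (y : Fin 15 → ZMod 2) :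
    applyGates (ts.map roundRobinGate) ψ y =
      sgn ((ts.map fun t => y t.1 * y t.2.1 * y t.2.2).sum) * ψ y := by
  induction ts generalizing ψ with
  | nil => simp
  | cons t ts ih =>
    rw [List.map_cons, applyGates_cons, ih, roundRobinGate_apply, List.map_cons, List.sum_cons,
      sgn_add]
    ring

/-- Summing the monomials over the product of the three supports gives the product of three linear
forms, which are the values of the three logical `Z` parities; `eq_of_rows` identifies them with the
logical bits. -/
theorem encode_roundRobin {SX SZ : Matrix (Fin 7) (Fin 15) (ZMod 2)} (h : IsLogicalBasis SX SZ)
    (hT : HasTargetLogicals SZ) {order : List Triple} (ho : order.Perm triples)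
    (φ : State (Fin 7)) :
    applyGates (order.map roundRobinGate) (encode SX φ) = encode SX (logicalCCZ *ᵥ φ) := by
  ext y
  rw [applyGates_roundRobin, h.eq_of_rows, h.eq_of_rows]
  split_ifs with hy
  · have e : (order.map fun t => y t.1 * y t.2.1 * y t.2.2).sum =
        (SZ *ᵥ y) 0 * (SZ *ᵥ y) 1 * (SZ *ᵥ y) 2 := by
      rw [(ho.map _).sum_eq]
      simp only [Matrix.mulVec, hT.1, hT.2.1, hT.2.2]
      simp [triples, dotProduct, indicator, Fin.sum_univ_succ, qb, SProd.sprod, List.product]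
      ring_nf
    rw [e, logicalCCZ, Matrix.mulVec_diagonal]
    ring
  · rw [mul_zero]

theorem faultTolerant_cczProtocol {SX SZ : Matrix (Fin 7) (Fin 15) (ZMod 2)}
    (h : IsLogicalBasis SX SZ) (hT : HasTargetLogicals SZ) {order : List Triple}
    (ho : order.Perm triples) :
    FaultTolerant SX (cczProtocol order (xRule order) (finalRule order)) logicalCCZ := by
  intro φ χ ψ' hrun
  have hr : Remaining order order [] (encode SX φ) (encode SX (logicalCCZ *ᵥ φ)) :=
    ⟨fun _ => rfl, fun t ht => ho.mem_iff.1 ht, h.range_encode ▸ ⟨_, rfl⟩, h.inCode φ,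
      encode_roundRobin h hT ho φ⟩
  obtain ⟨χ', h'⟩ := mem_of_run_one hrun (safe1_protocolFrom hr χ)
  exact ⟨χ', h'.symm⟩

/-! ### A logical basis with the three given operators -/

/-- Logical `X` operators. -/
def exampleX : Matrix (Fin 7) (Fin 15) (ZMod 2) :=
  !![1,0,1,1,1,1,0,0,1,0,0,1,0,0,0;
     0,0,0,0,0,0,1,1,1,1,0,1,0,0,0;
     1,0,1,0,1,0,1,0,0,0,0,0,0,0,0;
     1,1,1,0,1,1,0,0,1,1,0,0,0,0,0;
     0,1,1,1,1,1,1,1,1,0,0,0,0,0,0;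
     0,1,1,0,0,1,1,0,0,0,0,0,0,0,0;
     0,0,0,1,1,1,1,0,0,0,0,0,0,0,0]

/-- Logical `Z` operators. -/
def exampleZ : Matrix (Fin 7) (Fin 15) (ZMod 2) :=
  !![1,0,0,1,1,0,0,0,0,0,0,0,0,0,0;
     1,0,0,0,0,1,1,0,0,0,0,0,0,0,0;
     1,0,0,0,0,0,0,1,1,0,0,0,0,0,0;
     1,1,1,0,0,0,0,0,0,0,0,0,0,0,0;
     0,1,0,1,0,1,0,0,0,0,0,0,0,0,0;
     0,1,0,0,0,0,0,1,0,1,0,0,0,0,0;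
     0,0,0,1,0,0,0,1,0,0,0,1,0,0,0]

theorem isLogicalBasis_example : IsLogicalBasis exampleX exampleZ := by
  refine ⟨?_, ?_, ?_⟩ <;> decide +kernel

theorem hasTargetLogicals_example : HasTargetLogicals exampleZ := by
  refine ⟨?_, ?_, ?_⟩ <;> decide +kernel

/-! ### Closed subgroups of a unitary group and their one-parameter subgroups -/

section Lie

open NormedSpace selfAdjoint Filter Topology

variable {A : Type*} [CStarAlgebra A]

/-- Telescoping: exchanging one factor at a time costs at most `‖x - y‖`, as powers of contractions
are contractions. -/
theorem norm_pow_sub_pow_le {x y : A} (hx : ‖x‖ ≤ 1) (hy : ‖y‖ ≤ 1) (n : ℕ) :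
    ‖x ^ n - y ^ n‖ ≤ n * ‖x - y‖ := by
  induction n with
  | zero => simp
  | succ n ih =>
    have e : x ^ (n + 1) - y ^ (n + 1) = x ^ n * (x - y) + (x ^ n - y ^ n) * y := by
      rw [pow_succ, pow_succ]; noncomm_ring
    have h1 : ‖x ^ n * (x - y)‖ ≤ ‖x - y‖ := by
      rcases n.eq_zero_or_pos with rfl | hn
      · simp
      · exact (norm_mul_le _ _).trans (mul_le_of_le_one_left (norm_nonneg _)
          ((norm_pow_le' x hn).trans (pow_le_one₀ (norm_nonneg _) hx)))
    have h2 : ‖(x ^ n - y ^ n) * y‖ ≤ n * ‖x - y‖ :=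
      (norm_mul_le _ _).trans ((mul_le_of_le_one_right (norm_nonneg _) hy).trans ih)
    rw [e]
    push_cast
    linarith [norm_add_le (x ^ n * (x - y)) ((x ^ n - y ^ n) * y)]

theorem norm_unitary_le_one (u : unitary A) : ‖(u : A)‖ ≤ 1 := by
  nontriviality A
  exact (CStarRing.norm_coe_unitary u).le

theorem expUnitary_smul_coe (t : ℝ) (a : selfAdjoint A) :
    (expUnitary (t • a) : A) = exp (t • (Complex.I • (a : A))) := by
  rw [expUnitary_coe, selfAdjoint.val_smul, smul_comm]

theorem expUnitary_add_smul (s t : ℝ) (a : selfAdjoint A) :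
    expUnitary ((s + t) • a) = expUnitary (s • a) * expUnitary (t • a) := by
  rw [add_smul, Commute.expUnitary_add]
  rw [selfAdjoint.val_smul, selfAdjoint.val_smul]
  exact ((Commute.refl (a : A)).smul_left s).smul_right t

/-- The Lie product formula. -/
theorem tendsto_expUnitary_add (a b : selfAdjoint A) :
    Tendsto (fun n : ℕ => (expUnitary ((n : ℝ)⁻¹ • a) * expUnitary ((n : ℝ)⁻¹ • b)) ^ n) atTop
      (𝓝 (expUnitary (a + b))) := by
  rw [tendsto_subtype_rng]
  -- The difference vanishes to first order at `0`, so `n * ‖f (1 / n)‖` tends to `0`, and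
  -- telescoping transfers this bound to the `n`-th powers.
  set f : ℝ → A := fun s => (expUnitary (s • a) : A) * (expUnitary (s • b) : A) -
    (expUnitary (s • (a + b)) : A) with hf
  have hd (c : selfAdjoint A) : HasDerivAt (fun s : ℝ => (expUnitary (s • c) : A))
      (Complex.I • (c : A)) 0 := by
    have := hasDerivAt_exp_smul_const (𝕂 := ℝ) (Complex.I • (c : A)) 0
    simp only [zero_smul, exp_zero, one_mul] at this
    simpa only [expUnitary_smul_coe] using this
  have hf0 : f 0 = 0 := by simp [hf]
  have hf' : HasDerivAt f 0 0 := by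
    have := ((hd a).mul (hd b)).sub (hd (a + b))
    simp only [zero_smul, expUnitary_zero, OneMemClass.coe_one, mul_one, one_mul,
      AddSubgroup.coe_add, smul_add, sub_self] at this
    simpa only [hf, smul_add] using! this
  have hlim : Tendsto (fun n : ℕ => (n : ℝ) * ‖f ((n : ℝ)⁻¹)‖) atTop (𝓝 0) := by
    have h1 := (hasDerivAt_iff_tendsto_slope_zero.1 hf').norm
    have h2 : Tendsto (fun n : ℕ => ((n : ℝ)⁻¹)) atTop (𝓝[≠] 0) := by
      refine tendsto_nhdsWithin_iff.2 ⟨tendsto_inv_atTop_nhds_zero_nat, ?_⟩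
      filter_upwards [eventually_gt_atTop 0] with n hn
      simp [hn.ne']
    have h3 := h1.comp h2
    rw [norm_zero] at h3
    refine h3.congr fun n => ?_
    simp [hf0, norm_smul]
  refine tendsto_iff_norm_sub_tendsto_zero.2 (squeeze_zero' (Eventually.of_forall fun n =>
    norm_nonneg _) ?_ hlim)
  filter_upwards [eventually_gt_atTop 0] with n hn
  have e : expUnitary (a + b) = expUnitary ((n : ℝ)⁻¹ • (a + b)) ^ n := by
    have : ∀ (m : ℕ) (c : selfAdjoint A), expUnitary c ^ m = expUnitary ((m : ℝ) • c) := by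
      intro m c
      induction m with
      | zero => simp
      | succ m ih =>
        rw [pow_succ, ih, Nat.cast_succ, expUnitary_add_smul, one_smul]
    rw [this, smul_smul, mul_inv_cancel₀ (by positivity), one_smul]
  rw [e]
  push_cast
  refine (norm_pow_sub_pow_le ?_ (norm_unitary_le_one _) n).trans_eq rfl
  exact norm_unitary_le_one (expUnitary ((n : ℝ)⁻¹ • a) * expUnitary ((n : ℝ)⁻¹ • b))

/-- The generators of the one-parameter subgroups of a closed subgroup of the unitary group. -/
def lieAlg (Γ : Subgroup (unitary A)) (hΓ : IsClosed (Γ : Set (unitary A))) :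
    Submodule ℝ (selfAdjoint A) where
  carrier := {a | ∀ t : ℝ, expUnitary (t • a) ∈ Γ}
  zero_mem' t := by simp [Γ.one_mem]
  smul_mem' c a ha t := by rw [smul_smul]; exact ha _
  add_mem' {a b} ha hb t := by
    rw [smul_add]
    refine hΓ.mem_of_tendsto (tendsto_expUnitary_add (t • a) (t • b))
      (Eventually.of_forall fun n => Γ.pow_mem (Γ.mul_mem ?_ ?_) n)
    · rw [smul_smul]; exact ha _
    · rw [smul_smul]; exact hb _

variable {Γ : Subgroup (unitary A)} {hΓ : IsClosed (Γ : Set (unitary A))}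

theorem mem_lieAlg {a : selfAdjoint A} : a ∈ lieAlg Γ hΓ ↔ ∀ t : ℝ, expUnitary (t • a) ∈ Γ := Iff.rfl

/-- Conjugation by `u` carries the one-parameter group of `a` to that of `b`. -/
theorem lieAlg_conj {a b : selfAdjoint A} {u : unitary A} (hu : u ∈ Γ) (ha : a ∈ lieAlg Γ hΓ)
    (h : (u : A) * a = b * u) : b ∈ lieAlg Γ hΓ := by
  let _ : NormedAlgebra ℚ A := .restrictScalars ℚ ℂ A
  intro t
  have e : expUnitary (t • b) = u * expUnitary (t • a) * u⁻¹ := by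
    rw [eq_mul_inv_iff_mul_eq]
    ext
    simp only [Submonoid.coe_mul, expUnitary_smul_coe]
    have hb : t • (Complex.I • (b : A)) =
        Unitary.toUnits u * (t • (Complex.I • (a : A))) * ((Unitary.toUnits u)⁻¹ : Aˣ) := by
      rw [Units.eq_mul_inv_iff_mul_eq, Unitary.val_toUnits_apply]
      simp only [mul_smul_comm, smul_mul_assoc, h]
    rw [hb, exp_units_conj, ← Unitary.val_toUnits_apply u, Units.inv_mul_cancel_right]
  rw [e]
  exact Γ.mul_mem (Γ.mul_mem hu (ha t)) (Γ.inv_mem hu)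

/-- The exponential of an element with `j ^ 3 = j`. -/
theorem exp_of_pow_three {j : A} (hj : j ^ 3 = j) (t : ℝ) : exp (t • (Complex.I • j)) =
    1 + (Complex.I * Complex.sin t) • j + (Complex.cos t - 1) • j ^ 2 := by
  let _ : NormedAlgebra ℚ A := .restrictScalars ℚ ℂ A
  set x : A := Complex.I • j with hx
  -- `R` is the claimed exponential. It satisfies the differential equation of `exp (t • x)`, so `R
  -- t * exp (t • -x)` is constant.
  set R : ℝ → A := fun t => 1 + (Complex.I * Complex.sin t) • j + (Complex.cos t - 1) • j ^ 2 with hR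
  have hcos (t : ℝ) : HasDerivAt (fun t : ℝ => Complex.cos t - 1) (-Complex.sin t) t :=
    ((Complex.hasDerivAt_cos (t : ℂ)).comp_ofReal).sub_const 1
  have hsin (t : ℝ) : HasDerivAt (fun t : ℝ => Complex.I * Complex.sin t)
      (Complex.I * Complex.cos t) t :=
    ((Complex.hasDerivAt_sin (t : ℂ)).comp_ofReal).const_mul _
  have hRd (t : ℝ) : HasDerivAt R (R t * x) t := by
    have e : R t * x = (Complex.I * Complex.cos t) • j + (-Complex.sin t) • j ^ 2 := by
      have h2 : j ^ 2 * j = j := by rw [← pow_succ, hj]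
      simp only [hR, hx, add_mul, one_mul, smul_mul_assoc, mul_smul_comm, h2, ← sq]
      match_scalars
      · ring
      · linear_combination Complex.sin t * Complex.I_mul_I
    rw [e]
    exact (((hsin t).smul_const j).const_add 1).add ((hcos t).smul_const (j ^ 2))
  have hE (t : ℝ) : HasDerivAt (fun t : ℝ => exp (t • -x)) (-x * exp (t • -x)) t :=
    hasDerivAt_exp_smul_const' (𝕂 := ℝ) (-x) t
  have hF (t : ℝ) : HasDerivAt (fun t => R t * exp (t • -x)) 0 t := by
    have := (hRd t).mul (hE t)
    rwa [neg_mul, mul_neg, mul_assoc, add_neg_cancel] at this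
  have h1 : R t * exp (t • -x) = 1 := by
    have := is_const_of_deriv_eq_zero (fun t => (hF t).differentiableAt)
      (fun t => (hF t).deriv) t 0
    simpa [hR] using this
  have h2 : exp (t • -x) * exp (t • x) = 1 := by
    rw [smul_neg, ← exp_add_of_commute (Commute.neg_left (Commute.refl _)), neg_add_cancel, exp_zero]
  calc exp (t • x) = R t * exp (t • -x) * exp (t • x) := by rw [h1, one_mul]
    _ = R t := by rw [mul_assoc, h2, mul_one]

theorem expUnitary_of_pow_three {j : selfAdjoint A} (hj : (j : A) ^ 3 = j) (t : ℝ) :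
    (expUnitary (t • j) : A) =
      1 + (Complex.I * Complex.sin t) • (j : A) + (Complex.cos t - 1) • (j : A) ^ 2 := by
  rw [expUnitary_smul_coe, exp_of_pow_three hj]

/-- As `j ^ 3 = j`, the one-parameter group is `2π`-periodic. The parameters whose exponential lies
in `Γ` form a closed subgroup of `ℝ` containing `θ` and `2π`; by irrationality it is dense, hence
everything. -/
theorem mem_lieAlg_of_irrational {j : selfAdjoint A} (hj : (j : A) ^ 3 = j) {θ : ℝ}
    (hθ : Irrational (θ / (2 * Real.pi))) (h : expUnitary (θ • j) ∈ Γ) : j ∈ lieAlg Γ hΓ := by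
  let S : AddSubgroup ℝ :=
    { carrier := {t | expUnitary (t • j) ∈ Γ}
      zero_mem' := by simp [Γ.one_mem]
      add_mem' := fun {s t} hs ht => by
        change expUnitary ((s + t) • j) ∈ Γ
        rw [expUnitary_add_smul]; exact Γ.mul_mem hs ht
      neg_mem' := fun {t} ht => by
        have e : expUnitary ((-t) • j) = (expUnitary (t • j))⁻¹ := by
          rw [eq_inv_iff_mul_eq_one, ← expUnitary_add_smul, neg_add_cancel, zero_smul,
            expUnitary_zero]
        change expUnitary ((-t) • j) ∈ Γ
        rw [e]; exact Γ.inv_mem ht }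
  have hcont : Continuous fun t : ℝ => expUnitary (t • j) :=
    continuous_expUnitary.comp (continuous_id.smul continuous_const)
  have hS : IsClosed (S : Set ℝ) := hΓ.preimage hcont
  have h2 : 2 * Real.pi ∈ S := by
    have e : expUnitary ((2 * Real.pi) • j) = 1 := by
      ext
      rw [expUnitary_of_pow_three hj]
      push_cast
      simp
    change expUnitary _ ∈ Γ
    rw [e]; exact Γ.one_mem
  have hsub : AddSubgroup.closure {θ, 2 * Real.pi} ≤ S := by
    rw [AddSubgroup.closure_le]
    rintro x (rfl | rfl)
    · exact h
    · exact h2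
  have hd := (dense_addSubgroupClosure_pair_iff.2 hθ).mono (SetLike.coe_subset_coe.2 hsub)
  intro t
  have := hd.closure_eq ▸ Set.mem_univ t
  rwa [hS.closure_eq] at this

/-- Rotating one of two anticommuting generators about the other. -/
theorem mul_mem_lieAlg {a b c : selfAdjoint A} (ha : a ∈ lieAlg Γ hΓ) (hb : b ∈ lieAlg Γ hΓ)
    (ha2 : (a : A) * a = 1) (hab : (b : A) * a = -(a * b)) (hc : (c : A) = Complex.I • ((a : A) * b)) :
    c ∈ lieAlg Γ hΓ := by
  -- Conjugating `b` by `exp (i s a)` gives `exp (2 i s a) * b` because `a` and `b` anticommute; at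
  -- `s = π / 4` this is `i a b`.
  refine lieAlg_conj (ha (Real.pi / 4)) hb ?_
  have h3 : (a : A) ^ 3 = a := by rw [pow_succ, sq, ha2, one_mul]
  have h4 : (a : A) * b * a = -b := by
    rw [mul_assoc, hab, mul_neg, ← mul_assoc, ha2, one_mul]
  rw [expUnitary_of_pow_three h3, hc]
  have e1 : Complex.sin ((Real.pi / 4 : ℝ) : ℂ) = Complex.cos ((Real.pi / 4 : ℝ) : ℂ) := by
    rw [← Complex.ofReal_sin, ← Complex.ofReal_cos, Real.sin_pi_div_four, Real.cos_pi_div_four]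
  rw [sq, ha2, e1]
  generalize Complex.cos ((Real.pi / 4 : ℝ) : ℂ) = s
  simp only [add_mul, mul_add, mul_one, one_mul, smul_mul_assoc, mul_smul_comm, smul_smul, h4,
    smul_neg]
  match_scalars
  · linear_combination s * Complex.I_mul_I
  · ring

/-- A finite spectrum misses some point of the circle. Multiplying `u` by a phase moves this point
to `-1`, and then `u` has a logarithm. The phase itself is an exponential of a multiple of `1`. -/
theorem eq_top_of_lieAlg (h : lieAlg Γ hΓ = ⊤)
    (hfin : ∀ u : unitary A, (spectrum ℂ (u : A)).Finite) : Γ = ⊤ := by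
  rw [eq_top_iff]
  intro u _
  have hall (a : selfAdjoint A) : expUnitary a ∈ Γ := by
    have := mem_lieAlg.1 (h ▸ Submodule.mem_top : a ∈ lieAlg Γ hΓ) 1
    rwa [one_smul] at this
  obtain ⟨θ, hθ⟩ : ∃ θ : ℝ, -Complex.exp (θ * Complex.I) ∉ spectrum ℂ (u : A) := by
    by_contra! hcon
    have hinj : Set.InjOn (fun θ : ℝ => -Complex.exp (θ * Complex.I)) (Set.Ioc (-Real.pi) Real.pi) := by
      intro a ha b hb hab
      have := congrArg Complex.arg (neg_injective hab)
      rwa [Complex.arg_exp_mul_I, Complex.arg_exp_mul_I, (toIocMod_eq_self _).2 (by simpa [two_mul] using ha),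
        (toIocMod_eq_self _).2 (by simpa [two_mul] using hb)] at this
    exact (Set.infinite_of_injOn_mapsTo hinj (fun θ _ => hcon θ)
      (Set.Ioc_infinite (by linarith [Real.pi_pos]))) (hfin u)
  set v : unitary A := expUnitary ((-θ) • (1 : selfAdjoint A)) * u with hv
  have hvu : (v : A) = Complex.exp (-(θ * Complex.I)) • (u : A) := by
    rw [hv, Submonoid.coe_mul, expUnitary_smul_coe]
    have : (-θ) • (Complex.I • ((1 : selfAdjoint A) : A)) =
        algebraMap ℂ A (-(θ * Complex.I)) := by
      rw [Algebra.algebraMap_eq_smul_one, selfAdjoint.val_one, ← Complex.coe_smul, smul_smul]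
      push_cast
      rw [neg_mul]
    rw [this, ← algebraMap_exp_comm, ← Complex.exp_eq_exp_ℂ, Algebra.algebraMap_eq_smul_one,
      smul_mul_assoc, one_mul]
  have hnorm : ‖(v - 1 : A)‖ < 2 := by
    rw [Unitary.norm_sub_one_lt_two_iff v.2, hvu]
    intro hmem
    apply hθ
    set c : ℂˣ := Units.mk0 (Complex.exp (-(θ * Complex.I))) (Complex.exp_ne_zero _) with hc
    have h1 := (spectrum.smul_mem_smul_iff (R := ℂ) (a := (u : A)) (s := -Complex.exp (θ * Complex.I))
      (r := c)).1
    apply h1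
    have e1 : c • -Complex.exp (θ * Complex.I) = -1 := by
      rw [Units.smul_def, hc, Units.val_mk0, smul_eq_mul, mul_neg, ← Complex.exp_add,
        neg_add_cancel, Complex.exp_zero]
    rw [e1]
    exact hmem
  have e : u = (expUnitary ((-θ) • (1 : selfAdjoint A)))⁻¹ * expUnitary (Unitary.argSelfAdjoint v) := by
    rw [expUnitary_argSelfAdjoint hnorm, hv, inv_mul_cancel_left]
  rw [e]
  exact Γ.mul_mem (Γ.inv_mem (hall _)) (hall _)

theorem compactSpace_unitary [ProperSpace A] : CompactSpace (unitary A) := by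
  refine isCompact_iff_compactSpace.1 ?_
  refine Metric.isCompact_of_isClosed_isBounded isClosed_unitary
    (Metric.isBounded_iff_subset_closedBall (0 : A) |>.2 ⟨1, fun u hu => ?_⟩)
  rw [mem_closedBall_zero_iff]
  exact norm_unitary_le_one ⟨u, hu⟩

end Lie

/-! ### Hadamard and phase gates -/

section OneQubit

variable {W : Type} [Fintype W] [DecidableEq W]

theorem update_eq_of_add (y : W → ZMod 2) (w : W) (b : ZMod 2) :
    Function.update y w b = y + Pi.single w (y w + b) := by
  ext w'
  by_cases h : w' = w
  · subst h; simp [← add_assoc, zmod2_add_self]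
  · simp [h]

theorem h_apply (w : W) (ψ : State W) (y : W → ZMod 2) : (Gate.h w).apply ψ y =
    ((Real.sqrt 2 : ℝ) : ℂ)⁻¹ * (sgn (y w) * ψ y + ψ (y + Pi.single w 1)) := by
  simp only [Gate.apply, sum_zmod2, update_eq_of_add]
  rcases zmod2_cases (y w) with h | h <;> simp [h, zmod2_add_self, add_comm]

theorem h_pauli (w : W) (x z : W → ZMod 2) (ψ : State W) :
    (Gate.h w).apply (pauli x z ψ) = sgn (x w * z w) •
      pauli (Function.update x w (z w)) (Function.update z w (x w)) ((Gate.h w).apply ψ) := by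
  ext y
  simp only [h_apply, pauli, Pi.smul_apply, smul_eq_mul, update_eq_of_add, add_dotProduct,
    dotProduct_add, sgn_add, single_dotProduct, dotProduct_single, Pi.add_apply, Pi.single_eq_same,
    mul_one]
  have e1 : y + (x + Pi.single w (x w + z w)) + Pi.single w 1 =
    y + x + Pi.single w (x w + z w + 1) := by
    simp only [Pi.single_add, add_assoc]
  have e2 : y + Pi.single w 1 + x = y + x + Pi.single w 1 := add_right_comm _ _ _
  rw [e1, e2, ← add_assoc]
  rcases zmod2_cases (x w) with hx | hx <;> rcases zmod2_cases (z w) with hz | hz <;>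
    rcases zmod2_cases (y w) with hy | hy <;> simp [hx, hz, hy, zmod2_add_self] <;> ring

/-- The power of `i` that a phase gate contributes on a bit flip. -/
def phaseOf (b : ZMod 2) : ℂ := if b = 0 then 1 else -Complex.I

theorem s_pauli (w : W) (x z : W → ZMod 2) (ψ : State W) :
    (Gate.s w).apply (pauli x z ψ) =
      phaseOf (x w) • pauli x (Function.update z w (z w + x w)) ((Gate.s w).apply ψ) := by
  ext y
  simp only [Gate.apply, pauli, Pi.smul_apply, smul_eq_mul, update_eq_of_add, add_dotProduct,
    sgn_add, single_dotProduct, Pi.add_apply]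
  rw [← add_assoc, zmod2_add_self, zero_add]
  rcases zmod2_cases (x w) with hx | hx <;> rcases zmod2_cases (y w) with hy | hy <;>
    simp [hx, hy, zmod2_add_self, phaseOf]
  · ring
  · linear_combination sgn (z ⬝ᵥ y) * ψ (y + x) * Complex.I_mul_I

/-- The inner product of two states is preserved. -/
def IsIsometry (V : State W → State W) : Prop := ∀ ψ φ, star (V ψ) ⬝ᵥ V φ = star ψ ⬝ᵥ φ

theorem star_sgn (b : ZMod 2) : star (sgn b) = sgn b := by
  rcases zmod2_cases b with rfl | rfl <;> simp

theorem isIsometry_h (w : W) : IsIsometry (Gate.h w).apply := by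
  intro ψ φ
  have hs : ((Real.sqrt 2 : ℝ) : ℂ)⁻¹ * ((Real.sqrt 2 : ℝ) : ℂ)⁻¹ = 1 / 2 := by
    rw [← mul_inv, ← Complex.ofReal_mul, Real.mul_self_sqrt zero_le_two]; norm_num
  have e (y : W → ZMod 2) : star ((Gate.h w).apply ψ y) * (Gate.h w).apply φ y =
      (1 / 2) * (star (ψ y) * φ y) +
      (1 / 2) * (star (ψ (y + Pi.single w 1)) * φ (y + Pi.single w 1)) +
      (1 / 2) * (sgn (y w) * (star (ψ y) * φ (y + Pi.single w 1)) +
        sgn (y w) * (star (ψ (y + Pi.single w 1)) * φ y)) := by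
    rw [h_apply, h_apply]
    simp only [star_mul', star_add, star_sgn, star_inv₀]
    have h1 : star ((Real.sqrt 2 : ℝ) : ℂ) = ((Real.sqrt 2 : ℝ) : ℂ) := Complex.conj_ofReal _
    rw [h1]
    linear_combination ((sgn (y w) * star (ψ y) + star (ψ (y + Pi.single w 1))) *
      (sgn (y w) * φ y + φ (y + Pi.single w 1))) * hs +
      (1 / 2) * (star (ψ y) * φ y) * sgn_mul_self (y w)
  have shift (f : (W → ZMod 2) → ℂ) : ∑ y, f (y + (Pi.single w 1 : W → ZMod 2)) = ∑ y, f y :=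
    Equiv.sum_comp (Equiv.addRight (Pi.single w 1 : W → ZMod 2)) f
  -- Shifting the summation index by the basis vector of `w` reverses the sign, so the cross terms
  -- cancel.
  have anti : ∑ y : W → ZMod 2, sgn (y w) * (star (ψ (y + Pi.single w 1)) * φ y) =
      -∑ y : W → ZMod 2, sgn (y w) * (star (ψ y) * φ (y + Pi.single w 1)) := by
    rw [← shift, ← Finset.sum_neg_distrib]
    refine Finset.sum_congr rfl fun y _ => ?_
    rw [add_assoc, ← Pi.single_add, zmod2_add_self, Pi.single_zero, add_zero, Pi.add_apply,
      Pi.single_eq_same, sgn_add, sgn_one]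
    ring
  simp only [dotProduct, Pi.star_apply, e, Finset.sum_add_distrib, ← Finset.mul_sum, anti]
  rw [shift fun y => star (ψ y) * φ y]
  ring

theorem isIsometry_s (w : W) : IsIsometry (Gate.s w).apply := by
  intro ψ φ
  refine Finset.sum_congr rfl fun y _ => ?_
  simp only [Gate.apply, Pi.star_apply, star_mul']
  rcases zmod2_cases (y w) with hy | hy <;> simp [hy]
  linear_combination (-starRingEnd ℂ (ψ y) * φ y) * Complex.I_mul_I

theorem isIsometry_applyGates {gs : List (Gate W)} (h : ∀ g ∈ gs, IsIsometry g.apply) :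
    IsIsometry (applyGates gs) := by
  induction gs with
  | nil => intro ψ φ; rfl
  | cons g gs ih =>
    intro ψ φ
    rw [applyGates_cons, applyGates_cons, ih (fun g' hg => h g' (by simp [hg])), h g (by simp)]

theorem hs_pauli {l : List W} (hl : l.Nodup) (x z : W → ZMod 2) (ψ : State W) :
    applyGates (l.map Gate.h) (pauli x z ψ) = sgn ((l.map fun w => x w * z w).sum) •
      pauli (fun w => if w ∈ l then z w else x w) (fun w => if w ∈ l then x w else z w)
        (applyGates (l.map Gate.h) ψ) := by
  induction l generalizing x z ψ with
  | nil => simp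
  | cons w l ih =>
    obtain ⟨hw, hl⟩ := List.nodup_cons.1 hl
    rw [List.map_cons, applyGates_cons, applyGates_cons, h_pauli, ← gatesLin_apply, map_smul,
      gatesLin_apply, ih hl, smul_smul, List.map_cons, List.sum_cons, sgn_add]
    congr 1
    · congr 3
      refine List.map_congr_left fun v hv => ?_
      have : v ≠ w := fun e => hw (e ▸ hv)
      simp [this]
    · congr 1 <;> ext v <;> by_cases hv : v = w
      · subst hv; simp [hw]
      · simp [hv]
      · subst hv; simp [hw]
      · simp [hv]

theorem ss_pauli {l : List W} (hl : l.Nodup) (x z : W → ZMod 2) (ψ : State W) :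
    applyGates (l.map Gate.s) (pauli x z ψ) = (l.map fun w => phaseOf (x w)).prod •
      pauli x (fun w => if w ∈ l then z w + x w else z w) (applyGates (l.map Gate.s) ψ) := by
  induction l generalizing x z ψ with
  | nil => simp
  | cons w l ih =>
    obtain ⟨hw, hl⟩ := List.nodup_cons.1 hl
    rw [List.map_cons, applyGates_cons, applyGates_cons, s_pauli, ← gatesLin_apply, map_smul,
      gatesLin_apply, ih hl, smul_smul, List.map_cons, List.prod_cons]
    congr 2
    ext v
    by_cases hv : v = w
    · subst hv; simp [hw]
    · simp [hv]

theorem applyGates_h_pauli {n : ℕ} (x z : Fin n → ZMod 2) (ψ : State (Fin n)) :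
    applyGates ((List.finRange n).map Gate.h) (pauli x z ψ) =
      sgn (x ⬝ᵥ z) • pauli z x (applyGates ((List.finRange n).map Gate.h) ψ) := by
  rw [hs_pauli (List.nodup_finRange n), dotProduct, Fin.sum_univ_def]
  simp only [List.mem_finRange, if_true]

theorem applyGates_s_pauli {n : ℕ} (x z : Fin n → ZMod 2) (ψ : State (Fin n)) :
    applyGates ((List.finRange n).map Gate.s) (pauli x z ψ) =
      (∏ q, phaseOf (x q)) • pauli x (z + x) (applyGates ((List.finRange n).map Gate.s) ψ) := by
  rw [ss_pauli (List.nodup_finRange n), Fin.prod_univ_def]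
  simp only [List.mem_finRange, if_true]
  rfl

end OneQubit

/-! ### Permutations of the wires -/

section Swaps

variable {W : Type} [Fintype W] [DecidableEq W]

/-- A pair of different wires. -/
abbrev Pair (W : Type) := {p : W × W // p.1 ≠ p.2}

/-- A swap gate, made of three CNOT gates. -/
def swapGates (p : Pair W) : List (Gate W) :=
  [.cnot p.1.1 p.1.2 p.2, .cnot p.1.2 p.1.1 p.2.symm, .cnot p.1.1 p.1.2 p.2]

/-- The wire to which a sequence of swaps moves a wire. -/
def track (ps : List (Pair W)) (w : W) : W := ps.foldl (fun w p => Equiv.swap p.1.1 p.1.2 w) w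

theorem applyGates_swapGates (p : Pair W) (ψ : State W) (y : W → ZMod 2) :
    applyGates (swapGates p) ψ y = ψ fun w => y (Equiv.swap p.1.1 p.1.2 w) := by
  obtain ⟨⟨u, v⟩, h : u ≠ v⟩ := p
  simp only [swapGates, applyGates_cons, applyGates_nil, Gate.apply]
  congr 1
  ext w
  by_cases hu : w = u
  · subst hu
    simp [h, h.symm]
    generalize y w = a; generalize y v = b
    revert a b; decide
  · by_cases hv : w = v
    · subst hv
      simp [h, h.symm]
      generalize y w = a; generalize y u = b
      revert a b; decide
    · simp [hu, hv, Equiv.swap_apply_of_ne_of_ne hu hv]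

theorem applyGates_swaps (ps : List (Pair W)) (ψ : State W) (y : W → ZMod 2) :
    applyGates (ps.flatMap swapGates) ψ y = ψ fun w => y (track ps w) := by
  induction ps generalizing ψ with
  | nil => rfl
  | cons p ps ih =>
    rw [List.flatMap_cons, applyGates_append, ih, applyGates_swapGates]
    rfl

theorem track_injective (ps : List (Pair W)) : Function.Injective (track ps) := by
  induction ps with
  | nil => exact fun _ _ h => h
  | cons p ps ih => exact fun a b h => (Equiv.swap p.1.1 p.1.2).injective (ih h)

theorem track_bijective (ps : List (Pair W)) : Function.Bijective (track ps) :=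
  Finite.injective_iff_bijective.1 (track_injective ps)

/-- The permutation of the wires by a sequence of swaps. -/
def trackEquiv (ps : List (Pair W)) : Equiv.Perm W := Equiv.ofBijective _ (track_bijective ps)

theorem pauli_comp_perm {W' : Type} [Fintype W'] (π : Equiv.Perm W') (x z : W' → ZMod 2)
    (ψ : State W') (y : W' → ZMod 2) : pauli x z ψ (y ∘ π) =
      pauli (x ∘ π.symm) (z ∘ π.symm) (fun y => ψ (y ∘ π)) y := by
  simp only [pauli]
  congr 1
  · congr 1
    rw [comp_equiv_symm_dotProduct]
  · congr 1
    ext w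
    simp

theorem swaps_pauli (ps : List (Pair W)) {S : Set W} {x z : W → ZMod 2} (hx : SuppIn S x)
    (hz : SuppIn S z) : ∃ x' z', SuppIn (track ps '' S) x' ∧ SuppIn (track ps '' S) z' ∧
      ∀ ψ, applyGates (ps.flatMap swapGates) (pauli x z ψ) =
        pauli x' z' (applyGates (ps.flatMap swapGates) ψ) := by
  have key (x : W → ZMod 2) (hx : SuppIn S x) :
      SuppIn (track ps '' S) (x ∘ (trackEquiv ps).symm) := fun w hw =>
    hx _ fun hS => hw ⟨_, hS, (trackEquiv ps).apply_symm_apply w⟩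
  refine ⟨_, _, key x hx, key z hz, fun ψ => funext fun y => ?_⟩
  rw [applyGates_swaps]
  refine (pauli_comp_perm (trackEquiv ps) x z ψ y).trans ?_
  congr 1
  ext y
  rw [applyGates_swaps]
  rfl

/-- After a fault in a sequence of swaps, the errors are in the image of one wire, or in the final
position of the two wires that were being swapped. -/
theorem swaps_fault {a : ℕ} {ps : List (Pair (Wire a))} {l₁ l₂ : List (Gate (Wire a))}
    (h : ps.flatMap swapGates = l₁ ++ l₂) {S : Set (Wire a)} (hS : FaultSupport l₁ S)
    {x z : Wire a → ZMod 2} (hx : SuppIn S x) (hz : SuppIn S z) :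
    ∃ S', ((∃ w, S' = {w}) ∨ ∃ qs p rs, ps = qs ++ p :: rs ∧
        S' = {track rs p.1.1, track rs p.1.2}) ∧
      ∃ x' z', SuppIn S' x' ∧ SuppIn S' z' ∧
        ∀ ψ, applyGates l₂ (pauli x z ψ) = pauli x' z' (applyGates l₂ ψ) := by
  induction ps generalizing l₁ S with
  | nil =>
    obtain ⟨rfl, rfl⟩ : l₁ = [] ∧ l₂ = [] := by simpa using h.symm
    refine ⟨S, Or.inl ?_, x, z, hx, hz, fun _ => rfl⟩
    rcases hS with hS | ⟨l', g, h', -⟩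
    · exact hS
    · simp at h'
  | cons p ps ih =>
    obtain ⟨⟨u, v⟩, huv : u ≠ v⟩ := p
    rw [List.flatMap_cons] at h
    -- A fault within the three CNOTs of the first swap, or right behind them, stays on the pair or
    -- on one outside wire. The remaining swaps then only relocate it.
    have inside (m₁ m₂ : List (Gate (Wire a))) (hm : swapGates ⟨(u, v), huv⟩ = m₁ ++ m₂)
        (hS : FaultSupport m₁ S) (hl : l₂ = m₂ ++ ps.flatMap swapGates) :
        ∃ S', ((∃ w, S' = {w}) ∨ ∃ qs p rs, (⟨(u, v), huv⟩ :: ps : List (Pair (Wire a))) =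
          qs ++ p :: rs ∧ S' = {track rs p.1.1, track rs p.1.2}) ∧
          ∃ x' z', SuppIn S' x' ∧ SuppIn S' z' ∧
            ∀ ψ, applyGates l₂ (pauli x z ψ) = pauli x' z' (applyGates l₂ ψ) := by
      have hmem (g : Gate (Wire a)) (hg : g ∈ m₁ ++ m₂) : g.support ⊆ {u, v} ∧
          (g.Tracks {u, v}) ∧ g.IsClassical := by
        rw [← hm] at hg
        simp only [swapGates, List.mem_cons, List.not_mem_nil, or_false] at hg
        rcases hg with rfl | rfl | rfl
        · exact ⟨fun w hw => hw, Or.inl ⟨_, _, _, rfl, by simp, by simp⟩, trivial⟩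
        · exact ⟨fun w hw => (Set.pair_comm v u) ▸ hw, Or.inl ⟨_, _, _, rfl, by simp, by simp⟩,
            trivial⟩
        · exact ⟨fun w hw => hw, Or.inl ⟨_, _, _, rfl, by simp, by simp⟩, trivial⟩
      have hcase : S ⊆ {u, v} ∨ ∃ w, S = {w} ∧ w ∉ ({u, v} : Set (Wire a)) := by
        rcases hS with ⟨w, rfl⟩ | ⟨l', g, rfl, rfl⟩
        · by_cases hw : w ∈ ({u, v} : Set (Wire a))
          · exact Or.inl (Set.singleton_subset_iff.2 hw)
          · exact Or.inr ⟨w, rfl, hw⟩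
        · exact Or.inl (hmem g (by simp)).1
      rcases hcase with hsub | ⟨w, rfl, hw⟩
      · obtain ⟨x₁, z₁, hx₁, hz₁, e₁⟩ := exists_pauli_of_tracks (gs := m₂)
          (fun g hg => (hmem g (by simp [hg])).2.1) (hx.mono hsub) (hz.mono hsub)
        obtain ⟨x₂, z₂, hx₂, hz₂, e₂⟩ := swaps_pauli ps hx₁ hz₁
        rw [Set.image_pair] at hx₂ hz₂
        refine ⟨_, Or.inr ⟨[], ⟨(u, v), huv⟩, ps, rfl, rfl⟩, x₂, z₂, hx₂, hz₂, fun ψ => ?_⟩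
        rw [hl, applyGates_append, e₁, e₂, ← applyGates_append]
      · have e₁ := pauli_commute_disjoint_list (gs := m₂) (S := {w}) (fun g hg =>
          ⟨(hmem g (by simp [hg])).2.2, fun w' hw' h => hw
            (by rw [← Set.mem_singleton_iff.1 h]; exact (hmem g (by simp [hg])).1 hw')⟩) hx hz
        obtain ⟨x₂, z₂, hx₂, hz₂, e₂⟩ := swaps_pauli ps hx hz
        rw [Set.image_singleton] at hx₂ hz₂
        refine ⟨_, Or.inl ⟨_, rfl⟩, x₂, z₂, hx₂, hz₂, fun ψ => ?_⟩
        rw [hl, applyGates_append, e₁, e₂, ← applyGates_append]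
    rcases List.append_eq_append_iff.1 h with ⟨m, rfl, hm⟩ | ⟨m, hm, hl⟩
    -- If the cut is exactly at the end of the first swap, a gate fault still belongs to that swap.
    · rcases List.eq_nil_or_concat m with rfl | ⟨m', g, rfl⟩
      · exact inside _ [] (List.append_nil _).symm (by simpa using hS) (by simpa using hm.symm)
      · have hS' : FaultSupport (m'.concat g) S := by
          rcases hS with hS | ⟨l', g', h1, h2⟩
          · exact Or.inl hS
          · refine Or.inr ⟨m', g', ?_, h2⟩
            rw [List.concat_eq_append, ← List.append_assoc] at h1
            rw [List.concat_eq_append, (List.append_inj' h1 rfl).2]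
        obtain ⟨S', hS'', hres⟩ := ih hm hS' hx hz
        refine ⟨S', hS''.imp id ?_, hres⟩
        rintro ⟨qs, p, rs, rfl, h2⟩
        exact ⟨_ :: qs, p, rs, rfl, h2⟩
    · exact inside _ m hm hS hl

end Swaps

/-! ### Fault-tolerant Clifford operations -/

/-- Errors on at most one data qubit. -/
def LocalErr {a : ℕ} (x z : Wire a → ZMod 2) : Prop :=
  ∃ q, ∀ i, i ≠ q → x (Sum.inl i) = 0 ∧ z (Sum.inl i) = 0

theorem dataPart_eq_single {a : ℕ} {x : Wire a → ZMod 2} {q : Fin 15}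
    (h : ∀ i, i ≠ q → x (Sum.inl i) = 0) : dataPart x = Pi.single q (x (Sum.inl q)) := by
  ext i
  by_cases hi : i = q
  · subst hi; simp [dataPart]
  · rw [Pi.single_eq_of_ne hi]; exact h i hi

/-- There is a protocol with four ancilla qubits that, with at most one fault, has the effect `V`
on encoded states. -/
def Implemented (SX : Matrix (Fin 7) (Fin 15) (ZMod 2)) (V : State (Fin 15) → State (Fin 15)) :
    Prop :=
  ∃ p : Protocol 4, ∀ (φ : State (Fin 7)) (χ : State (Fin 4)) (ψ' : State (Wire 4)),
    Run 1 p (tensor (encode SX φ) χ) ψ' → ∃ χ' : State (Fin 4), ψ' = tensor (V (encode SX φ)) χ'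

/-- Every fault in the circuit leads to an error on one data qubit. -/
def FaultsStayLocal (gs : List (Gate (Wire 4))) : Prop :=
  ∀ l₁ l₂, gs = l₁ ++ l₂ → ∀ S, FaultSupport l₁ S → ∀ x z, SuppIn S x → SuppIn S z →
    ∃ (κ : ℂ) (x' z' : Wire 4 → ZMod 2), LocalErr x' z' ∧
      ∀ ψ, applyGates l₂ (pauli x z ψ) = κ • pauli x' z' (applyGates l₂ ψ)

section Basis

variable {SX SZ : Matrix (Fin 7) (Fin 15) (ZMod 2)}

theorem pauli_mem_codeSpace {a c : Fin 15 → ZMod 2} (ha : synd a = 0) (hc : synd c = 0)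
    {d : State (Fin 15)} (hd : d ∈ codeSpace) : pauli a c d ∈ codeSpace := by
  rw [mem_codeSpace_iff] at hd ⊢
  refine ⟨fun y hy => ?_, fun y u => ?_⟩
  · have := hd.1 _ (right_ne_zero_of_mul hy)
    rwa [synd_add, ha, add_zero] at this
  · simp only [pauli, dotProduct_add]
    rw [add_right_comm, hd.2, dotProduct_comm c (u ᵥ* parityCheck), dotProduct_row_eq]
    rw [hc, dotProduct_zero, add_zero]

/-- The Pauli operator given by `a` and `c` costs no gates: it is added to every entry of the final
table. As both strings have zero syndrome, the table still recognises every single-qubit error. -/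
theorem IsLogicalBasis.implemented (h : IsLogicalBasis SX SZ) {gs : List (Gate (Wire 4))}
    {V : State (Fin 15) → State (Fin 15)}
    (hV : ∀ d (χ : State (Fin 4)), applyGates gs (tensor d χ) = tensor (V d) χ)
    (hcode : ∀ d ∈ codeSpace, V d ∈ codeSpace) (hfault : FaultsStayLocal gs)
    {a c : Fin 15 → ZMod 2} (ha : synd a = 0) (hc : synd c = 0) :
    Implemented SX fun d => pauli a c (V d) := by
  set table : (Fin 4 → ZMod 2) → (Fin 4 → ZMod 2) → (Fin 15 → ZMod 2) × (Fin 15 → ZMod 2) :=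
    fun s t => (decodeIn singles s + a, decodeIn singles t + c) with htable
  refine ⟨withGates gs (.finish table), fun φ χ ψ' hrun => ?_⟩
  set D : State (Fin 15) := V (encode SX φ) with hD
  have hDc : D ∈ codeSpace := hcode _ (h.range_encode ▸ ⟨φ, rfl⟩)
  have loc (x z : Wire 4 → ZMod 2) (hxz : LocalErr x z) (χ : State (Fin 4)) :
      pauli x z (tensor D χ) ∈ safe (goal (pauli a c D)) (.finish table) := by
    obtain ⟨q, hq⟩ := hxz
    rw [pauli_tensor, dataPart_eq_single fun i hi => (hq i hi).1,
      dataPart_eq_single fun i hi => (hq i hi).2]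
    generalize x (Sum.inl q) = b
    generalize z (Sum.inl q) = b'
    have e : pauli (Pi.single q b) (Pi.single q b') D = sgn (c ⬝ᵥ (Pi.single q b + a)) •
        pauli (Pi.single q b + a) (Pi.single q b' + c) (pauli a c D) := by
      rw [pauli_pauli, smul_smul, sgn_mul_self, one_smul, add_add_cancel_string,
        add_add_cancel_string]
    rw [e, smul_tensor]
    refine Submodule.smul_mem _ _ (finish_mem_safe (pauli_mem_codeSpace ha hc hDc) _ _ _ ?_ _)
    simp only [htable, synd_add, ha, hc, add_zero]
    rw [decodeIn_eq injOn_singles ⟨q, b, rfl⟩, decodeIn_eq injOn_singles ⟨q, b', rfl⟩]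
  have single (w : Wire 4) (b b' : ZMod 2) : LocalErr (Pi.single w b) (Pi.single w b') := by
    rcases w with q | k
    · exact ⟨q, fun i hi => by simp [hi]⟩
    · exact ⟨0, fun i _ => by simp⟩
  have hsafe : Safe1 (goal (pauli a c D)) (withGates gs (.finish table)) (tensor (encode SX φ) χ) := by
    refine safe1_withGates ?_ fun l₁ l₂ hl S hS x z hx hz => ?_
    · rw [hV]
      exact fun w b b' => loc _ _ (single w b b') χ
    · obtain ⟨κ, x', z', h1, h2⟩ := hfault l₁ l₂ hl S hS x z hx hz
      rw [h2, ← applyGates_append, ← hl, hV]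
      exact Submodule.smul_mem _ _ (loc _ _ h1 χ)
  obtain ⟨χ', h'⟩ := mem_of_run_one hrun hsafe
  exact ⟨χ', h'.symm⟩

end Basis

/-! ### Transversal gates keep errors on one qubit -/

section Transversal

theorem LocalErr.update {a : ℕ} {x z : Wire a → ZMod 2} (h : LocalErr x z) (w : Wire a)
    (b b' : ZMod 2) (hb : x w = 0 → z w = 0 → b = 0 ∧ b' = 0) :
    LocalErr (Function.update x w b) (Function.update z w b') := by
  obtain ⟨q, hq⟩ := h
  refine ⟨q, fun i hi => ?_⟩
  by_cases hw : Sum.inl i = w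
  · subst hw
    simpa using hb (hq i hi).1 (hq i hi).2
  · rw [Function.update_of_ne hw, Function.update_of_ne hw]
    exact hq i hi

/-- A fault of a one-wire gate hits one wire, and each later gate turns an error on at most one data
qubit into another such error. -/
theorem faultsStayLocal_of_gates {gs : List (Gate (Wire 4))}
    (hsupp : ∀ g ∈ gs, ∃ w, g.support = {w})
    (hg : ∀ g ∈ gs, ∀ x z, LocalErr x z → ∃ (κ : ℂ) (x' z' : Wire 4 → ZMod 2), LocalErr x' z' ∧
      ∀ ψ, g.apply (pauli x z ψ) = κ • pauli x' z' (g.apply ψ)) : FaultsStayLocal gs := by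
  intro l₁ l₂ hl S hS x z hx hz
  have hloc : LocalErr x z := by
    have : ∃ w, S = {w} := by
      rcases hS with hS | ⟨l', g, rfl, rfl⟩
      · exact hS
      · exact hsupp g (by simp [hl])
    obtain ⟨w, rfl⟩ := this
    rcases w with q | k
    · exact ⟨q, fun i hi => ⟨hx _ (by simpa using hi), hz _ (by simpa using hi)⟩⟩
    · exact ⟨0, fun i _ => ⟨hx _ (by simp), hz _ (by simp)⟩⟩
  have hmem : ∀ g ∈ l₂, g ∈ gs := fun g hg => by simp [hl, hg]
  clear hl hS hx hz
  induction l₂ generalizing x z with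
  | nil => exact ⟨1, x, z, hloc, fun ψ => by simp⟩
  | cons g l ih =>
    obtain ⟨κ, x', z', h1, h2⟩ := hg g (hmem g (by simp)) x z hloc
    obtain ⟨κ', x'', z'', h3, h4⟩ := ih x' z' h1 fun g' h => hmem g' (by simp [h])
    refine ⟨κ * κ', x'', z'', h3, fun ψ => ?_⟩
    rw [applyGates_cons, applyGates_cons, h2, ← gatesLin_apply, map_smul, gatesLin_apply, h4,
      smul_smul]

theorem faultsStayLocal_h : FaultsStayLocal ((List.finRange 15).map fun q => .h (Sum.inl q)) := by
  refine faultsStayLocal_of_gates (fun g hg => ?_) fun g hg x z hxz => ?_ <;>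
    obtain ⟨q, -, rfl⟩ := List.mem_map.1 hg
  · exact ⟨_, rfl⟩
  · exact ⟨_, _, _, hxz.update _ _ _ fun h1 h2 => ⟨h2, h1⟩, h_pauli _ x z⟩

theorem faultsStayLocal_s : FaultsStayLocal ((List.finRange 15).map fun q => .s (Sum.inl q)) := by
  refine faultsStayLocal_of_gates (fun g hg => ?_) fun g hg x z hxz => ?_ <;>
    obtain ⟨q, -, rfl⟩ := List.mem_map.1 hg
  · exact ⟨_, rfl⟩
  · refine ⟨_, _, _, ?_, s_pauli (Sum.inl q) x z⟩
    have := hxz.update (Sum.inl q) (x (Sum.inl q)) (z (Sum.inl q) + x (Sum.inl q))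
      fun h1 h2 => ⟨h1, by rw [h1, h2, add_zero]⟩
    rwa [Function.update_eq_self] at this

theorem faultsStayLocal_nil : FaultsStayLocal [] :=
  faultsStayLocal_of_gates (by simp) (by simp)

theorem update_inl {a : ℕ} (y : Wire a → ZMod 2) (q : Fin 15) (b : ZMod 2) :
    (fun i => Function.update y (Sum.inl q) b (Sum.inl i)) =
      Function.update (fun i => y (Sum.inl i)) q b := by
  ext i
  by_cases h : i = q
  · subst h; simp
  · simp [h]

theorem h_tensor {a : ℕ} (q : Fin 15) (d : State (Fin 15)) (χ : State (Fin a)) :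
    (Gate.h (Sum.inl q)).apply (tensor d χ) = tensor ((Gate.h q).apply d) χ := by
  ext y
  simp only [Gate.apply, tensor, update_inl]
  simp only [ne_eq, reduceCtorEq, not_false_eq_true, Function.update_of_ne, Finset.sum_mul,
    Finset.mul_sum]
  exact Finset.sum_congr rfl fun _ _ => by ring

theorem s_tensor {a : ℕ} (q : Fin 15) (d : State (Fin 15)) (χ : State (Fin a)) :
    (Gate.s (Sum.inl q)).apply (tensor d χ) = tensor ((Gate.s q).apply d) χ := by
  ext y
  simp only [Gate.apply, tensor]
  ring

theorem applyGates_map_tensor {a : ℕ} (G : Fin 15 → Gate (Wire a)) (G' : Fin 15 → Gate (Fin 15))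
    (h : ∀ q d (χ : State (Fin a)), (G q).apply (tensor d χ) = tensor ((G' q).apply d) χ)
    (l : List (Fin 15)) (d : State (Fin 15)) (χ : State (Fin a)) :
    applyGates (l.map G) (tensor d χ) = tensor (applyGates (l.map G') d) χ := by
  induction l generalizing d with
  | nil => rfl
  | cons q l ih => rw [List.map_cons, applyGates_cons, h, ih]; rfl

end Transversal

/-! ### Hadamard gates, phase gates and permutations that preserve the code -/

section Stabilizers

variable {d : State (Fin 15)}

theorem pauli_row_zero (hd : d ∈ codeSpace) (u : Fin 4 → ZMod 2) :
    pauli (u ᵥ* parityCheck) 0 d = d := by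
  ext y
  simp only [pauli, zero_dotProduct, sgn_zero, one_mul, ((mem_codeSpace_iff d).1 hd).2]

theorem pauli_zero_row (hd : d ∈ codeSpace) (u : Fin 4 → ZMod 2) :
    pauli 0 (u ᵥ* parityCheck) d = d := by
  have := pauli_add_row ((mem_codeSpace_iff d).1 hd).1 0 0 u
  simpa [synd_zero] using this

/-- Hadamard gates on all the data qubits. -/
def allH : State (Fin 15) →ₗ[ℂ] State (Fin 15) := gatesLin ((List.finRange 15).map Gate.h)

/-- Phase gates on all the data qubits. -/
def allS : State (Fin 15) →ₗ[ℂ] State (Fin 15) := gatesLin ((List.finRange 15).map Gate.s)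

theorem allH_pauli (x z : Fin 15 → ZMod 2) (ψ : State (Fin 15)) :
    allH (pauli x z ψ) = sgn (x ⬝ᵥ z) • pauli z x (allH ψ) := applyGates_h_pauli x z ψ

theorem allS_pauli (x z : Fin 15 → ZMod 2) (ψ : State (Fin 15)) :
    allS (pauli x z ψ) = (∏ q, phaseOf (x q)) • pauli x (z + x) (allS ψ) := applyGates_s_pauli x z ψ

theorem isIsometry_allH : IsIsometry allH := isIsometry_applyGates fun g hg => by
  obtain ⟨q, -, rfl⟩ := List.mem_map.1 hg
  exact isIsometry_h q

theorem isIsometry_allS : IsIsometry allS := isIsometry_applyGates fun g hg => by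
  obtain ⟨q, -, rfl⟩ := List.mem_map.1 hg
  exact isIsometry_s q

/-- The `X` and `Z` stabilizers have the same supports, and the Hadamard gates exchange them. -/
theorem allH_mem_codeSpace (hd : d ∈ codeSpace) : allH d ∈ codeSpace := by
  intro r
  constructor
  · have := allH_pauli 0 (parityCheck r) d
    rwa [(hd r).2, zero_dotProduct, sgn_zero, one_smul, eq_comm] at this
  · have := allH_pauli (parityCheck r) 0 d
    rwa [(hd r).1, dotProduct_zero, sgn_zero, one_smul, eq_comm] at this

theorem prod_phaseOf_row (r : Fin 4) : ∏ q, phaseOf (parityCheck r q) = 1 := by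
  simp only [phaseOf, Finset.prod_ite, Finset.prod_const_one, one_mul, Finset.prod_const]
  have : ∀ r : Fin 4, (Finset.univ.filter fun q => ¬parityCheck r q = 0).card = 8 := by
    decide +kernel
  rw [this, show (8 : ℕ) = 4 * 2 by rfl, pow_mul, neg_pow, Complex.I_pow_four]
  norm_num

/-- Phase gates turn an `X` stabilizer into its product with the `Z` stabilizer on the same support.
The factor `(-i) ^ 8` is trivial because the checks have weight eight. -/
theorem allS_mem_codeSpace (hd : d ∈ codeSpace) : allS d ∈ codeSpace := by
  intro r
  have h2 : pauli 0 (parityCheck r) (allS d) = allS d := by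
    have := allS_pauli 0 (parityCheck r) d
    rwa [(hd r).2, add_zero, show (∏ q, phaseOf ((0 : Fin 15 → ZMod 2) q)) = 1 by simp [phaseOf],
      one_smul, eq_comm] at this
  have h1 : pauli (parityCheck r) (parityCheck r) (allS d) = allS d := by
    have := allS_pauli (parityCheck r) 0 d
    rwa [(hd r).1, prod_phaseOf_row, one_smul, zero_add, eq_comm] at this
  refine ⟨?_, h2⟩
  have := pauli_pauli 0 (parityCheck r) (parityCheck r) (parityCheck r) (allS d)
  rw [h1, h2, dotProduct_zero, sgn_zero, one_smul, zero_add, string_add_self] at this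
  exact this.symm

/-- A permutation of the data qubits. -/
def permute (π : Equiv.Perm (Fin 15)) : State (Fin 15) →ₗ[ℂ] State (Fin 15) where
  toFun d y := d (y ∘ π)
  map_add' _ _ := rfl
  map_smul' _ _ := rfl

theorem permute_pauli (π : Equiv.Perm (Fin 15)) (x z : Fin 15 → ZMod 2) (ψ : State (Fin 15)) :
    permute π (pauli x z ψ) = pauli (x ∘ π.symm) (z ∘ π.symm) (permute π ψ) :=
  funext fun y => pauli_comp_perm π x z ψ y

theorem isIsometry_permute (π : Equiv.Perm (Fin 15)) : IsIsometry (permute π) := fun ψ φ =>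
  Equiv.sum_comp (π.symm.arrowCongr (Equiv.refl (ZMod 2))) fun y => star (ψ y) * φ y

/-- The permutation maps stabilizers to stabilizers. -/
def PreservesRows (π : Equiv.Perm (Fin 15)) : Prop :=
  ∀ r, ∃ u : Fin 4 → ZMod 2, parityCheck r ∘ π = u ᵥ* parityCheck

variable {π : Equiv.Perm (Fin 15)}

theorem permute_mem_codeSpace (hπ : PreservesRows π) (hd : d ∈ codeSpace) :
    permute π d ∈ codeSpace := by
  intro r
  obtain ⟨u, hu⟩ := hπ r
  have e : (u ᵥ* parityCheck) ∘ π.symm = parityCheck r := by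
    rw [← hu, Function.comp_assoc, Equiv.self_comp_symm, Function.comp_id]
  have e0 : (0 : Fin 15 → ZMod 2) ∘ π.symm = 0 := rfl
  constructor
  · have := permute_pauli π (u ᵥ* parityCheck) 0 d
    rwa [pauli_row_zero hd, e, e0, eq_comm] at this
  · have := permute_pauli π 0 (u ᵥ* parityCheck) d
    rwa [pauli_zero_row hd, e, e0, eq_comm] at this

theorem synd_comp_symm (hπ : PreservesRows π) {a : Fin 15 → ZMod 2} (ha : synd a = 0) :
    synd (a ∘ π.symm) = 0 := by
  ext r
  obtain ⟨u, hu⟩ := hπ r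
  change parityCheck r ⬝ᵥ (a ∘ π.symm) = 0
  rw [dotProduct_comp_equiv_symm, hu, dotProduct_row_eq, ha, dotProduct_zero]

/-- Move the contents of the given data qubits cyclically, with the help of an ancilla qubit. -/
def cycleSwaps (l : List (Fin 15)) : List (Pair (Wire 4)) :=
  ((Sum.inr 0 :: l.map Sum.inl).zip (l.map Sum.inl ++ [Sum.inr 0])).filterMap fun p =>
    if h : p.1 ≠ p.2 then some ⟨p, h⟩ else none

/-- The decidable form of the condition that a fault during the swaps leads to at most one error on
the data. -/
def swapsLocal : List (Pair (Wire 4)) → Bool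
  | [] => true
  | p :: ps => decide (∃ q : Fin 15, ∀ i, i ≠ q → track ps p.1.1 ≠ Sum.inl i ∧
      track ps p.1.2 ≠ Sum.inl i) && swapsLocal ps

/-- In each swap of `cycleSwaps` one of the two contents is that of the ancilla, which travels
through the cycle like a hole and ends on the ancilla again. So a faulty swap damages only one
content bound for the data; `swapsLocal` checks this directly. -/
theorem faultsStayLocal_swaps {ps : List (Pair (Wire 4))} (h : swapsLocal ps = true) :
    FaultsStayLocal (ps.flatMap swapGates) := by
  intro l₁ l₂ hl S hS x z hx hz
  obtain ⟨S', hS', x', z', hx', hz', e⟩ := swaps_fault hl hS hx hz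
  refine ⟨1, x', z', ?_, fun ψ => by rw [e, one_smul]⟩
  rcases hS' with ⟨w, rfl⟩ | ⟨qs, p, rs, rfl, rfl⟩
  · rcases w with q | k
    · exact ⟨q, fun i hi => ⟨hx' _ (by simpa using hi), hz' _ (by simpa using hi)⟩⟩
    · exact ⟨0, fun i _ => ⟨hx' _ (by simp), hz' _ (by simp)⟩⟩
  · have : ∃ q : Fin 15, ∀ i, i ≠ q → track rs p.1.1 ≠ Sum.inl i ∧ track rs p.1.2 ≠ Sum.inl i := by
      clear hl hS
      induction qs with
      | nil =>
        rw [List.nil_append, swapsLocal, Bool.and_eq_true] at h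
        exact of_decide_eq_true h.1
      | cons q qs ih =>
        rw [List.cons_append, swapsLocal, Bool.and_eq_true] at h
        exact ih h.2
    obtain ⟨q, hq⟩ := this
    have hn (i : Fin 15) (hi : i ≠ q) : Sum.inl i ∉ ({track rs p.1.1, track rs p.1.2} : Set (Wire 4)) := by
      rintro (h | h)
      · exact (hq i hi).1 h.symm
      · exact (hq i hi).2 h.symm
    exact ⟨q, fun i hi => ⟨hx' _ (hn i hi), hz' _ (hn i hi)⟩⟩

theorem applyGates_swaps_tensor {ps : List (Pair (Wire 4))}
    (h : ∀ w, track ps w = Sum.map π id w) (d : State (Fin 15)) (χ : State (Fin 4)) :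
    applyGates (ps.flatMap swapGates) (tensor d χ) = tensor (permute π d) χ := by
  ext y
  rw [applyGates_swaps]
  simp only [tensor, h, permute, LinearMap.coe_mk, AddHom.coe_mk]
  rfl

end Stabilizers

/-! ### Two automorphisms of the Hamming code -/

section Automorphisms

/-- Doubling in the field with sixteen elements, whose non-zero elements label the qubits. -/
def frobeniusShift : Equiv.Perm (Fin 15) where
  toFun := ![1, 3, 5, 7, 9, 11, 13, 2, 0, 6, 4, 10, 8, 14, 12]
  invFun := ![8, 0, 7, 1, 10, 2, 9, 3, 12, 4, 11, 5, 14, 6, 13]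
  left_inv := by decide
  right_inv := by decide

/-- The transvection that exchanges the qubits `1, 11` and `3, 9` and `5, 15` and `7, 13`. -/
def transvection : Equiv.Perm (Fin 15) where
  toFun := ![10, 1, 8, 3, 14, 5, 12, 7, 2, 9, 0, 11, 6, 13, 4]
  invFun := ![10, 1, 8, 3, 14, 5, 12, 7, 2, 9, 0, 11, 6, 13, 4]
  left_inv := by decide
  right_inv := by decide

/-- Swaps that implement `frobeniusShift`. -/
def shiftSwaps : List (Pair (Wire 4)) :=
  cycleSwaps [0, 8, 12, 14, 13, 6, 9, 4, 10, 11, 5, 2, 7, 3, 1]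

/-- Swaps that implement `transvection`. -/
def transvectionSwaps : List (Pair (Wire 4)) :=
  cycleSwaps [0, 10] ++ cycleSwaps [2, 8] ++ cycleSwaps [4, 14] ++ cycleSwaps [6, 12]

/-- The permutation is linear on the labels, regarded as non-zero vectors of length four, so a row
composed with it is again a combination of rows. -/
theorem preservesRows_shift : PreservesRows frobeniusShift := by
  unfold PreservesRows; decide +kernel

theorem preservesRows_transvection : PreservesRows transvection := by
  unfold PreservesRows; decide +kernel

theorem track_shift : ∀ w, track shiftSwaps w = Sum.map frobeniusShift id w := by decide +kernel

theorem track_transvection : ∀ w, track transvectionSwaps w = Sum.map transvection id w := by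
  decide +kernel

theorem swapsLocal_shift : swapsLocal shiftSwaps = true := by decide +kernel

theorem swapsLocal_transvection : swapsLocal transvectionSwaps = true := by decide +kernel

end Automorphisms

/-! ### Operators on the logical qubits -/

/-- Operators on seven qubits. -/
abbrev LMat := Matrix (Fin 7 → ZMod 2) (Fin 7 → ZMod 2) ℂ

/-- The matrix of a Pauli operator. -/
def pauliMat (x z : Fin 7 → ZMod 2) : LMat := LinearMap.toMatrix' (pauliLin x z)

theorem pauliMat_mulVec (x z : Fin 7 → ZMod 2) (φ : State (Fin 7)) :
    pauliMat x z *ᵥ φ = pauli x z φ := by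
  rw [pauliMat, LinearMap.toMatrix'_mulVec, pauliLin_apply]

theorem eq_of_forall_mulVec {A B : LMat} (h : ∀ φ : State (Fin 7), A *ᵥ φ = B *ᵥ φ) : A = B :=
  Matrix.mulVec_injective (funext h)

theorem pauliMat_apply (x z u v : Fin 7 → ZMod 2) :
    pauliMat x z u v = if v = u + x then sgn (z ⬝ᵥ u) else 0 := by
  rw [pauliMat, LinearMap.toMatrix'_apply, pauliLin_apply, pauli]
  by_cases h : v = u + x
  · rw [if_pos h, h, Pi.single_eq_same, mul_one]
  · rw [if_neg h, Pi.single_eq_of_ne (Ne.symm h), mul_zero]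

theorem pauliMat_mul (x z x' z' : Fin 7 → ZMod 2) :
    pauliMat x z * pauliMat x' z' = sgn (z' ⬝ᵥ x) • pauliMat (x + x') (z + z') :=
  eq_of_forall_mulVec fun φ => by
    rw [← Matrix.mulVec_mulVec, Matrix.smul_mulVec, pauliMat_mulVec, pauliMat_mulVec,
      pauliMat_mulVec, pauli_pauli]

theorem pauliMat_zero : pauliMat 0 0 = 1 := eq_of_forall_mulVec fun φ => by
  rw [pauliMat_mulVec, pauli_zero_zero, Matrix.one_mulVec]

theorem star_pauliMat (x z : Fin 7 → ZMod 2) : star (pauliMat x z) = sgn (z ⬝ᵥ x) • pauliMat x z := by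
  ext u v
  rw [Matrix.star_apply, Matrix.smul_apply, pauliMat_apply, pauliMat_apply]
  have : u = v + x ↔ v = u + x :=
    ⟨fun h => by rw [h, add_add_cancel_string], fun h => by rw [h, add_add_cancel_string]⟩
  by_cases h : v = u + x
  · rw [if_pos h, if_pos (this.2 h), star_sgn, h, dotProduct_add, sgn_add, smul_eq_mul, mul_comm]
  · rw [if_neg h, if_neg (mt this.1 h), star_zero, smul_zero]

/-- Every operator is a combination of Pauli operators. -/
theorem eq_sum_pauliMat (A : LMat) : A = ∑ x : Fin 7 → ZMod 2, ∑ z : Fin 7 → ZMod 2,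
    (1 / 128 * ∑ y, sgn (z ⬝ᵥ y) * A y (y + x)) • pauliMat x z := by
  ext u v
  simp only [Matrix.sum_apply, Matrix.smul_apply, pauliMat_apply, smul_eq_mul, mul_ite, mul_zero]
  rw [Finset.sum_eq_single (u + v)]
  · have e : v = u + (u + v) := by rw [← add_assoc, string_add_self, zero_add]
    simp only [← e, if_true]
    have key (y : Fin 7 → ZMod 2) : ∑ z : Fin 7 → ZMod 2, sgn (z ⬝ᵥ y) * sgn (z ⬝ᵥ u) =
        if y = u then 128 else 0 := by
      have h1 := sum_sgn_dotProduct (y + u)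
      simp only [dotProduct_add, sgn_add] at h1
      rw [h1]
      by_cases h : y = u
      · rw [if_pos h, if_pos (by rw [h, string_add_self])]
        norm_num
      · rw [if_neg h, if_neg (fun h' => h (eq_of_add_eq_zero h'))]
    have : ∀ z : Fin 7 → ZMod 2, (1 / 128 * ∑ y, sgn (z ⬝ᵥ y) * A y (y + (u + v))) *
        sgn (z ⬝ᵥ u) = ∑ y, (1 / 128 * A y (y + (u + v))) * (sgn (z ⬝ᵥ y) * sgn (z ⬝ᵥ u)) := by
      intro z
      rw [Finset.mul_sum, Finset.sum_mul]
      exact Finset.sum_congr rfl fun y _ => by ring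
    simp only [this]
    rw [Finset.sum_comm]
    simp only [← Finset.mul_sum, key]
    rw [Finset.sum_eq_single u (fun y _ hy => by rw [if_neg hy, mul_zero]) (by simp), if_pos rfl,
      ← e]
    ring
  · intro x _ hx
    refine Finset.sum_eq_zero fun z _ => if_neg fun h => hx ?_
    rw [h, ← add_assoc, string_add_self, zero_add]
  · simp

theorem mem_unitaryGroup_of_isometry {A : LMat}
    (h : ∀ φ ψ : State (Fin 7), star (A *ᵥ φ) ⬝ᵥ (A *ᵥ ψ) = star φ ⬝ᵥ ψ) :
    A ∈ Matrix.unitaryGroup (Fin 7 → ZMod 2) ℂ := by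
  rw [Matrix.mem_unitaryGroup_iff']
  ext i j
  have := h (Pi.single i 1) (Pi.single j 1)
  rw [Matrix.star_mulVec, ← Matrix.dotProduct_mulVec, Matrix.mulVec_mulVec] at this
  simpa [Matrix.one_apply, Pi.single_apply, eq_comm, Matrix.star_eq_conjTranspose] using this

/-! ### The logical action of operations on the block -/

section Basis

variable {SX SZ : Matrix (Fin 7) (Fin 15) (ZMod 2)}

/-- `encode` as a linear map. -/
def encodeLin (SX : Matrix (Fin 7) (Fin 15) (ZMod 2)) : State (Fin 7) →ₗ[ℂ] State (Fin 15) where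
  toFun := encode SX
  map_add' φ ψ := by ext y; simp [encode, add_mul, Finset.sum_add_distrib]
  map_smul' c φ := by ext y; simp [encode, mul_assoc, Finset.mul_sum]

theorem encode_smul (c : ℂ) (φ : State (Fin 7)) : encode SX (c • φ) = c • encode SX φ :=
  (encodeLin SX).map_smul c φ

/-- The inverse of the encoding map. -/
def decodeLin (SX : Matrix (Fin 7) (Fin 15) (ZMod 2)) : State (Fin 15) →ₗ[ℂ] State (Fin 7) where
  toFun ψ x := 4 * ψ (x ᵥ* SX)
  map_add' φ ψ := by ext y; simp [mul_add]
  map_smul' c φ := by ext y; simp; ring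

theorem IsLogicalBasis.decode_encode (h : IsLogicalBasis SX SZ) (φ : State (Fin 7)) :
    decodeLin SX (encode SX φ) = φ := by
  ext x
  change 4 * encode SX φ (x ᵥ* SX) = φ x
  rw [h.eq_of_rows, if_pos (h.synd_X x), h.Z_X]
  ring

theorem IsLogicalBasis.encode_injective (h : IsLogicalBasis SX SZ) :
    Function.Injective (encode SX) := fun φ ψ e => by
  rw [← h.decode_encode φ, e, h.decode_encode]

/-- Each logical basis state is spread over sixteen strings with amplitude `1 / 4`, and different
basis states occupy disjoint strings. -/
theorem IsLogicalBasis.encode_isometry (h : IsLogicalBasis SX SZ) (φ ψ : State (Fin 7)) :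
    star (encode SX φ) ⬝ᵥ encode SX ψ = star φ ⬝ᵥ ψ := by
  have hinj : Function.Injective fun p : (Fin 7 → ZMod 2) × (Fin 4 → ZMod 2) =>
      p.1 ᵥ* SX + p.2 ᵥ* parityCheck := by
    rintro ⟨x, u⟩ ⟨x', u'⟩ e
    have e1 := congrArg (SZ *ᵥ ·) e
    simp only [Matrix.mulVec_add, h.Z_X, h.Z_check, add_zero] at e1
    subst e1
    have e2 := add_left_cancel e
    have : (u + u') ᵥ* parityCheck = 0 := by
      rw [Matrix.add_vecMul, e2, string_add_self]
    rw [eq_of_add_eq_zero (row_eq_zero this)]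
  rw [dotProduct, ← Fintype.sum_of_injective _ hinj (fun p => star (φ p.1) * ψ p.1 / 16)]
  · rw [Fintype.sum_prod_type]
    simp only [Finset.sum_const, Finset.card_univ, nsmul_eq_mul]
    refine Finset.sum_congr rfl fun x _ => ?_
    simp
    ring
  · intro y hy
    have : encode SX ψ y = 0 := by
      rw [h.eq_of_rows, if_neg fun hs => hy ?_]
      obtain ⟨u, hu⟩ := h.exists_row hs
      exact ⟨(_, u), hu.symm⟩
    rw [this, mul_zero]
  · rintro ⟨x, u⟩
    have e (φ : State (Fin 7)) : encode SX φ (x ᵥ* SX + u ᵥ* parityCheck) = φ x / 4 := by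
      rw [h.encode_add_row, h.eq_of_rows, if_pos (h.synd_X x), h.Z_X]
    rw [Pi.star_apply, e, e]
    simp
    ring

/-- The logical operator is `V` placed between encoding and decoding; decoding inverts encoding on
the code space, which `V` preserves. -/
theorem IsLogicalBasis.exists_unitary (h : IsLogicalBasis SX SZ)
    {V : State (Fin 15) →ₗ[ℂ] State (Fin 15)} (hiso : IsIsometry V)
    (hcode : ∀ d ∈ codeSpace, V d ∈ codeSpace) :
    ∃ U : Matrix.unitaryGroup (Fin 7 → ZMod 2) ℂ,
      ∀ φ, encode SX ((U : LMat) *ᵥ φ) = V (encode SX φ) := by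
  have key (φ : State (Fin 7)) : encode SX
      (LinearMap.toMatrix' (decodeLin SX ∘ₗ V ∘ₗ encodeLin SX) *ᵥ φ) = V (encode SX φ) := by
    rw [LinearMap.toMatrix'_mulVec]
    change encode SX (decodeLin SX (V (encode SX φ))) = _
    obtain ⟨φ', hφ'⟩ : V (encode SX φ) ∈ Set.range (encode SX) := by
      rw [h.range_encode]
      exact hcode _ (h.range_encode ▸ ⟨φ, rfl⟩)
    rw [← hφ', h.decode_encode]
  refine ⟨⟨_, mem_unitaryGroup_of_isometry fun φ ψ => ?_⟩, key⟩
  rw [← h.encode_isometry, key, key, hiso, h.encode_isometry]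

/-- The action on the logical qubits of a Pauli operator on the code block. -/
def logicalPauli (SX SZ : Matrix (Fin 7) (Fin 15) (ZMod 2)) (a c : Fin 15 → ZMod 2) : LMat :=
  pauliMat (SZ *ᵥ a) (SX *ᵥ c)

/-- The stabilizer part of `a` is orthogonal to `c`, so commutation of logical Pauli operators can
be read off from the physical strings. -/
theorem IsLogicalBasis.dotProduct_eq (h : IsLogicalBasis SX SZ) {a c : Fin 15 → ZMod 2}
    (ha : synd a = 0) (hc : synd c = 0) : (SX *ᵥ c) ⬝ᵥ (SZ *ᵥ a) = c ⬝ᵥ a := by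
  obtain ⟨u, hu⟩ := h.exists_row ha
  conv_rhs => rw [hu, dotProduct_add, dotProduct_comm c (u ᵥ* parityCheck), dotProduct_row_eq, hc,
    dotProduct_zero, add_zero, dotProduct_comm, ← Matrix.dotProduct_mulVec, dotProduct_comm]

theorem IsLogicalBasis.encode_logicalPauli (h : IsLogicalBasis SX SZ) {a c : Fin 15 → ZMod 2}
    (ha : synd a = 0) (hc : synd c = 0) (φ : State (Fin 7)) :
    encode SX (logicalPauli SX SZ a c *ᵥ φ) = pauli a c (encode SX φ) := by
  ext y
  change _ = sgn (c ⬝ᵥ y) * encode SX φ (y + a)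
  rw [logicalPauli, pauliMat_mulVec, h.eq_of_rows, h.eq_of_rows, synd_add, ha, add_zero]
  split_ifs with hy
  · rw [pauli, h.dotProduct_eq hy hc, Matrix.mulVec_add]
    ring
  · rw [mul_zero]

theorem IsLogicalBasis.logicalPauli_mul (h : IsLogicalBasis SX SZ) {a c a' c' : Fin 15 → ZMod 2}
    (ha : synd a = 0) (hc' : synd c' = 0) :
    logicalPauli SX SZ a c * logicalPauli SX SZ a' c' =
      sgn (c' ⬝ᵥ a) • logicalPauli SX SZ (a + a') (c + c') := by
  rw [logicalPauli, logicalPauli, pauliMat_mul, h.dotProduct_eq ha hc', logicalPauli,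
    Matrix.mulVec_add, Matrix.mulVec_add]

theorem IsLogicalBasis.logicalPauli_add_row (h : IsLogicalBasis SX SZ) (a c : Fin 15 → ZMod 2)
    (u : Fin 4 → ZMod 2) :
    logicalPauli SX SZ a (c + u ᵥ* parityCheck) = logicalPauli SX SZ a c := by
  rw [logicalPauli, Matrix.mulVec_add, h.X_check, add_zero, logicalPauli]

/-- The operations from which universality is shown. -/
def gens (SX : Matrix (Fin 7) (Fin 15) (ZMod 2)) : Set (Matrix.unitaryGroup (Fin 7 → ZMod 2) ℂ) :=
  {U | (U : LMat) = logicalCCZ ∨ (IsClifford (U : LMat) ∧ ∃ p : Protocol 4, FaultTolerant SX p U)}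

/-- A physical operation that permutes Pauli operators up to scalars becomes a logical Clifford
generator with the same action on strings. The scalars `κ` are left open, since for rotations only
the axes matter. -/
theorem IsLogicalBasis.exists_clifford (h : IsLogicalBasis SX SZ)
    {V : State (Fin 15) →ₗ[ℂ] State (Fin 15)} (hiso : IsIsometry V)
    (hcode : ∀ d ∈ codeSpace, V d ∈ codeSpace) (himpl : Implemented SX V)
    (f g : (Fin 15 → ZMod 2) → (Fin 15 → ZMod 2) → Fin 15 → ZMod 2)
    (hf : ∀ a c, synd a = 0 → synd c = 0 → synd (f a c) = 0 ∧ synd (g a c) = 0)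
    (hV : ∀ a c, ∃ κ : ℂ, ∀ ψ, V (pauli a c ψ) = κ • pauli (f a c) (g a c) (V ψ)) :
    ∃ U ∈ gens SX, (∀ φ, encode SX ((U : LMat) *ᵥ φ) = V (encode SX φ)) ∧
      ∀ a c, synd a = 0 → synd c = 0 → ∃ κ : ℂ, (U : LMat) * logicalPauli SX SZ a c =
        κ • (logicalPauli SX SZ (f a c) (g a c) * (U : LMat)) := by
  obtain ⟨U, hU⟩ := h.exists_unitary hiso hcode
  have hcomm : ∀ a c, synd a = 0 → synd c = 0 → ∃ κ : ℂ,
      (U : LMat) * logicalPauli SX SZ a c =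
        κ • (logicalPauli SX SZ (f a c) (g a c) * (U : LMat)) := by
    intro a c ha hc
    obtain ⟨κ, hκ⟩ := hV a c
    refine ⟨κ, eq_of_forall_mulVec fun φ => h.encode_injective ?_⟩
    rw [← Matrix.mulVec_mulVec, hU, h.encode_logicalPauli ha hc, hκ, Matrix.smul_mulVec,
      ← Matrix.mulVec_mulVec, encode_smul, h.encode_logicalPauli (hf a c ha hc).1 (hf a c ha hc).2, hU]
  refine ⟨U, Or.inr ⟨fun x z => ?_, ?_⟩, hU, hcomm⟩
  · obtain ⟨κ, hκ⟩ := hcomm (x ᵥ* SX) (z ᵥ* SZ) (h.synd_X x) (h.synd_Z z)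
    refine ⟨SZ *ᵥ f (x ᵥ* SX) (z ᵥ* SZ), SX *ᵥ g (x ᵥ* SX) (z ᵥ* SZ), κ, fun φ => ?_⟩
    have := congrArg (· *ᵥ φ) hκ
    simp only [logicalPauli, h.Z_X, h.X_Z, Matrix.smul_mulVec, ← Matrix.mulVec_mulVec,
      pauliMat_mulVec] at this
    exact this
  · obtain ⟨p, hp⟩ := himpl
    exact ⟨p, fun φ χ ψ' hrun => by rw [hU]; exact hp φ χ ψ' hrun⟩

end Basis

/-! ### The closed group generated by the fault-tolerant operations -/

section Anticommuting

variable {A : Type*} [CStarAlgebra A] {a b : A}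

theorem isSelfAdjoint_I_smul_mul (ha : IsSelfAdjoint a) (hb : IsSelfAdjoint b)
    (hba : b * a = -(a * b)) : IsSelfAdjoint (Complex.I • (a * b)) := by
  rw [IsSelfAdjoint, star_smul, star_mul, ha.star_eq, hb.star_eq, hba, smul_neg, ← neg_smul]
  congr 1
  exact (congrArg _ Complex.conj_I).trans (neg_neg _)

theorem I_smul_mul_mul_self (ha : a * a = 1) (hb : b * b = 1) (hba : b * a = -(a * b)) :
    (Complex.I • (a * b)) * (Complex.I • (a * b)) = 1 := by
  rw [smul_mul_smul_comm, Complex.I_mul_I, mul_assoc, ← mul_assoc b a, hba, neg_mul,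
    mul_assoc a b, hb, mul_one, mul_neg, ha, smul_neg, neg_smul, one_smul, neg_neg]

end Anticommuting

/-! ### Algebra of projections built from involutions -/

section Projections

variable {A : Type*} [Ring A] [Algebra ℂ A]

/-- Sandwich relations multiply over commuting tensor factors. -/
theorem mul_mul_of_commute {P Q p q : A} {c d : ℂ} (h1 : P * Q * P = c • P) (h2 : p * q * p = d • p)
    (hpQ : Commute p Q) (hpP : Commute p P) (hqP : Commute q P) :
    P * p * (Q * q) * (P * p) = (c * d) • (P * p) := by
  calc P * p * (Q * q) * (P * p) = P * (p * Q) * (q * P) * p := by simp only [mul_assoc]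
    _ = P * Q * (p * P) * (q * p) := by rw [hpQ.eq, hqP.eq]; simp only [mul_assoc]
    _ = P * Q * P * (p * q * p) := by rw [hpP.eq]; simp only [mul_assoc]
    _ = _ := by rw [h1, h2, smul_mul_smul_comm]

/-- Conjugation by the involution `w` exchanges `p` and `1 - p` and fixes the other factors, so
adding the conjugate replaces `p` by `1`. -/
theorem average_eq {a b p w : A} (hw : w * w = 1) (ha : Commute w a) (hb : Commute w b)
    (hp : w * p = (1 - p) * w) : a * p * b + w * (a * p * b) * w = a * b := by
  have : w * (a * p * b) * w = a * (1 - p) * b := by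
    calc w * (a * p * b) * w = (w * a) * p * b * w := by simp only [mul_assoc]
      _ = a * (w * p) * b * w := by rw [ha.eq]; simp only [mul_assoc]
      _ = a * (1 - p) * (w * b) * w := by rw [hp]; simp only [mul_assoc]
      _ = a * (1 - p) * b * (w * w) := by rw [hb.eq]; simp only [mul_assoc]
      _ = a * (1 - p) * b := by rw [hw, mul_one]
  rw [this, mul_sub, mul_one, sub_mul]
  abel

/-- The projection onto the `-1` eigenspace of an involution. -/
def minusProj (z : A) : A := (1 / 2 : ℂ) • (1 - z)

theorem minusProj_mul_self {z : A} (hz : z * z = 1) : minusProj z * minusProj z = minusProj z := by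
  simp only [minusProj, smul_mul_smul_comm, mul_sub, sub_mul, mul_one, one_mul, hz]
  module

theorem mul_minusProj {z x : A} (h : z * x = -(x * z)) :
    x * minusProj z = (1 - minusProj z) * x := by
  simp only [minusProj, mul_smul_comm, sub_mul, smul_mul_assoc, mul_sub, mul_one, one_mul, h]
  module

/-- The part with `x` vanishes between the projections, since `x` exchanges the eigenspaces of `z`.
Only half of the identity remains. -/
theorem minusProj_mul_mul {z x : A} (hz : z * z = 1) (h : z * x = -(x * z)) :
    minusProj z * minusProj x * minusProj z = (1 / 2 : ℂ) • minusProj z := by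
  have e : minusProj z * x * minusProj z = 0 := by
    rw [mul_assoc, mul_minusProj h, ← mul_assoc, mul_sub, mul_one, minusProj_mul_self hz, sub_self,
      zero_mul]
  have e2 : minusProj x = (1 / 2 : ℂ) • (1 - x) := rfl
  rw [e2, mul_smul_comm, smul_mul_assoc, mul_sub, sub_mul, e, mul_one, minusProj_mul_self hz,
    sub_zero]

theorem minusProj_commutator {z x : A} (h : z * x = -(x * z)) :
    minusProj z * minusProj x - minusProj x * minusProj z = (1 / 2 : ℂ) • (z * x) := by
  have h' : x * z = -(z * x) := by rw [h, neg_neg]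
  simp only [minusProj, smul_mul_smul_comm, mul_sub, sub_mul, mul_one, one_mul, h']
  module

theorem Commute.minusProj_right {x z : A} (h : Commute x z) : Commute x (minusProj z) :=
  ((Commute.one_right x).sub_right h).smul_right _

theorem Commute.minusProj_left {x z : A} (h : Commute x z) : Commute (minusProj x) z :=
  h.symm.minusProj_right.symm

end Projections

/-! ### An irrational rotation from two projections -/

section Rotation

open selfAdjoint

variable {A : Type*} [CStarAlgebra A] {Γ : Subgroup (unitary A)} {hΓ : IsClosed (Γ : Set (unitary A))}

/-- By Niven's theorem a rational multiple of `π` has rational cosine only among `0`, `±1/2`, `±1`.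
-/
theorem irrational_arccos : Irrational (Real.arccos (-3 / 4) / (2 * Real.pi)) := by
  rintro ⟨r, hr⟩
  have hc : Real.cos (Real.arccos (-3 / 4)) = -3 / 4 := Real.cos_arccos (by norm_num) (by norm_num)
  have := niven (θ := Real.arccos (-3 / 4)) ⟨2 * r, by
    rw [eq_div_iff (by positivity)] at hr
    push_cast
    linarith⟩ ⟨-3 / 4, by rw [hc]; norm_num⟩
  rw [hc] at this
  norm_num at this

/-- The generator of the rotations in the planes spanned by the images of two projections. -/
def rotator (P Q : A) : A := (-Complex.I * (8 / (Real.sqrt 7 : ℂ))) • (P * Q - Q * P)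

theorem isSelfAdjoint_rotator {P Q : A} (hP : IsSelfAdjoint P) (hQ : IsSelfAdjoint Q) :
    IsSelfAdjoint (rotator P Q) := by
  have : star (-Complex.I * (8 / (Real.sqrt 7 : ℂ))) = -(-Complex.I * (8 / (Real.sqrt 7 : ℂ))) := by
    simp
  rw [IsSelfAdjoint, rotator, star_smul, this, star_sub, star_mul, star_mul, hP.star_eq, hQ.star_eq,
    neg_smul, ← smul_neg, neg_sub]

/-- The product of the reflections in `P` and `Q` rotates by an angle with cosine `2 / 8 - 1 = -3 /
4` and sine `√7 / 4`. The factor `8 / √7` makes the square of the generator `(8 / 7) (P + Q - P Q -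
Q P)` and its cube the generator itself, so the explicit exponential identifies the rotation. -/
theorem rotator_mem {P Q : A} (hP : IsSelfAdjoint P) (hQ : IsSelfAdjoint Q) (hPP : P * P = P)
    (hQQ : Q * Q = Q) (hPQP : P * Q * P = (1 / 8 : ℂ) • P) (hQPQ : Q * P * Q = (1 / 8 : ℂ) • Q)
    {u v : unitary A} (hu : u ∈ Γ) (hv : v ∈ Γ) (hu' : (u : A) = 1 - (2 : ℂ) • P)
    (hv' : (v : A) = 1 - (2 : ℂ) • Q) :
    (⟨rotator P Q, isSelfAdjoint_rotator hP hQ⟩ : selfAdjoint A) ∈ lieAlg Γ hΓ := by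
  have h7 : (Real.sqrt 7 : ℂ) * (Real.sqrt 7 : ℂ) = 7 := by
    rw [← Complex.ofReal_mul, Real.mul_self_sqrt (by norm_num)]; norm_num
  have h7' : (Real.sqrt 7 : ℂ) ≠ 0 := fun h => by rw [h] at h7; norm_num at h7
  have hcc : (-Complex.I * (8 / (Real.sqrt 7 : ℂ))) * (-Complex.I * (8 / (Real.sqrt 7 : ℂ))) =
      -64 / 7 := by
    field_simp
    rw [Complex.I_sq, sq (Real.sqrt 7 : ℂ), h7]
    norm_num
  rw [mul_assoc] at hPQP hQPQ
  have r1 (X : A) : P * (P * X) = P * X := by rw [← mul_assoc, hPP]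
  have r2 (X : A) : Q * (Q * X) = Q * X := by rw [← mul_assoc, hQQ]
  have hsq : rotator P Q ^ 2 = (8 / 7 : ℂ) • (P + Q - P * Q - Q * P) := by
    rw [sq, rotator, smul_mul_smul_comm, hcc]
    simp only [mul_sub, sub_mul, mul_assoc, hPQP, hQPQ, r1, r2, mul_smul_comm]
    module
  have hcube : rotator P Q ^ 3 = rotator P Q := by
    rw [pow_succ, hsq, rotator]
    simp only [mul_sub, sub_mul, add_mul, mul_assoc, hPQP, hQPQ, r1, r2,
      mul_smul_comm, smul_mul_assoc]
    module
  refine mem_lieAlg_of_irrational hcube irrational_arccos ?_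
  have e : expUnitary (Real.arccos (-3 / 4) •
      (⟨rotator P Q, isSelfAdjoint_rotator hP hQ⟩ : selfAdjoint A)) = u * v := by
    ext
    rw [expUnitary_of_pow_three hcube, Submonoid.coe_mul, hu', hv', ← Complex.ofReal_cos,
      ← Complex.ofReal_sin, Real.cos_arccos (by norm_num) (by norm_num), Real.sin_arccos]
    have hs : Real.sqrt (1 - (-3 / 4) ^ 2) = Real.sqrt 7 / 4 := by
      rw [show (1 - (-3 / 4) ^ 2 : ℝ) = 7 / 4 ^ 2 by norm_num, Real.sqrt_div (by norm_num),
        Real.sqrt_sq (by norm_num)]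
    have hr : (Complex.I * ((Real.sqrt 7 / 4 : ℝ) : ℂ)) • rotator P Q = (2 : ℂ) • (P * Q - Q * P) := by
      rw [rotator, smul_smul]
      congr 1
      push_cast
      field_simp
      rw [Complex.I_sq]
      norm_num
    rw [hs]
    change 1 + (Complex.I * ((Real.sqrt 7 / 4 : ℝ) : ℂ)) • rotator P Q +
      (((-3 / 4 : ℝ) : ℂ) - 1) • rotator P Q ^ 2 = _
    rw [hr, hsq]
    push_cast
    simp only [mul_sub, sub_mul, mul_one, one_mul, smul_mul_smul_comm]
    module
  rw [e]
  exact Γ.mul_mem hu hv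

/-- The generators form a vector space stable under conjugation by the group; this is the averaging
step. -/
theorem add_conj_mem {X Y : A} {hX : IsSelfAdjoint X} (h : (⟨X, hX⟩ : selfAdjoint A) ∈ lieAlg Γ hΓ)
    {w : unitary A} (hw : w ∈ Γ) (hws : IsSelfAdjoint (w : A)) (e : X + w * X * w = Y) :
    ∃ hY : IsSelfAdjoint Y, (⟨Y, hY⟩ : selfAdjoint A) ∈ lieAlg Γ hΓ := by
  have hww : (w : A) * w = 1 := by
    have := Unitary.coe_star_mul_self w
    rwa [hws.star_eq] at this
  have hZ : IsSelfAdjoint (w * X * w : A) := by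
    rw [IsSelfAdjoint, star_mul, star_mul, hws.star_eq, hX.star_eq, mul_assoc]
  have h2 : (⟨_, hZ⟩ : selfAdjoint A) ∈ lieAlg Γ hΓ := lieAlg_conj hw h (by
    change _ = (w : A) * X * w * w
    rw [mul_assoc _ (w : A), hww, mul_one])
  subst e
  exact ⟨hX.add hZ, (lieAlg Γ hΓ).add_mem h h2⟩

end Rotation

/-! ### The closed group and its rotations about logical Pauli operators -/

section Group

open scoped Matrix.Norms.L2Operator
open selfAdjoint

variable {SX SZ : Matrix (Fin 7) (Fin 15) (ZMod 2)}

/-- The closed group generated by the operations. -/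
def closedGroup (SX : Matrix (Fin 7) (Fin 15) (ZMod 2)) : Subgroup (unitary LMat) :=
  (Subgroup.closure (gens SX)).topologicalClosure

theorem isClosed_closedGroup (SX : Matrix (Fin 7) (Fin 15) (ZMod 2)) :
    IsClosed (closedGroup SX : Set (unitary LMat)) := Subgroup.isClosed_topologicalClosure _

theorem gens_subset {U : unitary LMat} (hU : U ∈ gens SX) : U ∈ closedGroup SX :=
  Subgroup.le_topologicalClosure _ (Subgroup.subset_closure hU)

/-- In the compact unitary group the monoid and the group generated by a set have the same closure,
so inverses of the generators are not needed. -/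
theorem dense_of_closedGroup_eq_top (h : closedGroup SX = ⊤) :
    Dense (Submonoid.closure (gens SX) : Set (Matrix.unitaryGroup (Fin 7 → ZMod 2) ℂ)) := by
  have : ProperSpace LMat := FiniteDimensional.proper ℂ LMat
  have : CompactSpace (unitary LMat) := compactSpace_unitary
  change Dense (Submonoid.closure (gens SX) : Set (unitary LMat))
  rw [dense_submonoidClosure_iff_subgroupClosure, dense_iff_closure_eq,
    ← Subgroup.topologicalClosure_coe]
  exact (congrArg _ h).trans Subgroup.coe_top

/-- The infinitesimal generators of the closed group. -/
def infinitesimal (SX : Matrix (Fin 7) (Fin 15) (ZMod 2)) : Submodule ℝ (selfAdjoint LMat) :=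
  lieAlg (closedGroup SX) (isClosed_closedGroup SX)

/-- The rotations about a Pauli operator lie in the closed group. -/
def Rot (SX SZ : Matrix (Fin 7) (Fin 15) (ZMod 2)) (a c : Fin 15 → ZMod 2) : Prop :=
  ∃ A ∈ infinitesimal SX, (A : LMat) * A = 1 ∧ ∃ μ : ℂ, (A : LMat) = μ • logicalPauli SX SZ a c

theorem Rot.conj {a c a' c' : Fin 15 → ZMod 2} (h : Rot SX SZ a c) {U : unitary LMat}
    (hU : U ∈ closedGroup SX) {κ : ℂ}
    (hκ : (U : LMat) * logicalPauli SX SZ a c = κ • (logicalPauli SX SZ a' c' * (U : LMat))) :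
    Rot SX SZ a' c' := by
  obtain ⟨A, hA, hA2, μ, hμ⟩ := h
  have hU1 : star (U : LMat) * U = 1 := Unitary.coe_star_mul_self U
  have hU2 : (U : LMat) * star (U : LMat) = 1 := Unitary.coe_mul_star_self U
  let B : selfAdjoint LMat := ⟨U * A * star (U : LMat), by
    rw [selfAdjoint.mem_iff, star_mul, star_mul, star_star, A.2.star_eq, mul_assoc]⟩
  refine ⟨B, lieAlg_conj hU hA ?_, ?_, μ * κ, ?_⟩
  · change _ = (U : LMat) * A * star (U : LMat) * U
    rw [mul_assoc _ _ (U : LMat), hU1, mul_one]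
  · change (U : LMat) * A * star (U : LMat) * (U * A * star (U : LMat)) = 1
    calc _ = (U : LMat) * A * (star (U : LMat) * U) * A * star (U : LMat) := by
          simp only [mul_assoc]
      _ = 1 := by rw [hU1, mul_one, mul_assoc (U : LMat), hA2, mul_one, hU2]
  · change (U : LMat) * A * star (U : LMat) = _
    rw [hμ, mul_smul_comm, hκ, smul_mul_assoc, smul_mul_assoc, mul_assoc, hU2, mul_one, smul_smul]

/-- Odd symplectic product means that the axes anticommute; a quarter turn about one takes the other
to `i` times their product. -/
theorem Rot.add (h : IsLogicalBasis SX SZ) {a c a' c' : Fin 15 → ZMod 2} (h1 : Rot SX SZ a c)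
    (h2 : Rot SX SZ a' c') (ha : synd a = 0) (hc : synd c = 0) (ha' : synd a' = 0)
    (hc' : synd c' = 0) (hanti : c ⬝ᵥ a' + c' ⬝ᵥ a = 1) : Rot SX SZ (a + a') (c + c') := by
  obtain ⟨A, hA, hA2, μ, hμ⟩ := h1
  obtain ⟨B, hB, hB2, ν, hν⟩ := h2
  have hs : sgn (c ⬝ᵥ a') = -sgn (c' ⬝ᵥ a) := by
    rw [show c ⬝ᵥ a' = c' ⬝ᵥ a + 1 by rw [← hanti, add_comm, add_assoc, zmod2_add_self, add_zero],
      sgn_add, sgn_one, mul_neg_one]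
  have hAB : (A : LMat) * B = (μ * ν * sgn (c' ⬝ᵥ a)) • logicalPauli SX SZ (a + a') (c + c') := by
    rw [hμ, hν, smul_mul_smul_comm, h.logicalPauli_mul ha hc', smul_smul]
  have hBA : (B : LMat) * A = -((A : LMat) * B) := by
    rw [hAB, hμ, hν, smul_mul_smul_comm, h.logicalPauli_mul ha' hc, smul_smul, hs, add_comm a',
      add_comm c', ← neg_smul]
    exact congrArg (· • logicalPauli SX SZ (a + a') (c + c')) (by ring)
  exact ⟨⟨_, isSelfAdjoint_I_smul_mul A.2 B.2 hBA⟩, mul_mem_lieAlg hA hB hA2 hBA rfl,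
    I_smul_mul_mul_self hA2 hB2 hBA, _, (congrArg (Complex.I • ·) hAB).trans (smul_smul _ _ _)⟩

end Group

/-! ### From two controlled gates to the rotations about one Pauli operator -/

section ThreePairs

open selfAdjoint

variable {A : Type*} [CStarAlgebra A] {Γ : Subgroup (unitary A)} {hΓ : IsClosed (Γ : Set (unitary A))}

/-- Three pairs of anticommuting involutions, the different pairs commuting. -/
structure ThreePairs (Γ : Subgroup (unitary A)) (z x : Fin 3 → A) : Prop where
  z_mem : ∀ i, ∃ u ∈ Γ, (u : A) = z i
  x_mem : ∀ i, ∃ u ∈ Γ, (u : A) = x i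
  z_self : ∀ i, IsSelfAdjoint (z i)
  x_self : ∀ i, IsSelfAdjoint (x i)
  z_sq : ∀ i, z i * z i = 1
  x_sq : ∀ i, x i * x i = 1
  zz : ∀ i j, Commute (z i) (z j)
  xx : ∀ i j, Commute (x i) (x j)
  zx : ∀ i j, i ≠ j → Commute (z i) (x j)
  anti : ∀ i, z i * x i = -(x i * z i)

/-- The product of three projections, onto the states that a controlled gate flips. -/
def tripleProj (z : Fin 3 → A) : A := minusProj (z 0) * minusProj (z 1) * minusProj (z 2)

theorem isSelfAdjoint_minusProj {z : A} (hz : IsSelfAdjoint z) : IsSelfAdjoint (minusProj z) := by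
  have : star (1 / 2 : ℂ) = 1 / 2 := by simp
  rw [IsSelfAdjoint, minusProj, star_smul, star_sub, star_one, hz.star_eq, this]

theorem isSelfAdjoint_tripleProj {z : Fin 3 → A} (hz : ∀ i, IsSelfAdjoint (z i))
    (hzz : ∀ i j, Commute (z i) (z j)) : IsSelfAdjoint (tripleProj z) := by
  have hc (i j : Fin 3) : Commute (minusProj (z i)) (minusProj (z j)) :=
    (hzz i j).minusProj_left.minusProj_right
  have h1 : IsSelfAdjoint (minusProj (z 0) * minusProj (z 1)) :=
    ((isSelfAdjoint_minusProj (hz 0)).commute_iff (isSelfAdjoint_minusProj (hz 1))).1 (hc 0 1)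
  exact (h1.commute_iff (isSelfAdjoint_minusProj (hz 2))).1 ((hc 0 2).mul_left (hc 1 2))

theorem tripleProj_mul_self {z : Fin 3 → A} (hz : ∀ i, z i * z i = 1)
    (hzz : ∀ i j, Commute (z i) (z j)) : tripleProj z * tripleProj z = tripleProj z := by
  have hc (i j : Fin 3) : Commute (minusProj (z i)) (minusProj (z j)) :=
    (hzz i j).minusProj_left.minusProj_right
  have hi (i : Fin 3) : IsIdempotentElem (minusProj (z i)) := minusProj_mul_self (hz i)
  exact (IsIdempotentElem.mul_of_commute (hc 0 1) (hi 0) (hi 1)).mul_of_commute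
    ((hc 0 2).mul_left (hc 1 2)) (hi 2)

variable {z x : Fin 3 → A}

theorem ThreePairs.symm (h : ThreePairs Γ z x) : ThreePairs Γ x z :=
  ⟨h.x_mem, h.z_mem, h.x_self, h.z_self, h.x_sq, h.z_sq, h.xx, h.zz,
    fun i j hij => (h.zx j i hij.symm).symm, fun i => by rw [h.anti, neg_neg]⟩

/-- Each of the three commuting pairs contributes a factor `1 / 2`. -/
theorem ThreePairs.sandwich (h : ThreePairs Γ z x) :
    tripleProj z * tripleProj x * tripleProj z = (1 / 8 : ℂ) • tripleProj z := by
  have hzz (i j : Fin 3) : Commute (minusProj (z i)) (minusProj (z j)) :=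
    (h.zz i j).minusProj_left.minusProj_right
  have hzx (i j : Fin 3) (hij : i ≠ j) : Commute (minusProj (z i)) (minusProj (x j)) :=
    (h.zx i j hij).minusProj_left.minusProj_right
  have h0 (i : Fin 3) := minusProj_mul_mul (h.z_sq i) (h.anti i)
  have h1 := mul_mul_of_commute (h0 0) (h0 1) (hzx 1 0 (by decide)) (hzz 1 0)
    (hzx 0 1 (by decide)).symm
  have h2 := mul_mul_of_commute h1 (h0 2) ((hzx 2 0 (by decide)).mul_right (hzx 2 1 (by decide)))
    ((hzz 2 0).mul_right (hzz 2 1)) ((hzx 0 2 (by decide)).mul_left (hzx 1 2 (by decide))).symm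
  rw [tripleProj, tripleProj, h2]
  norm_num

/-- Averaging over the second and the third pair. -/
theorem ThreePairs.average (h : ThreePairs Γ z x) {t : ℂ}
    {hX : IsSelfAdjoint (t • (tripleProj z * tripleProj x - tripleProj x * tripleProj z))}
    (hmem : (⟨_, hX⟩ : selfAdjoint A) ∈ lieAlg Γ hΓ) :
    ∃ hY : IsSelfAdjoint (t • ((1 / 2 : ℂ) • (z 0 * x 0))),
      (⟨_, hY⟩ : selfAdjoint A) ∈ lieAlg Γ hΓ := by
  have zz (i j : Fin 3) : Commute (z i) (minusProj (z j)) := (h.zz i j).minusProj_right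
  have xx (i j : Fin 3) : Commute (x i) (minusProj (x j)) := (h.xx i j).minusProj_right
  have zx (i j : Fin 3) (hij : i ≠ j) : Commute (z i) (minusProj (x j)) :=
    (h.zx i j hij).minusProj_right
  have xz (i j : Fin 3) (hij : i ≠ j) : Commute (x i) (minusProj (z j)) :=
    (h.zx j i hij.symm).symm.minusProj_right
  have zp (i : Fin 3) := mul_minusProj (h.symm.anti i)
  have xp (i : Fin 3) := mul_minusProj (h.anti i)
  have step {X₁ X₂ Y₁ Y₂ w : A} {hX : IsSelfAdjoint (t • (X₁ - X₂))}
      (hmem : (⟨_, hX⟩ : selfAdjoint A) ∈ lieAlg Γ hΓ) (hw : ∃ u ∈ Γ, (u : A) = w)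
      (hws : IsSelfAdjoint w) (e1 : X₁ + w * X₁ * w = Y₁) (e2 : X₂ + w * X₂ * w = Y₂) :
      ∃ hY : IsSelfAdjoint (t • (Y₁ - Y₂)), (⟨_, hY⟩ : selfAdjoint A) ∈ lieAlg Γ hΓ := by
    obtain ⟨u, hu, rfl⟩ := hw
    refine add_conj_mem hmem hu hws ?_
    rw [← e1, ← e2, mul_smul_comm, smul_mul_assoc, mul_sub, sub_mul]
    module
  have one (a : A) : Commute a 1 := Commute.one_right a
  have n01 : (0 : Fin 3) ≠ 1 := by decide
  have n02 : (0 : Fin 3) ≠ 2 := by decide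
  have n12 : (1 : Fin 3) ≠ 2 := by decide
  -- Conjugation by `x 1`, `z 1`, `x 2`, `z 2` in turn removes the projections of `z 1`, `x 1`, `z
  -- 2`, `x 2` from both orders of the commutator, until only the pair `0` is left.
  obtain ⟨_, m1⟩ := step (Y₁ := minusProj (z 0) * (minusProj (z 2) *
      (minusProj (x 0) * minusProj (x 1) * minusProj (x 2))))
    (Y₂ := minusProj (x 0) * minusProj (x 1) * minusProj (x 2) * minusProj (z 0) * minusProj (z 2))
    hmem (h.x_mem 1) (h.x_self 1)
    (by
      have := average_eq (h.x_sq 1) (xz 1 0 n01.symm) ((xz 1 2 n12).mul_right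
        (((xx 1 0).mul_right (xx 1 1)).mul_right (xx 1 2))) (xp 1)
      simpa only [tripleProj, mul_assoc] using this)
    (by
      have := average_eq (h.x_sq 1) ((((xx 1 0).mul_right (xx 1 1)).mul_right (xx 1 2)).mul_right
        (xz 1 0 n01.symm)) (xz 1 2 n12) (xp 1)
      simpa only [tripleProj, mul_assoc] using this)
  obtain ⟨_, m2⟩ := step (Y₁ := minusProj (z 0) * minusProj (z 2) * minusProj (x 0) * minusProj (x 2))
    (Y₂ := minusProj (x 0) * (minusProj (x 2) * minusProj (z 0) * minusProj (z 2)))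
    m1 (h.z_mem 1) (h.z_self 1)
    (by
      have := average_eq (h.z_sq 1) (((zz 1 0).mul_right (zz 1 2)).mul_right (zx 1 0 n01.symm))
        (zx 1 2 n12) (zp 1)
      simpa only [mul_assoc] using this)
    (by
      have := average_eq (h.z_sq 1) (zx 1 0 n01.symm)
        (((zx 1 2 n12).mul_right (zz 1 0)).mul_right (zz 1 2)) (zp 1)
      simpa only [mul_assoc] using this)
  obtain ⟨_, m3⟩ := step (Y₁ := minusProj (z 0) * (minusProj (x 0) * minusProj (x 2)))
    (Y₂ := minusProj (x 0) * minusProj (x 2) * minusProj (z 0) * 1)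
    m2 (h.x_mem 2) (h.x_self 2)
    (by
      have := average_eq (h.x_sq 2) (xz 2 0 n02.symm) ((xx 2 0).mul_right (xx 2 2)) (xp 2)
      simpa only [mul_assoc] using this)
    (by
      have := average_eq (h.x_sq 2) (((xx 2 0).mul_right (xx 2 2)).mul_right (xz 2 0 n02.symm))
        (one _) (xp 2)
      simpa only [mul_assoc, mul_one] using this)
  obtain ⟨h4, m4⟩ := step (Y₁ := minusProj (z 0) * minusProj (x 0) * 1)
    (Y₂ := minusProj (x 0) * minusProj (z 0))
    m3 (h.z_mem 2) (h.z_self 2)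
    (by
      have := average_eq (h.z_sq 2) ((zz 2 0).mul_right (zx 2 0 n02.symm)) (one _) (zp 2)
      simpa only [mul_assoc, mul_one] using this)
    (by
      have := average_eq (h.z_sq 2) (zx 2 0 n02.symm) (zz 2 0) (zp 2)
      simpa only [mul_assoc, mul_one] using this)
  have e : minusProj (z 0) * minusProj (x 0) * 1 - minusProj (x 0) * minusProj (z 0) =
      (1 / 2 : ℂ) • (z 0 * x 0) := by rw [mul_one, minusProj_commutator (h.anti 0)]
  simp only [e] at m4
  exact ⟨_, m4⟩

/-- Two controlled gates on overlapping triples of qubits generate the product of a pair. -/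
theorem ThreePairs.mul_mem (h : ThreePairs Γ z x) (hu : ∃ u ∈ Γ, (u : A) = 1 - (2 : ℂ) • tripleProj z)
    (hv : ∃ v ∈ Γ, (v : A) = 1 - (2 : ℂ) • tripleProj x) :
    ∃ B ∈ lieAlg Γ hΓ, (B : A) * B = 1 ∧ ∃ μ : ℂ, (B : A) = μ • (z 0 * x 0) := by
  obtain ⟨u, hu, hu'⟩ := hu
  obtain ⟨v, hv, hv'⟩ := hv
  obtain ⟨hY, m⟩ := h.average (rotator_mem (hΓ := hΓ) (isSelfAdjoint_tripleProj h.z_self h.zz)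
    (isSelfAdjoint_tripleProj h.x_self h.xx) (tripleProj_mul_self h.z_sq h.zz)
    (tripleProj_mul_self h.x_sq h.xx) h.sandwich h.symm.sandwich hu hv hu' hv')
  -- The factor `√7 / 4` cancels the `8 / √7` of `rotator` and the `1 / 2` of the commutator,
  -- leaving an involution.
  have hB : (((Real.sqrt 7 / 4 : ℝ) • (⟨_, hY⟩ : selfAdjoint A) : selfAdjoint A) : A) =
      (-Complex.I) • (z 0 * x 0) := by
    rw [selfAdjoint.val_smul, ← Complex.coe_smul, smul_smul, smul_smul]
    congr 1
    have h7 : (Real.sqrt 7 : ℂ) ≠ 0 := by simp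
    push_cast
    field_simp
    norm_num
  refine ⟨_, (lieAlg Γ hΓ).smul_mem (Real.sqrt 7 / 4) m, ?_, _, hB⟩
  have e : z 0 * x 0 * (z 0 * x 0) = -1 := by
    rw [mul_assoc, ← mul_assoc (x 0), ← neg_eq_iff_eq_neg.2 (h.anti 0), neg_mul, mul_assoc (z 0), h.x_sq,
      mul_one, mul_neg, h.z_sq]
  rw [hB, smul_mul_smul_comm, e]
  simp

end ThreePairs

/-! ### Fault-tolerant Clifford operations as members of the closed group -/

section Operations

open scoped Matrix.Norms.L2Operator
open selfAdjoint

variable {SX SZ : Matrix (Fin 7) (Fin 15) (ZMod 2)}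

theorem IsLogicalBasis.implemented_h (h : IsLogicalBasis SX SZ) : Implemented SX allH := by
  have := h.implemented (V := allH) (applyGates_map_tensor _ _ h_tensor _) (fun d hd => allH_mem_codeSpace hd)
    faultsStayLocal_h synd_zero synd_zero
  simpa only [pauli_zero_zero] using this

theorem IsLogicalBasis.implemented_s (h : IsLogicalBasis SX SZ) : Implemented SX allS := by
  have := h.implemented (V := allS) (applyGates_map_tensor _ _ s_tensor _) (fun d hd => allS_mem_codeSpace hd)
    faultsStayLocal_s synd_zero synd_zero
  simpa only [pauli_zero_zero] using this

theorem IsLogicalBasis.implemented_permute (h : IsLogicalBasis SX SZ) {π : Equiv.Perm (Fin 15)}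
    (hπ : PreservesRows π) {ps : List (Pair (Wire 4))} (hps : ∀ w, track ps w = Sum.map π id w)
    (hl : swapsLocal ps = true) : Implemented SX (permute π) := by
  have := h.implemented (applyGates_swaps_tensor hps) (fun d hd => permute_mem_codeSpace hπ hd)
    (faultsStayLocal_swaps hl) synd_zero synd_zero
  simpa only [pauli_zero_zero] using this

theorem IsLogicalBasis.implemented_pauli (h : IsLogicalBasis SX SZ) {a c : Fin 15 → ZMod 2}
    (ha : synd a = 0) (hc : synd c = 0) : Implemented SX (pauliLin a c) :=
  h.implemented (gs := []) (V := id) (fun _ _ => rfl) (fun _ hd => hd) faultsStayLocal_nil ha hc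

theorem isIsometry_pauli {W : Type} [Fintype W] [DecidableEq W] (a c : W → ZMod 2) :
    IsIsometry (pauli a c) := fun ψ φ => by
  have e (y : W → ZMod 2) : star (pauli a c ψ y) * pauli a c φ y = star (ψ (y + a)) * φ (y + a) := by
    simp only [pauli, star_mul', star_sgn]
    linear_combination star (ψ (y + a)) * φ (y + a) * sgn_mul_self (c ⬝ᵥ y)
  simp only [dotProduct, Pi.star_apply, e]
  exact Equiv.sum_comp (Equiv.addRight a) fun y => star (ψ y) * φ y

theorem IsLogicalBasis.exists_h (h : IsLogicalBasis SX SZ) : ∃ U ∈ closedGroup SX, ∀ a c,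
    synd a = 0 → synd c = 0 → ∃ κ : ℂ,
      (U : LMat) * logicalPauli SX SZ a c = κ • (logicalPauli SX SZ c a * (U : LMat)) := by
  obtain ⟨U, hU, -, hκ⟩ := h.exists_clifford isIsometry_allH (fun d hd => allH_mem_codeSpace hd)
    h.implemented_h (fun _ c => c) (fun a _ => a) (fun _ _ ha hc => ⟨hc, ha⟩)
    fun a c => ⟨_, allH_pauli a c⟩
  exact ⟨U, gens_subset hU, hκ⟩

theorem IsLogicalBasis.exists_s (h : IsLogicalBasis SX SZ) : ∃ U ∈ closedGroup SX, ∀ a c,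
    synd a = 0 → synd c = 0 → ∃ κ : ℂ,
      (U : LMat) * logicalPauli SX SZ a c = κ • (logicalPauli SX SZ a (c + a) * (U : LMat)) := by
  obtain ⟨U, hU, -, hκ⟩ := h.exists_clifford isIsometry_allS (fun d hd => allS_mem_codeSpace hd)
    h.implemented_s (fun a _ => a) (fun a c => c + a)
    (fun _ _ ha hc => ⟨ha, by rw [synd_add, ha, hc, add_zero]⟩) fun a c => ⟨_, allS_pauli a c⟩
  exact ⟨U, gens_subset hU, hκ⟩

theorem IsLogicalBasis.exists_permute (h : IsLogicalBasis SX SZ) {π : Equiv.Perm (Fin 15)}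
    (hπ : PreservesRows π) {ps : List (Pair (Wire 4))} (hps : ∀ w, track ps w = Sum.map π id w)
    (hl : swapsLocal ps = true) : ∃ U ∈ closedGroup SX, ∀ a c,
    synd a = 0 → synd c = 0 → ∃ κ : ℂ, (U : LMat) * logicalPauli SX SZ a c =
      κ • (logicalPauli SX SZ (a ∘ π.symm) (c ∘ π.symm) * (U : LMat)) := by
  obtain ⟨U, hU, -, hκ⟩ := h.exists_clifford (isIsometry_permute π)
    (fun d hd => permute_mem_codeSpace hπ hd) (h.implemented_permute hπ hps hl)
    (fun a _ => a ∘ π.symm) (fun _ c => c ∘ π.symm)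
    (fun _ _ ha hc => ⟨synd_comp_symm hπ ha, synd_comp_symm hπ hc⟩)
    fun a c => ⟨1, fun ψ => by rw [permute_pauli, one_smul]⟩
  exact ⟨U, gens_subset hU, hκ⟩

theorem IsLogicalBasis.exists_logicalPauli (h : IsLogicalBasis SX SZ) {a c : Fin 15 → ZMod 2}
    (ha : synd a = 0) (hc : synd c = 0) :
    ∃ U ∈ closedGroup SX, (U : LMat) = logicalPauli SX SZ a c := by
  obtain ⟨U, hU, hV, -⟩ := h.exists_clifford (V := pauliLin a c) (isIsometry_pauli a c)
    (fun d hd => pauli_mem_codeSpace ha hc hd) (h.implemented_pauli ha hc)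
    (fun a _ => a) (fun _ c => c) (fun _ _ ha hc => ⟨ha, hc⟩)
    fun a' c' => ⟨sgn (c' ⬝ᵥ a) * sgn (c ⬝ᵥ a'), fun ψ => by
      simp only [pauliLin_apply]
      rw [pauli_pauli, pauli_pauli, smul_smul, mul_assoc, sgn_mul_self, mul_one, add_comm a,
        add_comm c]⟩
  refine ⟨U, gens_subset hU, eq_of_forall_mulVec fun φ => h.encode_injective ?_⟩
  rw [hV, h.encode_logicalPauli ha hc, pauliLin_apply]

/-- A global phase is a Clifford operator implemented by doing nothing: the ancilla state absorbs
it. This supplies the identity direction, so that the full unitary group is reached and not only its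
projective image. -/
theorem IsLogicalBasis.one_mem_infinitesimal (h : IsLogicalBasis SX SZ) :
    (1 : selfAdjoint LMat) ∈ infinitesimal SX := by
  intro t
  have he : (expUnitary (t • (1 : selfAdjoint LMat)) : LMat) =
      Complex.exp (t * Complex.I) • (1 : LMat) := by
    rw [expUnitary_of_pow_three (one_pow 3), Complex.exp_mul_I, selfAdjoint.val_one, one_pow]
    module
  have hvec (φ : State (Fin 7)) : (expUnitary (t • (1 : selfAdjoint LMat)) : LMat) *ᵥ φ =
      Complex.exp (t * Complex.I) • φ := by
    rw [he, Matrix.smul_mulVec, Matrix.one_mulVec]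
  refine gens_subset (Or.inr ⟨fun x z => ⟨x, z, 1, fun φ => ?_⟩, ?_⟩)
  · rw [hvec, hvec, pauli_smul, one_smul]
  · obtain ⟨p, hp⟩ := h.implemented_pauli synd_zero synd_zero
    refine ⟨p, fun φ χ ψ' hrun => ?_⟩
    obtain ⟨χ', hχ⟩ := hp φ χ ψ' hrun
    refine ⟨(Complex.exp (t * Complex.I))⁻¹ • χ', ?_⟩
    rw [hχ, hvec, encode_smul, smul_tensor, tensor_smul, smul_smul,
      mul_inv_cancel₀ (Complex.exp_ne_zero _), one_smul, pauliLin_apply, pauli_zero_zero]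

end Operations

/-! ### The first Pauli rotation -/

section FirstRotation

open scoped Matrix.Norms.L2Operator
open selfAdjoint

variable {SX SZ : Matrix (Fin 7) (Fin 15) (ZMod 2)}

/-- The supports of the first three logical `Z` operators. -/
def targetZ : Fin 3 → Fin 15 → ZMod 2 :=
  ![indicator [qb 1, qb 4, qb 5], indicator [qb 1, qb 6, qb 7], indicator [qb 1, qb 8, qb 9]]

/-- The images of the target operators under the transvection. -/
def targetX (i : Fin 3) : Fin 15 → ZMod 2 := targetZ i ∘ transvection.symm

theorem synd_targetZ : ∀ i, synd (targetZ i) = 0 := by unfold synd; decide +kernel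

theorem synd_targetX (i : Fin 3) : synd (targetX i) = 0 :=
  synd_comp_symm preservesRows_transvection (synd_targetZ i)

/-- The transvection moves the targets to `{4, 11, 15}`, `{6, 11, 13}`, `{3, 8, 11}`. Each meets its
own target in one qubit and the other targets in none. -/
theorem targetX_dotProduct_targetZ : ∀ i j, targetX i ⬝ᵥ targetZ j = if i = j then 1 else 0 := by
  decide +kernel

theorem minusProj_diagonal {n : Type*} [Fintype n] [DecidableEq n] (f : n → ℂ) :
    minusProj (Matrix.diagonal f) = Matrix.diagonal fun y => (1 / 2 : ℂ) * (1 - f y) := by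
  rw [minusProj, ← Matrix.diagonal_one, Matrix.diagonal_sub, ← Matrix.diagonal_smul]
  rfl

theorem tripleProj_diagonal {n : Type*} [Fintype n] [DecidableEq n] (f : Fin 3 → n → ZMod 2) :
    1 - (2 : ℂ) • tripleProj (fun i => Matrix.diagonal fun y => sgn (f i y)) =
      Matrix.diagonal fun y => sgn (f 0 y * f 1 y * f 2 y) := by
  rw [tripleProj, minusProj_diagonal, minusProj_diagonal, minusProj_diagonal,
    Matrix.diagonal_mul_diagonal, Matrix.diagonal_mul_diagonal, ← Matrix.diagonal_one,
    ← Matrix.diagonal_smul, Matrix.diagonal_sub]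
  congr 1
  ext y
  rcases zmod2_cases (f 0 y) with h0 | h0 <;> rcases zmod2_cases (f 1 y) with h1 | h1 <;>
    rcases zmod2_cases (f 2 y) with h2 | h2 <;> simp [h0, h1, h2] <;> norm_num

theorem pauliMat_single (i : Fin 7) :
    pauliMat 0 (Pi.single i 1) = Matrix.diagonal fun y => sgn (y i) := by
  ext u v
  rw [pauliMat_apply, Matrix.diagonal_apply, add_zero, single_dotProduct, one_mul]
  simp only [eq_comm]

theorem HasTargetLogicals.eq_targetZ (hT : HasTargetLogicals SZ) (i : Fin 3) :
    SZ (Fin.castLE (by norm_num) i) = targetZ i := by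
  fin_cases i
  · exact hT.1
  · exact hT.2.1
  · exact hT.2.2

theorem IsLogicalBasis.X_targetZ (h : IsLogicalBasis SX SZ) (hT : HasTargetLogicals SZ) (i : Fin 3) :
    SX *ᵥ targetZ i = Pi.single (Fin.castLE (by norm_num) i) 1 := by
  have := h.X_Z (Pi.single (Fin.castLE (by norm_num) i) 1)
  rw [Matrix.single_one_vecMul] at this
  rw [← hT.eq_targetZ]
  exact this

theorem sgn_diagonal_mem (f : (Fin 7 → ZMod 2) → ZMod 2) :
    (Matrix.diagonal fun y => sgn (f y) : LMat) ∈ Matrix.unitaryGroup (Fin 7 → ZMod 2) ℂ := by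
  rw [Matrix.mem_unitaryGroup_iff, Matrix.star_eq_conjTranspose, Matrix.diagonal_conjTranspose,
    Matrix.diagonal_mul_diagonal]
  have : (fun y => sgn (f y) * star (fun y => sgn (f y)) y) = fun _ : Fin 7 → ZMod 2 => (1 : ℂ) := by
    ext y
    rw [Pi.star_apply, star_sgn, sgn_mul_self]
  rw [this, Matrix.diagonal_one]

theorem exists_logicalCCZ (SX : Matrix (Fin 7) (Fin 15) (ZMod 2)) :
    ∃ U ∈ closedGroup SX, (U : LMat) = logicalCCZ :=
  ⟨⟨logicalCCZ, sgn_diagonal_mem _⟩, gens_subset (Or.inl rfl), rfl⟩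

theorem logicalPauli_zero : logicalPauli SX SZ 0 0 = 1 := by
  rw [logicalPauli, Matrix.mulVec_zero, Matrix.mulVec_zero, pauliMat_zero]

/-- The second family is the conjugate of the first by the Hadamard gates followed by the
transvection: `Z` becomes `X` of the same support, which is then moved to the dual position.
Conjugation transports all relations within a family and the controlled gate; only the relations
across the families use overlaps of supports. -/
theorem IsLogicalBasis.threePairs (h : IsLogicalBasis SX SZ) (hT : HasTargetLogicals SZ) :
    ∃ x : Fin 3 → LMat, ThreePairs (closedGroup SX) (fun i => logicalPauli SX SZ 0 (targetZ i)) x ∧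
      (∃ u ∈ closedGroup SX,
        (u : LMat) = 1 - (2 : ℂ) • tripleProj fun i => logicalPauli SX SZ 0 (targetZ i)) ∧
      (∃ v ∈ closedGroup SX, (v : LMat) = 1 - (2 : ℂ) • tripleProj x) ∧
      ∀ i, ∃ κ : ℂ, x i = κ • logicalPauli SX SZ (targetX i) 0 := by
  obtain ⟨V₁, hV₁, e₁⟩ := h.exists_h
  obtain ⟨V₂, hV₂, e₂⟩ := h.exists_permute preservesRows_transvection track_transvection
    swapsLocal_transvection
  set V := V₂ * V₁ with hVdef
  have hV : V ∈ closedGroup SX := (closedGroup SX).mul_mem hV₂ hV₁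
  set z : Fin 3 → LMat := fun i => logicalPauli SX SZ 0 (targetZ i) with hz
  have z_mem (i : Fin 3) : ∃ u ∈ closedGroup SX, (u : LMat) = z i :=
    h.exists_logicalPauli synd_zero (synd_targetZ i)
  have z_self (i : Fin 3) : IsSelfAdjoint (z i) := by
    rw [IsSelfAdjoint, hz]
    simp only [logicalPauli, star_pauliMat, Matrix.mulVec_zero, dotProduct_zero, sgn_zero, one_smul]
  have z_mul (i j : Fin 3) : z i * z j = logicalPauli SX SZ 0 (targetZ i + targetZ j) := by
    simp only [hz]
    rw [h.logicalPauli_mul synd_zero (synd_targetZ j), dotProduct_zero, sgn_zero, one_smul, add_zero]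
  have z_sq (i : Fin 3) : z i * z i = 1 := by rw [z_mul, string_add_self, logicalPauli_zero]
  have zz (i j : Fin 3) : Commute (z i) (z j) := by
    rw [commute_iff_eq, z_mul, z_mul, add_comm]
  set f := Unitary.conjStarAlgAut ℂ LMat V with hf
  have hfa (B : LMat) : f B = V * B * star (V : LMat) := Unitary.conjStarAlgAut_apply ..
  have hV2 : (V : LMat) * star (V : LMat) = 1 := Unitary.coe_mul_star_self V
  have hx (i : Fin 3) : ∃ κ : ℂ, f (z i) = κ • logicalPauli SX SZ (targetX i) 0 := by
    obtain ⟨κ₁, h₁⟩ := e₁ 0 (targetZ i) synd_zero (synd_targetZ i)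
    obtain ⟨κ₂, h₂⟩ := e₂ (targetZ i) 0 (synd_targetZ i) synd_zero
    refine ⟨κ₁ * κ₂, ?_⟩
    rw [hfa]
    have : (V : LMat) * z i = (κ₁ * κ₂) • (logicalPauli SX SZ (targetX i) 0 * (V : LMat)) := by
      rw [hVdef, Submonoid.coe_mul, mul_assoc, h₁, mul_smul_comm, ← mul_assoc, h₂, smul_mul_assoc,
        smul_smul, mul_assoc]
      rfl
    rw [this, smul_mul_assoc, mul_assoc, hV2, mul_one]
  have hconj {B : LMat} (hB : ∃ u ∈ closedGroup SX, (u : LMat) = B) :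
      ∃ u ∈ closedGroup SX, (u : LMat) = f B := by
    obtain ⟨u, hu, rfl⟩ := hB
    exact ⟨V * u * V⁻¹, (closedGroup SX).mul_mem ((closedGroup SX).mul_mem hV hu)
      ((closedGroup SX).inv_mem hV), (hfa _).symm⟩
  have cross (i j : Fin 3) : ∃ κ : ℂ, z i * f (z j) = κ • logicalPauli SX SZ (targetX j) (targetZ i) ∧
      f (z j) * z i =
        (κ * sgn (targetX j ⬝ᵥ targetZ i)) • logicalPauli SX SZ (targetX j) (targetZ i) := by
    obtain ⟨κ, hκ⟩ := hx j
    refine ⟨κ, ?_, ?_⟩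
    · rw [hκ, mul_smul_comm, h.logicalPauli_mul synd_zero synd_zero, zero_dotProduct, sgn_zero,
        one_smul, zero_add, add_zero]
    · rw [hκ, smul_mul_assoc, h.logicalPauli_mul (synd_targetX j) (synd_targetZ i), smul_smul,
        zero_add, add_zero, dotProduct_comm]
  have hccz : ∃ u ∈ closedGroup SX, (u : LMat) = 1 - (2 : ℂ) • tripleProj z := by
    obtain ⟨u, hu, e⟩ := exists_logicalCCZ SX
    refine ⟨u, hu, ?_⟩
    have hzd : z = fun i => Matrix.diagonal fun y => sgn (y (Fin.castLE (by norm_num) i)) := by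
      funext i
      rw [hz]
      simp only [logicalPauli, Matrix.mulVec_zero, h.X_targetZ hT, pauliMat_single]
    rw [e, hzd, tripleProj_diagonal]
    rfl
  refine ⟨fun i => f (z i), ⟨z_mem, fun i => hconj (z_mem i), z_self, fun i => ?_, z_sq, fun i => ?_,
    zz, fun i j => (zz i j).map f, fun i j hij => ?_, fun i => ?_⟩, hccz, ?_, hx⟩
  · exact (z_self i).map f
  · rw [← map_mul, z_sq, map_one]
  · obtain ⟨κ, h1, h2⟩ := cross i j
    rw [commute_iff_eq, h1, h2, targetX_dotProduct_targetZ, if_neg hij.symm, sgn_zero, mul_one]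
  · obtain ⟨κ, h1, h2⟩ := cross i i
    rw [h1, h2, targetX_dotProduct_targetZ, if_pos rfl, sgn_one, mul_neg_one, neg_smul, neg_neg]
  · have := hconj hccz
    simpa only [tripleProj, minusProj, map_sub, map_one, map_smul, map_mul] using this

theorem IsLogicalBasis.rot_target (h : IsLogicalBasis SX SZ) (hT : HasTargetLogicals SZ) :
    Rot SX SZ (targetX 0) (targetZ 0) := by
  obtain ⟨x, hx, hu, hv, e⟩ := h.threePairs hT
  obtain ⟨B, hB, hB2, μ, hμ⟩ := hx.mul_mem (hΓ := isClosed_closedGroup SX) hu hv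
  obtain ⟨κ, hκ⟩ := e 0
  refine ⟨B, hB, hB2, μ * κ, ?_⟩
  rw [hμ, hκ, mul_smul_comm, h.logicalPauli_mul synd_zero synd_zero, zero_dotProduct, sgn_zero,
    one_smul, zero_add, add_zero, smul_smul]

end FirstRotation

/-! ### From one rotation to all rotations -/

section Spread

open scoped Matrix.Norms.L2Operator
open selfAdjoint

/-- The images of the first target operator under powers of `frobeniusShift`. -/
def line : ℕ → Fin 15 → ZMod 2
  | 0 => targetZ 0
  | k + 1 => line k ∘ frobeniusShift.symm

theorem synd_line (k : ℕ) : synd (line k) = 0 := by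
  induction k with
  | zero => exact synd_targetZ 0
  | succ k ih => exact synd_comp_symm preservesRows_shift ih

/-- Seven lines and the parity checks. -/
def genMatrix : Matrix (Fin 11) (Fin 15) (ZMod 2) :=
  !![1,0,0,1,1,0,0,0,0,0,0,0,0,0,0;
     0,1,0,0,0,0,0,1,0,1,0,0,0,0,0;
     0,0,0,0,0,1,0,1,0,0,0,0,0,1,0;
     0,0,0,0,0,1,0,0,0,0,1,0,1,0,0;
     0,0,0,1,0,0,0,0,0,1,0,0,0,1,0;
     0,0,0,0,0,0,1,1,0,0,0,0,0,0,1;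
     0,0,0,0,0,1,0,0,1,0,0,0,0,0,1;
     0,0,0,0,0,0,0,1,1,1,1,1,1,1,1;
     0,0,0,1,1,1,1,0,0,0,0,1,1,1,1;
     0,1,1,0,0,1,1,0,0,1,1,0,0,1,1;
     1,0,1,0,1,0,1,0,1,0,1,0,1,0,1]

/-- The inverse of `genMatrix` on the free positions. -/
def genInverse : Matrix (Fin 11) (Fin 11) (ZMod 2) :=
  !![1,1,0,0,0,0,1,0,1,0,0;
     0,0,1,0,1,1,1,0,0,1,0;
     1,0,1,1,0,0,0,0,1,0,1;
     0,0,0,1,1,0,0,1,1,0,1;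
     0,0,1,0,1,0,0,1,1,1,0;
     0,0,0,0,1,0,1,0,1,0,1;
     1,0,0,0,1,0,1,1,1,0,0;
     1,0,0,1,1,0,1,1,1,0,1;
     1,0,0,1,1,0,1,0,1,0,1;
     1,0,0,1,1,0,0,0,0,0,1;
     0,0,0,1,1,0,0,0,0,0,1]

theorem genMatrix_line : ∀ i : Fin 7, genMatrix (Fin.castLE (by norm_num) i) =
    line (![0, 1, 3, 5, 9, 10, 12] i) := by decide +kernel

theorem genMatrix_check : (genMatrix.submatrix (Fin.natAdd 7) id :
    Matrix (Fin 4) (Fin 15) (ZMod 2)) = parityCheck := by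
  decide +kernel

theorem genMatrix_inverse :
    (genMatrix.submatrix id freePos)ᵀ * genInverse = 1 := by decide +kernel

theorem parityCheck_mul_genMatrix : parityCheck * genMatrixᵀ = 0 := by decide +kernel

/-- Both sides satisfy the checks and agree on the free positions, where the generators form an
invertible matrix. So seven lines and the four checks span all code strings. -/
theorem eq_vecMul_genMatrix {w : Fin 15 → ZMod 2} (hw : synd w = 0) :
    w = (genInverse *ᵥ (w ∘ freePos)) ᵥ* genMatrix := by
  apply eq_of_add_eq_zero
  refine eq_zero_of_free ?_ fun k => ?_
  · rw [synd_add, hw, zero_add, synd, ← Matrix.mulVec_transpose, Matrix.mulVec_mulVec,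
      parityCheck_mul_genMatrix, Matrix.zero_mulVec]
  · have : (genInverse *ᵥ (w ∘ freePos)) ᵥ* genMatrix.submatrix id freePos = w ∘ freePos := by
      rw [← Matrix.mulVec_transpose, Matrix.mulVec_mulVec, genMatrix_inverse, Matrix.one_mulVec]
    have hk := congrFun this k
    have e : ((genInverse *ᵥ (w ∘ freePos)) ᵥ* genMatrix) (freePos k) = w (freePos k) := hk
    rw [Pi.add_apply, e, zmod2_add_self]

/-- Induction over the strings that satisfy the parity checks. -/
theorem code_induction {p : (Fin 15 → ZMod 2) → Prop} (h0 : p 0)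
    (hl : ∀ i : Fin 7, ∀ w, synd w = 0 → p w → p (w + line (![0, 1, 3, 5, 9, 10, 12] i)))
    (hc : ∀ r w, synd w = 0 → p w → p (w + parityCheck r)) {w : Fin 15 → ZMod 2} (hw : synd w = 0) :
    p w := by
  have hsynd (i : Fin 11) : synd (genMatrix i) = 0 := by
    ext r
    exact congrFun (congrFun parityCheck_mul_genMatrix r) i
  have hstep (i : Fin 11) (w) (hw : synd w = 0) (hp : p w) : p (w + genMatrix i) := by
    refine Fin.addCases (m := 7) (n := 4) (motive := fun i => p (w + genMatrix i)) (fun i => ?_)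
      (fun r => ?_) i
    · have := hl i w hw hp
      rwa [← genMatrix_line] at this
    · have := hc r w hw hp
      rwa [← congrFun genMatrix_check r] at this
  have key (v : Fin 11 → ZMod 2) (s : Finset (Fin 11)) :
      synd (∑ i ∈ s, v i • genMatrix i) = 0 ∧ p (∑ i ∈ s, v i • genMatrix i) := by
    induction s using Finset.induction_on with
    | empty => simpa [synd_zero] using h0
    | insert i s hi ih =>
      rw [Finset.sum_insert hi, add_comm]
      rcases zmod2_cases (v i) with hv | hv <;> rw [hv]
      · simpa using ih
      · rw [one_smul, synd_add, ih.1, hsynd, add_zero]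
        exact ⟨rfl, hstep i _ ih.1 ih.2⟩
  have e := (key (genInverse *ᵥ (w ∘ freePos)) Finset.univ).2
  rwa [← Matrix.vecMul_eq_sum, ← eq_vecMul_genMatrix hw] at e

variable {SX SZ : Matrix (Fin 7) (Fin 15) (ZMod 2)} {a c : Fin 15 → ZMod 2}

theorem Rot.swap (h : IsLogicalBasis SX SZ) (hr : Rot SX SZ a c) (ha : synd a = 0)
    (hc : synd c = 0) : Rot SX SZ c a := by
  obtain ⟨U, hU, hκ⟩ := h.exists_h
  exact hr.conj hU (hκ a c ha hc).choose_spec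

theorem Rot.shear (h : IsLogicalBasis SX SZ) (hr : Rot SX SZ a c) (ha : synd a = 0)
    (hc : synd c = 0) : Rot SX SZ a (c + a) := by
  obtain ⟨U, hU, hκ⟩ := h.exists_s
  exact hr.conj hU (hκ a c ha hc).choose_spec

theorem Rot.shift (h : IsLogicalBasis SX SZ) (hr : Rot SX SZ a c) (ha : synd a = 0)
    (hc : synd c = 0) : Rot SX SZ (a ∘ frobeniusShift.symm) (c ∘ frobeniusShift.symm) := by
  obtain ⟨U, hU, hκ⟩ := h.exists_permute preservesRows_shift track_shift swapsLocal_shift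
  exact hr.conj hU (hκ a c ha hc).choose_spec

theorem Rot.transvect (h : IsLogicalBasis SX SZ) (hr : Rot SX SZ a c) (ha : synd a = 0)
    (hc : synd c = 0) : Rot SX SZ (a ∘ transvection.symm) (c ∘ transvection.symm) := by
  obtain ⟨U, hU, hκ⟩ := h.exists_permute preservesRows_transvection track_transvection
    swapsLocal_transvection
  exact hr.conj hU (hκ a c ha hc).choose_spec

theorem Rot.add_row (h : IsLogicalBasis SX SZ) (hr : Rot SX SZ a c) (u : Fin 4 → ZMod 2) :
    Rot SX SZ a (c + u ᵥ* parityCheck) := by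
  unfold Rot
  rwa [h.logicalPauli_add_row]

theorem cz_mul_pauliMat (x z : Fin 7 → ZMod 2) :
    (Matrix.diagonal fun y => sgn (y 0 * y 1) : LMat) * pauliMat x z = sgn (x 0 * x 1) •
      (pauliMat x (z + x 0 • Pi.single 1 1 + x 1 • Pi.single 0 1) *
        Matrix.diagonal fun y => sgn (y 0 * y 1)) := by
  ext u v
  simp only [Matrix.diagonal_mul, Matrix.smul_apply, Matrix.mul_diagonal, pauliMat_apply,
    smul_eq_mul]
  by_cases hv : v = u + x
  · subst hv
    simp only [if_true, add_dotProduct, smul_dotProduct, single_dotProduct, one_mul, sgn_add,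
      smul_eq_mul, Pi.add_apply, mul_add, add_mul]
    rw [mul_comm (u 0) (x 1)]
    linear_combination (-sgn (u 0 * u 1) * sgn (z ⬝ᵥ u)) *
      (sgn_mul_self (x 0 * x 1) * (sgn (x 0 * u 1) * sgn (x 0 * u 1)) *
        (sgn (x 1 * u 0) * sgn (x 1 * u 0)) + sgn_mul_self (x 0 * u 1) *
        (sgn (x 1 * u 0) * sgn (x 1 * u 0)) + sgn_mul_self (x 1 * u 0))
  · simp [hv]

/-- Conjugating CCZ by the logical `X` of the third qubit replaces its bit by the bit plus one;
together with CCZ itself the phase `y 0 * y 1` remains. -/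
theorem IsLogicalBasis.exists_cz (h : IsLogicalBasis SX SZ) :
    ∃ U ∈ closedGroup SX, (U : LMat) = Matrix.diagonal fun y => sgn (y 0 * y 1) := by
  obtain ⟨u, hu, hu'⟩ := exists_logicalCCZ SX
  obtain ⟨w, hw, hw'⟩ := h.exists_logicalPauli (h.synd_X (Pi.single 2 1)) synd_zero
  refine ⟨u * (w * (u * w)), (closedGroup SX).mul_mem hu ((closedGroup SX).mul_mem hw
    ((closedGroup SX).mul_mem hu hw)), eq_of_forall_mulVec fun φ => ?_⟩
  simp only [Submonoid.coe_mul, hu', hw', ← Matrix.mulVec_mulVec, logicalPauli, h.Z_X,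
    Matrix.mulVec_zero, pauliMat_mulVec, logicalCCZ]
  ext y
  simp only [Matrix.mulVec_diagonal, pauli, zero_dotProduct, sgn_zero, one_mul,
    add_add_cancel_string]
  have e0 : (y + Pi.single 2 1 : Fin 7 → ZMod 2) 0 = y 0 := by simp
  have e1 : (y + Pi.single 2 1 : Fin 7 → ZMod 2) 1 = y 1 := by simp
  have e2 : (y + Pi.single 2 1 : Fin 7 → ZMod 2) 2 = y 2 + 1 := by simp
  rw [e0, e1, e2, mul_add, sgn_add, mul_one, ← mul_assoc, ← mul_assoc, sgn_mul_self, one_mul]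

/-- An axis that flips the second logical qubit but not the first picks up the first logical `Z`
under conjugation by CZ. -/
theorem Rot.add_target (h : IsLogicalBasis SX SZ) (hT : HasTargetLogicals SZ) (hr : Rot SX SZ a c)
    (h0 : targetZ 0 ⬝ᵥ a = 0) (h1 : targetZ 1 ⬝ᵥ a = 1) : Rot SX SZ a (c + targetZ 0) := by
  obtain ⟨U, hU, hU'⟩ := h.exists_cz
  have hZ (i : Fin 3) : (SZ *ᵥ a) (Fin.castLE (by norm_num) i) = targetZ i ⬝ᵥ a := by
    rw [← hT.eq_targetZ]
    rfl
  have hZ0 : (SZ *ᵥ a) 0 = 0 := (hZ 0).trans h0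
  have hZ1 : (SZ *ᵥ a) 1 = 1 := (hZ 1).trans h1
  refine hr.conj hU (κ := 1) ?_
  rw [hU', logicalPauli, cz_mul_pauliMat, hZ0, hZ1, zero_mul, sgn_zero, zero_smul, add_zero,
    one_smul, logicalPauli, Matrix.mulVec_add, h.X_targetZ hT, one_smul,
    one_smul]
  rfl

theorem IsLogicalBasis.rot_line (h : IsLogicalBasis SX SZ) (hT : HasTargetLogicals SZ) (k : ℕ) :
    Rot SX SZ 0 (line k) := by
  induction k with
  | zero =>
    -- The phase gates multiply the axis by the `X` string once more as a `Z` string. The two axes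
    -- anticommute, their product is the pure `Z` string `targetX 0`, and the transvection, an
    -- involution, takes it back to `targetZ 0`.
    have h1 := h.rot_target hT
    have h2 := h1.shear h (synd_targetX 0) (synd_targetZ 0)
    have h3 := h1.add h h2 (synd_targetX 0) (synd_targetZ 0) (synd_targetX 0)
      (by rw [synd_add, synd_targetX, synd_targetZ, add_zero]) (by decide +kernel)
    rw [string_add_self, ← add_assoc, string_add_self, zero_add] at h3
    have h4 := h3.transvect h synd_zero (synd_targetX 0)
    have e : targetX 0 ∘ transvection.symm = targetZ 0 := by decide +kernel
    rwa [e] at h4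
  | succ k ih =>
    have := ih.shift h synd_zero (synd_line k)
    rwa [Pi.zero_comp] at this

theorem IsLogicalBasis.rot_of_odd (h : IsLogicalBasis SX SZ) (hT : HasTargetLogicals SZ)
    (hc : synd c = 0) (hodd : c ⬝ᵥ line 3 = 1) : Rot SX SZ 0 c := by
  have hbase : Rot SX SZ (line 3) 0 := (h.rot_line hT 3).swap h synd_zero (synd_line 3)
  have hall {w} (hw : synd w = 0) : Rot SX SZ (line 3) w := by
    refine code_induction (p := fun w => Rot SX SZ (line 3) w) hbase (fun i w hw hr => ?_)
      (fun r w hw hr => ?_) hw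
    · by_cases hi : i = 0
      · subst hi
        exact hr.add_target h hT (by decide +kernel) (by decide +kernel)
      · have := hr.add h (h.rot_line hT (![0, 1, 3, 5, 9, 10, 12] i)) (synd_line 3) hw synd_zero
          (synd_line _) (by
            rw [dotProduct_zero, zero_add]
            revert i
            decide +kernel)
        rwa [add_zero] at this
    · have := hr.add_row h (Pi.single r 1)
      rw [Matrix.single_one_vecMul] at this
      exact this
  have := hbase.add h (hall hc) (synd_line 3) synd_zero (synd_line 3) hc
    (by rw [zero_dotProduct, zero_add, hodd])
  rwa [string_add_self, zero_add] at this

theorem line_periodic (k : ℕ) : line (k + 15) = line k := by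
  induction k with
  | zero => decide +kernel
  | succ k ih => rw [Nat.add_right_comm]; exact congrArg (· ∘ frobeniusShift.symm) ih

/-- Cyclic symmetry: shifting `c` back reduces to the line before. -/
theorem IsLogicalBasis.rot_of_odd_line (h : IsLogicalBasis SX SZ) (hT : HasTargetLogicals SZ) (k : ℕ)
    (hc : synd c = 0) (hodd : c ⬝ᵥ line (k + 3) = 1) : Rot SX SZ 0 c := by
  induction k generalizing c with
  | zero => exact h.rot_of_odd hT hc hodd
  | succ k ih =>
    have hback : synd (c ∘ frobeniusShift) = 0 := by
      have hinv : PreservesRows frobeniusShift.symm := by unfold PreservesRows; decide +kernel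
      exact synd_comp_symm hinv hc
    have := ih hback (by
      rw [← hodd, Nat.add_right_comm]
      exact (dotProduct_comp_equiv_symm c (line (k + 3)) frobeniusShift).symm)
    have h2 := this.shift h synd_zero hback
    rwa [Function.comp_assoc, Equiv.self_comp_symm, Function.comp_id] at h2

/-- Lines and checks span the code strings, and `c` is orthogonal to the checks. If it were also
orthogonal to every line, it would be orthogonal to `b`. -/
theorem IsLogicalBasis.rot_zero_left (h : IsLogicalBasis SX SZ) (hT : HasTargetLogicals SZ)
    (hc : synd c = 0) {b : Fin 15 → ZMod 2} (hb : synd b = 0) (hbc : c ⬝ᵥ b = 1) :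
    Rot SX SZ 0 c := by
  by_contra hcon
  have hline (k : ℕ) : c ⬝ᵥ line k = 0 := by
    rcases zmod2_cases (c ⬝ᵥ line k) with h0 | h1
    · exact h0
    -- Lines are available only from index `3` on; twelve further steps and period fifteen give back
    -- `line k`.
    · refine (hcon (h.rot_of_odd_line hT (k + 12) hc ?_)).elim
      rwa [show k + 12 + 3 = k + 15 by ring, line_periodic]
  have : c ⬝ᵥ b = 0 := by
    refine code_induction (p := fun b => c ⬝ᵥ b = 0) (dotProduct_zero c) (fun i w _ hw => ?_)
      (fun r w _ hw => ?_) hb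
    · rw [dotProduct_add, hw, hline, add_zero]
    · rw [dotProduct_add, hw, zero_add, dotProduct_comm]
      exact congrFun hc r
  rw [this] at hbc
  exact absurd hbc (by decide)

/-- If `a` and `c` overlap oddly, the axes `(a, 0)` and `(0, c)` anticommute and their product is
the wanted axis. Otherwise one passes through `(a, b)` and multiplies by `(0, b + c)`, which then
meets `a` oddly. -/
theorem IsLogicalBasis.rot_of_nontrivial (h : IsLogicalBasis SX SZ) (hT : HasTargetLogicals SZ)
    (ha : synd a = 0) (hc : synd c = 0) {b : Fin 15 → ZMod 2} (hb : synd b = 0) (hab : a ⬝ᵥ b = 1) :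
    Rot SX SZ a c := by
  have one {c} (hc : synd c = 0) (hac : a ⬝ᵥ c = 1) : Rot SX SZ a c := by
    have h1 := (h.rot_zero_left hT ha hb hab).swap h synd_zero ha
    have h2 := h.rot_zero_left hT hc ha (by rw [dotProduct_comm, hac])
    have := h1.add h h2 ha synd_zero synd_zero hc (by rw [dotProduct_zero, zero_add, dotProduct_comm, hac])
    rwa [add_zero, zero_add] at this
  rcases zmod2_cases (a ⬝ᵥ c) with hac | hac
  · have hcb : synd (b + c) = 0 := by rw [synd_add, hb, hc, add_zero]
    have hdot : (b + c) ⬝ᵥ a = 1 := by rw [dotProduct_comm, dotProduct_add, hab, hac, add_zero]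
    have := (one hb hab).add h (h.rot_zero_left hT hcb ha hdot) ha hb synd_zero hcb
      (by rw [dotProduct_zero, zero_add, hdot])
    rwa [add_zero, ← add_assoc, string_add_self, zero_add] at this
  · exact one hc hac

/-- Every Pauli operator on the logical qubits is, up to a phase, an infinitesimal generator. -/
theorem IsLogicalBasis.exists_infinitesimal (h : IsLogicalBasis SX SZ) (hT : HasTargetLogicals SZ)
    (x z : Fin 7 → ZMod 2) : ∃ B ∈ infinitesimal SX, ∃ ν : ℂ, pauliMat x z = ν • (B : LMat) := by
  have of_rot (hr : Rot SX SZ (x ᵥ* SX) (z ᵥ* SZ)) :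
      ∃ B ∈ infinitesimal SX, ∃ ν : ℂ, pauliMat x z = ν • (B : LMat) := by
    obtain ⟨B, hB, hB2, μ, hμ⟩ := hr
    rw [logicalPauli, h.Z_X, h.X_Z] at hμ
    have hμ0 : μ ≠ 0 := by
      rintro rfl
      rw [hμ, zero_smul, zero_mul] at hB2
      exact zero_ne_one hB2
    exact ⟨B, hB, μ⁻¹, by rw [hμ, smul_smul, inv_mul_cancel₀ hμ0, one_smul]⟩
  have pair (x z : Fin 7 → ZMod 2) : (x ᵥ* SX) ⬝ᵥ (z ᵥ* SZ) = x ⬝ᵥ z := by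
    rw [← Matrix.dotProduct_mulVec, ← Matrix.mulVec_transpose, Matrix.mulVec_mulVec, h.2.2,
      Matrix.one_mulVec]
  have exists_single {x : Fin 7 → ZMod 2} (hx : x ≠ 0) : ∃ j, x j = 1 := by
    obtain ⟨j, hj⟩ := Function.ne_iff.1 hx
    exact ⟨j, zmod2_ne_zero.1 hj⟩
  by_cases hx : x = 0
  · by_cases hz : z = 0
    · subst hx hz
      exact ⟨1, h.one_mem_infinitesimal, 1, by rw [pauliMat_zero, one_smul, selfAdjoint.val_one]⟩
    · obtain ⟨j, hj⟩ := exists_single hz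
      refine of_rot ?_
      rw [hx, Matrix.zero_vecMul]
      refine h.rot_zero_left hT (h.synd_Z z) (h.synd_X (Pi.single j 1)) ?_
      rw [dotProduct_comm, pair, single_dotProduct, one_mul, hj]
  · obtain ⟨j, hj⟩ := exists_single hx
    refine of_rot (h.rot_of_nontrivial hT (h.synd_X x) (h.synd_Z z) (h.synd_Z (Pi.single j 1)) ?_)
    rw [pair, dotProduct_single, mul_one, hj]

/-- Pauli operators span all operators over `ℂ`, and each is a multiple of a self-adjoint generator.
For self-adjoint `A`, averaging the expansion with its adjoint leaves real coefficients. -/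
theorem IsLogicalBasis.infinitesimal_eq_top (h : IsLogicalBasis SX SZ) (hT : HasTargetLogicals SZ) :
    infinitesimal SX = ⊤ := by
  rw [eq_top_iff]
  intro A _
  choose B hB ν hν using h.exists_infinitesimal hT
  have hA : (A : LMat) = ∑ x : Fin 7 → ZMod 2, ∑ z : Fin 7 → ZMod 2,
      (1 / 128 * (∑ y, sgn (z ⬝ᵥ y) * (A : LMat) y (y + x)) * ν x z) • (B x z : LMat) := by
    conv_lhs => rw [eq_sum_pauliMat (A : LMat)]
    simp only [hν, smul_smul]
  have hre : A = ∑ x : Fin 7 → ZMod 2, ∑ z : Fin 7 → ZMod 2,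
      (1 / 128 * (∑ y, sgn (z ⬝ᵥ y) * (A : LMat) y (y + x)) * ν x z).re • B x z := by
    have hstar : (A : LMat) = ∑ x : Fin 7 → ZMod 2, ∑ z : Fin 7 → ZMod 2,
        star (1 / 128 * (∑ y, sgn (z ⬝ᵥ y) * (A : LMat) y (y + x)) * ν x z) • (B x z : LMat) := by
      have := congrArg star hA
      simp only [star_sum, star_smul, selfAdjoint.star_val_eq] at this
      exact this
    have hsum := congrArg₂ (· + ·) hA hstar
    simp only [← Finset.sum_add_distrib, ← add_smul, Complex.star_def, Complex.add_conj] at hsum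
    refine Subtype.ext (smul_right_injective LMat (two_ne_zero (α := ℂ)) ?_)
    simp only [two_smul, hsum, AddSubgroup.val_finsetSum, selfAdjoint.val_smul]
    simp only [← two_smul ℂ, Finset.smul_sum]
    refine Finset.sum_congr rfl fun x _ => Finset.sum_congr rfl fun z _ => ?_
    rw [← Complex.coe_smul, smul_smul]
    push_cast
    rfl
  rw [hre]
  exact Submodule.sum_mem _ fun x _ => Submodule.sum_mem _ fun z _ =>
    Submodule.smul_mem _ _ (hB x z)

theorem dense_closure_gens (h : IsLogicalBasis SX SZ) (hT : HasTargetLogicals SZ) :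
    Dense (Submonoid.closure (gens SX) : Set (Matrix.unitaryGroup (Fin 7 → ZMod 2) ℂ)) :=
  dense_of_closedGroup_eq_top (eq_top_of_lieAlg (h.infinitesimal_eq_top hT) fun u =>
    Matrix.finite_spectrum (u : LMat))

end Spread

end EncodedCCZ

end

theorem mainTheorem2 :
    -- the three operators are logical `Z` operators of three logical qubits of the code
    (∃ SX SZ : Matrix (Fin 7) (Fin 15) (ZMod 2), IsLogicalBasis SX SZ ∧ HasTargetLogicals SZ) ∧
    (∀ SX SZ : Matrix (Fin 7) (Fin 15) (ZMod 2), IsLogicalBasis SX SZ → HasTargetLogicals SZ →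
      Set.range (encode SX) = codeSpace ∧
      -- the round-robin circuit implements the logical CCZ
      (∀ order : List (Fin 15 × Fin 15 × Fin 15), order.Perm triples → ∀ φ : State (Fin 7),
        applyGates (order.map roundRobinGate) (encode SX φ) = encode SX (logicalCCZ *ᵥ φ)) ∧
      -- with the fault-tolerant Clifford operations on 19 qubits it is universal
      Dense (Submonoid.closure
        {U : Matrix.unitaryGroup (Fin 7 → ZMod 2) ℂ |
          (U : Matrix (Fin 7 → ZMod 2) (Fin 7 → ZMod 2) ℂ) = logicalCCZ ∨
          (IsClifford (U : Matrix (Fin 7 → ZMod 2) (Fin 7 → ZMod 2) ℂ) ∧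
            ∃ p : Protocol 4, FaultTolerant SX p U)} :
        Set (Matrix.unitaryGroup (Fin 7 → ZMod 2) ℂ))) ∧
    -- the circuit made of gadgets and error correction implements it fault-tolerantly
    (∀ order : List (Fin 15 × Fin 15 × Fin 15), order.Perm triples →
      ∃ (xr : Record → Fin 15 → ZMod 2)
        (fr : Record → (Fin 4 → ZMod 2) → (Fin 4 → ZMod 2) →
          (Fin 15 → ZMod 2) × (Fin 15 → ZMod 2)),
        ∀ SX SZ : Matrix (Fin 7) (Fin 15) (ZMod 2), IsLogicalBasis SX SZ →
          HasTargetLogicals SZ → FaultTolerant SX (cczProtocol order xr fr) logicalCCZ) := by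
  exact ⟨⟨exampleX, exampleZ, isLogicalBasis_example, hasTargetLogicals_example⟩,
    fun SX SZ h hT => ⟨h.range_encode, fun order ho φ => encode_roundRobin h hT ho φ,
      dense_closure_gens h hT⟩,
    fun order ho => ⟨xRule order, finalRule order, fun SX SZ h hT =>
      faultTolerant_cczProtocol h hT ho⟩⟩
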